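/- **Setting.** A metric $L$-structure is a complete metric space $A$ with interpretations of the symbols of a language $L$: constants as points of $A$, $n$-ary function symbols as continuous maps $A^n\to A$, $n$-ary predicate symbols as continuous maps $A^n\to\mathbb R$. An $L$-embedding is an isometry commuting with the interpretations of all symbols. A tuple $\bar a\in A^n$ is an ordered generator of $A$ if $A$ is the only closed subset of $A$ that contains the entries of $\bar a$ and is closed under all constants and function symbols of $L$; $A$ is finitely generated if it has an ordered generator of some finite length. Let $\mathscr K$ be a category whose objects are metric $L$-structures and whose morphisms are $L$-embeddings. A joint embedding of objects $A,B$ is a pair $(\iota,\eta)$ of morphisms $\iota\colon A\to C$, $\eta\colon B\to C$ of $\mathscr K$ into a common object $C$. Let $\mathscr K_n$ be the class of pairs $\langle A,\bar a\rangle$ with $A$ an object of $\mathscr K$ and $\bar a\in A^n$ an ordered generator of $A$, and put $$d^{\mathscr K}(\langle A,\bar a\rangle,\langle B,\bar b\rangle)=\inf\bigl\{\max_i d(\iota(a_i),\eta(b_i)) : (\iota,\eta)\text{ a joint embedding of }A,B\bigr\}.$$ $\mathscr K$ is a *Fraïssé category* if all its objects are finitely generated and separable and the following hold. * (JEP) Any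 two objects have a joint embedding. * (NAP) For all morphisms $\iota_1\colon A\to B_1$, $\iota_2\colon A\to B_2$, every finite $G\subseteq A$ and every $\varepsilon>0$ there is a joint embedding $(\eta_1,\eta_2)$ of $B_1,B_2$ with $d(\eta_1\iota_1(a),\eta_2\iota_2(a))\le\varepsilon$ for all $a\in G$. * (WPP) For every $n$, $\mathscr K_n$ is separable with respect to $d^{\mathscr K}$. * (CCP) For all $n,m$, every $n$-ary predicate symbol $P$ and every $n$-ary function symbol $f$ (constants being allowed as $0$-ary function symbols), the maps $\langle A,(\bar a,\bar b)\rangle\mapsto P^A(\bar a)$ from $\mathscr K_{n+m}$ to $\mathbb R$ and $\langle A,(\bar a,\bar b)\rangle\mapsto\langle A,(\bar a,\bar b,f^A(\bar a))\rangle$ from $\mathscr K_{n+m}$ to $\mathscr K_{n+m+1}$ send Cauchy sequences to Cauchy sequences. The language $L_{\mathrm{TC}^*}$ of unital tracial C*-algebras has the constants $0,1$, unary function symbols for the multiplication by each $\lambda\in\mathbb C$ and for the involution, binary function symbols for addition and multiplication, and unary predicates for the (real and imaginary part of the) trace. A unital C*-algebra with a distinguished tracial state is a metric $L_{\mathrm{TC}^*}$-structure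 with respect to the norm distance, and the $L_{\mathrm{TC}^*}$-embeddings between such structures are exactly the trace-preserving injective unital $*$-homomorphisms. For integers $p,q\ge1$ let $\mathcal Z_{p,q}$ be the C*-algebra of all continuous functions $f\colon[0,1]\to\mathbb M_p\otimes\mathbb M_q$ with $f(0)\in\mathbb M_p\otimes1_q$ and $f(1)\in1_p\otimes\mathbb M_q$. Let $\mathscr K_{\mathcal Z}$ be the category whose objects are all pairs $\langle\mathcal Z_{p,q},\tau\rangle$ with $p,q\ge 1$ coprime and $\tau$ a faithful tracial state on $\mathcal Z_{p,q}$, and whose morphisms are all $L_{\mathrm{TC}^*}$-embeddings between them. **Theorem.** $\mathscr K_{\mathcal Z}$ is a Fraïssé category. -/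

import Mathlib

open scoped ENNReal Kronecker ComplexOrder Matrix.Norms.L2Operator

universe u v w

/-! ### Metric structures -/

/-- A metric `L`-structure: a complete metric space together with continuous interpretations of the
symbols of `L`. The function symbols of arity `0` are the constant symbols, and the relation symbols
of `L` are its predicate symbols, interpreted by continuous real-valued functions. -/
structure MetricStructure (L : FirstOrder.Language.{u, v}) where
  carrier : Type w
  metric : MetricSpace carrier
  complete : CompleteSpace carrier
  func : ∀ {n : ℕ}, L.Functions n → (Fin n → carrier) → carrier
  continuous_func : ∀ {n : ℕ} (f : L.Functions n), Continuous (func f)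
  pred : ∀ {n : ℕ}, L.Relations n → (Fin n → carrier) → ℝ
  continuous_pred : ∀ {n : ℕ} (P : L.Relations n), Continuous (pred P)

namespace MetricStructure

variable {L : FirstOrder.Language.{u, v}}

instance : CoeSort (MetricStructure.{u, v, w} L) (Type w) := ⟨carrier⟩

attribute [instance] metric complete

/-- An `L`-embedding: an isometry that commutes with the interpretations of all symbols. -/
structure Embedding (A B : MetricStructure.{u, v, w} L) where
  toFun : A → B
  isometry : Isometry toFun
  map_func : ∀ {n : ℕ} (f : L.Functions n) (a : Fin n → A),
    B.func f (fun i => toFun (a i)) = toFun (A.func f a)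
  map_pred : ∀ {n : ℕ} (P : L.Relations n) (a : Fin n → A),
    B.pred P (fun i => toFun (a i)) = A.pred P a

instance (A B : MetricStructure.{u, v, w} L) : CoeFun (Embedding A B) (fun _ => A → B) :=
  ⟨Embedding.toFun⟩

/-- The identity embedding. -/
def Embedding.id (A : MetricStructure.{u, v, w} L) : Embedding A A where
  toFun a := a
  isometry := isometry_id
  map_func _ _ := rfl
  map_pred _ _ := rfl

/-- The composition `g ∘ f` of embeddings. -/
def Embedding.comp {A B C : MetricStructure.{u, v, w} L} (g : Embedding B C) (f : Embedding A B) :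
    Embedding A C where
  toFun a := g (f a)
  isometry := g.isometry.comp f.isometry
  map_func h a := by rw [g.map_func h (fun i => f (a i)), f.map_func]
  map_pred P a := by rw [g.map_pred P (fun i => f (a i)), f.map_pred]

/-- The tuple `a` generates `A`: the smallest closed subset of `A` that contains all `a i` and is
closed under the interpretations of the constant and function symbols is `A` itself. -/
def IsGenerator (A : MetricStructure.{u, v, w} L) {n : ℕ} (a : Fin n → A) : Prop :=
  ∀ S : Set A, IsClosed S → (∀ i, a i ∈ S) →
    (∀ (k : ℕ) (f : L.Functions k) (y : Fin k → A), (∀ i, y i ∈ S) → A.func f y ∈ S) →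
    S = Set.univ

/-- `A` is generated by a finite tuple. -/
def FinitelyGenerated (A : MetricStructure.{u, v, w} L) : Prop :=
  ∃ (n : ℕ) (a : Fin n → A), A.IsGenerator a

theorem IsGenerator.snoc {A : MetricStructure.{u, v, w} L} {n : ℕ} {a : Fin n → A}
    (h : A.IsGenerator a) (b : A) : A.IsGenerator (Fin.snoc (α := fun _ => A) a b) := by
  intro S hS hmem hfun
  refine h S hS (fun i => ?_) hfun
  have := hmem i.castSucc
  rwa [Fin.snoc_castSucc] at this

end MetricStructure

/-! ### Fraïssé categories of metric structures -/

/-- A category of metric `L`-structures and `L`-embeddings: a class of structures (indexed by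
`Obj`) together with sets of embeddings that contain the identities and are closed under
composition. -/
structure MetricCategory (L : FirstOrder.Language.{u, v}) where
  Obj : Type w
  str : Obj → MetricStructure.{u, v, w} L
  Mor : ∀ A B : Obj, Set (MetricStructure.Embedding (str A) (str B))
  id_mem : ∀ A : Obj, MetricStructure.Embedding.id (str A) ∈ Mor A A
  comp_mem : ∀ {A B C : Obj} {g : MetricStructure.Embedding (str B) (str C)}
    {f : MetricStructure.Embedding (str A) (str B)},
    g ∈ Mor B C → f ∈ Mor A B → g.comp f ∈ Mor A C

namespace MetricCategory

variable {L : FirstOrder.Language.{u, v}} (K : MetricCategory.{u, v, w} L)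

/-- A joint embedding of `A` and `B` in `K`: a pair of morphisms into a common object. -/
structure JointEmbedding (A B : K.Obj) where
  target : K.Obj
  left : MetricStructure.Embedding (K.str A) (K.str target)
  right : MetricStructure.Embedding (K.str B) (K.str target)
  left_mem : left ∈ K.Mor A target
  right_mem : right ∈ K.Mor B target

/-- The joint embedding property. -/
def JEP : Prop := ∀ A B : K.Obj, Nonempty (K.JointEmbedding A B)

/-- The near amalgamation property. -/
def NAP : Prop :=
  ∀ (A B₁ B₂ : K.Obj), ∀ i₁ ∈ K.Mor A B₁, ∀ i₂ ∈ K.Mor A B₂,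
    ∀ G : Set (K.str A), G.Finite → ∀ ε : ℝ, 0 < ε →
      ∃ J : K.JointEmbedding B₁ B₂, ∀ a ∈ G, dist (J.left (i₁ a)) (J.right (i₂ a)) ≤ ε

/-- The class of pairs of an object of `K` and an ordered generating `n`-tuple of it. -/
structure Generated (n : ℕ) where
  obj : K.Obj
  tuple : Fin n → K.str obj
  isGenerator : (K.str obj).IsGenerator tuple

variable {K}

/-- The distance of `⟨A, a⟩` and `⟨B, b⟩`: the infimum of `max_i d (ι (a i), η (b i))` over all joint
embeddings `(ι, η)` of `A` and `B` (it is `⊤` if there are none). -/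
noncomputable def gdist {n : ℕ} (X Y : K.Generated n) : ℝ≥0∞ :=
  ⨅ J : K.JointEmbedding X.obj Y.obj, ⨆ i, edist (J.left (X.tuple i)) (J.right (Y.tuple i))

/-- Cauchy sequences with respect to `gdist`. -/
def IsCauchy {n : ℕ} (X : ℕ → K.Generated n) : Prop :=
  ∀ ε : ℝ≥0∞, 0 < ε → ∃ N, ∀ k ≥ N, ∀ l ≥ N, gdist (X k) (X l) < ε

/-- The pair `⟨A, (a, b, f(a))⟩` obtained from `⟨A, (a, b)⟩`, where `f` is an `n`-ary function symbol
and `a` has length `n`. -/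
def Generated.adjoin {n m : ℕ} (f : L.Functions n) (X : K.Generated (n + m)) :
    K.Generated (n + m + 1) where
  obj := X.obj
  tuple := Fin.snoc (α := fun _ => K.str X.obj) X.tuple
    ((K.str X.obj).func f (fun i => X.tuple (Fin.castAdd m i)))
  isGenerator := X.isGenerator.snoc _

variable (K)

/-- The weak Polish property: every `K.Generated n` is separable. -/
def WPP : Prop :=
  ∀ n : ℕ, ∃ S : Set (K.Generated n), S.Countable ∧
    ∀ X : K.Generated n, ∀ ε : ℝ≥0∞, 0 < ε → ∃ Y ∈ S, gdist X Y < ε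

/-- The Cauchy continuity property. -/
def CCP : Prop :=
  (∀ (n m : ℕ) (P : L.Relations n) (X : ℕ → K.Generated (n + m)), IsCauchy X →
    CauchySeq (fun k => (K.str (X k).obj).pred P (fun i => (X k).tuple (Fin.castAdd m i)))) ∧
  (∀ (n m : ℕ) (f : L.Functions n) (X : ℕ → K.Generated (n + m)), IsCauchy X →
    IsCauchy (fun k => (X k).adjoin f))

/-- A Fraïssé category: a category of finitely generated separable metric `L`-structures and
`L`-embeddings that satisfies JEP, NAP, WPP and CCP. -/
structure IsFraisse : Prop where
  finitelyGenerated : ∀ A : K.Obj, (K.str A).FinitelyGenerated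
  separable : ∀ A : K.Obj, TopologicalSpace.SeparableSpace (K.str A)
  jep : K.JEP
  nap : K.NAP
  wpp : K.WPP
  ccp : K.CCP

end MetricCategory

/-! ### Unital tracial C*-algebras as metric structures -/

/-- The constant and function symbols of the language of unital tracial C*-algebras. -/
inductive TCStarFunc : ℕ → Type
  | zero : TCStarFunc 0
  | one : TCStarFunc 0
  | smul (c : ℂ) : TCStarFunc 1
  | star : TCStarFunc 1
  | add : TCStarFunc 2
  | mul : TCStarFunc 2

/-- The predicate symbols: the trace. Since predicates are real-valued, the complex-valued trace is
given by its real and imaginary parts. -/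
inductive TCStarPred : ℕ → Type
  | trRe : TCStarPred 1
  | trIm : TCStarPred 1

/-- The language of unital tracial C*-algebras. -/
def LTCStar : FirstOrder.Language.{0, 0} := ⟨TCStarFunc, TCStarPred⟩

/-- A tracial state on a unital C*-algebra. -/
structure TracialState (A : Type w) [CStarAlgebra A] where
  toCLM : A →L[ℂ] ℂ
  map_one : toCLM 1 = 1
  nonneg : ∀ a : A, 0 ≤ toCLM (star a * a)
  tracial : ∀ a b : A, toCLM (a * b) = toCLM (b * a)

/-- Faithfulness of a tracial state. -/
def TracialState.Faithful {A : Type w} [CStarAlgebra A] (τ : TracialState A) : Prop :=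
  ∀ a : A, τ.toCLM (star a * a) = 0 → a = 0

/-- The interpretation of the function symbols in a C*-algebra. -/
def TCStarFunc.interp {A : Type w} [CStarAlgebra A] :
    ∀ {n : ℕ}, TCStarFunc n → (Fin n → A) → A
  | _, .zero, _ => 0
  | _, .one, _ => 1
  | _, .smul c, y => c • y 0
  | _, .star, y => Star.star (y 0)
  | _, .add, y => y 0 + y 1
  | _, .mul, y => y 0 * y 1

/-- The interpretation of the predicate symbols. -/
noncomputable def TCStarPred.interp {A : Type w} [CStarAlgebra A] (τ : TracialState A) :
    ∀ {n : ℕ}, TCStarPred n → (Fin n → A) → ℝ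
  | _, .trRe, y => (τ.toCLM (y 0)).re
  | _, .trIm, y => (τ.toCLM (y 0)).im

theorem TCStarFunc.continuous_interp {A : Type w} [CStarAlgebra A] {n : ℕ} (f : TCStarFunc n) :
    Continuous (f.interp : (Fin n → A) → A) := by
  cases f
  · exact continuous_const
  · exact continuous_const
  · exact (continuous_apply 0).const_smul _
  · exact (continuous_apply 0).star
  · exact (continuous_apply 0).add (continuous_apply 1)
  · exact (continuous_apply 0).mul (continuous_apply 1)

theorem TCStarPred.continuous_interp {A : Type w} [CStarAlgebra A] (τ : TracialState A) {n : ℕ}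
    (P : TCStarPred n) : Continuous (P.interp τ) := by
  cases P
  · exact Complex.continuous_re.comp (τ.toCLM.continuous.comp (continuous_apply 0))
  · exact Complex.continuous_im.comp (τ.toCLM.continuous.comp (continuous_apply 0))

/-- A unital C*-algebra with a distinguished tracial state as a metric structure; the distance is
the norm distance. -/
noncomputable def tracialStructure (A : Type w) [CStarAlgebra A] (τ : TracialState A) :
    MetricStructure.{0, 0, w} LTCStar where
  carrier := A
  metric := inferInstance
  complete := inferInstance
  func := TCStarFunc.interp
  continuous_func f := TCStarFunc.continuous_interp f
  pred := TCStarPred.interp τ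
  continuous_pred P := TCStarPred.continuous_interp τ P

/-- The embeddings of unital tracial C*-algebras as metric structures are exactly the
trace-preserving injective unital *-homomorphisms. -/
theorem exists_tracial_embedding_iff {A B : Type w} [CStarAlgebra A] [CStarAlgebra B]
    (τ : TracialState A) (σ : TracialState B) (φ : A → B) :
    (∃ e : MetricStructure.Embedding (tracialStructure A τ) (tracialStructure B σ), e.toFun = φ) ↔
      ∃ ψ : A →⋆ₐ[ℂ] B, Function.Injective ψ ∧ (∀ a, σ.toCLM (ψ a) = τ.toCLM a) ∧ ⇑ψ = φ := by
  constructor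
  · rintro ⟨e, rfl⟩
    let g : A → B := e.toFun
    have h0 : g 0 = 0 := (e.map_func (n := 0) TCStarFunc.zero ![]).symm
    have h1 : g 1 = 1 := (e.map_func (n := 0) TCStarFunc.one ![]).symm
    have hs (c : ℂ) (a : A) : g (c • a) = c • g a :=
      (e.map_func (n := 1) (TCStarFunc.smul c) ![a]).symm
    have hst (a : A) : g (star a) = star (g a) :=
      (e.map_func (n := 1) TCStarFunc.star ![a]).symm
    have ha (a b : A) : g (a + b) = g a + g b :=
      (e.map_func (n := 2) TCStarFunc.add ![a, b]).symm
    have hm (a b : A) : g (a * b) = g a * g b :=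
      (e.map_func (n := 2) TCStarFunc.mul ![a, b]).symm
    have hr (a : A) : (σ.toCLM (g a)).re = (τ.toCLM a).re :=
      e.map_pred (n := 1) TCStarPred.trRe ![a]
    have hi (a : A) : (σ.toCLM (g a)).im = (τ.toCLM a).im :=
      e.map_pred (n := 1) TCStarPred.trIm ![a]
    refine ⟨{ toFun := g, map_one' := h1, map_mul' := hm, map_zero' := h0, map_add' := ha,
              commutes' := fun c => ?_, map_star' := hst }, e.isometry.injective,
            fun a => Complex.ext (hr a) (hi a), rfl⟩
    rw [Algebra.algebraMap_eq_smul_one, Algebra.algebraMap_eq_smul_one]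
    exact (hs c 1).trans (congrArg (fun b : B => c • b) h1)
  · rintro ⟨ψ, hinj, htr, rfl⟩
    refine ⟨⟨ψ, NonUnitalStarAlgHom.isometry ψ hinj, ?_, ?_⟩, rfl⟩
    · intro n f a
      cases f
      · exact (map_zero ψ).symm
      · exact (map_one ψ).symm
      · exact (map_smul ψ _ _).symm
      · exact (map_star ψ _).symm
      · exact (map_add ψ _ _).symm
      · exact (map_mul ψ _ _).symm
    · intro n P a
      cases P
      · exact congrArg Complex.re (htr _)
      · exact congrArg Complex.im (htr _)

/-! ### Dimension drop algebras -/

/-- The matrix algebra `M_p ⊗ M_q`, realised as the matrices indexed by pairs (so that the elementary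
tensors are the Kronecker products), with the operator norm. -/
abbrev MatTensor (p q : ℕ) : Type := Matrix (Fin p × Fin q) (Fin p × Fin q) ℂ

/-- The dimension drop algebra `Z_{p,q}`: the continuous functions `f` from `[0,1]` to `M_p ⊗ M_q`
with `f 0 ∈ M_p ⊗ 1` and `f 1 ∈ 1 ⊗ M_q`. -/
noncomputable def dimensionDrop (p q : ℕ) : StarSubalgebra ℂ C(unitInterval, MatTensor p q) where
  carrier := {f | (∃ a : Matrix (Fin p) (Fin p) ℂ, f 0 = a ⊗ₖ (1 : Matrix (Fin q) (Fin q) ℂ)) ∧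
    ∃ b : Matrix (Fin q) (Fin q) ℂ, f 1 = (1 : Matrix (Fin p) (Fin p) ℂ) ⊗ₖ b}
  mul_mem' := by
    rintro f g ⟨⟨a, ha⟩, b, hb⟩ ⟨⟨a', ha'⟩, b', hb'⟩
    refine ⟨⟨a * a', ?_⟩, b * b', ?_⟩
    · rw [ContinuousMap.mul_apply, ha, ha', ← Matrix.mul_kronecker_mul, one_mul]
    · rw [ContinuousMap.mul_apply, hb, hb', ← Matrix.mul_kronecker_mul, one_mul]
  add_mem' := by
    rintro f g ⟨⟨a, ha⟩, b, hb⟩ ⟨⟨a', ha'⟩, b', hb'⟩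
    refine ⟨⟨a + a', ?_⟩, b + b', ?_⟩
    · rw [ContinuousMap.add_apply, ha, ha', Matrix.add_kronecker]
    · rw [ContinuousMap.add_apply, hb, hb', Matrix.kronecker_add]
  algebraMap_mem' := by
    intro c
    refine ⟨⟨c • 1, ?_⟩, c • 1, ?_⟩
    · rw [Algebra.algebraMap_eq_smul_one, ContinuousMap.smul_apply, ContinuousMap.one_apply,
        Matrix.smul_kronecker, Matrix.one_kronecker_one]
    · rw [Algebra.algebraMap_eq_smul_one, ContinuousMap.smul_apply, ContinuousMap.one_apply,
        Matrix.kronecker_smul, Matrix.one_kronecker_one]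
  star_mem' := by
    rintro f ⟨⟨a, ha⟩, b, hb⟩
    refine ⟨⟨star a, ?_⟩, star b, ?_⟩
    · rw [ContinuousMap.star_apply, ha, Matrix.star_eq_conjTranspose,
        Matrix.conjTranspose_kronecker, Matrix.conjTranspose_one, Matrix.star_eq_conjTranspose]
    · rw [ContinuousMap.star_apply, hb, Matrix.star_eq_conjTranspose,
        Matrix.conjTranspose_kronecker, Matrix.conjTranspose_one, Matrix.star_eq_conjTranspose]

instance dimensionDrop_isClosed (p q : ℕ) :
    IsClosed (dimensionDrop p q : Set C(unitInterval, MatTensor p q)) := by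
  let l : Matrix (Fin p) (Fin p) ℂ →ₗ[ℂ] MatTensor p q :=
    { toFun := fun a => a ⊗ₖ (1 : Matrix (Fin q) (Fin q) ℂ)
      map_add' := fun a b => Matrix.add_kronecker a b _
      map_smul' := fun c a => Matrix.smul_kronecker c a _ }
  let r : Matrix (Fin q) (Fin q) ℂ →ₗ[ℂ] MatTensor p q :=
    { toFun := fun b => (1 : Matrix (Fin p) (Fin p) ℂ) ⊗ₖ b
      map_add' := fun a b => Matrix.kronecker_add _ a b
      map_smul' := fun c a => Matrix.kronecker_smul c _ a }
  have hl : IsClosed ((LinearMap.range l : Submodule ℂ (MatTensor p q)) : Set (MatTensor p q)) :=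
    Submodule.closed_of_finiteDimensional _
  have hr : IsClosed ((LinearMap.range r : Submodule ℂ (MatTensor p q)) : Set (MatTensor p q)) :=
    Submodule.closed_of_finiteDimensional _
  have key : (dimensionDrop p q : Set C(unitInterval, MatTensor p q)) =
      (fun f : C(unitInterval, MatTensor p q) => f 0) ⁻¹' (LinearMap.range l : Submodule ℂ _) ∩
      (fun f : C(unitInterval, MatTensor p q) => f 1) ⁻¹' (LinearMap.range r : Submodule ℂ _) := by
    ext f
    constructor
    · rintro ⟨⟨a, ha⟩, b, hb⟩
      exact ⟨⟨a, ha.symm⟩, ⟨b, hb.symm⟩⟩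
    · rintro ⟨⟨a, ha⟩, ⟨b, hb⟩⟩
      exact ⟨⟨a, ha.symm⟩, b, hb.symm⟩
  rw [key]
  exact (hl.preimage (continuous_eval_const 0)).inter
    (hr.preimage (continuous_eval_const 1))

/-- A pair `⟨Z_{p,q}, τ⟩` of a prime dimension drop algebra and a faithful tracial state on it. -/
structure PrimeDimDrop where
  p : ℕ
  q : ℕ
  p_pos : 0 < p
  q_pos : 0 < q
  coprime : Nat.Coprime p q
  trace : TracialState (dimensionDrop p q)
  faithful : trace.Faithful

/-- The category of prime dimension drop algebras with a faithful tracial state and all embeddings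
between them as unital tracial C*-algebras. -/
noncomputable def KZ : MetricCategory.{0, 0, 0} LTCStar where
  Obj := PrimeDimDrop
  str Z := tracialStructure (dimensionDrop Z.p Z.q) Z.trace
  Mor _ _ := Set.univ
  id_mem _ := Set.mem_univ _
  comp_mem _ _ := Set.mem_univ _

/-! The Lebesgue trace f ↦ ∫ ntr (f t) dt is a universal target. A tracial state on Z_{p,q} is
determined by its restriction to the centre C[0,1] (`TracialState.apply_eq_central`), hence by a
probability measure, which has full support if the state is faithful. The quantile function Q of
that measure is then continuous and fixes 0 and 1, so f ↦ f ∘ Q embeds ⟨Z_{p,q}, τ⟩ into Z_{p,q}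
with the Lebesgue trace (`TracialState.exists_reparam`, `KZ.exists_embedding_leb`). WPP follows,
because up to these embeddings all tuples lie in countably many separable spaces. CCP holds because
the operations are uniformly continuous on bounded sets with moduli independent of the algebra, and
the traces are contractive. Finite generation is a Stone–Weierstrass argument.

JEP rests on `dimensionDrop.exists_standard`: for every large multiple R of PQ there is a map ψ from
Z_{P,Q} to Z_{R,R+1} that preserves the Lebesgue trace and has the form ψ(f)(t) = u_t
diag(f(ξ_1(t)), …, f(ξ_k(t))) u_t*, where the ξ_j are short paths whose average distribution is
Lebesgue measure. The multiplicities of the points ξ_j(0) produce a value in M_R ⊗ 1, those of the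
points ξ_j(1) a value in 1 ⊗ M_{R+1}. The second is possible because P and Q are coprime: the end
point fibres M_P and M_Q absorb the remainder 1 of R+1 modulo PQ.

For NAP, JEP reduces the problem to two trace-preserving maps φ₁, φ₂ from Z_{p,q} into one Z_{P,Q}
with the Lebesgue trace. Both are composed with a single standard ψ with very short paths. By a
uniqueness theorem (`exists_unitary_of_trace_close`), finite-dimensional representations whose
traces are close to a given faithful τ are approximately unitarily equivalent; this gives unitaries
X₀ in M_R ⊗ 1 and X₁ in 1 ⊗ M_{R+1} that almost conjugate ψφ₁ to ψφ₂ at t = 0 and t = 1. Since the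
blocks vary slowly, X₀* u₁* X₁ u₁ almost commutes with the image of φ₁ at t = 0. A basic homotopy
lemma (`exists_path_of_almostCommutes`) joins it to 1 through unitaries that still almost commute.
This yields a path W of unitaries from X₀ to X₁, and WψW* and ψ are the amalgamating maps.

Uniqueness and homotopy both rest on cuts. A finite-dimensional representation of Z_{p,q} extends to
discontinuous functions (`dimensionDrop.exists_extension`) and so has spectral projections. The
interval is covered by short slots, consecutive ones overlapping in a band; a cut is a projection
between the spectral projections of the two ends of a band that commutes with all functions constant
on the band. A family of cuts replaces the representation, up to a small error, by a direct sum of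
representations of matrix algebras, which are classified by ranks. The ranks can be matched: for 0 <
r ≤ 1 the spectral projection of [0,r) has rank divisible by p and congruent modulo q to the total
dimension, so such ranks in two representations of the same size differ by a multiple of pq, and
that difference is realised in the commutant of the pq × pq matrix units of the band. -/

open MeasureTheory unitInterval

/-! ### The normalised trace -/

/-- The normalised trace of a matrix. -/
noncomputable def ntr {ι : Type*} [Fintype ι] : Matrix ι ι ℂ →ₗ[ℂ] ℂ :=
  (Fintype.card ι : ℂ)⁻¹ • Matrix.traceLinearMap ι ℂ ℂ

section ntr
variable {ι κ : Type*} [Fintype ι] [Fintype κ]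

theorem ntr_apply (M : Matrix ι ι ℂ) : ntr M = (Fintype.card ι : ℂ)⁻¹ * M.trace := rfl

theorem ntr_one [DecidableEq ι] [Nonempty ι] : ntr (1 : Matrix ι ι ℂ) = 1 := by
  rw [ntr_apply, Matrix.trace_one]
  exact inv_mul_cancel₀ (by exact_mod_cast Fintype.card_ne_zero)

theorem ntr_mul_comm (M N : Matrix ι ι ℂ) : ntr (M * N) = ntr (N * M) := by
  rw [ntr_apply, ntr_apply, Matrix.trace_mul_comm]

theorem ntr_submatrix_equiv (e : κ ≃ ι) (M : Matrix ι ι ℂ) : ntr (M.submatrix e e) = ntr M := by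
  rw [ntr_apply, ntr_apply, Fintype.card_congr e]
  congr 1
  exact Fintype.sum_equiv e _ _ (fun _ => rfl)

theorem ntr_kronecker (M : Matrix ι ι ℂ) (N : Matrix κ κ ℂ) :
    ntr (M ⊗ₖ N) = ntr M * ntr N := by
  rw [ntr_apply, ntr_apply, ntr_apply, Matrix.trace_kronecker, Fintype.card_prod]
  push_cast
  rw [mul_inv]
  ring

theorem ntr_blockDiagonal [DecidableEq κ] (M : κ → Matrix ι ι ℂ) :
    ntr (Matrix.blockDiagonal M) = (Fintype.card κ : ℂ)⁻¹ * ∑ k, ntr (M k) := by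
  simp only [ntr_apply, Matrix.trace_blockDiagonal, Fintype.card_prod]
  rw [← Finset.mul_sum]
  push_cast
  rw [mul_inv]
  ring

theorem continuous_ntr [DecidableEq ι] : Continuous (ntr : Matrix ι ι ℂ → ℂ) :=
  LinearMap.continuous_of_finiteDimensional _

theorem ntr_star_mul_self_nonneg (M : Matrix ι ι ℂ) : 0 ≤ ntr (star M * M) := by
  rw [ntr_apply, Matrix.star_eq_conjTranspose]
  refine mul_nonneg ?_ (Matrix.posSemidef_conjTranspose_mul_self M).trace_nonneg
  rw [← Complex.ofReal_natCast, ← Complex.ofReal_inv]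
  exact_mod_cast inv_nonneg.2 (Nat.cast_nonneg _)

theorem eq_zero_of_ntr_star_mul_self {M : Matrix ι ι ℂ} (h : ntr (star M * M) = 0) : M = 0 := by
  rcases isEmpty_or_nonempty ι with hι | hι
  · exact Subsingleton.elim _ _
  rw [ntr_apply, Matrix.star_eq_conjTranspose] at h
  have hc : (Fintype.card ι : ℂ)⁻¹ ≠ 0 := inv_ne_zero (by exact_mod_cast Fintype.card_ne_zero)
  exact Matrix.trace_conjTranspose_mul_self_eq_zero_iff.1 ((mul_eq_zero.1 h).resolve_left hc)

/-- A linear functional on matrices with the trace property is a multiple of the trace. -/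
theorem eq_ntr_mul_of_comm [DecidableEq ι] [Nonempty ι] (φ : Matrix ι ι ℂ →ₗ[ℂ] ℂ)
    (h : ∀ M N, φ (M * N) = φ (N * M)) (M : Matrix ι ι ℂ) : φ M = ntr M * φ 1 := by
  obtain ⟨i0⟩ := ‹Nonempty ι›
  -- The units e_ii and e_{i0 i0} are the two products of e_{i i0} and e_{i0 i}; for i ≠ j, e_ij =
  -- e_ii e_ij while e_ij e_ii = 0.
  have key : ∀ i j, φ (Matrix.single i j 1) = if i = j then φ (Matrix.single i0 i0 1) else 0 := by
    intro i j
    split_ifs with hij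
    · subst hij
      have h1 := h (Matrix.single i i0 1) (Matrix.single i0 i 1)
      simpa using h1
    · have h1 := h (Matrix.single i i 1) (Matrix.single i j 1)
      rw [Matrix.single_mul_single_same, one_mul,
        Matrix.single_mul_single_of_ne (h := Ne.symm hij), map_zero] at h1
      exact h1
  have expand : ∀ N : Matrix ι ι ℂ, φ N = N.trace * φ (Matrix.single i0 i0 1) := by
    intro N
    conv_lhs => rw [Matrix.matrix_eq_sum_single N]
    simp only [map_sum]
    have : ∀ i j, φ (Matrix.single i j (N i j)) =
        if i = j then N i j * φ (Matrix.single i0 i0 1) else 0 := by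
      intro i j
      have : Matrix.single i j (N i j) = N i j • Matrix.single i j (1 : ℂ) := by
        rw [Matrix.smul_single, smul_eq_mul, mul_one]
      rw [this, map_smul, key, smul_eq_mul, mul_ite, mul_zero]
    simp only [this, Finset.sum_ite_eq, Finset.mem_univ, if_true, Matrix.trace, Matrix.diag,
      Finset.sum_mul]
  have hc : (Fintype.card ι : ℂ) ≠ 0 := by
    have : Nonempty ι := ⟨i0⟩
    exact_mod_cast Fintype.card_ne_zero
  rw [expand M, expand 1, ntr_apply, Matrix.trace_one]
  field_simp

end ntr

/-! ### Elements of the dimension drop algebras -/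

namespace dimensionDrop
variable {p q : ℕ}

/-- Evaluation at a point. -/
noncomputable def eval (t : I) : dimensionDrop p q →⋆ₐ[ℂ] MatTensor p q where
  toFun f := f.1 t
  map_one' := rfl
  map_mul' _ _ := rfl
  map_zero' := rfl
  map_add' _ _ := rfl
  commutes' _ := rfl
  map_star' _ := rfl

theorem continuous_eval (f : dimensionDrop p q) : Continuous fun t => eval t f :=
  f.1.continuous

theorem ext {f g : dimensionDrop p q} (h : ∀ t, eval t f = eval t g) : f = g :=
  Subtype.ext (ContinuousMap.ext h)

theorem norm_eval_le (t : I) (f : dimensionDrop p q) : ‖eval t f‖ ≤ ‖f‖ :=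
  ContinuousMap.norm_coe_le_norm f.1 t

theorem norm_le {f : dimensionDrop p q} {C : ℝ} (hC : 0 ≤ C) (h : ∀ t, ‖eval t f‖ ≤ C) :
    ‖f‖ ≤ C :=
  (ContinuousMap.norm_le f.1 hC).2 h

/-- The element `t ↦ β t • M`. -/
noncomputable def bump (β : C(I, ℂ)) (M : MatTensor p q)
    (h0 : ∃ a : Matrix (Fin p) (Fin p) ℂ, β 0 • M = a ⊗ₖ (1 : Matrix (Fin q) (Fin q) ℂ))
    (h1 : ∃ b : Matrix (Fin q) (Fin q) ℂ, β 1 • M = (1 : Matrix (Fin p) (Fin p) ℂ) ⊗ₖ b) :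
    dimensionDrop p q :=
  ⟨⟨fun t => β t • M, β.continuous.smul continuous_const⟩, h0, h1⟩

@[simp]
theorem eval_bump (β : C(I, ℂ)) (M : MatTensor p q) (h0) (h1) (t : I) :
    eval t (bump β M h0 h1) = β t • M := rfl

/-- The central elements `t ↦ g t • 1`. -/
noncomputable def central : C(I, ℂ) →⋆ₐ[ℂ] dimensionDrop p q where
  toFun g := bump g 1
    ⟨g 0 • 1, by rw [Matrix.smul_kronecker, Matrix.one_kronecker_one]⟩
    ⟨g 1 • 1, by rw [Matrix.kronecker_smul, Matrix.one_kronecker_one]⟩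
  map_one' := ext fun t => by simp
  map_mul' g h := ext fun t => by simp [smul_smul, mul_comm]
  map_zero' := ext fun t => by simp
  map_add' g h := ext fun t => by simp [add_smul]
  commutes' c := ext fun t => by
    simp [Algebra.algebraMap_eq_smul_one]
  map_star' g := ext fun t => by rw [map_star, eval_bump, eval_bump, star_smul, star_one]; rfl

@[simp]
theorem eval_central (g : C(I, ℂ)) (t : I) :
    eval t (central g : dimensionDrop p q) = g t • 1 := rfl

theorem exists_eval_zero (f : dimensionDrop p q) :
    ∃ a : Matrix (Fin p) (Fin p) ℂ, eval 0 f = a ⊗ₖ (1 : Matrix (Fin q) (Fin q) ℂ) := f.2.1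

theorem exists_eval_one (f : dimensionDrop p q) :
    ∃ b : Matrix (Fin q) (Fin q) ℂ, eval 1 f = (1 : Matrix (Fin p) (Fin p) ℂ) ⊗ₖ b := f.2.2

/-- The function `t ↦ ntr (f t)`. -/
noncomputable def ntrFun (f : dimensionDrop p q) : C(I, ℂ) :=
  ⟨fun t => ntr (eval t f), continuous_ntr.comp (continuous_eval f)⟩

@[simp]
theorem ntrFun_apply (f : dimensionDrop p q) (t : I) : ntrFun f t = ntr (eval t f) := rfl

end dimensionDrop

/-- Complex continuous functions from real ones. -/
noncomputable def complexify (h : C(I, ℝ)) : C(I, ℂ) := ⟨fun t => (h t : ℂ), by fun_prop⟩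

@[simp]
theorem complexify_apply (h : C(I, ℝ)) (t : I) : complexify h t = (h t : ℂ) := rfl

/-- The square root of a function. -/
noncomputable def sqrtMap (h : C(I, ℝ)) : C(I, ℝ) := ⟨fun t => Real.sqrt (h t), by fun_prop⟩

theorem complexify_sqrtMap_mul_self {h : C(I, ℝ)} (hh : ∀ t, 0 ≤ h t) :
    complexify (sqrtMap h) * complexify (sqrtMap h) = complexify h := by
  ext t
  simp only [ContinuousMap.mul_apply, complexify_apply, sqrtMap, ContinuousMap.coe_mk]
  rw [← Complex.ofReal_mul, Real.mul_self_sqrt (hh t)]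

/-! ### Tracial states -/

namespace TracialState
open dimensionDrop

variable {p q : ℕ} (τ : TracialState (dimensionDrop p q))

/-- The trace property, for the elements `β • e M` with `e` a linear multiplicative map. -/
theorem apply_smul_eq {k : Type*} [Fintype k] [DecidableEq k] [Nonempty k]
    (e : Matrix k k ℂ →ₗ[ℂ] MatTensor p q) (he : ∀ M N, e (M * N) = e M * e N)
    (he1 : e 1 = 1) {β : C(I, ℝ)} (hβ : ∀ t, 0 ≤ β t)
    (h0 : ∀ M, ∃ a : Matrix (Fin p) (Fin p) ℂ,
      complexify (sqrtMap β) 0 • e M = a ⊗ₖ (1 : Matrix (Fin q) (Fin q) ℂ))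
    (h1 : ∀ M, ∃ b : Matrix (Fin q) (Fin q) ℂ,
      complexify (sqrtMap β) 1 • e M = (1 : Matrix (Fin p) (Fin p) ℂ) ⊗ₖ b)
    (M : Matrix k k ℂ) (F : dimensionDrop p q) (hF : ∀ t, eval t F = (β t : ℂ) • e M) :
    τ.toCLM F = ntr M * τ.toCLM (central (complexify β)) := by
  -- With the square root of β, each β • e (M * N) is a product of two elements of the algebra.
  -- Hence M ↦ τ (β • e M) has the trace property on the whole matrix algebra and is a multiple of
  -- `ntr`.
  let s (M) : dimensionDrop p q := bump (complexify (sqrtMap β)) (e M) (h0 M) (h1 M)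
  have hs (t : I) : (complexify (sqrtMap β) t) * (complexify (sqrtMap β) t) = (β t : ℂ) := by
    rw [← ContinuousMap.mul_apply, complexify_sqrtMap_mul_self hβ, complexify_apply]
  have hprod (M N) (t) : eval t (s M * s N) = (β t : ℂ) • e (M * N) := by
    rw [map_mul, eval_bump, eval_bump, smul_mul_smul_comm, hs, he]
  let S : Matrix k k ℂ →ₗ[ℂ] dimensionDrop p q :=
    { toFun := fun M => s M * s 1
      map_add' := fun M N => dimensionDrop.ext fun t => by
        rw [map_add, hprod, hprod, hprod, add_mul, map_add, smul_add]
      map_smul' := fun c M => dimensionDrop.ext fun t => by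
        rw [map_smul, hprod, hprod, smul_mul_assoc, map_smul, smul_comm, RingHom.id_apply] }
  have hS (M N) : S (M * N) = s M * s N := dimensionDrop.ext fun t => by
    rw [hprod]
    exact (hprod _ _ t).trans (by rw [mul_one])
  have key := eq_ntr_mul_of_comm (τ.toCLM.toLinearMap ∘ₗ S) (fun M N => by
    simp only [LinearMap.comp_apply, hS]
    exact τ.tracial _ _) M
  have e1 : S M = F := dimensionDrop.ext fun t => by
    rw [hF]; exact (hprod _ _ t).trans (by rw [mul_one])
  have e2 : S 1 = central (complexify β) := dimensionDrop.ext fun t => by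
    refine (hprod _ _ t).trans ?_
    rw [mul_one, he1, eval_central, complexify_apply]
  simp only [LinearMap.comp_apply, e1, e2] at key
  exact key

/-- The deviation of a tracial state from its composition with the centre-valued trace. -/
noncomputable def defect : dimensionDrop p q →ₗ[ℂ] ℂ where
  toFun f := τ.toCLM f - τ.toCLM (central (ntrFun f))
  map_add' f g := by
    have : ntrFun (f + g) = ntrFun f + ntrFun g := by ext t; simp
    rw [this, map_add, map_add, map_add]; ring
  map_smul' c f := by
    have : ntrFun (c • f) = c • ntrFun f := by ext t; simp
    rw [this, map_smul, map_smul, map_smul, RingHom.id_apply, smul_sub]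

/-- Since `e` preserves the normalised trace, the centre-valued trace of β • e M is ntr M • β, and
`apply_smul_eq` gives the same value to τ on both elements. -/
theorem defect_eq_zero_of_smul {k : Type} [Fintype k] [DecidableEq k] [Nonempty k]
    (e : Matrix k k ℂ →ₗ[ℂ] MatTensor p q) (he : ∀ M N, e (M * N) = e M * e N)
    (he1 : e 1 = 1) (het : ∀ M, ntr (e M) = ntr M) {β : C(I, ℝ)} (hβ : ∀ t, 0 ≤ β t)
    (h0 : ∀ M, ∃ a : Matrix (Fin p) (Fin p) ℂ,
      complexify (sqrtMap β) 0 • e M = a ⊗ₖ (1 : Matrix (Fin q) (Fin q) ℂ))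
    (h1 : ∀ M, ∃ b : Matrix (Fin q) (Fin q) ℂ,
      complexify (sqrtMap β) 1 • e M = (1 : Matrix (Fin p) (Fin p) ℂ) ⊗ₖ b)
    (M : Matrix k k ℂ) (F : dimensionDrop p q) (hF : ∀ t, eval t F = (β t : ℂ) • e M) :
    τ.defect F = 0 := by
  have e2 : (central (ntrFun F) : dimensionDrop p q) = ntr M • central (complexify β) :=
    dimensionDrop.ext fun t => by
      rw [map_smul, eval_central, eval_central, ntrFun_apply, hF, map_smul, het, smul_smul,
        complexify_apply, smul_eq_mul, mul_comm]
  change τ.toCLM F - τ.toCLM (central (ntrFun F)) = 0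
  rw [τ.apply_smul_eq e he he1 hβ h0 h1 M F hF, e2, map_smul, smul_eq_mul, sub_self]

/-- The previous lemma takes a square root of its coefficient, so h is split into its positive and
negative parts. Because h vanishes at the end points, the whole of M_p ⊗ M_q may serve as matrix
algebra. -/
theorem defect_smul_real [Nonempty (Fin p × Fin q)] (h : C(I, ℝ)) (z0 : h 0 = 0) (z1 : h 1 = 0)
    (M : MatTensor p q) (F : dimensionDrop p q) (hF : ∀ t, eval t F = (h t : ℂ) • M) :
    τ.defect F = 0 := by
  have Dpos (h : C(I, ℝ)) (hpos : ∀ t, 0 ≤ h t) (z0 : h 0 = 0) (z1 : h 1 = 0)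
      (F : dimensionDrop p q) (hF : ∀ t, eval t F = (h t : ℂ) • M) : τ.defect F = 0 :=
    τ.defect_eq_zero_of_smul (LinearMap.id : MatTensor p q →ₗ[ℂ] MatTensor p q) (fun _ _ => rfl)
      rfl (fun _ => rfl) hpos (fun M => ⟨0, by simp [sqrtMap, z0]⟩)
      (fun M => ⟨0, by simp [sqrtMap, z1]⟩) M F hF
  let hp : C(I, ℝ) := ⟨fun t => max (h t) 0, by fun_prop⟩
  let hn : C(I, ℝ) := ⟨fun t => max (-h t) 0, by fun_prop⟩
  let P : dimensionDrop p q := bump (complexify hp) M ⟨0, by simp [hp, z0]⟩ ⟨0, by simp [hp, z1]⟩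
  let N : dimensionDrop p q := bump (complexify hn) M ⟨0, by simp [hn, z0]⟩ ⟨0, by simp [hn, z1]⟩
  have : F = P + (-1 : ℂ) • N := dimensionDrop.ext fun t => by
    rw [hF, map_add, map_smul, eval_bump, eval_bump, smul_smul, ← add_smul]
    congr 1
    have : h t = max (h t) 0 + -1 * max (-h t) 0 := by
      rcases le_total (h t) 0 with h' | h'
      · rw [max_eq_right h', max_eq_left (by linarith)]; ring
      · rw [max_eq_left h', max_eq_right (by linarith)]; ring
    simp only [complexify_apply, hp, hn, ContinuousMap.coe_mk]
    exact_mod_cast this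
  rw [this, map_add, map_smul,
    Dpos hp (fun t => le_max_right _ _) (by simp [hp, z0]) (by simp [hp, z1]) P (fun t => rfl),
    Dpos hn (fun t => le_max_right _ _) (by simp [hn, z0]) (by simp [hn, z1]) N (fun t => rfl),
    smul_zero, add_zero]

theorem defect_smul_complex [Nonempty (Fin p × Fin q)] (h : C(I, ℂ)) (z0 : h 0 = 0)
    (z1 : h 1 = 0) (M : MatTensor p q) (F : dimensionDrop p q) (hF : ∀ t, eval t F = h t • M) :
    τ.defect F = 0 := by
  let hr : C(I, ℝ) := ⟨fun t => (h t).re, by fun_prop⟩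
  let hi : C(I, ℝ) := ⟨fun t => (h t).im, by fun_prop⟩
  let P : dimensionDrop p q := bump (complexify hr) M ⟨0, by simp [hr, z0]⟩ ⟨0, by simp [hr, z1]⟩
  let N : dimensionDrop p q := bump (complexify hi) M ⟨0, by simp [hi, z0]⟩ ⟨0, by simp [hi, z1]⟩
  have : F = P + Complex.I • N := dimensionDrop.ext fun t => by
    rw [hF, map_add, map_smul, eval_bump, eval_bump, smul_smul, ← add_smul]
    congr 1
    simp only [complexify_apply, hr, hi, ContinuousMap.coe_mk]
    rw [mul_comm, Complex.re_add_im]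
  rw [this, map_add, map_smul,
    τ.defect_smul_real hr (by simp [hr, z0]) (by simp [hr, z1]) M P (fun t => rfl),
    τ.defect_smul_real hi (by simp [hi, z0]) (by simp [hi, z1]) M N (fun t => rfl),
    smul_zero, add_zero]

theorem defect_eq_zero_of_vanish [Nonempty (Fin p × Fin q)] (G : dimensionDrop p q)
    (G0 : eval 0 G = 0) (G1 : eval 1 G = 0) : τ.defect G = 0 := by
  let c (i j) : C(I, ℂ) := ⟨fun t => eval t G i j,
    (continuous_apply j).comp ((continuous_apply i).comp (continuous_eval G))⟩
  have c0 (i j) : c i j 0 = 0 := congrFun (congrFun G0 i) j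
  have c1 (i j) : c i j 1 = 0 := congrFun (congrFun G1 i) j
  let E (i j) : dimensionDrop p q := bump (c i j) (Matrix.single i j 1)
    ⟨0, by rw [c0, zero_smul, Matrix.zero_kronecker]⟩
    ⟨0, by rw [c1, zero_smul, Matrix.kronecker_zero]⟩
  have hG : G = ∑ i, ∑ j, E i j := dimensionDrop.ext fun t => by
    conv_lhs => rw [Matrix.matrix_eq_sum_single (eval t G)]
    simp only [map_sum, E, eval_bump, Matrix.smul_single, smul_eq_mul, mul_one]
    rfl
  rw [hG, map_sum]
  refine Finset.sum_eq_zero fun i _ => ?_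
  rw [map_sum]
  exact Finset.sum_eq_zero fun j _ => τ.defect_smul_complex (c i j) (c0 i j) (c1 i j) _ _
    (fun t => rfl)

/-- The witness is (1 - t) • (a ⊗ 1). It does not vanish at 0, so only the trace property of M_p,
not that of M_p ⊗ M_q, is available for it. -/
theorem exists_defect_zero_left (hp : 0 < p) (hq : 0 < q) (a : Matrix (Fin p) (Fin p) ℂ) :
    ∃ F : dimensionDrop p q, eval 0 F = a ⊗ₖ (1 : Matrix (Fin q) (Fin q) ℂ) ∧ eval 1 F = 0 ∧
      τ.defect F = 0 := by
  have : Nonempty (Fin p) := ⟨⟨0, hp⟩⟩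
  have : Nonempty (Fin q) := ⟨⟨0, hq⟩⟩
  let l : Matrix (Fin p) (Fin p) ℂ →ₗ[ℂ] MatTensor p q :=
    { toFun := fun a => a ⊗ₖ (1 : Matrix (Fin q) (Fin q) ℂ)
      map_add' := fun a b => Matrix.add_kronecker a b _
      map_smul' := fun c a => Matrix.smul_kronecker c a _ }
  let β : C(I, ℝ) := ⟨fun t => 1 - (t : ℝ), by fun_prop⟩
  have b0 : complexify β 0 = 1 := by simp [β]
  have b1 : complexify β 1 = 0 := by simp [β]
  have s1 : complexify (sqrtMap β) 1 = 0 := by simp [sqrtMap, β]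
  refine ⟨bump (complexify β) (l a) ⟨complexify β 0 • a, (Matrix.smul_kronecker _ _ _).symm⟩
    ⟨0, by rw [b1, zero_smul, Matrix.kronecker_zero]⟩, ?_, ?_, ?_⟩
  · rw [eval_bump, b0, one_smul]; rfl
  · rw [eval_bump, b1, zero_smul]
  · refine τ.defect_eq_zero_of_smul l (fun M N => ?_) (Matrix.one_kronecker_one) (fun M => ?_)
      (β := β) (fun t => sub_nonneg.2 t.2.2) (fun M => ⟨_, (Matrix.smul_kronecker _ _ _).symm⟩)
      (fun M => ⟨0, by rw [s1, zero_smul, Matrix.kronecker_zero]⟩) a _ (fun t => rfl)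
    · change (M * N) ⊗ₖ _ = (M ⊗ₖ _) * (N ⊗ₖ _)
      rw [← Matrix.mul_kronecker_mul, one_mul]
    · change ntr (M ⊗ₖ _) = _
      rw [ntr_kronecker, ntr_one, mul_one]

theorem exists_defect_zero_right (hp : 0 < p) (hq : 0 < q) (b : Matrix (Fin q) (Fin q) ℂ) :
    ∃ F : dimensionDrop p q, eval 0 F = 0 ∧ eval 1 F = (1 : Matrix (Fin p) (Fin p) ℂ) ⊗ₖ b ∧
      τ.defect F = 0 := by
  have : Nonempty (Fin p) := ⟨⟨0, hp⟩⟩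
  have : Nonempty (Fin q) := ⟨⟨0, hq⟩⟩
  let r : Matrix (Fin q) (Fin q) ℂ →ₗ[ℂ] MatTensor p q :=
    { toFun := fun b => (1 : Matrix (Fin p) (Fin p) ℂ) ⊗ₖ b
      map_add' := fun a b => Matrix.kronecker_add _ a b
      map_smul' := fun c a => Matrix.kronecker_smul c _ a }
  let β : C(I, ℝ) := ⟨fun t => (t : ℝ), by fun_prop⟩
  have b0 : complexify β 0 = 0 := by simp [β]
  have b1 : complexify β 1 = 1 := by simp [β]
  have s0 : complexify (sqrtMap β) 0 = 0 := by simp [sqrtMap, β]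
  refine ⟨bump (complexify β) (r b) ⟨0, by rw [b0, zero_smul, Matrix.zero_kronecker]⟩
    ⟨complexify β 1 • b, (Matrix.kronecker_smul _ _ _).symm⟩, ?_, ?_, ?_⟩
  · rw [eval_bump, b0, zero_smul]
  · rw [eval_bump, b1, one_smul]; rfl
  · refine τ.defect_eq_zero_of_smul r (fun M N => ?_) (Matrix.one_kronecker_one) (fun M => ?_)
      (β := β) (fun t => t.2.1) (fun M => ⟨0, by rw [s0, zero_smul, Matrix.zero_kronecker]⟩)
      (fun M => ⟨_, (Matrix.kronecker_smul _ _ _).symm⟩) b _ (fun t => rfl)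
    · change _ ⊗ₖ (M * N) = (_ ⊗ₖ M) * (_ ⊗ₖ N)
      rw [← Matrix.mul_kronecker_mul, one_mul]
    · change ntr (_ ⊗ₖ M) = _
      rw [ntr_kronecker, ntr_one, one_mul]

/-- A tracial state on a dimension drop algebra is determined by its restriction to the centre. -/
theorem apply_eq_central (hp : 0 < p) (hq : 0 < q) (f : dimensionDrop p q) :
    τ.toCLM f = τ.toCLM (central (ntrFun f)) := by
  have : Nonempty (Fin p) := ⟨⟨0, hp⟩⟩
  have : Nonempty (Fin q) := ⟨⟨0, hq⟩⟩
  obtain ⟨a, ha⟩ := exists_eval_zero f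
  obtain ⟨b, hb⟩ := exists_eval_one f
  obtain ⟨f₀, h00, h01, D0⟩ := τ.exists_defect_zero_left hp hq a
  obtain ⟨f₁, h10, h11, D1⟩ := τ.exists_defect_zero_right hp hq b
  -- Subtracting lifts of both end values leaves a function that vanishes at 0 and 1.
  have DG := τ.defect_eq_zero_of_vanish (f + (-1 : ℂ) • f₀ + (-1 : ℂ) • f₁)
    (by rw [map_add, map_add, map_smul, map_smul, ha, h00, h10, smul_zero, add_zero, neg_one_smul,
      add_neg_cancel])
    (by rw [map_add, map_add, map_smul, map_smul, hb, h01, h11, smul_zero, add_zero, neg_one_smul,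
      add_neg_cancel])
  rw [map_add, map_add, map_smul, map_smul, D0, D1, smul_zero, add_zero, add_zero] at DG
  exact sub_eq_zero.1 DG

end TracialState

/-! ### The Lebesgue trace -/

namespace dimensionDrop
variable {p q : ℕ}

/-- Full support of Lebesgue measure is what makes the Lebesgue trace faithful. -/
instance : Measure.IsOpenPosMeasure (volume : Measure I) where
  open_pos U hU hne h0 := by
    obtain ⟨x, hx⟩ := hne
    obtain ⟨ε, hε, hball⟩ := Metric.isOpen_iff.1 hU x hx
    have hlt : max (0 : ℝ) (x - ε) < min 1 (x + ε) := by
      have := x.2.1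
      have := x.2.2
      refine max_lt (lt_min (by norm_num) (by linarith)) (lt_min (by linarith) (by linarith))
    let a : I := ⟨max 0 (x - ε), le_max_left _ _, (hlt.trans_le (min_le_left _ _)).le⟩
    let b : I := ⟨min 1 (x + ε), ((le_max_left _ _).trans hlt.le), min_le_left _ _⟩
    have hsub : Set.Ioo a b ⊆ U := fun y hy => hball <| by
      have h1 : max (0 : ℝ) (x - ε) < y := hy.1
      have h2 : (y : ℝ) < min 1 (x + ε) := hy.2
      rw [Metric.mem_ball, Subtype.dist_eq, Real.dist_eq, abs_lt]
      exact ⟨by linarith [le_max_right (0 : ℝ) (x - ε)], by linarith [min_le_right 1 ((x : ℝ) + ε)]⟩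
    have := measure_mono_null hsub h0
    rw [unitInterval.volume_Ioo, ENNReal.ofReal_eq_zero] at this
    exact absurd hlt (not_lt.2 (sub_nonpos.1 this))

theorem integrable_of_continuous {E : Type*} [NormedAddCommGroup E] [NormedSpace ℝ E]
    [SecondCountableTopologyEither I E] {f : I → E} (hf : Continuous f) : Integrable f :=
  hf.integrable_of_hasCompactSupport (HasCompactSupport.of_compactSpace f)

theorem norm_integral_le_of_forall {f : I → ℂ} {C : ℝ} (h : ∀ t, ‖f t‖ ≤ C) :
    ‖∫ t, f t‖ ≤ C := by
  have := norm_integral_le_of_norm_le_const (μ := (volume : Measure I)) (f := f) (C := C)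
    (Filter.Eventually.of_forall h)
  simpa using this

theorem norm_trace_le {ι : Type*} [Fintype ι] [DecidableEq ι] :
    ∃ C : ℝ, 0 ≤ C ∧ ∀ M : Matrix ι ι ℂ, ‖ntr M‖ ≤ C * ‖M‖ :=
  ⟨‖LinearMap.toContinuousLinearMap (ntr : Matrix ι ι ℂ →ₗ[ℂ] ℂ)‖, norm_nonneg _, fun M =>
    (LinearMap.toContinuousLinearMap (ntr : Matrix ι ι ℂ →ₗ[ℂ] ℂ)).le_opNorm M⟩

/-- The functional `f ↦ ∫ ntr (f t)`. -/
noncomputable def lebLinear (p q : ℕ) : dimensionDrop p q →ₗ[ℂ] ℂ where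
  toFun f := ∫ t, ntr (eval t f)
  map_add' f g := by
    simp only [map_add]
    exact integral_add (integrable_of_continuous (ntrFun f).continuous)
      (integrable_of_continuous (ntrFun g).continuous)
  map_smul' c f := by
    simp only [map_smul, smul_eq_mul]
    exact integral_const_mul _ _

/-- The functional `f ↦ ∫ ntr (f t)` as a continuous functional. -/
noncomputable def lebCLM (p q : ℕ) : dimensionDrop p q →L[ℂ] ℂ :=
  ⟨lebLinear p q, by
    obtain ⟨C, hC, h⟩ := norm_trace_le (ι := Fin p × Fin q)
    exact AddMonoidHomClass.continuous_of_bound (lebLinear p q) C fun f =>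
      norm_integral_le_of_forall fun t =>
        (h _).trans (mul_le_mul_of_nonneg_left (norm_eval_le t f) hC)⟩

theorem lebCLM_apply (f : dimensionDrop p q) : lebCLM p q f = ∫ t, ntr (eval t f) := rfl

/-- The Lebesgue trace. -/
noncomputable def lebTrace (hp : 0 < p) (hq : 0 < q) : TracialState (dimensionDrop p q) where
  toCLM := lebCLM p q
  map_one := by
    have : Nonempty (Fin p) := ⟨⟨0, hp⟩⟩
    have : Nonempty (Fin q) := ⟨⟨0, hq⟩⟩
    rw [lebCLM_apply]
    simp [ntr_one]
  nonneg f := by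
    rw [lebCLM_apply]
    refine integral_nonneg fun t => ?_
    change 0 ≤ ntr (eval t (star f * f))
    rw [map_mul, map_star]
    exact ntr_star_mul_self_nonneg _
  tracial f g := by
    rw [lebCLM_apply, lebCLM_apply]
    simp only [map_mul, ntr_mul_comm]

theorem lebTrace_apply (hp : 0 < p) (hq : 0 < q) (f : dimensionDrop p q) :
    (lebTrace hp hq).toCLM f = ∫ t, ntr (eval t f) := rfl

theorem lebTrace_faithful (hp : 0 < p) (hq : 0 < q) :
    (lebTrace hp hq : TracialState (dimensionDrop p q)).Faithful := by
  intro f hf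
  rw [lebTrace_apply] at hf
  let g : I → ℝ := fun t => (ntr (eval t (star f * f))).re
  have hpos (t) : 0 ≤ ntr (eval t (star f * f)) := by
    rw [map_mul, map_star]
    exact ntr_star_mul_self_nonneg _
  have hg (t) : ntr (eval t (star f * f)) = (g t : ℂ) := Complex.ext rfl (by
    rw [Complex.ofReal_im]; exact (Complex.le_def.1 (hpos t)).2.symm)
  have hg0 : 0 ≤ g := fun t => (Complex.le_def.1 (hpos t)).1
  have hgc : Continuous g := Complex.continuous_re.comp (ntrFun (star f * f)).continuous
  have hint : ∫ t, g t = 0 := by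
    simp only [hg] at hf
    rw [integral_complex_ofReal] at hf
    exact_mod_cast hf
  rw [integral_eq_zero_iff_of_nonneg hg0 (integrable_of_continuous hgc)] at hint
  have h0 : g = 0 := (Continuous.ae_eq_iff_eq volume hgc continuous_zero).1 hint
  refine dimensionDrop.ext fun t => ?_
  rw [map_zero]
  refine eq_zero_of_ntr_star_mul_self ?_
  rw [← map_star, ← map_mul, hg, h0]
  rfl

end dimensionDrop

/-! ### Quantile functions -/

/-- A probability measure on the unit interval with full support is the image of Lebesgue measure
under a continuous map that fixes the end points. -/
theorem exists_continuous_quantile (μ : Measure I) [IsProbabilityMeasure μ]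
    [μ.IsOpenPosMeasure] :
    ∃ Q : C(I, I), Q 0 = 0 ∧ Q 1 = 1 ∧ volume.map Q = μ := by
  let ν : Measure ℝ := μ.map (Subtype.val : I → ℝ)
  have hν : IsProbabilityMeasure ν := Measure.isProbabilityMeasure_map (by fun_prop)
  let F := ProbabilityTheory.cdf ν
  have hF (x : I) : F x = μ.real (Set.Iic x) := by
    change ProbabilityTheory.cdf ν x = _
    rw [ProbabilityTheory.cdf_eq_real, Measure.real, Measure.map_apply (by fun_prop)
      measurableSet_Iic]
    rfl
  have hF0 (x : ℝ) : 0 ≤ F x := ProbabilityTheory.cdf_nonneg ν x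
  have hF1 (x : ℝ) : F x ≤ 1 := ProbabilityTheory.cdf_le_one ν x
  -- Full support makes the distribution function strictly increasing. Atoms are harmless: they are
  -- jumps of F, across which the quantile function is constant.
  have hmono : StrictMono fun x : I => F x := by
    intro x y hxy
    simp only [hF]
    have h1 : μ.real (Set.Iic y) = μ.real (Set.Iic x) + μ.real (Set.Ioc x y) := by
      rw [← measureReal_union _ measurableSet_Ioc, Set.Iic_union_Ioc_eq_Iic hxy.le]
      exact Set.disjoint_left.2 fun a ha hb => not_lt.2 ha hb.1
    have h2 : 0 < μ.real (Set.Ioc x y) := by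
      refine ENNReal.toReal_pos (ne_of_gt ?_) (measure_ne_top _ _)
      exact (isOpen_Ioo.measure_pos μ (Set.nonempty_Ioo.2 hxy)).trans_le
        (measure_mono Set.Ioo_subset_Ioc_self)
    rw [h1]
    linarith
  -- The point 0 is adjoined by hand: if μ has an atom at 0, no x in I satisfies F x ≤ s for small
  -- s.
  let S (s : I) : Set ℝ := {x | ∃ h : x ∈ I, x = 0 ∨ F x ≤ s}
  have hS0 (s) : (0 : ℝ) ∈ S s := ⟨unitInterval.zero_mem, Or.inl rfl⟩
  have hSb (s) : BddAbove (S s) := ⟨1, fun x hx => hx.1.2⟩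
  let Q₀ (s : I) : I := ⟨sSup (S s), le_csSup (hSb s) (hS0 s), csSup_le ⟨0, hS0 s⟩
    fun x hx => hx.1.2⟩
  have hQmono : Monotone Q₀ := fun s s' h => csSup_le_csSup (hSb s') ⟨0, hS0 s⟩
    fun x hx => ⟨hx.1, hx.2.imp_right fun h' => h'.trans h⟩
  have hQF (y : I) : Q₀ ⟨F y, hF0 y, hF1 y⟩ = y := by
    apply Subtype.ext
    refine le_antisymm (csSup_le ⟨0, hS0 _⟩ ?_) (le_csSup (hSb _) ⟨y.2, Or.inr le_rfl⟩)
    rintro x ⟨hx, h | h⟩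
    · rw [h]; exact y.2.1
    · exact (hmono.le_iff_le (a := ⟨x, hx⟩) (b := y)).1 h
  have hQsurj : Function.Surjective Q₀ := fun y => ⟨_, hQF y⟩
  -- A monotone surjection has no jumps; surjectivity came from the strict monotonicity of F.
  have hQc : Continuous Q₀ := hQmono.continuous_of_surjective hQsurj
  refine ⟨⟨Q₀, hQc⟩, ?_, ?_, ?_⟩
  · obtain ⟨s, hs⟩ := hQsurj 0
    have := hQmono (show (0 : I) ≤ s from s.2.1)
    rw [hs] at this
    exact le_antisymm this (Q₀ 0).2.1
  · obtain ⟨s, hs⟩ := hQsurj 1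
    have := hQmono (show s ≤ (1 : I) from s.2.2)
    rw [hs] at this
    exact le_antisymm (Q₀ 1).2.2 this
  · have : IsFiniteMeasure (volume.map Q₀) := Measure.isFiniteMeasure_map _ _
    refine Measure.ext_of_Iic _ _ fun x => ?_
    change volume.map Q₀ _ = _
    rw [Measure.map_apply hQc.measurable measurableSet_Iic]
    have : Q₀ ⁻¹' Set.Iic x = Set.Iic ⟨F x, hF0 x, hF1 x⟩ := by
      ext s
      constructor
      · intro hs
        -- For y to the right of x the supremum excludes F y < s; right continuity of F then gives s
        -- ≤ F x.
        have key : ∀ y : ℝ, (x : ℝ) < y → (s : ℝ) ≤ F y := by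
          intro y hy
          by_contra hlt
          rw [not_le] at hlt
          have hy1 : y ≤ 1 := by
            by_contra h1
            have : F (1 : ℝ) = 1 := by
              have := hF 1
              rw [show Set.Iic (1 : I) = Set.univ from Set.eq_univ_of_forall fun z => z.2.2,
                probReal_univ] at this
              exact this
            have := F.mono (not_le.1 h1).le
            linarith [s.2.2]
          have hyI : y ∈ I := ⟨x.2.1.trans hy.le, hy1⟩
          have h2 : y ≤ Q₀ s := le_csSup (hSb s) ⟨hyI, Or.inr hlt.le⟩
          have h3 : (Q₀ s : ℝ) ≤ x := hs
          linarith
        have hc : Filter.Tendsto F (nhdsWithin (x : ℝ) (Set.Ioi x)) (nhds (F x)) :=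
          ((F.right_continuous x).mono Set.Ioi_subset_Ici_self)
        exact ge_of_tendsto hc (Filter.eventually_of_mem self_mem_nhdsWithin key)
      · intro hs
        have := hQmono (show s ≤ ⟨F x, hF0 x, hF1 x⟩ from hs)
        rwa [hQF] at this
    rw [this, unitInterval.volume_Iic]
    change ENNReal.ofReal (F x) = _
    rw [hF, ofReal_measureReal]

/-! ### The measure of a tracial state -/

namespace TracialState
open dimensionDrop
variable {p q : ℕ} (τ : TracialState (dimensionDrop p q))

theorem central_nonneg {h : C(I, ℝ)} (hh : ∀ t, 0 ≤ h t) :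
    0 ≤ τ.toCLM (central (complexify h)) := by
  have : (central (complexify h) : dimensionDrop p q) =
      star (central (complexify (sqrtMap h))) * central (complexify (sqrtMap h)) := by
    rw [← map_star, ← map_mul, ← complexify_sqrtMap_mul_self hh]
    congr 2
    ext t
    simp
  rw [this]
  exact τ.nonneg _

/-- If the trace of h = √h · √h were 0, faithfulness would force the central element √h to vanish.
-/
theorem central_pos (hτ : τ.Faithful) (hp : 0 < p) (hq : 0 < q) {h : C(I, ℝ)}
    (hh : ∀ t, 0 ≤ h t) {t : I} (ht : h t ≠ 0) :
    0 < τ.toCLM (central (complexify h)) := by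
  refine lt_of_le_of_ne (τ.central_nonneg hh) fun h0 => ht ?_
  have : (central (complexify h) : dimensionDrop p q) =
      star (central (complexify (sqrtMap h))) * central (complexify (sqrtMap h)) := by
    rw [← map_star, ← map_mul, ← complexify_sqrtMap_mul_self hh]
    congr 2
    ext t
    simp
  rw [this] at h0
  have h1 := hτ _ h0.symm
  have h2 : eval t (central (complexify (sqrtMap h)) : dimensionDrop p q) = 0 := by
    rw [h1, map_zero]
  rw [eval_central] at h2
  have h3 := congrFun (congrFun h2 (⟨0, hp⟩, ⟨0, hq⟩)) (⟨0, hp⟩, ⟨0, hq⟩)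
  simp only [Matrix.smul_apply, Matrix.one_apply_eq, smul_eq_mul, mul_one, Matrix.zero_apply,
    complexify_apply, Complex.ofReal_eq_zero] at h3
  exact (Real.sqrt_eq_zero (hh t)).1 h3

/-- The restriction of a tracial state to the real part of the centre, as a real functional. -/
noncomputable def centralReal : C(I, ℝ) →ₗ[ℝ] ℝ where
  toFun h := (τ.toCLM (central (complexify h))).re
  map_add' g h := by
    have : complexify (g + h) = complexify g + complexify h := by ext t; simp
    rw [this, map_add, map_add, Complex.add_re]
  map_smul' c h := by
    have : complexify (c • h) = (c : ℂ) • complexify h := by ext t; simp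
    rw [this, map_smul, map_smul, smul_eq_mul, Complex.re_ofReal_mul]
    rfl

theorem centralReal_nonneg {h : C(I, ℝ)} (hh : ∀ t, 0 ≤ h t) : 0 ≤ τ.centralReal h :=
  (Complex.le_def.1 (τ.central_nonneg hh)).1

theorem central_complexify (h : C(I, ℝ)) :
    τ.toCLM (central (complexify h)) = (τ.centralReal h : ℂ) := by
  have hpos (h : C(I, ℝ)) (hh : ∀ t, 0 ≤ h t) : (τ.toCLM (central (complexify h))).im = 0 :=
    (Complex.le_def.1 (τ.central_nonneg hh)).2.symm
  refine Complex.ext rfl ?_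
  rw [Complex.ofReal_im]
  let hp : C(I, ℝ) := ⟨fun t => max (h t) 0, by fun_prop⟩
  let hn : C(I, ℝ) := ⟨fun t => max (-h t) 0, by fun_prop⟩
  have e : complexify h = complexify hp + (-1 : ℂ) • complexify hn := by
    ext t
    have : h t = max (h t) 0 + -1 * max (-h t) 0 := by
      rcases le_total (h t) 0 with h' | h'
      · rw [max_eq_right h', max_eq_left (by linarith)]; ring
      · rw [max_eq_left h', max_eq_right (by linarith)]; ring
    simp only [complexify_apply, ContinuousMap.add_apply, ContinuousMap.smul_apply, smul_eq_mul,
      hp, hn, ContinuousMap.coe_mk]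
    exact_mod_cast this
  rw [e, map_add, map_smul, map_add, map_smul, neg_one_smul, Complex.add_im, Complex.neg_im,
    hpos hp fun t => le_max_right _ _, hpos hn fun t => le_max_right _ _]
  simp

/-- This is Riesz representation on the centre. For full support, the distance to the complement of
a nonempty open set is a nonzero positive central function, so its trace is positive; were the open
set null, its integral would be 0. -/
theorem exists_measure (hτ : τ.Faithful) (hp : 0 < p) (hq : 0 < q) :
    ∃ μ : Measure I, IsProbabilityMeasure μ ∧ μ.IsOpenPosMeasure ∧
      ∀ h : C(I, ℝ), ∫ t, h t ∂μ = τ.centralReal h := by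
  let Λ : CompactlySupportedContinuousMap I ℝ →ₚ[ℝ] ℝ := PositiveLinearMap.mk₀
    { toFun := fun h => τ.centralReal h.toContinuousMap
      map_add' := fun g h => τ.centralReal.map_add g.toContinuousMap h.toContinuousMap
      map_smul' := fun c h => τ.centralReal.map_smul c h.toContinuousMap }
    (fun h hh => τ.centralReal_nonneg fun t => hh t)
  let μ := RealRMK.rieszMeasure Λ
  have hμ (h : C(I, ℝ)) : ∫ t, h t ∂μ = τ.centralReal h :=
    RealRMK.integral_rieszMeasure Λ (CompactlySupportedContinuousMap.continuousMapEquiv h)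
  have hfin : IsFiniteMeasure μ := inferInstance
  have hone : τ.centralReal 1 = 1 := by
    have : complexify 1 = 1 := by ext t; simp
    change (τ.toCLM (central (complexify 1))).re = 1
    rw [this, _root_.map_one, τ.map_one, Complex.one_re]
  refine ⟨μ, ⟨?_⟩, ⟨fun U hU hne h0 => ?_⟩, hμ⟩
  · have := hμ 1
    rw [hone] at this
    simp only [ContinuousMap.one_apply, integral_const, smul_eq_mul, mul_one] at this
    rw [Measure.real, ENNReal.toReal_eq_one_iff] at this
    exact this
  · obtain ⟨x, hx⟩ := hne
    let h : C(I, ℝ) := ⟨fun t => Metric.infDist t Uᶜ, by fun_prop⟩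
    -- The distance to the empty set is 0 by convention, so the case where U is everything is
    -- separate: there the total mass 1 contradicts nullity.
    rcases Set.eq_empty_or_nonempty Uᶜ with hem | hnem
    · rw [Set.compl_empty_iff.1 hem] at h0
      have := hμ 1
      rw [hone, Measure.measure_univ_eq_zero.1 h0] at this
      simp at this
    have hx0 : h x ≠ 0 := fun h' => by
      have := (hU.isClosed_compl.mem_iff_infDist_zero hnem).2 h'
      exact this hx
    have h1 := τ.central_pos hτ hp hq (h := h) (fun t => Metric.infDist_nonneg) hx0
    rw [τ.central_complexify, ← hμ] at h1
    have : ∫ t, h t ∂μ = 0 := by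
      refine integral_eq_zero_of_ae ?_
      have hU0 : Uᶜ ∈ ae μ := by rw [mem_ae_iff, compl_compl]; exact h0
      refine Filter.eventually_of_mem hU0 fun t ht => ?_
      exact Metric.infDist_zero_of_mem ht
    rw [this] at h1
    simp at h1

/-- Every faithful tracial state is the image of the Lebesgue trace under a reparametrisation of
the interval. -/
theorem exists_reparam (hτ : τ.Faithful) (hp : 0 < p) (hq : 0 < q) :
    ∃ Q : C(I, I), Q 0 = 0 ∧ Q 1 = 1 ∧
      ∀ f : dimensionDrop p q, τ.toCLM f = ∫ t, ntr (eval (Q t) f) := by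
  obtain ⟨μ, h1, h2, hμ⟩ := τ.exists_measure hτ hp hq
  obtain ⟨Q, Q0, Q1, hQ⟩ := exists_continuous_quantile μ
  refine ⟨Q, Q0, Q1, fun f => ?_⟩
  have hreal (h : C(I, ℝ)) : τ.toCLM (central (complexify h)) = ∫ t, (h (Q t) : ℂ) := by
    rw [τ.central_complexify, ← hμ, ← hQ, integral_map Q.continuous.measurable.aemeasurable
      h.continuous.aestronglyMeasurable, integral_complex_ofReal]
  let hr : C(I, ℝ) := ⟨fun t => (ntrFun f t).re, by fun_prop⟩
  let hi : C(I, ℝ) := ⟨fun t => (ntrFun f t).im, by fun_prop⟩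
  have e : ntrFun f = complexify hr + Complex.I • complexify hi := by
    ext t
    simp only [complexify_apply, ContinuousMap.add_apply, ContinuousMap.smul_apply, smul_eq_mul,
      hr, hi, ContinuousMap.coe_mk]
    rw [mul_comm, Complex.re_add_im]
  rw [τ.apply_eq_central hp hq, e, map_add, map_smul, map_add, map_smul, hreal, hreal, smul_eq_mul,
    ← integral_const_mul, ← integral_add (integrable_of_continuous (by fun_prop))
      (integrable_of_continuous (by fun_prop))]
  refine integral_congr_ae (Filter.Eventually.of_forall fun t => ?_)
  change ((ntr (eval (Q t) f)).re : ℂ) + Complex.I * (ntr (eval (Q t) f)).im = _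
  rw [mul_comm, Complex.re_add_im]

end TracialState

/-! ### Reparametrisations of the interval as embeddings -/

namespace dimensionDrop
variable {p q : ℕ}

/-- Composition with a reparametrisation of the interval that fixes the end points. -/
noncomputable def reparam (Q : C(I, I)) (h0 : Q 0 = 0) (h1 : Q 1 = 1) :
    dimensionDrop p q →⋆ₐ[ℂ] dimensionDrop p q where
  toFun f := ⟨f.1.comp Q, by
    obtain ⟨⟨a, ha⟩, b, hb⟩ := f.2
    exact ⟨⟨a, by rw [ContinuousMap.comp_apply, h0, ha]⟩,
      b, by rw [ContinuousMap.comp_apply, h1, hb]⟩⟩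
  map_one' := rfl
  map_mul' _ _ := rfl
  map_zero' := rfl
  map_add' _ _ := rfl
  commutes' _ := rfl
  map_star' _ := rfl

theorem eval_reparam (Q : C(I, I)) (h0 : Q 0 = 0) (h1 : Q 1 = 1) (t : I)
    (f : dimensionDrop p q) : eval t (reparam Q h0 h1 f) = eval (Q t) f := rfl

theorem surjective_of_fix {Q : C(I, I)} (h0 : Q 0 = 0) (h1 : Q 1 = 1) :
    Function.Surjective Q := by
  intro y
  have := intermediate_value_univ (0 : I) 1 Q.continuous
  rw [h0, h1] at this
  exact this ⟨y.2.1, y.2.2⟩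

theorem reparam_injective (Q : C(I, I)) (h0 : Q 0 = 0) (h1 : Q 1 = 1) :
    Function.Injective (reparam Q h0 h1 : dimensionDrop p q →⋆ₐ[ℂ] dimensionDrop p q) := by
  intro f g h
  refine dimensionDrop.ext fun t => ?_
  obtain ⟨s, rfl⟩ := surjective_of_fix h0 h1 t
  rw [← eval_reparam Q h0 h1, ← eval_reparam Q h0 h1, h]

end dimensionDrop

/-! ### Morphisms -/

/-- The prime dimension drop algebra with the Lebesgue trace. -/
noncomputable def PrimeDimDrop.leb (p q : ℕ) (hp : 0 < p) (hq : 0 < q) (h : Nat.Coprime p q) :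
    PrimeDimDrop :=
  ⟨p, q, hp, hq, h, dimensionDrop.lebTrace hp hq, dimensionDrop.lebTrace_faithful hp hq⟩

theorem KZ.exists_embedding {X Y : PrimeDimDrop}
    (ψ : dimensionDrop X.p X.q →⋆ₐ[ℂ] dimensionDrop Y.p Y.q) (hψ : Function.Injective ψ)
    (htr : ∀ a, Y.trace.toCLM (ψ a) = X.trace.toCLM a) :
    ∃ e : MetricStructure.Embedding (KZ.str X) (KZ.str Y),
      ∀ a : dimensionDrop X.p X.q, (show dimensionDrop Y.p Y.q from e.toFun a) = ψ a := by
  obtain ⟨e, he⟩ := (exists_tracial_embedding_iff X.trace Y.trace ψ).2 ⟨ψ, hψ, htr, rfl⟩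
  exact ⟨e, fun a => congrFun he a⟩

theorem KZ.exists_starAlgHom {X Y : PrimeDimDrop}
    (e : MetricStructure.Embedding (KZ.str X) (KZ.str Y)) :
    ∃ ψ : dimensionDrop X.p X.q →⋆ₐ[ℂ] dimensionDrop Y.p Y.q, Function.Injective ψ ∧
      (∀ a, Y.trace.toCLM (ψ a) = X.trace.toCLM a) ∧
      ∀ a : dimensionDrop X.p X.q, (show dimensionDrop Y.p Y.q from e.toFun a) = ψ a := by
  obtain ⟨ψ, h1, h2, h3⟩ :=
    (exists_tracial_embedding_iff X.trace Y.trace e.toFun).1 ⟨e, rfl⟩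
  exact ⟨ψ, h1, h2, fun a => (congrFun h3 a).symm⟩

/-- Every object embeds into the one with the Lebesgue trace on the same algebra. -/
theorem KZ.exists_embedding_leb (X : PrimeDimDrop) :
    Nonempty (MetricStructure.Embedding (KZ.str X)
      (KZ.str (PrimeDimDrop.leb X.p X.q X.p_pos X.q_pos X.coprime))) := by
  obtain ⟨Q, h0, h1, hQ⟩ := X.trace.exists_reparam X.faithful X.p_pos X.q_pos
  obtain ⟨e, -⟩ := KZ.exists_embedding (X := X)
    (Y := PrimeDimDrop.leb X.p X.q X.p_pos X.q_pos X.coprime)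
    (dimensionDrop.reparam Q h0 h1) (dimensionDrop.reparam_injective Q h0 h1) fun f => by
      rw [hQ]; rfl
  exact ⟨e⟩

/-! ### Finite generation -/

/-- A tuple that is contained in no proper closed star subalgebra is a generator. -/
theorem tracialStructure_isGenerator {A : Type*} [CStarAlgebra A] (τ : TracialState A) {n : ℕ}
    (a : Fin n → A)
    (h : ∀ S : StarSubalgebra ℂ A, IsClosed (S : Set A) → (∀ i, a i ∈ S) → S = ⊤) :
    (tracialStructure A τ).IsGenerator a := by
  intro S hS ha hf
  have f0 : (0 : A) ∈ S := hf 0 TCStarFunc.zero ![] (fun i => i.elim0)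
  have f1 : (1 : A) ∈ S := hf 0 TCStarFunc.one ![] (fun i => i.elim0)
  have fs (c : ℂ) (x : A) (hx : x ∈ S) : c • x ∈ S :=
    hf 1 (TCStarFunc.smul c) ![x] (fun i => by fin_cases i; exact hx)
  have fst (x : A) (hx : x ∈ S) : star x ∈ S :=
    hf 1 TCStarFunc.star ![x] (fun i => by fin_cases i; exact hx)
  have fa (x y : A) (hx : x ∈ S) (hy : y ∈ S) : x + y ∈ S :=
    hf 2 TCStarFunc.add ![x, y] (fun i => by fin_cases i; exacts [hx, hy])
  have fm (x y : A) (hx : x ∈ S) (hy : y ∈ S) : x * y ∈ S :=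
    hf 2 TCStarFunc.mul ![x, y] (fun i => by fin_cases i; exacts [hx, hy])
  let T : StarSubalgebra ℂ A :=
    { carrier := S
      mul_mem' := fun hx hy => fm _ _ hx hy
      add_mem' := fun hx hy => fa _ _ hx hy
      algebraMap_mem' := fun c => by
        rw [Algebra.algebraMap_eq_smul_one]
        exact fs c 1 f1
      star_mem' := fun hx => fst _ hx }
  have hT := h T hS ha
  exact Set.eq_univ_of_forall fun x => (show x ∈ T by rw [hT]; trivial)

namespace dimensionDrop
variable {p q : ℕ}

theorem continuous_central : Continuous (central : C(I, ℂ) →⋆ₐ[ℂ] dimensionDrop p q) :=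
  AddMonoidHomClass.continuous_of_bound (central : C(I, ℂ) →⋆ₐ[ℂ] dimensionDrop p q) 1 fun g => by
    rw [one_mul]
    exact NonUnitalStarAlgHom.norm_apply_le _ g

/-- The identity function on the interval. -/
noncomputable def idC : C(I, ℂ) := ⟨fun t => ((t : ℝ) : ℂ), by fun_prop⟩

/-- Stone–Weierstrass: the functions whose central element lies in S form a closed star subalgebra
of C(I) that contains the identity function and hence separates points. -/
theorem central_mem_of_idC_mem (S : StarSubalgebra ℂ (dimensionDrop p q))
    (hS : IsClosed (S : Set (dimensionDrop p q))) (h : central idC ∈ S) (g : C(I, ℂ)) :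
    central g ∈ S := by
  let T : StarSubalgebra ℂ C(I, ℂ) := S.comap central
  have hT : IsClosed (T : Set C(I, ℂ)) := hS.preimage continuous_central
  have hsep : T.SeparatesPoints := by
    intro x y hxy
    refine ⟨idC, ⟨idC, h, rfl⟩, fun h' => hxy ?_⟩
    have : ((x : ℝ) : ℂ) = ((y : ℝ) : ℂ) := h'
    exact Subtype.ext (by exact_mod_cast this)
  have htop := ContinuousMap.starSubalgebra_topologicalClosure_eq_top_of_separatesPoints T hsep
  have : g ∈ T.topologicalClosure := by rw [htop]; trivial
  have h2 : g ∈ closure (T : Set C(I, ℂ)) := this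
  rw [hT.closure_eq] at h2
  exact h2

/-- The function `t * (1 - t)`. -/
noncomputable def hat : C(I, ℂ) := ⟨fun t => ((t : ℝ) : ℂ) * (1 - ((t : ℝ) : ℂ)), by fun_prop⟩

/-- The functions g with g • M in S form a closed ideal of C(I), because S contains the centre. A
closed ideal is determined by its common zero set, and `hat` vanishes at the end points only. -/
theorem smul_mem_of_hat_mem (S : StarSubalgebra ℂ (dimensionDrop p q))
    (hS : IsClosed (S : Set (dimensionDrop p q))) (h : central idC ∈ S) (M : MatTensor p q)
    (hM : ∃ F ∈ S, ∀ t, eval t F = hat t • M) (g : C(I, ℂ)) (g0 : g 0 = 0) (g1 : g 1 = 0) :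
    ∃ F ∈ S, ∀ t, eval t F = g t • M := by
  let J : Ideal C(I, ℂ) :=
    { carrier := {g | ∃ F ∈ S, ∀ t, eval t F = g t • M}
      add_mem' := by
        rintro a b ⟨F, hF, hF'⟩ ⟨G, hG, hG'⟩
        exact ⟨F + G, S.add_mem hF hG, fun t => by
          rw [map_add, hF', hG', ContinuousMap.add_apply, add_smul]⟩
      zero_mem' := ⟨0, S.zero_mem, fun t => by rw [map_zero, ContinuousMap.zero_apply, zero_smul]⟩
      smul_mem' := by
        rintro c a ⟨F, hF, hF'⟩
        exact ⟨central c * F, S.mul_mem (central_mem_of_idC_mem S hS h c) hF, fun t => by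
          rw [map_mul, hF', eval_central, smul_mul_smul_comm, one_mul]; rfl⟩ }
  have hJ : IsClosed (J : Set C(I, ℂ)) := by
    have hcl : IsClosed ((Subtype.val : dimensionDrop p q → C(I, MatTensor p q)) '' S) :=
      (dimensionDrop_isClosed p q).isClosedEmbedding_subtypeVal.isClosedMap _ hS
    have hc : Continuous fun g : C(I, ℂ) =>
        (g • ContinuousMap.const I M : C(I, MatTensor p q)) :=
      ContinuousMap.continuous_of_continuous_uncurry _
        ((ContinuousEval.continuous_eval : Continuous fun x : C(I, ℂ) × I => x.1 x.2).smul continuous_const)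
    convert hcl.preimage hc using 1
    ext g
    constructor
    · rintro ⟨F, hF, hF'⟩
      exact ⟨F, hF, ContinuousMap.ext hF'⟩
    · rintro ⟨F, hF, hF'⟩
      exact ⟨F, hF, fun t => congrArg (fun k : C(I, MatTensor p q) => k t) hF'⟩
  have hg : g ∈ J.closure := by
    rw [← ContinuousMap.idealOfSet_ofIdeal_eq_closure, ContinuousMap.mem_idealOfSet]
    intro x hx
    rw [Set.mem_compl_iff, ContinuousMap.mem_setOfIdeal] at hx
    by_contra hgx
    refine hx ⟨hat, hM, ?_⟩
    have hx0 : x ≠ 0 := fun h => hgx (h ▸ g0)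
    have hx1 : x ≠ 1 := fun h => hgx (h ▸ g1)
    refine mul_ne_zero ?_ ?_
    · exact fun h => hx0 (Subtype.ext (by exact_mod_cast h))
    · exact sub_ne_zero.2 (fun h => hx1 (Subtype.ext (by exact_mod_cast h.symm)))
  have h2 : g ∈ closure (J : Set C(I, ℂ)) := hg
  rw [hJ.closure_eq] at h2
  exact h2

/-- The element `t ↦ (1 - t) • (a ⊗ 1)`. -/
noncomputable def left (a : Matrix (Fin p) (Fin p) ℂ) : dimensionDrop p q :=
  bump (1 - idC) (a ⊗ₖ 1) ⟨a, by simp [idC]⟩ ⟨0, by simp [idC]⟩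

/-- The element `t ↦ t • (1 ⊗ b)`. -/
noncomputable def right (b : Matrix (Fin q) (Fin q) ℂ) : dimensionDrop p q :=
  bump idC (1 ⊗ₖ b) ⟨0, by simp [idC]⟩ ⟨b, by simp [idC]⟩

/-- The element `t ↦ t (1 - t) • M`. -/
noncomputable def middle (M : MatTensor p q) : dimensionDrop p q :=
  bump hat M ⟨0, by simp [hat]⟩ ⟨0, by simp [hat]⟩

/-- An element with end values a ⊗ 1 and 1 ⊗ b is `left a + right b` plus a function G vanishing at
both ends; each matrix entry of G is covered by the ideal argument of `smul_mem_of_hat_mem`. -/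
theorem eq_top_of_mem (S : StarSubalgebra ℂ (dimensionDrop p q))
    (hS : IsClosed (S : Set (dimensionDrop p q))) (h : central idC ∈ S)
    (hl : ∀ i j, left (Matrix.single i j 1) ∈ S) (hr : ∀ i j, right (Matrix.single i j 1) ∈ S)
    (hm : ∀ i j, middle (Matrix.single i j 1) ∈ S) : S = ⊤ := by
  have hl' (a : Matrix (Fin p) (Fin p) ℂ) : left a ∈ S := by
    have : (left a : dimensionDrop p q) = ∑ i, ∑ j, a i j • left (Matrix.single i j 1) :=
      dimensionDrop.ext fun t => by
        simp only [map_sum, map_smul, left, eval_bump]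
        ext x y
        simp only [Matrix.sum_apply, Matrix.smul_apply, Matrix.kroneckerMap_apply, smul_eq_mul,
          Matrix.single_apply]
        rw [Finset.sum_eq_single x.1, Finset.sum_eq_single y.1]
        · simp; ring
        · intro b _ hb; simp [hb]
        · simp
        · intro b _ hb; simp [hb]
        · simp
    rw [this]
    exact S.sum_mem fun i _ => S.sum_mem fun j _ => S.smul_mem (hl i j) _
  have hr' (a : Matrix (Fin q) (Fin q) ℂ) : right a ∈ S := by
    have : (right a : dimensionDrop p q) = ∑ i, ∑ j, a i j • right (Matrix.single i j 1) :=
      dimensionDrop.ext fun t => by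
        simp only [map_sum, map_smul, right, eval_bump]
        ext x y
        simp only [Matrix.sum_apply, Matrix.smul_apply, Matrix.kroneckerMap_apply, smul_eq_mul,
          Matrix.single_apply]
        rw [Finset.sum_eq_single x.2, Finset.sum_eq_single y.2]
        · simp; ring
        · intro b _ hb; simp [hb]
        · simp
        · intro b _ hb; simp [hb]
        · simp
    rw [this]
    exact S.sum_mem fun i _ => S.sum_mem fun j _ => S.smul_mem (hr i j) _
  refine StarSubalgebra.ext fun f => ⟨fun _ => trivial, fun _ => ?_⟩
  obtain ⟨a, ha⟩ := exists_eval_zero f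
  obtain ⟨b, hb⟩ := exists_eval_one f
  have a0 : eval 0 (left a : dimensionDrop p q) = a ⊗ₖ 1 := by simp [left, idC]
  have a1 : eval 1 (left a : dimensionDrop p q) = 0 := by simp [left, idC]
  have b0 : eval 0 (right b : dimensionDrop p q) = 0 := by simp [right, idC]
  have b1 : eval 1 (right b : dimensionDrop p q) = 1 ⊗ₖ b := by simp [right, idC]
  obtain ⟨G, hG⟩ : ∃ G : dimensionDrop p q, G = f + (-1 : ℂ) • left a + (-1 : ℂ) • right b :=
    ⟨_, rfl⟩
  have G0 : eval 0 G = 0 := by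
    rw [hG, map_add, map_add, map_smul, map_smul, ha, a0, b0, smul_zero, add_zero, neg_one_smul,
      add_neg_cancel]
  have G1 : eval 1 G = 0 := by
    rw [hG, map_add, map_add, map_smul, map_smul, hb, a1, b1, smul_zero, add_zero, neg_one_smul,
      add_neg_cancel]
  have hGS : G ∈ S := by
    have key (i j) : ∃ F ∈ S, ∀ t, eval t F = (eval t G i j) • Matrix.single i j (1 : ℂ) :=
      smul_mem_of_hat_mem S hS h (Matrix.single i j 1) ⟨_, hm i j, fun t => rfl⟩
        ⟨fun t => eval t G i j,
          (continuous_apply j).comp ((continuous_apply i).comp (continuous_eval G))⟩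
        (congrFun (congrFun G0 i) j) (congrFun (congrFun G1 i) j)
    choose F hF hF' using key
    have : G = ∑ i, ∑ j, F i j := dimensionDrop.ext fun t => by
      conv_lhs => rw [Matrix.matrix_eq_sum_single (eval t G)]
      simp only [map_sum, hF', Matrix.smul_single, smul_eq_mul, mul_one]
    rw [this]
    exact S.sum_mem fun i _ => S.sum_mem fun j _ => hF i j
  have hf : f = G + left a + right b := dimensionDrop.ext fun t => by
    rw [hG]
    simp only [map_add, map_smul]
    module
  rw [hf]
  exact S.add_mem (S.add_mem hGS (hl' a)) (hr' b)

end dimensionDrop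

theorem KZ.finitelyGenerated (X : PrimeDimDrop) : (KZ.str X).FinitelyGenerated := by
  let ι := Unit ⊕ (Fin X.p × Fin X.p) ⊕ (Fin X.q × Fin X.q) ⊕
    ((Fin X.p × Fin X.q) × (Fin X.p × Fin X.q))
  let a : ι → dimensionDrop X.p X.q := fun i => match i with
    | .inl _ => dimensionDrop.central dimensionDrop.idC
    | .inr (.inl x) => dimensionDrop.left (Matrix.single x.1 x.2 1)
    | .inr (.inr (.inl x)) => dimensionDrop.right (Matrix.single x.1 x.2 1)
    | .inr (.inr (.inr x)) => dimensionDrop.middle (Matrix.single x.1 x.2 1)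
  let e := (Fintype.equivFin ι).symm
  refine ⟨Fintype.card ι, fun i => a (e i), ?_⟩
  refine tracialStructure_isGenerator X.trace (fun i => a (e i)) fun S hS hmem => ?_
  have hmem' (i : ι) : a i ∈ S := by
    have := hmem (e.symm i)
    rwa [e.apply_symm_apply] at this
  exact dimensionDrop.eq_top_of_mem S hS (hmem' (.inl ())) (fun i j => hmem' (.inr (.inl (i, j))))
    (fun i j => hmem' (.inr (.inr (.inl (i, j))))) (fun i j => hmem' (.inr (.inr (.inr (i, j)))))

instance dimensionDrop.secondCountable (p q : ℕ) : SecondCountableTopology (dimensionDrop p q) :=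
  TopologicalSpace.Subtype.secondCountableTopology _

theorem KZ.separable (X : PrimeDimDrop) : TopologicalSpace.SeparableSpace (KZ.str X) :=
  inferInstanceAs (TopologicalSpace.SeparableSpace (dimensionDrop X.p X.q))

/-! ### Norm bounds for traces -/

theorem norm_apply_le_l2_opNorm {ι : Type*} [Fintype ι] [DecidableEq ι] (M : Matrix ι ι ℂ)
    (i j : ι) : ‖M i j‖ ≤ ‖M‖ := by
  have h1 := Matrix.l2_opNorm_mulVec M (EuclideanSpace.single j (1 : ℂ))
  rw [PiLp.norm_single, norm_one, mul_one] at h1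
  refine le_trans ?_ h1
  have h2 := PiLp.norm_apply_le (p := 2) (WithLp.toLp 2 (M.mulVec (EuclideanSpace.single j (1 : ℂ)).ofLp)) i
  refine le_trans (le_of_eq ?_) h2
  simp

theorem norm_ntr_le {ι : Type*} [Fintype ι] [DecidableEq ι] (M : Matrix ι ι ℂ) :
    ‖ntr M‖ ≤ ‖M‖ := by
  rcases isEmpty_or_nonempty ι with hι | hι
  · rw [Subsingleton.elim M 0, map_zero, norm_zero, norm_zero]
  have hc : (0 : ℝ) < Fintype.card ι := by exact_mod_cast Fintype.card_pos
  rw [ntr_apply, norm_mul, norm_inv, Complex.norm_natCast]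
  rw [inv_mul_le_iff₀ hc]
  refine (norm_sum_le _ _).trans ?_
  refine (Finset.sum_le_sum fun i _ => norm_apply_le_l2_opNorm M i i).trans ?_
  rw [Finset.sum_const, nsmul_eq_mul, Finset.card_univ]

/-- `TracialState` carries continuity but no norm bound; the integral formula over the
reparametrised interval supplies the bound 1, which CCP needs uniformly over all objects. -/
theorem TracialState.norm_apply_le {p q : ℕ} (τ : TracialState (dimensionDrop p q))
    (hτ : τ.Faithful) (hp : 0 < p) (hq : 0 < q) (f : dimensionDrop p q) :
    ‖τ.toCLM f‖ ≤ ‖f‖ := by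
  obtain ⟨Q, -, -, hQ⟩ := τ.exists_reparam hτ hp hq
  rw [hQ]
  exact dimensionDrop.norm_integral_le_of_forall fun t =>
    (norm_ntr_le _).trans (dimensionDrop.norm_eval_le _ _)

/-! ### Estimates in tracial structures -/

theorem norm_tracial_embedding {A B : Type} [CStarAlgebra A] [CStarAlgebra B] {τ : TracialState A}
    {τ' : TracialState B}
    (e : MetricStructure.Embedding (tracialStructure A τ) (tracialStructure B τ')) (a : A) :
    norm (E := B) (e.toFun a) = ‖a‖ := by
  obtain ⟨ψ, hψ, -, h⟩ := (exists_tracial_embedding_iff τ τ' e.toFun).1 ⟨e, rfl⟩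
  rw [← congrFun h a]
  exact NonUnitalStarAlgHom.norm_map ψ hψ a

theorem norm_le_norm_add_dist_of_tracial {A B C : Type} [CStarAlgebra A] [CStarAlgebra B]
    [CStarAlgebra C] {τ : TracialState A} {τ' : TracialState B} {ρ : TracialState C}
    (e : MetricStructure.Embedding (tracialStructure A τ) (tracialStructure C ρ))
    (e' : MetricStructure.Embedding (tracialStructure B τ') (tracialStructure C ρ)) (a : A) (b : B) :
    ‖a‖ ≤ ‖b‖ + dist (e.toFun a) (e'.toFun b) := by
  have h1 := norm_tracial_embedding e a
  have h2 := norm_tracial_embedding e' b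
  have h3 : norm (E := C) (e.toFun a) - norm (E := C) (e'.toFun b) ≤
      dist (α := C) (e.toFun a) (e'.toFun b) :=
    (norm_sub_norm_le (E := C) _ _).trans (dist_eq_norm (E := C) _ _).ge
  rw [h1, h2] at h3
  exact sub_le_iff_le_add'.1 h3

/-- The interpretations of the function symbols are uniformly continuous on bounded sets, uniformly
in the algebra. -/
theorem TCStarFunc.interp_uniform {n : ℕ} (f : TCStarFunc n) (B : ℝ) (hB : 0 < B) {ε : ℝ}
    (hε : 0 < ε) :
    ∃ δ : ℝ, 0 < δ ∧ ∀ (A : Type) [CStarAlgebra A] (x y : Fin n → A), (∀ i, ‖x i‖ ≤ B) →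
      (∀ i, ‖y i‖ ≤ B) → (∀ i, dist (x i) (y i) < δ) → dist (f.interp x) (f.interp y) < ε := by
  cases f with
  | zero => exact ⟨1, one_pos, fun A _ x y _ _ _ => by simpa [TCStarFunc.interp] using hε⟩
  | one => exact ⟨1, one_pos, fun A _ x y _ _ _ => by simpa [TCStarFunc.interp] using hε⟩
  | smul c =>
    refine ⟨ε / (‖c‖ + 1), by positivity, fun A _ x y _ _ h => ?_⟩
    change dist (c • x 0) (c • y 0) < ε
    rw [dist_smul₀]
    have := h 0
    rw [lt_div_iff₀ (by positivity)] at this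
    nlinarith [dist_nonneg (x := x 0) (y := y 0), norm_nonneg c]
  | star =>
    refine ⟨ε, hε, fun A _ x y _ _ h => ?_⟩
    change dist (Star.star (x 0)) (Star.star (y 0)) < ε
    rw [dist_eq_norm, ← star_sub, norm_star, ← dist_eq_norm]
    exact h 0
  | add =>
    refine ⟨ε / 2, by positivity, fun A _ x y _ _ h => ?_⟩
    change dist (x 0 + x 1) (y 0 + y 1) < ε
    have := dist_add_add_le (x 0) (x 1) (y 0) (y 1)
    linarith [h 0, h 1]
  | mul =>
    refine ⟨ε / (2 * B), by positivity, fun A _ x y hx hy h => ?_⟩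
    change dist (x 0 * x 1) (y 0 * y 1) < ε
    have e : x 0 * x 1 - y 0 * y 1 = x 0 * (x 1 - y 1) + (x 0 - y 0) * y 1 := by noncomm_ring
    have h0 := h 0
    have h1 := h 1
    rw [dist_eq_norm] at h0 h1 ⊢
    rw [e]
    have n1 := norm_mul_le (x 0) (x 1 - y 1)
    have n2 := norm_mul_le (x 0 - y 0) (y 1)
    have n3 := norm_add_le (x 0 * (x 1 - y 1)) ((x 0 - y 0) * y 1)
    rw [lt_div_iff₀ (by positivity)] at h0 h1
    have m1 : ‖x 0‖ * ‖x 1 - y 1‖ ≤ B * ‖x 1 - y 1‖ :=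
      mul_le_mul_of_nonneg_right (hx 0) (norm_nonneg _)
    have m2 : ‖x 0 - y 0‖ * ‖y 1‖ ≤ ‖x 0 - y 0‖ * B :=
      mul_le_mul_of_nonneg_left (hy 1) (norm_nonneg _)
    linarith

theorem TCStarPred.dist_interp_le {n : ℕ} (P : TCStarPred n) {A : Type} [CStarAlgebra A]
    (τ : TracialState A) (hτ : ∀ a, ‖τ.toCLM a‖ ≤ ‖a‖) (x y : Fin n → A) {ε : ℝ}
    (h : ∀ i, dist (x i) (y i) < ε) : dist (P.interp τ x) (P.interp τ y) < ε := by
  have key (i) : ‖τ.toCLM (x i) - τ.toCLM (y i)‖ < ε := by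
    rw [← map_sub]
    refine (hτ _).trans_lt ?_
    rw [← dist_eq_norm]
    exact h i
  cases P with
  | trRe =>
    refine lt_of_le_of_lt ?_ (key 0)
    rw [Real.dist_eq]
    exact Complex.abs_re_le_norm (τ.toCLM (x 0) - τ.toCLM (y 0))
  | trIm =>
    refine lt_of_le_of_lt ?_ (key 0)
    rw [Real.dist_eq]
    exact Complex.abs_im_le_norm (τ.toCLM (x 0) - τ.toCLM (y 0))

/-! ### The Cauchy continuity property -/

namespace KZ
open MetricCategory

/-- The algebra underlying an object, as a normed space. -/
abbrev Alg (X : KZ.Obj) : Type := dimensionDrop (PrimeDimDrop.p X) (PrimeDimDrop.q X)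

theorem norm_embedding {X Y : KZ.Obj} (e : MetricStructure.Embedding (KZ.str X) (KZ.str Y))
    (a : Alg X) : norm (E := Alg Y) (e.toFun a) = ‖a‖ :=
  norm_tracial_embedding (τ := PrimeDimDrop.trace X) (τ' := PrimeDimDrop.trace Y) e a

theorem norm_le_norm_add_dist {X Y Z : KZ.Obj}
    (e : MetricStructure.Embedding (KZ.str X) (KZ.str Z))
    (e' : MetricStructure.Embedding (KZ.str Y) (KZ.str Z)) (a : Alg X) (b : Alg Y) :
    ‖a‖ ≤ ‖b‖ + dist (e.toFun a) (e'.toFun b) :=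
  norm_le_norm_add_dist_of_tracial (τ := PrimeDimDrop.trace X) (τ' := PrimeDimDrop.trace Y)
    (ρ := PrimeDimDrop.trace Z) e e' a b

theorem exists_joint_of_gdist_lt {n : ℕ} {X Y : KZ.Generated n} {ε : ℝ≥0∞}
    (h : gdist X Y < ε) : ∃ J : KZ.JointEmbedding X.obj Y.obj,
      ∀ i, edist (J.left (X.tuple i)) (J.right (Y.tuple i)) < ε := by
  obtain ⟨J, hJ⟩ := iInf_lt_iff.1 h
  exact ⟨J, fun i => (le_iSup (fun i => edist (J.left (X.tuple i)) (J.right (Y.tuple i))) i).trans_lt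
    hJ⟩

theorem gdist_le_of_joint {n : ℕ} {X Y : KZ.Generated n} {ε : ℝ≥0∞}
    (J : KZ.JointEmbedding X.obj Y.obj)
    (h : ∀ i, edist (J.left (X.tuple i)) (J.right (Y.tuple i)) ≤ ε) : gdist X Y ≤ ε :=
  (iInf_le _ J).trans (iSup_le h)

theorem isCauchy_exists {n : ℕ} {X : ℕ → KZ.Generated n} (hX : IsCauchy X) {ε : ℝ} (hε : 0 < ε) :
    ∃ N, ∀ k ≥ N, ∀ l ≥ N, ∃ J : KZ.JointEmbedding (X k).obj (X l).obj,
      ∀ i, dist (J.left ((X k).tuple i)) (J.right ((X l).tuple i)) < ε := by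
  obtain ⟨N, hN⟩ := hX (ENNReal.ofReal ε) (ENNReal.ofReal_pos.2 hε)
  refine ⟨N, fun k hk l hl => ?_⟩
  obtain ⟨J, hJ⟩ := exists_joint_of_gdist_lt (hN k hk l hl)
  refine ⟨J, fun i => ?_⟩
  have := hJ i
  rwa [edist_dist, ENNReal.ofReal_lt_ofReal_iff hε] at this

/-- Along a Cauchy sequence the norms of the generators are bounded. -/
theorem exists_norm_bound {n : ℕ} {X : ℕ → KZ.Generated n} (hX : IsCauchy X) :
    ∃ (N : ℕ) (B : ℝ), 0 < B ∧ ∀ k ≥ N, ∀ i, norm (E := Alg (X k).obj) ((X k).tuple i) ≤ B := by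
  obtain ⟨N, hN⟩ := isCauchy_exists hX one_pos
  refine ⟨N, (∑ i, norm (E := Alg (X N).obj) ((X N).tuple i)) + 1,
    add_pos_of_nonneg_of_pos (Finset.sum_nonneg fun i _ => norm_nonneg _) one_pos,
    fun k hk i => ?_⟩
  obtain ⟨J, hJ⟩ := hN k hk N le_rfl
  have h1 := norm_le_norm_add_dist J.left J.right ((X k).tuple i) ((X N).tuple i)
  have h4 : norm (E := Alg (X N).obj) ((X N).tuple i) ≤
      ∑ i, norm (E := Alg (X N).obj) ((X N).tuple i) :=
    Finset.single_le_sum (f := fun i => norm (E := Alg (X N).obj) ((X N).tuple i))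
      (fun i _ => norm_nonneg _) (Finset.mem_univ i)
  exact h1.trans (add_le_add h4 (hJ i).le)

theorem ccp_pred {n m : ℕ} (P : TCStarPred n) (X : ℕ → KZ.Generated (n + m)) (hX : IsCauchy X) :
    CauchySeq (fun k => (KZ.str (X k).obj).pred P (fun i => (X k).tuple (Fin.castAdd m i))) := by
  rw [Metric.cauchySeq_iff]
  intro ε hε
  obtain ⟨N, hN⟩ := isCauchy_exists hX hε
  refine ⟨N, fun k hk l hl => ?_⟩
  obtain ⟨J, hJ⟩ := hN k hk l hl
  have h1 := J.left.map_pred (L := LTCStar) P (fun i => (X k).tuple (Fin.castAdd m i))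
  have h2 := J.right.map_pred (L := LTCStar) P (fun i => (X l).tuple (Fin.castAdd m i))
  refine (le_of_eq (congrArg₂ dist h1.symm h2.symm)).trans_lt ?_
  exact TCStarPred.dist_interp_le P (PrimeDimDrop.trace J.target)
    ((PrimeDimDrop.trace J.target).norm_apply_le (PrimeDimDrop.faithful J.target)
      (PrimeDimDrop.p_pos J.target) (PrimeDimDrop.q_pos J.target)) _ _ fun i => hJ _

/-- A joint embedding that nearly matches the tuples also nearly matches the values of f.
Multiplication is uniformly continuous only on bounded sets, which suffices because the norms along
a Cauchy sequence are eventually bounded. -/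
theorem ccp_func {n m : ℕ} (f : TCStarFunc n) (X : ℕ → KZ.Generated (n + m)) (hX : IsCauchy X) :
    IsCauchy (fun k => (X k).adjoin (L := LTCStar) f) := by
  obtain ⟨N₁, B, hB, hN₁⟩ := exists_norm_bound hX
  intro ε hε
  obtain ⟨r, hr, hrε⟩ : ∃ r : ℝ, 0 < r ∧ ENNReal.ofReal r < ε := by
    obtain ⟨r, h1, h2⟩ := ENNReal.lt_iff_exists_nnreal_btwn.1 hε
    exact ⟨r, by exact_mod_cast h1, by simpa using h2⟩
  obtain ⟨δ, hδ, hf⟩ := TCStarFunc.interp_uniform f B hB hr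
  obtain ⟨N₂, hN₂⟩ := isCauchy_exists hX (lt_min hδ hr)
  refine ⟨max N₁ N₂, fun k hk l hl => ?_⟩
  obtain ⟨J, hJ⟩ := hN₂ k (le_of_max_le_right hk) l (le_of_max_le_right hl)
  change gdist ((X k).adjoin (L := LTCStar) f) ((X l).adjoin (L := LTCStar) f) < ε
  refine (gdist_le_of_joint (X := (X k).adjoin (L := LTCStar) f)
    (Y := (X l).adjoin (L := LTCStar) f) (ε := ENNReal.ofReal r) J fun i => ?_).trans_lt hrε
  rw [edist_dist]
  refine ENNReal.ofReal_le_ofReal ?_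
  change dist (J.left (Fin.snoc (α := fun _ => KZ.str (X k).obj) (X k).tuple _ i))
    (J.right (Fin.snoc (α := fun _ => KZ.str (X l).obj) (X l).tuple _ i)) ≤ r
  refine Fin.lastCases ?_ (fun i => ?_) i
  · rw [Fin.snoc_last, Fin.snoc_last]
    have h1 := J.left.map_func (L := LTCStar) f (fun i => (X k).tuple (Fin.castAdd m i))
    have h2 := J.right.map_func (L := LTCStar) f (fun i => (X l).tuple (Fin.castAdd m i))
    refine (le_of_eq (congrArg₂ dist h1.symm h2.symm)).trans ?_
    refine (hf (Alg J.target) _ _ (fun i => ?_) (fun i => ?_) (fun i => ?_)).le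
    · exact (norm_embedding J.left _).le.trans (hN₁ k (le_of_max_le_left hk) _)
    · exact (norm_embedding J.right _).le.trans (hN₁ l (le_of_max_le_left hl) _)
    · exact (hJ (Fin.castAdd m i)).trans_le (min_le_left _ _)
  · rw [Fin.snoc_castSucc, Fin.snoc_castSucc]
    exact ((hJ i).trans_le (min_le_right _ _)).le

theorem ccp : KZ.CCP :=
  ⟨fun _ _ P X hX => ccp_pred P X hX, fun _ _ f X hX => ccp_func f X hX⟩

/-! ### The weak Polish property -/

/-- Passing to the Lebesgue trace turns every generated tuple into a point of the countable disjoint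
union of the second countable spaces Z_{p,q}^n. Close points lie in the same summand, and the two
embeddings into the common Lebesgue object form the required joint embedding. The dense set is
chosen inside the range of `code`, so that its points come from generated tuples. -/
theorem wpp : KZ.WPP := by
  intro n
  let E : ℕ × ℕ → Type := fun a => Fin n → dimensionDrop a.1 a.2
  -- `v` is the image of the tuple of `X` in the algebra with the Lebesgue trace
  let R (X : KZ.Generated n) (v : Σ a, E a) : Prop :=
    ∃ (hp : 0 < v.1.1) (hq : 0 < v.1.2) (hc : Nat.Coprime v.1.1 v.1.2)
      (e : MetricStructure.Embedding (KZ.str X.obj) (KZ.str (PrimeDimDrop.leb v.1.1 v.1.2 hp hq hc))),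
      ∀ i, (show dimensionDrop v.1.1 v.1.2 from e.toFun (X.tuple i)) = v.2 i
  have hR (X : KZ.Generated n) : ∃ v : Σ a, E a, R X v := by
    obtain ⟨e⟩ := exists_embedding_leb X.obj
    exact ⟨⟨(PrimeDimDrop.p X.obj, PrimeDimDrop.q X.obj), fun i => e.toFun (X.tuple i)⟩, _, _, _, e,
      fun i => rfl⟩
  choose code hcode using hR
  have hsc : SecondCountableTopology (Σ a, E a) := inferInstance
  obtain ⟨s, hsc, hsd⟩ := TopologicalSpace.exists_countable_dense (Set.range code)
  let pre : Set.range code → KZ.Generated n := fun z => z.2.choose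
  have hpre (z : Set.range code) : code (pre z) = z.1 := z.2.choose_spec
  refine ⟨pre '' s, hsc.image _, fun X ε hε => ?_⟩
  obtain ⟨r, hr, hrε⟩ : ∃ r : ℝ, 0 < r ∧ ENNReal.ofReal r < ε := by
    obtain ⟨r, h1, h2⟩ := ENNReal.lt_iff_exists_nnreal_btwn.1 hε
    exact ⟨r, by exact_mod_cast h1, by simpa using h2⟩
  obtain ⟨hp, hq, hc, e, he⟩ := hcode X
  let U : Set (Σ a, E a) := Sigma.mk (code X).1 '' Metric.ball (code X).2 r
  have hU : IsOpen U := isOpenMap_sigmaMk _ Metric.isOpen_ball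
  obtain ⟨z, hzs, hzU⟩ := hsd.exists_mem_open (hU.preimage continuous_subtype_val)
    ⟨⟨code X, X, rfl⟩, (code X).2, Metric.mem_ball_self hr, rfl⟩
  refine ⟨pre z, ⟨z, hzs, rfl⟩, ?_⟩
  obtain ⟨v, hv, hvz⟩ := hzU
  have hY := hcode (pre z)
  rw [hpre, ← hvz] at hY
  obtain ⟨hp', hq', hc', e', he'⟩ := hY
  refine (gdist_le_of_joint (ε := ENNReal.ofReal r)
    ⟨PrimeDimDrop.leb _ _ hp hq hc, e, e', Set.mem_univ _, Set.mem_univ _⟩ fun i => ?_).trans_lt hrε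
  rw [edist_dist]
  refine ENNReal.ofReal_le_ofReal ?_
  have h1 := he i
  have h2 := he' i
  change dist (show dimensionDrop (code X).1.1 (code X).1.2 from e.toFun (X.tuple i))
    (show dimensionDrop (code X).1.1 (code X).1.2 from e'.toFun ((pre z).tuple i)) ≤ r
  rw [h1]
  refine (le_of_eq (congrArg _ h2)).trans ?_
  rw [dist_comm]
  exact (dist_le_pi_dist v (code X).2 i).trans (Metric.mem_ball.1 hv).le

end KZ

/-! ### Block diagonal matrices -/

/-- The block diagonal embedding of a finite power of a matrix algebra, with relabelled indices. -/
noncomputable def blockHom {κ m J : Type*} [Fintype κ] [DecidableEq κ] [Fintype m] [DecidableEq m]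
    [Fintype J] [DecidableEq J] (e : κ ≃ m × J) :
    (J → Matrix m m ℂ) →⋆ₐ[ℂ] Matrix κ κ ℂ where
  toFun M := (Matrix.blockDiagonal M).submatrix e e
  map_one' := by rw [Matrix.blockDiagonal_one, Matrix.submatrix_one_equiv]
  map_mul' M N := by
    rw [Matrix.submatrix_mul_equiv]
    exact congrArg (fun A => A.submatrix e e) (Matrix.blockDiagonal_mul M N)
  map_zero' := by rw [Matrix.blockDiagonal_zero]; rfl
  map_add' M N := by rw [Matrix.blockDiagonal_add]; rfl
  commutes' c := by
    rw [Algebra.algebraMap_eq_smul_one, Matrix.blockDiagonal_smul, Matrix.blockDiagonal_one,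
      Algebra.algebraMap_eq_smul_one, Matrix.submatrix_smul, Pi.smul_apply, Pi.smul_apply,
      Matrix.submatrix_one_equiv]
  map_star' M := by
    ext i j
    simp only [Matrix.star_eq_conjTranspose, Matrix.conjTranspose_submatrix,
      Matrix.blockDiagonal_conjTranspose]
    rfl

section blockHom
variable {κ m J : Type*} [Fintype κ] [DecidableEq κ] [Fintype m] [DecidableEq m]
    [Fintype J] [DecidableEq J]

theorem blockHom_apply (e : κ ≃ m × J) (M : J → Matrix m m ℂ) :
    blockHom e M = (Matrix.blockDiagonal M).submatrix e e := rfl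

theorem norm_blockHom_le (e : κ ≃ m × J) (M : J → Matrix m m ℂ) {C : ℝ} (hC : 0 ≤ C)
    (h : ∀ j, ‖M j‖ ≤ C) : ‖blockHom e M‖ ≤ C := by
  let _ : CStarAlgebra (J → Matrix m m ℂ) := { }
  exact (NonUnitalStarAlgHom.norm_apply_le (blockHom e) M).trans
    ((pi_norm_le_iff_of_nonneg hC).2 h)

theorem ntr_blockHom (e : κ ≃ m × J) (M : J → Matrix m m ℂ) :
    ntr (blockHom e M) = (Fintype.card J : ℂ)⁻¹ * ∑ j, ntr (M j) := by
  rw [blockHom_apply, ntr_submatrix_equiv, ntr_blockDiagonal]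

theorem continuous_blockHom (e : κ ≃ m × J) : Continuous (blockHom e) :=
  LinearMap.continuous_of_finiteDimensional
    ((blockHom e : (J → Matrix m m ℂ) →ₐ[ℂ] Matrix κ κ ℂ).toLinearMap)

end blockHom

/-! ### Paths of unitary matrices -/

theorem continuousOn_spectrum {ι : Type*} [Fintype ι] [DecidableEq ι] (U : Matrix ι ι ℂ)
    (f : ℂ → ℂ) : ContinuousOn f (spectrum ℂ U) :=
  (Matrix.finite_spectrum U).continuousOn f

/-- A unitary matrix is joined to `1` by a path of unitaries that commute with everything that
commutes with the given matrix. -/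
theorem exists_unitary_path {ι : Type*} [Fintype ι] [DecidableEq ι] {U : Matrix ι ι ℂ}
    (hU : U ∈ unitary (Matrix ι ι ℂ)) :
    ∃ w : I → Matrix ι ι ℂ, Continuous w ∧ w 0 = 1 ∧ w 1 = U ∧
      (∀ t, w t ∈ unitary (Matrix ι ι ℂ)) ∧ ∀ M, Commute M U → ∀ t, Commute M (w t) := by
  have hN : IsStarNormal U := by
    constructor
    rw [commute_iff_eq, (Unitary.mem_iff.1 hU).1, (Unitary.mem_iff.1 hU).2]
  -- The spectrum is finite, so the argument function, though discontinuous on the circle, may be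
  -- applied to U. Then U = exp(i arg U), and exp(i t arg U) commutes with whatever commutes with U
  -- and its adjoint.
  let x : selfAdjoint (Matrix ι ι ℂ) := ⟨_, IsSelfAdjoint.cfc_arg U⟩
  have h1 : ((selfAdjoint.expUnitary x : unitary (Matrix ι ι ℂ)) : Matrix ι ι ℂ) = U := by
    rw [selfAdjoint.expUnitary_coe]
    have hc (f : ℂ → ℂ) : ContinuousOn f (spectrum ℂ U) := continuousOn_spectrum U f
    change NormedSpace.exp (Complex.I • cfc (Complex.ofReal ∘ Complex.arg : ℂ → ℂ) U) = U
    rw [← CFC.exp_eq_normedSpace_exp (𝕜 := ℂ), ← cfc_smul Complex.I _ U (hc _),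
      ← cfc_comp' _ _ U NormedSpace.exp_continuous.continuousOn (hc _)]
    conv_rhs => rw [← cfc_id' ℂ U]
    refine cfc_congr fun y hy => ?_
    have hy₁ : ‖y‖ = 1 := spectrum.norm_eq_one_of_unitary hU hy
    have h2 : Complex.I * y.arg = Complex.log y :=
      Complex.ext (by simp [Complex.log_re, hy₁]) (by simp [Complex.log_im])
    have h3 : y ≠ 0 := by rintro rfl; simp at hy₁
    simpa [← Complex.exp_eq_exp_ℂ, h2] using Complex.exp_log h3
  let γ := selfAdjoint.expUnitaryPathToOne x
  refine ⟨fun t => γ t, ?_, ?_, ?_, fun t => (γ t).2, fun M hM t => ?_⟩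
  · exact continuous_subtype_val.comp γ.continuous
  · exact congrArg Subtype.val γ.source
  · exact (congrArg Subtype.val γ.target).trans h1
  · have h2 : Commute M (star U) := by
      have e1 := (Unitary.mem_iff.1 hU).1
      have e2 := (Unitary.mem_iff.1 hU).2
      calc M * star U = star U * (U * M) * star U := by rw [← mul_assoc, e1, one_mul]
        _ = star U * M * (U * star U) := by rw [← hM.eq]; simp only [mul_assoc]
        _ = star U * M := by rw [e2, mul_one]
    have h3 : Commute M (x : Matrix ι ι ℂ) := (Commute.cfc hM.symm h2.symm _).symm
    change Commute M (selfAdjoint.expUnitary ((t : ℝ) • x) : Matrix ι ι ℂ)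
    rw [selfAdjoint.expUnitary_coe]
    exact ((h3.smul_right (t : ℝ)).smul_right Complex.I).exp_right

/-! ### Uniformly distributed paths -/

/-- The path `γ` from `x` to `y` is uniformly distributed on the interval between `l` and `r`. -/
structure IsSweep (γ : ℝ → ℝ) (x y l r : ℝ) : Prop where
  continuous : Continuous γ
  zero : γ 0 = x
  one : γ 1 = y
  mem : ∀ t ∈ Set.Icc (0 : ℝ) 1, γ t ∈ Set.uIcc l r
  integral : ∀ g : ℝ → ℂ, Continuous g →
    (r - l) • ∫ t in (0 : ℝ)..1, g (γ t) = ∫ s in l..r, g s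

/-- The path runs from 0 to y at speed 1, then from y to 1 and back to y at speed 2. Points below y
are passed once at speed 1 and points above y twice at speed 2, so the distribution is uniform. -/
theorem exists_isSweep_unit {y : ℝ} (h0 : 0 ≤ y) (h1 : y ≤ 1) : ∃ γ, IsSweep γ 0 y 0 1 := by
  obtain ⟨γ, hγ⟩ : ∃ γ : ℝ → ℝ, γ = fun t => min t y + (1 - y) - |2 * max t y - 1 - y| := ⟨_, rfl⟩
  have hc : Continuous γ := by rw [hγ]; fun_prop
  have e1 : ∀ t, t ≤ y → γ t = t := fun t ht => by
    rw [hγ]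
    simp only [min_eq_left ht, max_eq_right ht]
    rw [abs_of_nonpos (by linarith)]
    ring
  have e2 : ∀ t, y ≤ t → t ≤ (1 + y) / 2 → γ t = 2 * t - y := fun t ht ht' => by
    rw [hγ]
    simp only [min_eq_right ht, max_eq_left ht]
    rw [abs_of_nonpos (by linarith)]
    ring
  have e3 : ∀ t, (1 + y) / 2 ≤ t → γ t = (2 + y) - 2 * t := fun t ht => by
    have ht' : y ≤ t := by linarith
    rw [hγ]
    simp only [min_eq_right ht', max_eq_left ht']
    rw [abs_of_nonneg (by linarith)]
    ring
  refine ⟨γ, hc, e1 0 h0, ?_, fun t ht => ?_, fun g hg => ?_⟩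
  · rw [e3 1 (by linarith)]
    ring
  · rw [Set.uIcc_of_le zero_le_one]
    rcases le_total t y with h | h
    · rw [e1 t h]
      exact ht
    rcases le_total t ((1 + y) / 2) with h' | h'
    · rw [e2 t h h']
      constructor <;> linarith
    · rw [e3 t h']
      constructor <;> linarith [ht.2]
  · rw [sub_zero, one_smul]
    have hi (a b : ℝ) : IntervalIntegrable (fun t => g (γ t)) volume a b :=
      (hg.comp hc).intervalIntegrable _ _
    rw [← intervalIntegral.integral_add_adjacent_intervals (hi 0 ((1 + y) / 2)) (hi _ 1),
      ← intervalIntegral.integral_add_adjacent_intervals (hi 0 y) (hi _ ((1 + y) / 2)),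
      ← intervalIntegral.integral_add_adjacent_intervals (hg.intervalIntegrable 0 y)
        (hg.intervalIntegrable y 1)]
    have i1 : ∫ t in (0 : ℝ)..y, g (γ t) = ∫ t in (0 : ℝ)..y, g t :=
      intervalIntegral.integral_congr fun t ht => by
        rw [Set.uIcc_of_le h0] at ht
        change g (γ t) = g t
        rw [e1 t ht.2]
    have i2 : ∫ t in y..(1 + y) / 2, g (γ t) = (2 : ℝ)⁻¹ • ∫ t in y..1, g t := by
      rw [intervalIntegral.integral_congr (g := fun t => g (2 * t - y)) fun t ht => by
        rw [Set.uIcc_of_le (by linarith)] at ht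
        change g (γ t) = _
        rw [e2 t ht.1 ht.2], intervalIntegral.integral_comp_mul_sub _ two_ne_zero]
      congr 2 <;> ring
    have i3 : ∫ t in (1 + y) / 2..1, g (γ t) = (2 : ℝ)⁻¹ • ∫ t in y..1, g t := by
      rw [intervalIntegral.integral_congr (g := fun t => g ((2 + y) - 2 * t)) fun t ht => by
        rw [Set.uIcc_of_le (by linarith)] at ht
        change g (γ t) = _
        rw [e3 t ht.1], intervalIntegral.integral_comp_sub_mul _ two_ne_zero]
      congr 2 <;> ring
    rw [i1, i2, i3, add_assoc, ← add_smul]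
    norm_num

namespace IsSweep

/-- The signed form of the field `integral` makes the roles of l and r interchangeable; this
provides the sweeps that start at the right end. -/
theorem symm {γ : ℝ → ℝ} {x y l r : ℝ} (h : IsSweep γ x y l r) : IsSweep γ x y r l where
  continuous := h.continuous
  zero := h.zero
  one := h.one
  mem t ht := Set.uIcc_comm l r ▸ h.mem t ht
  integral g hg := by
    rw [intervalIntegral.integral_symm l r, ← h.integral g hg, ← neg_smul, neg_sub]

theorem reverse {γ : ℝ → ℝ} {x y l r : ℝ} (h : IsSweep γ x y l r) :
    IsSweep (fun t => γ (1 - t)) y x l r where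
  continuous := h.continuous.comp (by fun_prop)
  zero := by rw [sub_zero, h.one]
  one := by rw [sub_self, h.zero]
  mem t ht := h.mem _ ⟨by linarith [ht.2], by linarith [ht.1]⟩
  integral g hg := by
    rw [intervalIntegral.integral_comp_sub_left (fun t => g (γ t)) 1, sub_self, sub_zero,
      h.integral g hg]

theorem affine {γ : ℝ → ℝ} {x y : ℝ} (h : IsSweep γ x y 0 1) (l r : ℝ) :
    IsSweep (fun t => l + (r - l) * γ t) (l + (r - l) * x) (l + (r - l) * y) l r where
  continuous := by have := h.continuous; fun_prop
  zero := by rw [h.zero]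
  one := by rw [h.one]
  mem t ht := by
    have := h.mem t ht
    rw [Set.uIcc_of_le zero_le_one] at this
    rw [← segment_eq_uIcc, segment_eq_image']
    exact ⟨γ t, this, by simp [mul_comm]⟩
  integral g hg := by
    have e := h.integral (fun s => g (l + (r - l) * s)) (by fun_prop)
    rw [sub_zero, one_smul] at e
    rw [e, intervalIntegral.smul_integral_comp_add_mul]
    congr 1 <;> ring

end IsSweep

theorem exists_isSweep {l r x : ℝ} (hlr : l < r) (hx : x ∈ Set.Icc l r) {a : ℝ}
    (ha : a = l ∨ a = r) : ∃ γ, IsSweep γ a x l r := by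
  have h0 : 0 < r - l := sub_pos.2 hlr
  rcases ha with rfl | rfl
  · obtain ⟨γ, hγ⟩ := exists_isSweep_unit (y := (x - a) / (r - a))
      (div_nonneg (sub_nonneg.2 hx.1) h0.le) ((div_le_one h0).2 (by linarith [hx.2]))
    have := hγ.affine a r
    rw [mul_zero, add_zero, mul_div_cancel₀ _ h0.ne', add_sub_cancel] at this
    exact ⟨_, this⟩
  · have h1 : l - a ≠ 0 := (by linarith : l - a < 0).ne
    obtain ⟨γ, hγ⟩ := exists_isSweep_unit (y := (a - x) / (a - l))
      (div_nonneg (by linarith [hx.2]) h0.le) ((div_le_one h0).2 (by linarith [hx.1]))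
    have := (hγ.affine a l).symm
    rw [mul_zero, add_zero, show a + (l - a) * ((a - x) / (a - l)) = x by field_simp; ring] at this
    exact ⟨_, this⟩

/-- A sweep of [l, r] from a to the common point x is followed, at double speed each, by a reversed
sweep of [l', r'] from x to b. The distribution is the mean of the two uniform distributions. -/
theorem exists_double_sweep {l r l' r' x a b : ℝ} (hlr : l < r) (hlr' : l' < r')
    (hx : x ∈ Set.Icc l r) (hx' : x ∈ Set.Icc l' r') (ha : a = l ∨ a = r) (hb : b = l' ∨ b = r') :
    ∃ γ : ℝ → ℝ, Continuous γ ∧ γ 0 = a ∧ γ 1 = b ∧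
      (∀ t ∈ Set.Icc (0 : ℝ) 1, γ t ∈ Set.Icc l r ∪ Set.Icc l' r') ∧
      ∀ g : ℝ → ℂ, Continuous g → ∫ t in (0 : ℝ)..1, g (γ t) =
        (2 : ℝ)⁻¹ • ((r - l)⁻¹ • (∫ s in l..r, g s) + (r' - l')⁻¹ • ∫ s in l'..r', g s) := by
  obtain ⟨γ₁, h1⟩ := exists_isSweep hlr hx ha
  obtain ⟨γ₂, h2⟩ := exists_isSweep hlr' hx' hb
  replace h2 := h2.reverse
  obtain ⟨γ₂', hγ₂'⟩ : ∃ γ : ℝ → ℝ, γ = fun t => γ₂ (1 - t) := ⟨_, rfl⟩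
  rw [← hγ₂'] at h2
  obtain ⟨γ, hγ⟩ : ∃ γ : ℝ → ℝ, γ = fun t => if t ≤ 2⁻¹ then γ₁ (2 * t) else γ₂' (2 * t - 1) :=
    ⟨_, rfl⟩
  have e1 : ∀ t, t ≤ 2⁻¹ → γ t = γ₁ (2 * t) := fun t ht => by rw [hγ]; exact if_pos ht
  have e2 : ∀ t, 2⁻¹ ≤ t → γ t = γ₂' (2 * t - 1) := fun t ht => by
    rcases ht.eq_or_lt with rfl | ht
    · rw [e1 _ le_rfl]
      norm_num
      rw [h1.one, h2.zero]
    · rw [hγ]; exact if_neg (not_le.2 ht)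
  have hc : Continuous γ := by
    rw [hγ]
    refine Continuous.if_le (h1.continuous.comp (by fun_prop)) (h2.continuous.comp (by fun_prop))
      continuous_id continuous_const fun t ht => ?_
    rw [ht]
    norm_num
    rw [h1.one, h2.zero]
  refine ⟨γ, hc, ?_, ?_, fun t ht => ?_, fun g hg => ?_⟩
  · rw [e1 _ (by norm_num), mul_zero, h1.zero]
  · rw [e2 _ (by norm_num), show (2 : ℝ) * 1 - 1 = 1 by norm_num, h2.one]
  · rcases le_total t 2⁻¹ with h | h
    · rw [e1 t h, ← Set.uIcc_of_le hlr.le]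
      exact Or.inl (h1.mem _ ⟨by linarith [ht.1], by linarith⟩)
    · rw [e2 t h, ← Set.uIcc_of_le hlr'.le]
      exact Or.inr (h2.mem _ ⟨by linarith, by linarith [ht.2]⟩)
  · have hi (a b : ℝ) : IntervalIntegrable (fun t => g (γ t)) volume a b :=
      (hg.comp hc).intervalIntegrable _ _
    rw [← intervalIntegral.integral_add_adjacent_intervals (hi 0 2⁻¹) (hi _ 1)]
    have i1 : ∫ t in (0 : ℝ)..2⁻¹, g (γ t) = (2 : ℝ)⁻¹ • ∫ t in (0 : ℝ)..1, g (γ₁ t) := by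
      rw [intervalIntegral.integral_congr (g := fun t => g (γ₁ (2 * t))) fun t ht => by
        rw [Set.uIcc_of_le (by norm_num)] at ht
        change g (γ t) = _
        rw [e1 t ht.2], intervalIntegral.integral_comp_mul_left (fun t => g (γ₁ t)) two_ne_zero]
      norm_num
    have i2 : ∫ t in (2⁻¹ : ℝ)..1, g (γ t) = (2 : ℝ)⁻¹ • ∫ t in (0 : ℝ)..1, g (γ₂' t) := by
      rw [intervalIntegral.integral_congr (g := fun t => g (γ₂' (2 * t - 1))) fun t ht => by
        rw [Set.uIcc_of_le (by norm_num)] at ht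
        change g (γ t) = _
        rw [e2 t ht.1], intervalIntegral.integral_comp_mul_sub (fun t => g (γ₂' t)) two_ne_zero]
      norm_num
    rw [i1, i2, ← smul_add, ← h1.integral g hg, ← h2.integral g hg,
      inv_smul_smul₀ (sub_pos.2 hlr).ne', inv_smul_smul₀ (sub_pos.2 hlr').ne']

/-- The integral over the unit interval as a type. -/
theorem integral_unitInterval (F : ℝ → ℂ) : ∫ t : I, F t = ∫ t in (0 : ℝ)..1, F t := by
  rw [intervalIntegral.integral_of_le zero_le_one, ← integral_Icc_eq_integral_Ioc]
  exact integral_subtype measurableSet_Icc F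

/-- A family of paths with prescribed end points, small diameter and average distribution the
Lebesgue measure. -/
theorem exists_paths_aux {l r l' r' x a b : ℝ} (hlr : l < r) (hlr' : l' < r')
    (hx : x ∈ Set.Icc l r) (hx' : x ∈ Set.Icc l' r') (ha : a = l ∨ a = r) (hb : b = l' ∨ b = r')
    (h0 : 0 ≤ l) (h0' : 0 ≤ l') (h1 : r ≤ 1) (h1' : r' ≤ 1) {η : ℝ} (hη : r - l ≤ η)
    (hη' : r' - l' ≤ η) :
    ∃ ξ : C(I, I), (ξ 0 : ℝ) = a ∧ (ξ 1 : ℝ) = b ∧ (∀ s t, dist (ξ s) (ξ t) ≤ 2 * η) ∧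
      ∀ g : C(I, ℂ), ∫ t, g (ξ t) =
        (2 : ℝ)⁻¹ • ((r - l)⁻¹ • (∫ s in l..r, g (Set.projIcc 0 1 zero_le_one s)) +
          (r' - l')⁻¹ • ∫ s in l'..r', g (Set.projIcc 0 1 zero_le_one s)) := by
  obtain ⟨γ, hc, g0, g1, hm, hI⟩ := exists_double_sweep hlr hlr' hx hx' ha hb
  have hI01 : ∀ t ∈ Set.Icc (0 : ℝ) 1, γ t ∈ Set.Icc (0 : ℝ) 1 := fun t ht => by
    rcases hm t ht with h | h
    · exact ⟨h0.trans h.1, h.2.trans h1⟩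
    · exact ⟨h0'.trans h.1, h.2.trans h1'⟩
  -- All points visited lie in one of two intervals that contain x and have length at most η; hence
  -- the diameter bound 2η.
  have hx2 : ∀ t ∈ Set.Icc (0 : ℝ) 1, |γ t - x| ≤ η := fun t ht => by
    rcases hm t ht with h | h
    · rw [abs_le]; constructor <;> linarith [h.1, h.2, hx.1, hx.2]
    · rw [abs_le]; constructor <;> linarith [h.1, h.2, hx'.1, hx'.2]
  let ξ : C(I, I) := ⟨fun t => ⟨γ t, hI01 t t.2⟩, by fun_prop⟩
  refine ⟨ξ, g0, g1, fun s t => ?_, fun g => ?_⟩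
  · rw [Subtype.dist_eq]
    change dist (γ s) (γ t) ≤ _
    rw [Real.dist_eq, abs_le]
    have e1 := abs_le.1 (hx2 s s.2)
    have e2 := abs_le.1 (hx2 t t.2)
    constructor <;> linarith [e1.1, e1.2, e2.1, e2.2]
  · refine Eq.trans ?_ (hI (fun s => g (Set.projIcc 0 1 zero_le_one s))
      (g.continuous.comp continuous_projIcc))
    rw [← integral_unitInterval]
    refine integral_congr_ae (Filter.Eventually.of_forall fun t => ?_)
    change g (ξ t) = g (Set.projIcc 0 1 zero_le_one (γ t))
    rw [Set.projIcc_of_mem zero_le_one (hI01 t t.2)]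
    rfl

/-! ### Families of paths with average distribution the Lebesgue measure -/

/-- The lexicographic enumeration of a sequence of blocks of sizes `n b`. -/
def IsLex {k B : ℕ} (n : ℕ → ℕ) (E : Fin k ≃ (Σ b : Fin B, Fin (n b))) : Prop :=
  ∀ j : Fin k, (j : ℕ) = ∑ i ∈ Finset.range (E j).1, n i + (E j).2

theorem exists_isLex {k B : ℕ} (n : ℕ → ℕ) (h : ∑ i ∈ Finset.range B, n i = k) :
    ∃ E : Fin k ≃ (Σ b : Fin B, Fin (n b)), IsLex n E := by
  have h' : ∑ i : Fin B, n i = k := by rw [← h, Finset.sum_range]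
  refine ⟨((finSigmaFinEquiv (n := fun b : Fin B => n b)).trans (finCongr h')).symm, fun j => ?_⟩
  obtain ⟨x, rfl⟩ := ((finSigmaFinEquiv (n := fun b : Fin B => n b)).trans (finCongr h')).surjective j
  rw [Equiv.symm_apply_apply, Finset.sum_range]
  simp [finSigmaFinEquiv_apply]

section Lex
variable {k B : ℕ} {n : ℕ → ℕ} {E : Fin k ≃ (Σ b : Fin B, Fin (n b))}

/-- The interval of block b has length n b / k and is used by n b of the k indices, so the weights
cancel and the intervals add up to [0,1]. -/
theorem IsLex.sum_smul_integral (h : ∑ i ∈ Finset.range B, n i = k) (hk : 0 < k)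
    {G : ℝ → ℂ} (hG : Continuous G) (E : Fin k ≃ (Σ b : Fin B, Fin (n b))) (S : ℕ → ℝ)
    (hS : ∀ b, S b = (∑ i ∈ Finset.range b, n i : ℕ) / (k : ℝ)) :
    ∑ j, (S ((E j).1 + 1) - S (E j).1)⁻¹ • ∫ s in S (E j).1..S ((E j).1 + 1), G s =
      (k : ℝ) • ∫ s in (0 : ℝ)..1, G s := by
  have hk' : (k : ℝ) ≠ 0 := by exact_mod_cast hk.ne'
  have hd (b : ℕ) : S (b + 1) - S b = n b / k := by
    rw [hS, hS, Finset.sum_range_succ]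
    push_cast
    ring
  have h0 : S 0 = 0 := by rw [hS]; simp
  have h1 : S B = 1 := by rw [hS, h, div_self hk']
  rw [← h0, ← h1, ← intervalIntegral.sum_integral_adjacent_intervals (a := S)
    fun b _ => hG.intervalIntegrable _ _, Finset.smul_sum, Finset.sum_range,
    E.sum_comp (fun x => (S (x.1 + 1) - S x.1)⁻¹ • ∫ s in S x.1..S (x.1 + 1), G s),
    Fintype.sum_sigma]
  refine Finset.sum_congr rfl fun b _ => ?_
  dsimp only
  rw [Finset.sum_const, Finset.card_univ, Fintype.card_fin, hd, ← Nat.cast_smul_eq_nsmul ℝ,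
    smul_smul]
  -- An empty block has a degenerate interval and contributes 0 on both sides.
  rcases Nat.eq_zero_or_pos (n b) with hb | hb
  · have : S (b + 1) = S b := by
      have := hd b
      rw [hb] at this
      simpa [sub_eq_zero] using this
    rw [this, intervalIntegral.integral_same, smul_zero, smul_zero]
  · have hb' : (n b : ℝ) ≠ 0 := by exact_mod_cast hb.ne'
    congr 1
    field_simp

/-- Since the enumeration is increasing, index j falls into the block whose interval contains j / k.
For two partitions of the same k indices, j / k is therefore a common point of the two intervals of
j, as `exists_double_sweep` requires. -/
theorem IsLex.block (hE : IsLex n E) (h : ∑ i ∈ Finset.range B, n i = k) (hk : 0 < k) (S : ℕ → ℝ)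
    (hS : ∀ b, S b = (∑ i ∈ Finset.range b, n i : ℕ) / (k : ℝ)) (j : Fin k) :
    S (E j).1 < S ((E j).1 + 1) ∧ (j / k : ℝ) ∈ Set.Icc (S (E j).1) (S ((E j).1 + 1)) ∧
      0 ≤ S (E j).1 ∧ S ((E j).1 + 1) ≤ 1 := by
  have hk' : (0 : ℝ) < k := by exact_mod_cast hk
  have h1 := hE j
  have h2 := (E j).2.2
  have h3 : ∑ i ∈ Finset.range ((E j).1 + 1), n i ≤ k := by
    exact (Finset.sum_le_sum_of_subset (Finset.range_subset_range.2 (E j).1.2)).trans h.le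
  rw [hS, hS]
  refine ⟨?_, ⟨?_, ?_⟩, by positivity, ?_⟩
  · rw [div_lt_div_iff_of_pos_right hk', Finset.sum_range_succ]
    exact_mod_cast (by omega)
  · rw [div_le_div_iff_of_pos_right hk']
    exact_mod_cast (by omega)
  · rw [div_le_div_iff_of_pos_right hk', Finset.sum_range_succ]
    exact_mod_cast (by omega)
  · rw [div_le_one hk']
    exact_mod_cast h3

end Lex

/-- Path j is distributed half over the interval of j in the first partition and half over that in
the second. Summed over j, each half contributes k/2 times Lebesgue measure. -/
theorem exists_paths {k B B' : ℕ} {n n' : ℕ → ℕ} (hk : 0 < k)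
    (h : ∑ i ∈ Finset.range B, n i = k) (h' : ∑ i ∈ Finset.range B', n' i = k)
    {E : Fin k ≃ (Σ b : Fin B, Fin (n b))} {E' : Fin k ≃ (Σ b : Fin B', Fin (n' b))}
    (hE : IsLex n E) (hE' : IsLex n' E') {S S' : ℕ → ℝ}
    (hS : ∀ b, S b = (∑ i ∈ Finset.range b, n i : ℕ) / (k : ℝ))
    (hS' : ∀ b, S' b = (∑ i ∈ Finset.range b, n' i : ℕ) / (k : ℝ))
    {a a' : ℕ → ℝ} (ha : ∀ b, a b = S b ∨ a b = S (b + 1))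
    (ha' : ∀ b, b < B' → a' b = S' b ∨ a' b = S' (b + 1))
    {η : ℝ} (hη : ∀ b, (n b : ℝ) ≤ η * k) (hη' : ∀ b, (n' b : ℝ) ≤ η * k) :
    ∃ ξ : Fin k → C(I, I), (∀ j, (ξ j 0 : ℝ) = a (E j).1) ∧ (∀ j, (ξ j 1 : ℝ) = a' (E' j).1) ∧
      (∀ j s t, dist (ξ j s) (ξ j t) ≤ 2 * η) ∧
      ∀ g : C(I, ℂ), ∑ j, ∫ t, g (ξ j t) = (k : ℂ) * ∫ t, g t := by
  have hk' : (0 : ℝ) < k := by exact_mod_cast hk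
  have hd (b : ℕ) : S (b + 1) - S b ≤ η := by
    rw [hS, hS, ← sub_div, Finset.sum_range_succ, div_le_iff₀ hk']
    push_cast
    linarith [hη b]
  have hd' (b : ℕ) : S' (b + 1) - S' b ≤ η := by
    rw [hS', hS', ← sub_div, Finset.sum_range_succ, div_le_iff₀ hk']
    push_cast
    linarith [hη' b]
  have key (j : Fin k) := exists_paths_aux (hE.block h hk S hS j).1 (hE'.block h' hk S' hS' j).1
    (hE.block h hk S hS j).2.1 (hE'.block h' hk S' hS' j).2.1 (ha (E j).1)
    (ha' (E' j).1 (E' j).1.2) (hE.block h hk S hS j).2.2.1 (hE'.block h' hk S' hS' j).2.2.1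
    (hE.block h hk S hS j).2.2.2 (hE'.block h' hk S' hS' j).2.2.2 (hd _) (hd' _)
  choose ξ h0 h1 h2 h3 using key
  refine ⟨ξ, h0, h1, h2, fun g => ?_⟩
  have hc : Continuous fun s => g (Set.projIcc 0 1 zero_le_one s) :=
    g.continuous.comp continuous_projIcc
  simp only [h3]
  rw [← Finset.smul_sum, Finset.sum_add_distrib, IsLex.sum_smul_integral h hk hc E S hS,
    IsLex.sum_smul_integral h' hk hc E' S' hS', ← two_smul ℝ, inv_smul_smul₀ two_ne_zero,
    ← integral_unitInterval]
  simp only [Set.projIcc_val]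
  rw [Complex.real_smul, Complex.ofReal_natCast]

/-! ### Block diagonal matrices of the form `a ⊗ 1` and `1 ⊗ b` -/

section BlockForms
variable {P Q R S k c₀ B : ℕ}

/-- There are only c₀ different blocks, each repeated S times, so regrouping the indices turns the
block diagonal matrix into A ⊗ 1_S. -/
theorem exists_left_form (hR : P * Q * c₀ = R) (E : Fin k ≃ (Σ _ : Fin c₀, Fin S)) :
    ∃ e : Fin R × Fin S ≃ (Fin P × Fin Q) × Fin k, ∀ M : Fin c₀ → MatTensor P Q,
      ∃ A : Matrix (Fin R) (Fin R) ℂ, blockHom e (fun j => M (E j).1) = A ⊗ₖ 1 := by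
  obtain ⟨α⟩ : Nonempty (Fin R ≃ (Fin P × Fin Q) × Fin c₀) :=
    ⟨Fintype.equivOfCardEq (by simp [hR])⟩
  let e : Fin R × Fin S ≃ (Fin P × Fin Q) × Fin k :=
    { toFun := fun x => ((α x.1).1, E.symm ⟨(α x.1).2, x.2⟩)
      invFun := fun y => (α.symm (y.1, (E y.2).1), (E y.2).2)
      left_inv := fun x => by simp
      right_inv := fun y => by simp }
  refine ⟨e, fun M => ⟨(Matrix.blockDiagonal M).submatrix α α, ?_⟩⟩
  ext ⟨x, y⟩ ⟨x', y'⟩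
  simp only [blockHom_apply, Matrix.submatrix_apply, Matrix.blockDiagonal_apply,
    Matrix.kroneckerMap_apply, Matrix.one_apply, e, Equiv.coe_fn_mk, Equiv.apply_eq_iff_eq,
    Equiv.apply_symm_apply, Sigma.mk.injEq, heq_eq_eq]
  split_ifs with h1 h2 h3 h4 h5 <;> simp_all

/-- If each group of c₀ n_b equal blocks is 1_R ⊗ N_b in the labelling θ_b, the labellings glue to
one in which the whole matrix is 1_R ⊗ diag(N_b), because the n_b add up to S. -/
theorem exists_right_form {n : ℕ → ℕ} (hS : ∑ b ∈ Finset.range B, n b = S)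
    (E : Fin k ≃ (Σ b : Fin B, Fin (c₀ * n b)))
    (θ : ∀ b : Fin B, (Fin P × Fin Q) × Fin (c₀ * n b) ≃ Fin R × Fin (n b)) :
    ∃ e : Fin R × Fin S ≃ (Fin P × Fin Q) × Fin k, ∀ M : Fin B → MatTensor P Q,
      (∀ b : Fin B, ∃ N, Matrix.blockDiagonal (fun _ : Fin (c₀ * n b) => M b) =
        ((1 : Matrix (Fin R) (Fin R) ℂ) ⊗ₖ N).submatrix (θ b) (θ b)) →
      ∃ A : Matrix (Fin S) (Fin S) ℂ,
        blockHom e (fun j => M (E j).1) = (1 : Matrix (Fin R) (Fin R) ℂ) ⊗ₖ A := by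
  obtain ⟨β⟩ : Nonempty (Fin S ≃ (Σ b : Fin B, Fin (n b))) :=
    ⟨Fintype.equivOfCardEq (by simp [← hS, Finset.sum_range])⟩
  let T : (Fin P × Fin Q) × (Σ b : Fin B, Fin (c₀ * n b)) ≃ Fin R × (Σ b : Fin B, Fin (n b)) :=
    { toFun := fun y => ((θ y.2.1 (y.1, y.2.2)).1, ⟨y.2.1, (θ y.2.1 (y.1, y.2.2)).2⟩)
      invFun := fun x =>
        (((θ x.2.1).symm (x.1, x.2.2)).1, ⟨x.2.1, ((θ x.2.1).symm (x.1, x.2.2)).2⟩)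
      left_inv := fun y => by simp
      right_inv := fun x => by simp }
  let e : (Fin P × Fin Q) × Fin k ≃ Fin R × Fin S :=
    (((Equiv.refl _).prodCongr E).trans T).trans ((Equiv.refl _).prodCongr β.symm)
  have he (m b i) : e (m, E.symm ⟨b, i⟩) = ((θ b (m, i)).1, β.symm ⟨b, (θ b (m, i)).2⟩) := by
    simp only [e, T, Equiv.trans_apply, Equiv.prodCongr_apply, Prod.map, Equiv.apply_symm_apply,
      Equiv.refl_apply, Equiv.coe_fn_mk]
  refine ⟨e.symm, fun M hM => ?_⟩
  choose N hN using hM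
  refine ⟨(Matrix.blockDiagonal' N).submatrix β β, ?_⟩
  have key : Matrix.blockDiagonal (fun j => M (E j).1) =
      ((1 : Matrix (Fin R) (Fin R) ℂ) ⊗ₖ
        (Matrix.blockDiagonal' N).submatrix β β).submatrix e e := by
    ext ⟨m, j⟩ ⟨m', j'⟩
    obtain ⟨⟨b, i⟩, rfl⟩ := E.symm.surjective j
    obtain ⟨⟨b', i'⟩, rfl⟩ := E.symm.surjective j'
    rw [Matrix.submatrix_apply, he, he]
    simp only [Matrix.submatrix_apply, Matrix.blockDiagonal_apply, Matrix.kroneckerMap_apply,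
      Equiv.apply_eq_iff_eq, Equiv.apply_symm_apply]
    by_cases hb : b = b'
    · subst hb
      have := congrFun (congrFun (hN b) (m, i)) (m', i')
      rw [Matrix.blockDiagonal_apply, Matrix.submatrix_apply, Matrix.kroneckerMap_apply] at this
      rw [Matrix.blockDiagonal'_apply_eq, ← this]
      simp
    · rw [Matrix.blockDiagonal'_apply_ne _ _ _ hb, mul_zero, if_neg (by simp [hb])]
  rw [blockHom_apply, key, Matrix.submatrix_submatrix]
  simp

/-- The number of copies of M is c₀ P Q = R, so N is M itself. -/
theorem exists_right_form_mid (hR : P * Q * c₀ = R) {n : ℕ} (hn : n = P * Q) :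
    ∃ θ : (Fin P × Fin Q) × Fin (c₀ * n) ≃ Fin R × Fin n, ∀ M : MatTensor P Q,
      ∃ N, Matrix.blockDiagonal (fun _ : Fin (c₀ * n) => M) =
        ((1 : Matrix (Fin R) (Fin R) ℂ) ⊗ₖ N).submatrix θ θ := by
  obtain ⟨α⟩ : Nonempty (Fin R ≃ (Fin P × Fin Q) × Fin c₀) :=
    ⟨Fintype.equivOfCardEq (by simp [hR])⟩
  obtain ⟨β⟩ : Nonempty (Fin (c₀ * n) ≃ Fin c₀ × (Fin P × Fin Q)) :=
    ⟨Fintype.equivOfCardEq (by simp [hn])⟩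
  obtain ⟨γ⟩ : Nonempty (Fin n ≃ (Fin P × Fin Q)) :=
    ⟨Fintype.equivOfCardEq (by simp [hn])⟩
  let θ : (Fin P × Fin Q) × Fin (c₀ * n) ≃ Fin R × Fin n :=
    { toFun := fun y => (α.symm ((β y.2).2, (β y.2).1), γ.symm y.1)
      invFun := fun x => (γ x.2, β.symm ((α x.1).2, (α x.1).1))
      left_inv := fun y => by simp
      right_inv := fun y => by simp }
  refine ⟨θ, fun M => ⟨M.submatrix γ γ, ?_⟩⟩
  ext ⟨m, j⟩ ⟨m', j'⟩
  obtain ⟨x, rfl⟩ := β.symm.surjective j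
  obtain ⟨x', rfl⟩ := β.symm.surjective j'
  simp only [Matrix.submatrix_apply, Matrix.blockDiagonal_apply, Matrix.kroneckerMap_apply, θ,
    Equiv.coe_fn_mk, Equiv.apply_eq_iff_eq, Equiv.apply_symm_apply, Matrix.one_apply, Prod.ext_iff]
  split_ifs <;> simp_all

/-- Each block a ⊗ 1_Q is Q copies of a, so a occurs Q c₀ r P = R r times in all, and N can be taken
as r copies of a. At an end point a group may thus have size a multiple of P instead of PQ. -/
theorem exists_right_form_zero (hR : P * Q * c₀ = R) {n r : ℕ} (hn : n = r * P) :
    ∃ θ : (Fin P × Fin Q) × Fin (c₀ * n) ≃ Fin R × Fin n, ∀ a : Matrix (Fin P) (Fin P) ℂ,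
      ∃ N, Matrix.blockDiagonal (fun _ : Fin (c₀ * n) => (a ⊗ₖ 1 : MatTensor P Q)) =
        ((1 : Matrix (Fin R) (Fin R) ℂ) ⊗ₖ N).submatrix θ θ := by
  obtain ⟨α⟩ : Nonempty (Fin R ≃ (Fin P × Fin Q) × Fin c₀) :=
    ⟨Fintype.equivOfCardEq (by simp [hR])⟩
  obtain ⟨β⟩ : Nonempty (Fin (c₀ * n) ≃ Fin c₀ × (Fin r × Fin P)) :=
    ⟨Fintype.equivOfCardEq (by simp [hn])⟩
  obtain ⟨γ⟩ : Nonempty (Fin n ≃ (Fin r × Fin P)) :=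
    ⟨Fintype.equivOfCardEq (by simp [hn])⟩
  let θ : (Fin P × Fin Q) × Fin (c₀ * n) ≃ Fin R × Fin n :=
    { toFun := fun y => (α.symm (((β y.2).2.2, y.1.2), (β y.2).1), γ.symm ((β y.2).2.1, y.1.1))
      invFun := fun x => (((γ x.2).2, (α x.1).1.2), β.symm ((α x.1).2, ((γ x.2).1, (α x.1).1.1)))
      left_inv := fun y => by simp
      right_inv := fun y => by simp }
  refine ⟨θ, fun a => ⟨((1 : Matrix (Fin r) (Fin r) ℂ) ⊗ₖ a).submatrix γ γ, ?_⟩⟩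
  ext ⟨m, j⟩ ⟨m', j'⟩
  obtain ⟨x, rfl⟩ := β.symm.surjective j
  obtain ⟨x', rfl⟩ := β.symm.surjective j'
  simp only [Matrix.submatrix_apply, Matrix.blockDiagonal_apply, Matrix.kroneckerMap_apply, θ,
    Equiv.coe_fn_mk, Equiv.apply_eq_iff_eq, Equiv.apply_symm_apply, Matrix.one_apply, Prod.ext_iff]
  split_ifs <;> simp_all

/-- The mirror image: 1_P ⊗ b is P copies of b, so b occurs P c₀ r Q = R r times. -/
theorem exists_right_form_one (hR : P * Q * c₀ = R) {n r : ℕ} (hn : n = r * Q) :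
    ∃ θ : (Fin P × Fin Q) × Fin (c₀ * n) ≃ Fin R × Fin n, ∀ b : Matrix (Fin Q) (Fin Q) ℂ,
      ∃ N, Matrix.blockDiagonal (fun _ : Fin (c₀ * n) => (1 ⊗ₖ b : MatTensor P Q)) =
        ((1 : Matrix (Fin R) (Fin R) ℂ) ⊗ₖ N).submatrix θ θ := by
  obtain ⟨α⟩ : Nonempty (Fin R ≃ (Fin P × Fin Q) × Fin c₀) :=
    ⟨Fintype.equivOfCardEq (by simp [hR])⟩
  obtain ⟨β⟩ : Nonempty (Fin (c₀ * n) ≃ Fin c₀ × (Fin r × Fin Q)) :=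
    ⟨Fintype.equivOfCardEq (by simp [hn])⟩
  obtain ⟨γ⟩ : Nonempty (Fin n ≃ (Fin r × Fin Q)) :=
    ⟨Fintype.equivOfCardEq (by simp [hn])⟩
  let θ : (Fin P × Fin Q) × Fin (c₀ * n) ≃ Fin R × Fin n :=
    { toFun := fun y => (α.symm ((y.1.1, (β y.2).2.2), (β y.2).1), γ.symm ((β y.2).2.1, y.1.2))
      invFun := fun x => (((α x.1).1.1, (γ x.2).2), β.symm ((α x.1).2, ((γ x.2).1, (α x.1).1.2)))
      left_inv := fun y => by simp
      right_inv := fun y => by simp }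
  refine ⟨θ, fun b => ⟨((1 : Matrix (Fin r) (Fin r) ℂ) ⊗ₖ b).submatrix γ γ, ?_⟩⟩
  ext ⟨m, j⟩ ⟨m', j'⟩
  obtain ⟨x, rfl⟩ := β.symm.surjective j
  obtain ⟨x', rfl⟩ := β.symm.surjective j'
  simp only [Matrix.submatrix_apply, Matrix.blockDiagonal_apply, Matrix.kroneckerMap_apply, θ,
    Equiv.coe_fn_mk, Equiv.apply_eq_iff_eq, Equiv.apply_symm_apply, Matrix.one_apply, Prod.ext_iff]
  split_ifs <;> simp_all

end BlockForms

/-- Permutations of the indices are implemented by unitaries. -/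
theorem exists_unitary_perm {κ : Type*} [Fintype κ] [DecidableEq κ] (τ : κ ≃ κ) :
    ∃ V ∈ unitary (Matrix κ κ ℂ), ∀ N : Matrix κ κ ℂ, V * N * star V = N.submatrix τ τ := by
  let V : Matrix κ κ ℂ := (1 : Matrix κ κ ℂ).submatrix τ id
  have hV : star V = (1 : Matrix κ κ ℂ).submatrix id τ := by
    rw [Matrix.star_eq_conjTranspose, Matrix.conjTranspose_submatrix, Matrix.conjTranspose_one]
  have key (N : Matrix κ κ ℂ) : V * N * star V = N.submatrix τ τ := by
    have e1 : N = N.submatrix (Equiv.refl κ) (Equiv.refl κ) := rfl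
    rw [hV]
    change (1 : Matrix κ κ ℂ).submatrix τ (Equiv.refl κ) * N *
      (1 : Matrix κ κ ℂ).submatrix (Equiv.refl κ) τ = _
    conv_lhs => rw [e1]
    rw [Matrix.submatrix_mul_equiv, Matrix.submatrix_mul_equiv, one_mul, mul_one]
  refine ⟨V, ?_, key⟩
  rw [Unitary.mem_iff]
  have h2 : V * star V = 1 := by
    have := key 1
    rwa [mul_one, Matrix.submatrix_one_equiv] at this
  exact ⟨mul_eq_one_comm.1 h2, h2⟩

/-- Two block diagonal embeddings with different labellings are unitarily equivalent. -/
theorem exists_unitary_blockHom {κ m J : Type*} [Fintype κ] [DecidableEq κ] [Fintype m]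
    [DecidableEq m] [Fintype J] [DecidableEq J] (e e' : κ ≃ m × J) :
    ∃ V ∈ unitary (Matrix κ κ ℂ), ∀ M, blockHom e' M = V * blockHom e M * star V := by
  obtain ⟨V, hV, key⟩ := exists_unitary_perm (e'.trans e.symm)
  refine ⟨V, hV, fun M => ?_⟩
  rw [key, blockHom_apply, blockHom_apply, Matrix.submatrix_submatrix]
  have e1 : (e ∘ (e'.trans e.symm) : κ → m × J) = e' := by funext x; simp
  rw [e1]

/-! ### Standard embeddings into `Z_{R,R+1}` -/

namespace dimensionDrop
variable {P Q : ℕ}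

/-- The block diagonal representation given by evaluation at the points `x j`. -/
noncomputable def evalBlock {κ J : Type*} [Fintype κ] [DecidableEq κ] [Fintype J] [DecidableEq J]
    (e : κ ≃ (Fin P × Fin Q) × J) (x : J → I) : dimensionDrop P Q →⋆ₐ[ℂ] Matrix κ κ ℂ where
  toFun f := blockHom e fun j => eval (x j) f
  map_one' := by simp only [map_one]; exact map_one (blockHom e)
  map_mul' f g := by simp only [map_mul]; exact map_mul (blockHom e) _ _
  map_zero' := by simp only [map_zero]; exact map_zero (blockHom e)
  map_add' f g := by simp only [map_add]; exact map_add (blockHom e) _ _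
  commutes' c := by
    simp only [AlgHomClass.commutes]
    exact AlgHomClass.commutes (blockHom e) c
  map_star' f := by simp only [map_star]; exact map_star (blockHom e) _

theorem evalBlock_apply {κ J : Type*} [Fintype κ] [DecidableEq κ] [Fintype J] [DecidableEq J]
    (e : κ ≃ (Fin P × Fin Q) × J) (x : J → I) (f : dimensionDrop P Q) :
    evalBlock e x f = blockHom e fun j => eval (x j) f := rfl

/-- A continuous family of representations with the right values at the end points gives a
homomorphism into a dimension drop algebra. -/
theorem exists_starAlgHom_of_family {A : Type*} [Semiring A] [Algebra ℂ A] [Star A] {R S : ℕ}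
    (ρ : I → A →⋆ₐ[ℂ] MatTensor R S) (hc : ∀ f, Continuous fun t => ρ t f)
    (h0 : ∀ f, ∃ a : Matrix (Fin R) (Fin R) ℂ, ρ 0 f = a ⊗ₖ (1 : Matrix (Fin S) (Fin S) ℂ))
    (h1 : ∀ f, ∃ b : Matrix (Fin S) (Fin S) ℂ, ρ 1 f = (1 : Matrix (Fin R) (Fin R) ℂ) ⊗ₖ b) :
    ∃ ψ : A →⋆ₐ[ℂ] dimensionDrop R S, ∀ t f, eval t (ψ f) = ρ t f :=
  ⟨{  toFun := fun f => ⟨⟨fun t => ρ t f, hc f⟩, h0 f, h1 f⟩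
      map_one' := dimensionDrop.ext fun t => map_one (ρ t)
      map_mul' := fun f g => dimensionDrop.ext fun t => map_mul (ρ t) f g
      map_zero' := dimensionDrop.ext fun t => map_zero (ρ t)
      map_add' := fun f g => dimensionDrop.ext fun t => map_add (ρ t) f g
      commutes' := fun c => dimensionDrop.ext fun t => AlgHomClass.commutes (ρ t) c
      map_star' := fun f => dimensionDrop.ext fun t => map_star (ρ t) f }, fun _ _ => rfl⟩

/-- Conjugation by a unitary. -/
noncomputable def conj {A : Type*} [Semiring A] [Algebra ℂ A] [Star A] {κ : Type*} [Fintype κ] [DecidableEq κ]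
    (ρ : A →⋆ₐ[ℂ] Matrix κ κ ℂ) (V : Matrix κ κ ℂ) (hV : V ∈ unitary (Matrix κ κ ℂ)) :
    A →⋆ₐ[ℂ] Matrix κ κ ℂ :=
  ((Unitary.conjStarAlgAut ℂ (Matrix κ κ ℂ) ⟨V, hV⟩ : Matrix κ κ ℂ ≃⋆ₐ[ℂ] Matrix κ κ ℂ) :
    Matrix κ κ ℂ →⋆ₐ[ℂ] Matrix κ κ ℂ).comp ρ

theorem conj_apply {A : Type*} [Semiring A] [Algebra ℂ A] [Star A] {κ : Type*} [Fintype κ] [DecidableEq κ]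
    (ρ : A →⋆ₐ[ℂ] Matrix κ κ ℂ) (V : Matrix κ κ ℂ) (hV : V ∈ unitary (Matrix κ κ ℂ)) (f : A) :
    conj ρ V hV f = V * ρ f * star V := rfl

theorem ntr_conj {κ : Type*} [Fintype κ] [DecidableEq κ] {V : Matrix κ κ ℂ}
    (hV : V ∈ unitary (Matrix κ κ ℂ)) (M : Matrix κ κ ℂ) : ntr (V * M * star V) = ntr M := by
  rw [ntr_mul_comm, ← mul_assoc, (Unitary.mem_iff.1 hV).1, one_mul]

/-- The combinatorial part of the construction of standard embeddings: block diagonal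
representations by evaluations at points moving along short paths, of the forms `a ⊗ 1` at the
beginning and, up to a unitary, `1 ⊗ b` at the end. -/
theorem exists_path_labels {c₀ r₀ r₁ : ℕ} (hP : 0 < P) (hQ : 0 < Q) (hc₀ : 0 < c₀)
    (hr : r₀ * P + r₁ * Q = 1 + P * Q) :
    ∃ (ξ : Fin (c₀ * (P * Q * c₀ + 1)) → C(I, I))
      (e e' : Fin (P * Q * c₀) × Fin (P * Q * c₀ + 1) ≃ (Fin P × Fin Q) × Fin (c₀ * (P * Q * c₀ + 1))),
      (∀ j s t, dist (ξ j s) (ξ j t) ≤ 4 / c₀) ∧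
      (∀ g : C(I, ℂ), ∑ j, ∫ t, g (ξ j t) = ((c₀ * (P * Q * c₀ + 1) : ℕ) : ℂ) * ∫ t, g t) ∧
      (∀ f : dimensionDrop P Q, ∃ a, blockHom e (fun j => eval (ξ j 0) f) = a ⊗ₖ 1) ∧
      ∀ f : dimensionDrop P Q, ∃ b, blockHom e' (fun j => eval (ξ j 1) f) = 1 ⊗ₖ b := by
  obtain ⟨S, hS⟩ : ∃ S, S = P * Q * c₀ + 1 := ⟨_, rfl⟩
  obtain ⟨R, hR⟩ : ∃ R, P * Q * c₀ = R := ⟨_, rfl⟩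
  -- The number of blocks of size PQ that fill a matrix of size R S, as R = P Q c₀.
  obtain ⟨k, hk⟩ : ∃ k, k = c₀ * S := ⟨_, rfl⟩
  rw [← hS, hR, ← hk]
  have hk0 : 0 < k := by rw [hk, hS]; positivity
  have hk0' : (0 : ℝ) < k := by exact_mod_cast hk0
  have hc₀' : (0 : ℝ) < c₀ := by exact_mod_cast hc₀
  -- Multiplicities at t = 1, up to the factor c₀. They must add up to S = R + 1, which is 1 modulo
  -- PQ; the groups evaluated at 0 and 1 absorb this remainder through r₀ P + r₁ Q = 1 + PQ,
  -- replacing one of the c₀ groups of size PQ.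
  obtain ⟨n, hn0, hnm, hn1, hnle⟩ : ∃ n : ℕ → ℕ, n 0 = r₀ * P ∧
      (∀ b, b ≠ 0 → b < c₀ → n b = P * Q) ∧ n c₀ = r₁ * Q ∧ ∀ b, n b ≤ 1 + P * Q := by
    refine ⟨fun b => if b = 0 then r₀ * P else if b < c₀ then P * Q else r₁ * Q, rfl, ?_, ?_, ?_⟩
    · intro b hb hb'
      simp [hb, hb']
    · simp [hc₀.ne']
    · intro b
      dsimp only
      split_ifs <;> omega
  have hsum : ∑ b ∈ Finset.range (c₀ + 1), n b = S := by
    obtain ⟨c, rfl⟩ : ∃ c, c₀ = c + 1 := ⟨c₀ - 1, by omega⟩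
    rw [Finset.sum_range_succ, Finset.sum_range_succ', hn0, hn1, Finset.sum_congr rfl (g := fun _ => P * Q)
      fun b hb => hnm _ b.succ_ne_zero (by have := Finset.mem_range.1 hb; omega)]
    rw [Finset.sum_const, Finset.card_range, smul_eq_mul, hS]
    linarith
  have hsum1 : ∑ _b ∈ Finset.range c₀, S = k := by
    rw [Finset.sum_const, Finset.card_range, smul_eq_mul, hk]
  have hsum2 : ∑ b ∈ Finset.range (c₀ + 1), c₀ * n b = k := by
    rw [← Finset.mul_sum, hsum, hk]
  obtain ⟨E, hE⟩ := exists_isLex (fun _ => S) hsum1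
  obtain ⟨E', hE'⟩ := exists_isLex (fun b => c₀ * n b) hsum2
  obtain ⟨σ₁, hσ₁⟩ : ∃ s : ℕ → ℝ, ∀ b, s b = (∑ _i ∈ Finset.range b, S : ℕ) / (k : ℝ) :=
    ⟨_, fun b => rfl⟩
  obtain ⟨σ₂, hσ₂⟩ : ∃ s : ℕ → ℝ, ∀ b, s b = (∑ i ∈ Finset.range b, c₀ * n i : ℕ) / (k : ℝ) :=
    ⟨_, fun b => rfl⟩
  -- Every group is evaluated at the left end of its interval, except the last one, which has to be
  -- evaluated at 1.
  obtain ⟨a', ha', ha'0, ha'1⟩ : ∃ a' : ℕ → ℝ, (∀ b, b < c₀ + 1 → a' b = σ₂ b ∨ a' b = σ₂ (b + 1)) ∧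
      a' 0 = 0 ∧ a' c₀ = 1 := by
    refine ⟨fun b => if b = c₀ then σ₂ (b + 1) else σ₂ b, fun b _ => ?_, ?_, ?_⟩
    · dsimp only
      split_ifs
      · exact Or.inr rfl
      · exact Or.inl rfl
    · simp [hc₀.ne, hσ₂]
    · dsimp only
      rw [if_pos rfl, hσ₂, hsum2, div_self hk0'.ne']
  -- In the first partition the intervals have length 1/c₀; the factor 2 is needed for the second,
  -- where n b may reach 1 + PQ and c₀ (1 + PQ) ≤ 2 S.
  have hη (b : ℕ) : (S : ℝ) ≤ 2 / c₀ * k := by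
    rw [hk]
    push_cast
    rw [div_mul_eq_mul_div, le_div_iff₀ hc₀']
    have : (0 : ℝ) ≤ S := by positivity
    nlinarith
  have hη' (b : ℕ) : ((c₀ * n b : ℕ) : ℝ) ≤ 2 / c₀ * k := by
    rw [hk, div_mul_eq_mul_div, le_div_iff₀ hc₀']
    have h1 : c₀ * n b ≤ 2 * S := by
      rw [hS]
      have := Nat.mul_le_mul_left c₀ (hnle b)
      have h2 := Nat.mul_le_mul_left c₀ (Nat.mul_pos hP hQ)
      nlinarith
    have h2 : ((c₀ * n b : ℕ) : ℝ) ≤ 2 * S := by exact_mod_cast h1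
    push_cast at h2 ⊢
    nlinarith
  obtain ⟨ξ, h0, h1, hd, hI⟩ := exists_paths hk0 hsum1 hsum2 hE hE' hσ₁ hσ₂
    (a := σ₁) (a' := a') (fun b => Or.inl rfl) ha' hη hη'
  obtain ⟨e, he⟩ := exists_left_form (P := P) (Q := Q) hR E
  have hθ (b : Fin (c₀ + 1)) : ∃ θ : (Fin P × Fin Q) × Fin (c₀ * n b) ≃ Fin R × Fin (n b),
      ∀ f : dimensionDrop P Q, ∃ N, Matrix.blockDiagonal (fun _ : Fin (c₀ * n b) =>
        eval (Set.projIcc 0 1 zero_le_one (a' b)) f) =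
          ((1 : Matrix (Fin R) (Fin R) ℂ) ⊗ₖ N).submatrix θ θ := by
    by_cases hb : (b : ℕ) = 0
    · obtain ⟨θ, hθ⟩ := exists_right_form_zero (P := P) (Q := Q) hR (n := n b) (r := r₀)
        (by rw [hb, hn0])
      refine ⟨θ, fun f => ?_⟩
      rw [show a' b = 0 by rw [hb, ha'0], Set.projIcc_left]
      obtain ⟨a, ha⟩ := exists_eval_zero f
      obtain ⟨N, hN⟩ := hθ a
      exact ⟨N, by rw [← hN]; congr 1; funext _; exact ha⟩
    by_cases hb' : (b : ℕ) = c₀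
    · obtain ⟨θ, hθ⟩ := exists_right_form_one (P := P) (Q := Q) hR (n := n b) (r := r₁)
        (by rw [hb', hn1])
      refine ⟨θ, fun f => ?_⟩
      rw [show a' b = 1 by rw [hb', ha'1], Set.projIcc_right]
      obtain ⟨a, ha⟩ := exists_eval_one f
      obtain ⟨N, hN⟩ := hθ a
      exact ⟨N, by rw [← hN]; congr 1; funext _; exact ha⟩
    · obtain ⟨θ, hθ⟩ := exists_right_form_mid (P := P) (Q := Q) hR (n := n b)
        (hnm b hb (by have := b.2; omega))
      exact ⟨θ, fun f => hθ _⟩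
  choose θ hθ using hθ
  obtain ⟨e', he'⟩ := exists_right_form hsum E' θ
  refine ⟨ξ, e, e', fun j s t => (hd j s t).trans (le_of_eq (by ring)), hI, fun f => ?_, fun f => ?_⟩
  · obtain ⟨A, hA⟩ := he fun b => eval (Set.projIcc 0 1 zero_le_one (σ₁ b)) f
    refine ⟨A, ?_⟩
    rw [← hA]
    congr 1
    funext j
    rw [← h0 j, Set.projIcc_val]
  · obtain ⟨A, hA⟩ := he' (fun b => eval (Set.projIcc 0 1 zero_le_one (a' b)) f)
      fun b => hθ b f
    refine ⟨A, ?_⟩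
    rw [← hA]
    congr 1
    funext j
    rw [← h1 j, Set.projIcc_val]

/-- Standard embeddings of `Z_{P,Q}` into `Z_{R,R+1}`: up to a path of unitaries they are block
diagonal with slowly varying blocks, and they preserve the Lebesgue trace. -/
theorem exists_standard (hP : 0 < P) (hQ : 0 < Q) (hPQ : Nat.Coprime P Q) {δ : ℝ} (hδ : 0 < δ) :
    ∃ L : ℕ, ∀ R ≥ L, 0 < R → P * Q ∣ R →
      ∃ (D : I → dimensionDrop P Q →⋆ₐ[ℂ] MatTensor R (R + 1)) (u : I → MatTensor R (R + 1))
        (ψ : dimensionDrop P Q →⋆ₐ[ℂ] dimensionDrop R (R + 1)),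
        Continuous u ∧ u 0 = 1 ∧ (∀ t, u t ∈ unitary (MatTensor R (R + 1))) ∧
        (∀ t f, eval t (ψ f) = u t * D t f * star (u t)) ∧
        (∀ f η, 0 ≤ η → (∀ s t : I, dist s t ≤ δ → ‖eval s f - eval t f‖ ≤ η) →
          ∀ s t, ‖D s f - D t f‖ ≤ η) ∧
        ∀ f, lebCLM R (R + 1) (ψ f) = lebCLM P Q f := by
  obtain ⟨c, hc⟩ := exists_nat_ge (4 / δ)
  refine ⟨P * Q * c, fun R hRL hR0 hdvd => ?_⟩
  obtain ⟨c₀, rfl⟩ := hdvd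
  have hPQ0 : 0 < P * Q := Nat.mul_pos hP hQ
  have hc₀ : 0 < c₀ := Nat.pos_of_ne_zero (by rintro rfl; simp at hR0)
  have hcc : c ≤ c₀ := Nat.le_of_mul_le_mul_left hRL hPQ0
  -- The number 1 + PQ is beyond the Frobenius bound (P - 1)(Q - 1) of the coprime pair P, Q.
  obtain ⟨r₀, r₁, hr⟩ := Nat.exists_add_mul_eq_of_gcd_dvd_of_mul_pred_le P Q (1 + P * Q)
    (by rw [Nat.Coprime.gcd_eq_one hPQ]; exact one_dvd _)
    ((Nat.mul_le_mul (Nat.pred_le P) (Nat.pred_le Q)).trans (Nat.le_add_left _ _))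
  obtain ⟨ξ, e, e', hd, hI, h0, h1⟩ := exists_path_labels hP hQ hc₀ hr
  -- The diagonal form at t = 1 is 1 ⊗ b only in the labelling e', whereas e is used throughout. The
  -- path u from 1 to V performs the change of labelling and does not affect traces.
  obtain ⟨V, hV, hVe⟩ := exists_unitary_blockHom e e'
  obtain ⟨u, huc, hu0, hu1, hu, -⟩ := exists_unitary_path hV
  have hδ' : (4 : ℝ) / c₀ ≤ δ := by
    rw [div_le_iff₀ (by exact_mod_cast hc₀)]
    rw [div_le_iff₀ hδ] at hc
    have : (c : ℝ) ≤ c₀ := by exact_mod_cast hcc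
    nlinarith
  obtain ⟨ψ, hψ⟩ := exists_starAlgHom_of_family
    (fun t => conj (evalBlock e fun j => ξ j t) (u t) (hu t))
    (fun f => (huc.mul ((continuous_blockHom e).comp
      (continuous_pi fun j => (continuous_eval f).comp (ξ j).continuous))).mul huc.star)
    (fun f => by
      obtain ⟨a, ha⟩ := h0 f
      refine ⟨a, ?_⟩
      rw [conj_apply, hu0, one_mul, star_one, mul_one, ← ha]
      rfl)
    (fun f => by
      obtain ⟨b, hb⟩ := h1 f
      refine ⟨b, ?_⟩
      rw [conj_apply, hu1, ← hb, hVe]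
      rfl)
  refine ⟨fun t => evalBlock e fun j => ξ j t, u, ψ, huc, hu0, hu, fun t f => hψ t f,
    fun f η hη h s t => ?_, fun f => ?_⟩
  · rw [evalBlock_apply, evalBlock_apply, ← map_sub]
    exact norm_blockHom_le e _ hη fun j => h _ _ ((hd j s t).trans hδ')
  · rw [lebCLM_apply, lebCLM_apply]
    simp only [hψ, conj_apply, ntr_conj (hu _), evalBlock_apply, ntr_blockHom]
    rw [integral_const_mul, integral_finsetSum (f := fun j t => ntr (eval (ξ j t) f)) _ fun j _ =>
      integrable_of_continuous ((ntrFun f).continuous.comp (ξ j).continuous)]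
    have := hI (ntrFun f)
    refine (congrArg _ this).trans ?_
    rw [Fintype.card_fin, inv_mul_cancel_left₀]
    · rfl
    · exact_mod_cast (by positivity : 0 < c₀ * (P * Q * c₀ + 1)).ne'

end dimensionDrop

/-! ### The joint embedding property -/

namespace KZ

theorem injective_of_lebCLM {P Q R S : ℕ} (hP : 0 < P) (hQ : 0 < Q)
    (ψ : dimensionDrop P Q →⋆ₐ[ℂ] dimensionDrop R S)
    (h : ∀ f, dimensionDrop.lebCLM R S (ψ f) = dimensionDrop.lebCLM P Q f) :
    Function.Injective ψ := by
  rw [injective_iff_map_eq_zero]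
  intro f hf
  refine dimensionDrop.lebTrace_faithful hP hQ f ?_
  change dimensionDrop.lebCLM P Q (star f * f) = 0
  rw [← h, map_mul, hf, mul_zero, map_zero]

/-- Standard embeddings into Z_{R,R+1} exist for every sufficiently large R divisible by the product
of the two sizes, so a large common multiple serves both objects. -/
theorem jep : KZ.JEP := by
  intro X Y
  obtain ⟨LX, hX⟩ := dimensionDrop.exists_standard (PrimeDimDrop.p_pos X) (PrimeDimDrop.q_pos X)
    (PrimeDimDrop.coprime X) one_pos
  obtain ⟨LY, hY⟩ := dimensionDrop.exists_standard (PrimeDimDrop.p_pos Y) (PrimeDimDrop.q_pos Y)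
    (PrimeDimDrop.coprime Y) one_pos
  obtain ⟨eX⟩ := exists_embedding_leb X
  obtain ⟨eY⟩ := exists_embedding_leb Y
  have pX := Nat.mul_pos (PrimeDimDrop.p_pos X) (PrimeDimDrop.q_pos X)
  have pY := Nat.mul_pos (PrimeDimDrop.p_pos Y) (PrimeDimDrop.q_pos Y)
  obtain ⟨R, hR⟩ : ∃ R, R = (PrimeDimDrop.p X * PrimeDimDrop.q X) *
    ((PrimeDimDrop.p Y * PrimeDimDrop.q Y) * (LX + LY + 1)) := ⟨_, rfl⟩
  have hR0 : 0 < R := by rw [hR]; positivity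
  have hRL : LX + LY + 1 ≤ R := by
    rw [hR, ← mul_assoc]
    exact Nat.le_mul_of_pos_left _ (Nat.mul_pos pX pY)
  obtain ⟨-, -, ψX, -, -, -, -, -, hψX⟩ := hX R (by omega) hR0 ⟨_, hR⟩
  obtain ⟨-, -, ψY, -, -, -, -, -, hψY⟩ := hY R (by omega) hR0 (hR ▸ Dvd.intro_left
    ((PrimeDimDrop.p X * PrimeDimDrop.q X) * (LX + LY + 1)) (by ring))
  have hc : Nat.Coprime R (R + 1) := by simp
  obtain ⟨fX, -⟩ := exists_embedding
    (X := PrimeDimDrop.leb _ _ (PrimeDimDrop.p_pos X) (PrimeDimDrop.q_pos X) (PrimeDimDrop.coprime X))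
    (Y := PrimeDimDrop.leb R (R + 1) hR0 R.succ_pos hc) ψX
    (injective_of_lebCLM (PrimeDimDrop.p_pos X) (PrimeDimDrop.q_pos X) ψX hψX) hψX
  obtain ⟨fY, -⟩ := exists_embedding
    (X := PrimeDimDrop.leb _ _ (PrimeDimDrop.p_pos Y) (PrimeDimDrop.q_pos Y) (PrimeDimDrop.coprime Y))
    (Y := PrimeDimDrop.leb R (R + 1) hR0 R.succ_pos hc) ψY
    (injective_of_lebCLM (PrimeDimDrop.p_pos Y) (PrimeDimDrop.q_pos Y) ψY hψY) hψY
  exact ⟨⟨PrimeDimDrop.leb R (R + 1) hR0 R.succ_pos hc, fX.comp eX, fY.comp eY, Set.mem_univ _,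
    Set.mem_univ _⟩⟩

end KZ

/-! ### Projections in matrix algebras -/

section Projections
variable {κ : Type*} [Fintype κ] [DecidableEq κ]

/-- The diagonal projection onto a set of coordinates. -/
noncomputable def diagProj (s : Finset κ) : Matrix κ κ ℂ :=
  Matrix.diagonal fun i => if i ∈ s then 1 else 0

theorem diagProj_mul (s t : Finset κ) : diagProj s * diagProj t = diagProj (s ∩ t) := by
  rw [diagProj, diagProj, Matrix.diagonal_mul_diagonal, diagProj]
  congr 1
  funext i
  by_cases h1 : i ∈ s <;> by_cases h2 : i ∈ t <;> simp [h1, h2]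

theorem star_diagProj (s : Finset κ) : star (diagProj s) = diagProj s := by
  rw [diagProj, Matrix.star_eq_conjTranspose, Matrix.diagonal_conjTranspose]
  congr 1
  funext i
  by_cases h : i ∈ s <;> simp [h]

theorem trace_diagProj (s : Finset κ) : (diagProj s).trace = s.card := by
  simp [diagProj, Matrix.trace_diagonal]

theorem isStarProjection_diagProj (s : Finset κ) : IsStarProjection (diagProj s) :=
  ⟨by rw [IsIdempotentElem, diagProj_mul, Finset.inter_self], star_diagProj s⟩

/-- Conjugation by a unitary preserves projections. -/
theorem IsStarProjection.conj {e U : Matrix κ κ ℂ} (he : IsStarProjection e)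
    (hU : U ∈ unitary (Matrix κ κ ℂ)) : IsStarProjection (U * e * star U) := by
  have h1 := (Unitary.mem_iff.1 hU).1
  refine ⟨?_, ?_⟩
  · calc U * e * star U * (U * e * star U) = U * (e * (star U * U) * e) * star U := by noncomm_ring
      _ = U * e * star U := by rw [h1, mul_one, he.isIdempotentElem.eq]
  · rw [IsSelfAdjoint, star_mul, star_mul, star_star, he.isSelfAdjoint.star_eq, mul_assoc]

theorem trace_conj {U : Matrix κ κ ℂ} (hU : U ∈ unitary (Matrix κ κ ℂ)) (e : Matrix κ κ ℂ) :
    (U * e * star U).trace = e.trace := by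
  rw [Matrix.trace_mul_comm, ← mul_assoc, (Unitary.mem_iff.1 hU).1, one_mul]

theorem IsStarProjection.exists_diagProj {e : Matrix κ κ ℂ} (he : IsStarProjection e) :
    ∃ U ∈ unitary (Matrix κ κ ℂ), ∃ s : Finset κ, e = U * diagProj s * star U := by
  have hA : e.IsHermitian := he.isSelfAdjoint
  have hs := hA.spectral_theorem
  rw [Unitary.conjStarAlgAut_apply] at hs
  obtain ⟨U, hU, hUe⟩ : ∃ U, U ∈ unitary (Matrix κ κ ℂ) ∧
      U = (hA.eigenvectorUnitary : Matrix κ κ ℂ) := ⟨_, hA.eigenvectorUnitary.2, rfl⟩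
  rw [← hUe] at hs
  obtain ⟨d, hd⟩ : ∃ d : Matrix κ κ ℂ, d = Matrix.diagonal (RCLike.ofReal ∘ hA.eigenvalues) :=
    ⟨_, rfl⟩
  rw [← hd] at hs
  have h1 := (Unitary.mem_iff.1 hU).1
  have hdd : d * d = d := by
    have h3 : d = star U * e * U := by
      rw [hs]
      calc d = (star U * U) * d * (star U * U) := by rw [h1, one_mul, mul_one]
        _ = _ := by noncomm_ring
    have h4 := (Unitary.mem_iff.1 hU).2
    rw [h3]
    calc star U * e * U * (star U * e * U) = star U * (e * (U * star U) * e) * U := by noncomm_ring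
      _ = _ := by rw [h4, mul_one, he.isIdempotentElem.eq]
  refine ⟨U, hU, Finset.univ.filter fun i => hA.eigenvalues i = 1, ?_⟩
  suffices diagProj (Finset.univ.filter fun i => hA.eigenvalues i = 1) = d by rw [this, ← hs]
  rw [hd, Matrix.diagonal_mul_diagonal] at hdd
  rw [hd, diagProj]
  congr 1
  funext i
  have h5 := congrFun (Matrix.diagonal_injective hdd) i
  simp only [Function.comp_apply] at h5 ⊢
  have h6 : hA.eigenvalues i * hA.eigenvalues i = hA.eigenvalues i := by
    exact_mod_cast h5
  have h8 : hA.eigenvalues i * (hA.eigenvalues i - 1) = 0 := by linarith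
  rcases mul_eq_zero.1 h8 with h7 | h7
  · simp [h7]
  · simp [sub_eq_zero.1 h7]

theorem IsStarProjection.exists_trace_eq {e : Matrix κ κ ℂ} (he : IsStarProjection e) :
    ∃ n : ℕ, e.trace = n := by
  obtain ⟨U, hU, s, rfl⟩ := he.exists_diagProj
  exact ⟨s.card, by rw [trace_conj hU, trace_diagProj]⟩

theorem exists_unitary_diagProj {s t : Finset κ} (h : s.card = t.card) :
    ∃ W ∈ unitary (Matrix κ κ ℂ), W * diagProj s * star W = diagProj t := by
  obtain ⟨φ⟩ : Nonempty ({x // x ∈ t} ≃ {x // x ∈ s}) :=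
    ⟨Fintype.equivOfCardEq (by simp [h])⟩
  obtain ⟨τ, hτ⟩ : ∃ τ : κ ≃ κ, ∀ i, τ i ∈ s ↔ i ∈ t := by
    refine ⟨φ.extendSubtype, fun i => ⟨fun hi => ?_, fun hi => φ.extendSubtype_mem i hi⟩⟩
    by_contra hi'
    exact φ.extendSubtype_not_mem i hi' hi
  obtain ⟨W, hW, h2⟩ := exists_unitary_perm τ
  refine ⟨W, hW, ?_⟩
  rw [h2, diagProj, diagProj, Matrix.submatrix_diagonal_equiv]
  congr 1
  funext i
  simp [hτ]

/-- Projections of equal trace are unitarily equivalent. -/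
theorem IsStarProjection.exists_unitary {e f : Matrix κ κ ℂ} (he : IsStarProjection e)
    (hf : IsStarProjection f) (h : e.trace = f.trace) :
    ∃ W ∈ unitary (Matrix κ κ ℂ), W * e * star W = f := by
  obtain ⟨U, hU, s, rfl⟩ := he.exists_diagProj
  obtain ⟨V, hV, t, rfl⟩ := hf.exists_diagProj
  rw [trace_conj hU, trace_conj hV, trace_diagProj, trace_diagProj] at h
  obtain ⟨W, hW, hWst⟩ := exists_unitary_diagProj (s := s) (t := t) (by exact_mod_cast h)
  refine ⟨V * W * star U, mul_mem (mul_mem hV hW) (Unitary.star_mem hU), ?_⟩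
  have h1 := (Unitary.mem_iff.1 hU).1
  rw [← hWst]
  calc V * W * star U * (U * diagProj s * star U) * star (V * W * star U)
      = V * W * (star U * U) * diagProj s * (star U * U) * star W * star V := by
        rw [star_mul, star_mul, star_star]; noncomm_ring
    _ = V * (W * diagProj s * star W) * star V := by rw [h1, mul_one, mul_one]; noncomm_ring

/-- A projection dominates projections of every smaller trace. -/
theorem IsStarProjection.exists_le {e : Matrix κ κ ℂ} (he : IsStarProjection e) {n d : ℕ}
    (hn : e.trace = n) (hd : d ≤ n) :
    ∃ f : Matrix κ κ ℂ, IsStarProjection f ∧ e * f = f ∧ f * e = f ∧ f.trace = d := by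
  obtain ⟨U, hU, s, rfl⟩ := he.exists_diagProj
  rw [trace_conj hU, trace_diagProj] at hn
  have hn' : s.card = n := by exact_mod_cast hn
  obtain ⟨t, hts, htd⟩ := Finset.exists_subset_card_eq (hn'.symm ▸ hd)
  have h1 := (Unitary.mem_iff.1 hU).1
  have key (a b : Matrix κ κ ℂ) : U * a * star U * (U * b * star U) = U * (a * b) * star U := by
    calc _ = U * (a * (star U * U) * b) * star U := by noncomm_ring
      _ = _ := by rw [h1, mul_one]
  refine ⟨U * diagProj t * star U, (isStarProjection_diagProj t).conj hU, ?_, ?_, ?_⟩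
  · rw [key, diagProj_mul, Finset.inter_eq_right.2 hts]
  · rw [key, diagProj_mul, Finset.inter_eq_left.2 hts]
  · rw [trace_conj hU, trace_diagProj, htd]

/-- Close projections have the same trace. -/
theorem IsStarProjection.trace_eq_of_norm_sub_lt {e f : Matrix κ κ ℂ} (he : IsStarProjection e)
    (hf : IsStarProjection f) (h : ‖e - f‖ < 1 / 3) : e.trace = f.trace := by
  have hee := he.isIdempotentElem.eq
  have hff := hf.isIdempotentElem.eq
  -- This x intertwines e and f, and x - 1 = (2f - 1)(e - f). With the crude bound 3 for 2f - 1, the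
  -- hypothesis 1/3 makes x invertible.
  obtain ⟨x, hx⟩ : ∃ x, x = f * e + (1 - f) * (1 - e) := ⟨_, rfl⟩
  have h1 : x * e = f * x := by
    rw [hx]
    calc (f * e + (1 - f) * (1 - e)) * e = f * (e * e) + (1 - f) * (e - e * e) := by noncomm_ring
      _ = (f * f) * e + (f - f * f) * (1 - e) := by rw [hee, hff]; noncomm_ring
      _ = _ := by noncomm_ring
  have h2 : x - 1 = (2 * f - 1) * (e - f) := by
    rw [hx]
    calc f * e + (1 - f) * (1 - e) - 1 = 2 * (f * e) - 2 * f - e + f := by noncomm_ring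
      _ = 2 * (f * e) - 2 * (f * f) - e + f := by rw [hff]
      _ = _ := by noncomm_ring
  have h3 : ‖x - 1‖ < 1 := by
    rw [h2]
    have h4 : ‖(2 * f - 1 : Matrix κ κ ℂ)‖ ≤ 3 := by
      have h5 : ‖f‖ ≤ 1 := hf.norm_le
      have h6 : (2 * f - 1 : Matrix κ κ ℂ) = f + f - 1 := by noncomm_ring
      have h7 : ‖(1 : Matrix κ κ ℂ)‖ ≤ 1 := IsStarProjection.norm_le _
        ⟨one_mul 1, star_one _⟩
      rw [h6]
      linarith [norm_sub_le (f + f) 1, norm_add_le f f]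
    have h8 := norm_mul_le (2 * f - 1) (e - f)
    nlinarith [norm_nonneg (e - f), norm_nonneg (2 * f - 1)]
  obtain ⟨u, hu⟩ : IsUnit x := by
    have := isUnit_one_sub_of_norm_lt_one (x := 1 - x) (by rwa [norm_sub_rev])
    rwa [sub_sub_cancel] at this
  have h4 : f = x * e * (↑u⁻¹ : Matrix κ κ ℂ) := by
    rw [h1, ← hu, mul_assoc, Units.mul_inv, mul_one]
  rw [h4, Matrix.trace_mul_comm, ← mul_assoc, ← hu, Units.inv_mul, one_mul]

end Projections

/-! ### Systems of matrix units in matrix algebras -/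

/-- A (not necessarily unital) system of matrix units. -/
structure IsMatUnits {κ k : Type*} [Fintype κ] [Fintype k] (G : k → k → Matrix κ κ ℂ) : Prop where
  mul_same : ∀ i j l, G i j * G j l = G i l
  mul_ne : ∀ i j j' l, j ≠ j' → G i j * G j' l = 0
  star_eq : ∀ i j, star (G i j) = G j i

namespace IsMatUnits
variable {κ k : Type*} [Fintype κ] [Fintype k] {G G' : k → k → Matrix κ κ ℂ}

theorem mul_unit (hG : IsMatUnits G) (i j : k) : G i j * ∑ a, G a a = G i j := by
  rw [Finset.mul_sum, Finset.sum_eq_single j]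
  · exact hG.mul_same _ _ _
  · exact fun b _ hb => hG.mul_ne _ _ _ _ hb.symm
  · exact fun h => absurd (Finset.mem_univ _) h

theorem unit_mul (hG : IsMatUnits G) (i j : k) : (∑ a, G a a) * G i j = G i j := by
  rw [Finset.sum_mul, Finset.sum_eq_single i]
  · exact hG.mul_same _ _ _
  · exact fun b _ hb => hG.mul_ne _ _ _ _ hb
  · exact fun h => absurd (Finset.mem_univ _) h

theorem isStarProjection_diag (hG : IsMatUnits G) (i : k) : IsStarProjection (G i i) :=
  ⟨hG.mul_same _ _ _, hG.star_eq _ _⟩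

theorem trace_unit (hG : IsMatUnits G) (i₀ : k) :
    (∑ a, G a a).trace = Fintype.card k * (G i₀ i₀).trace := by
  rw [Matrix.trace_sum, Finset.sum_congr rfl (g := fun _ => (G i₀ i₀).trace) fun a _ => ?_,
    Finset.sum_const, Finset.card_univ, nsmul_eq_mul]
  rw [← hG.mul_same a i₀ a, Matrix.trace_mul_comm, hG.mul_same]

/-- Averaging over matrix units. -/
def avg (G : k → k → Matrix κ κ ℂ) (i₀ : k) (w : Matrix κ κ ℂ) : Matrix κ κ ℂ :=
  ∑ i, G i i₀ * w * G i₀ i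

theorem mul_avg (hG : IsMatUnits G) (i₀ : k) (w : Matrix κ κ ℂ) (i j : k) :
    G i j * avg G i₀ w = G i i₀ * w * G i₀ j := by
  rw [avg, Finset.mul_sum, Finset.sum_eq_single j]
  · rw [← mul_assoc, ← mul_assoc, hG.mul_same]
  · intro b _ hb
    rw [← mul_assoc, ← mul_assoc, hG.mul_ne _ _ _ _ hb.symm, zero_mul, zero_mul]
  · exact fun h => absurd (Finset.mem_univ _) h

theorem avg_mul (hG : IsMatUnits G) (i₀ : k) (w : Matrix κ κ ℂ) (i j : k) :
    avg G i₀ w * G i j = G i i₀ * w * G i₀ j := by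
  rw [avg, Finset.sum_mul, Finset.sum_eq_single i]
  · rw [mul_assoc, hG.mul_same]
  · intro b _ hb
    rw [mul_assoc, hG.mul_ne _ _ _ _ hb, mul_zero]
  · exact fun h => absurd (Finset.mem_univ _) h

theorem commute_avg (hG : IsMatUnits G) (i₀ : k) (w : Matrix κ κ ℂ) (i j : k) :
    Commute (G i j) (avg G i₀ w) := (hG.mul_avg i₀ w i j).trans (hG.avg_mul i₀ w i j).symm

theorem star_avg (hG : IsMatUnits G) (i₀ : k) (w : Matrix κ κ ℂ) :
    star (avg G i₀ w) = avg G i₀ (star w) := by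
  rw [avg, star_sum, avg]
  refine Finset.sum_congr rfl fun i _ => ?_
  rw [star_mul, star_mul, hG.star_eq, hG.star_eq, mul_assoc]

theorem avg_mul_unit (hG : IsMatUnits G) (i₀ : k) (w : Matrix κ κ ℂ) :
    avg G i₀ w * ∑ a, G a a = avg G i₀ w := by
  rw [Finset.mul_sum, avg]
  refine Finset.sum_congr rfl fun i _ => ?_
  exact hG.avg_mul i₀ w i i

theorem unit_mul_avg (hG : IsMatUnits G) (i₀ : k) (w : Matrix κ κ ℂ) :
    (∑ a, G a a) * avg G i₀ w = avg G i₀ w := by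
  rw [Finset.sum_mul, avg]
  refine Finset.sum_congr rfl fun i _ => ?_
  exact hG.mul_avg i₀ w i i

variable [DecidableEq κ]

/-- The average of `w` is close to `w` cut down by the unit if `w` almost commutes with elements
that implement the matrix units. -/
theorem norm_avg_sub_le (hG : IsMatUnits G) (i₀ : k) (w : Matrix κ κ ℂ) {η : ℝ}
    (h : ∀ i, ‖(∑ a, G a a) * w * G i₀ i - G i₀ i * w * ∑ a, G a a‖ ≤ η) :
    ‖avg G i₀ w - (∑ a, G a a) * w * ∑ a, G a a‖ ≤ Fintype.card k * η := by
  obtain ⟨p, hp⟩ : ∃ p, p = ∑ a, G a a := ⟨_, rfl⟩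
  have e1 : avg G i₀ w - p * w * p = ∑ i, G i i₀ * (p * w * G i₀ i - G i₀ i * w * p) := by
    have e2 : p * w * p = ∑ i, G i i * (w * p) := by
      rw [← Finset.sum_mul, ← hp, mul_assoc]
    rw [e2, avg, ← Finset.sum_sub_distrib]
    refine Finset.sum_congr rfl fun i _ => ?_
    calc G i i₀ * w * G i₀ i - G i i * (w * p)
        = (G i i₀ * p) * w * G i₀ i - (G i i₀ * G i₀ i) * (w * p) := by
          rw [hG.mul_same, hp, hG.mul_unit]
      _ = _ := by noncomm_ring
  rw [← hp, e1]
  refine (norm_sum_le _ _).trans ?_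
  refine (Finset.sum_le_sum (g := fun _ => η) fun i _ => ?_).trans (by simp)
  have h1 : ‖G i i₀‖ ≤ 1 := by
    have h2 : ‖G i i₀‖ * ‖G i i₀‖ ≤ 1 := by
      rw [← CStarRing.norm_star_mul_self, hG.star_eq, hG.mul_same]
      exact (hG.isStarProjection_diag i₀).norm_le
    nlinarith [norm_nonneg (G i i₀)]
  refine (norm_mul_le _ _).trans ?_
  have h3 := h i
  rw [← hp] at h3
  nlinarith [norm_nonneg (G i i₀), norm_nonneg (p * w * G i₀ i - G i₀ i * w * p)]

theorem isStarProjection_unit (hG : IsMatUnits G) : IsStarProjection (∑ a, G a a) := by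
  refine ⟨?_, ?_⟩
  · rw [IsIdempotentElem, Finset.mul_sum]
    exact Finset.sum_congr rfl fun i _ => hG.unit_mul i i
  · rw [IsSelfAdjoint, star_sum]
    exact Finset.sum_congr rfl fun i _ => hG.star_eq i i

/-- Two systems of matrix units with units of equal trace are intertwined by a partial isometry. -/
theorem exists_intertwiner (hG : IsMatUnits G) (hG' : IsMatUnits G') (i₀ : k)
    (h : (∑ a, G a a).trace = (∑ a, G' a a).trace) :
    ∃ v : Matrix κ κ ℂ, star v * v = ∑ a, G a a ∧ v * star v = ∑ a, G' a a ∧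
      ∀ i j, v * G i j = G' i j * v := by
  have hk : (Fintype.card k : ℂ) ≠ 0 := by
    have : Nonempty k := ⟨i₀⟩
    exact_mod_cast Fintype.card_ne_zero
  rw [hG.trace_unit i₀, hG'.trace_unit i₀] at h
  obtain ⟨W, hW, hWe⟩ := (hG.isStarProjection_diag i₀).exists_unitary
    (hG'.isStarProjection_diag i₀) (mul_left_cancel₀ hk h)
  -- A partial isometry between the two corner projections at i₀ is enough: the matrix units spread
  -- it over all corners.
  obtain ⟨w, hw⟩ : ∃ w, w = W * G i₀ i₀ := ⟨_, rfl⟩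
  have w1 : star w * w = G i₀ i₀ := by
    rw [hw, star_mul, hG.star_eq]
    calc G i₀ i₀ * star W * (W * G i₀ i₀) = G i₀ i₀ * (star W * W) * G i₀ i₀ := by noncomm_ring
      _ = _ := by rw [(Unitary.mem_iff.1 hW).1, mul_one, hG.mul_same]
  have w2 : w * star w = G' i₀ i₀ := by
    rw [hw, star_mul, hG.star_eq, ← hWe]
    calc W * G i₀ i₀ * (G i₀ i₀ * star W) = W * (G i₀ i₀ * G i₀ i₀) * star W := by noncomm_ring
      _ = _ := by rw [hG.mul_same]
  have w3 : w * G i₀ i₀ = w := by rw [hw, mul_assoc, hG.mul_same]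
  have w4 : G' i₀ i₀ * w = w := by rw [← w2, mul_assoc, w1, w3]
  obtain ⟨v, hv⟩ : ∃ v, v = ∑ i, G' i i₀ * w * G i₀ i := ⟨_, rfl⟩
  have vG (i j) : v * G i j = G' i i₀ * w * G i₀ j := by
    rw [hv, Finset.sum_mul, Finset.sum_eq_single i]
    · rw [mul_assoc, hG.mul_same]
    · intro b _ hb
      rw [mul_assoc, hG.mul_ne _ _ _ _ hb, mul_zero]
    · exact fun h => absurd (Finset.mem_univ _) h
  have Gv (i j) : G' i j * v = G' i i₀ * w * G i₀ j := by
    rw [hv, Finset.mul_sum, Finset.sum_eq_single j]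
    · rw [← mul_assoc, ← mul_assoc, hG'.mul_same]
    · intro b _ hb
      rw [← mul_assoc, ← mul_assoc, hG'.mul_ne _ _ _ _ hb.symm, zero_mul, zero_mul]
    · exact fun h => absurd (Finset.mem_univ _) h
  have sv : star v = ∑ i, G i i₀ * star w * G' i₀ i := by
    rw [hv, star_sum]
    refine Finset.sum_congr rfl fun i _ => ?_
    rw [star_mul, star_mul, hG.star_eq, hG'.star_eq, mul_assoc]
  refine ⟨v, ?_, ?_, fun i j => (vG i j).trans (Gv i j).symm⟩
  · rw [sv, Finset.sum_mul]
    refine Finset.sum_congr rfl fun i _ => ?_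
    rw [mul_assoc, Gv, mul_assoc (G' i₀ i₀), ← mul_assoc (G' i₀ i₀), w4]
    calc G i i₀ * star w * (w * G i₀ i) = G i i₀ * (star w * w) * G i₀ i := by noncomm_ring
      _ = _ := by rw [w1, hG.mul_same, hG.mul_same]
  · rw [sv, Finset.mul_sum]
    refine Finset.sum_congr rfl fun i _ => ?_
    rw [← mul_assoc, ← mul_assoc, vG]
    calc G' i i₀ * w * G i₀ i₀ * star w * G' i₀ i = G' i i₀ * (w * G i₀ i₀ * star w) * G' i₀ i := by
          noncomm_ring
      _ = _ := by rw [w3, w2, hG'.mul_same, hG'.mul_same]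

/-- Projections of prescribed trace in the commutant of a system of matrix units. -/
theorem exists_subprojection (hG : IsMatUnits G) (i₀ : k) {n d : ℕ}
    (hn : (∑ a, G a a).trace = n) (hd : Fintype.card k * d ≤ n) :
    ∃ e : Matrix κ κ ℂ, IsStarProjection e ∧ (∑ a, G a a) * e = e ∧ e * (∑ a, G a a) = e ∧
      (∀ i j, Commute (G i j) e) ∧ e.trace = (Fintype.card k * d : ℕ) := by
  have hk : 0 < Fintype.card k := Fintype.card_pos_iff.2 ⟨i₀⟩
  have hp := hG.isStarProjection_diag i₀
  obtain ⟨n', hn'⟩ := hp.exists_trace_eq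
  have hnn : n = Fintype.card k * n' := by
    have := hG.trace_unit i₀
    rw [hn, hn'] at this
    exact_mod_cast this
  -- A projection of trace d is chosen in one corner; averaging copies it into every corner, which
  -- multiplies its trace by card k and puts it in the commutant.
  obtain ⟨f, hf, f1, f2, f3⟩ := hp.exists_le hn' (d := d)
    (Nat.le_of_mul_le_mul_left (hnn ▸ hd) hk)
  have key (i : k) (b : Matrix κ κ ℂ) : G i i₀ * f * G i₀ i * b = G i i₀ * f * (G i₀ i * b) := by
    noncomm_ring
  refine ⟨avg G i₀ f, ⟨?_, ?_⟩, hG.unit_mul_avg _ _, hG.avg_mul_unit _ _,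
    fun i j => hG.commute_avg i₀ f i j, ?_⟩
  · rw [IsIdempotentElem]
    obtain ⟨b, hb⟩ : ∃ b, b = avg G i₀ f := ⟨_, rfl⟩
    rw [← hb]
    nth_rw 1 [hb]
    rw [hb, avg, Finset.sum_mul, ← avg]
    refine Finset.sum_congr rfl fun i _ => ?_
    rw [mul_assoc, hG.mul_avg]
    calc G i i₀ * f * (G i₀ i₀ * f * G i₀ i) = G i i₀ * (f * (G i₀ i₀ * f)) * G i₀ i := by
          noncomm_ring
      _ = _ := by rw [f1, hf.isIdempotentElem.eq]
  · rw [IsSelfAdjoint, hG.star_avg, hf.isSelfAdjoint.star_eq]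
  · rw [avg, Matrix.trace_sum, Finset.sum_congr rfl (g := fun _ => (d : ℂ)) fun i _ => ?_]
    · simp
    · rw [Matrix.trace_mul_comm, ← mul_assoc, hG.mul_same, f1, f3]

end IsMatUnits

/-! ### Perturbation of almost projections and almost unitaries -/

section Perturbation
variable {κ : Type*} [Fintype κ] [DecidableEq κ]

theorem continuousOn_real_spectrum (a : Matrix κ κ ℂ) (f : ℝ → ℝ) :
    ContinuousOn f (spectrum ℝ a) :=
  (Matrix.finite_real_spectrum (A := a)).continuousOn f

/-- An almost idempotent self-adjoint matrix is close to a projection that is a function of it. -/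
theorem exists_isStarProjection_near {w : Matrix κ κ ℂ} (hw : IsSelfAdjoint w) {δ : ℝ}
    (h : ‖w * w - w‖ ≤ δ) :
    ∃ e : Matrix κ κ ℂ, IsStarProjection e ∧ ‖e - w‖ ≤ 2 * δ ∧ (∀ b, Commute w b → Commute e b) ∧
      ∃ c, e = c * w ∧ e = w * c := by
  have hδ : 0 ≤ δ := (norm_nonneg _).trans h
  have hc (f : ℝ → ℝ) : ContinuousOn f (spectrum ℝ w) := continuousOn_real_spectrum w f
  -- Cut the spectrum at 1/2. From |x| |x - 1| ≤ δ, whichever factor is at least 1/2 in absolute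
  -- value bounds the other by 2δ.
  obtain ⟨χ, hχ⟩ : ∃ χ : ℝ → ℝ, χ = fun x => if 1 / 2 ≤ x then 1 else 0 := ⟨_, rfl⟩
  have hid : cfc (fun x : ℝ => x) w = w := cfc_id' ℝ w
  have hspec (x : ℝ) (hx : x ∈ spectrum ℝ w) : |x * x - x| ≤ δ := by
    have e1 : cfc (fun x : ℝ => x * x - x) w = w * w - w := by
      rw [cfc_sub _ _ w (hc _) (hc _), cfc_mul _ _ w (hc _) (hc _), hid]
    have := norm_apply_le_norm_cfc (fun x : ℝ => x * x - x) w hx (hc _)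
    rw [e1] at this
    exact this.trans h
  -- The factor c is χ(x)/x; the identities e = c w = w c place e under any projection that fixes w.
  refine ⟨cfc χ w, ⟨?_, cfc_predicate χ w⟩, ?_, fun b hb => ?_,
    cfc (fun x : ℝ => if 1 / 2 ≤ x then x⁻¹ else 0) w, ?_, ?_⟩
  · rw [IsIdempotentElem, ← cfc_mul _ _ w (hc _) (hc _)]
    refine cfc_congr fun x _ => ?_
    rw [hχ]
    dsimp only
    split_ifs <;> norm_num
  · have e1 : cfc χ w - w = cfc (fun x => χ x - x) w := by
      rw [cfc_sub _ _ w (hc _) (hc _), hid]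
    rw [e1]
    refine norm_cfc_le (by positivity) fun x hx => ?_
    have h1 := hspec x hx
    rw [Real.norm_eq_abs, hχ]
    dsimp only
    rw [show x * x - x = x * (x - 1) by ring, abs_mul] at h1
    split_ifs with h2
    · rw [abs_of_pos (by linarith : 0 < x)] at h1
      rw [abs_sub_comm]
      nlinarith [abs_nonneg (x - 1)]
    · rw [abs_of_neg (by linarith : x - 1 < 0)] at h1
      rw [zero_sub, abs_neg]
      nlinarith [abs_nonneg x]
  · exact hb.cfc_real χ
  · calc cfc χ w = cfc (fun x : ℝ => (if 1 / 2 ≤ x then x⁻¹ else 0) * x) w :=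
        cfc_congr fun x _ => by
          rw [hχ]
          dsimp only
          split_ifs with h2
          · rw [inv_mul_cancel₀ (by linarith)]
          · rw [zero_mul]
      _ = _ := by rw [cfc_mul _ _ w (hc _) (hc _), hid]
  · calc cfc χ w = cfc (fun x : ℝ => x * (if 1 / 2 ≤ x then x⁻¹ else 0)) w :=
        cfc_congr fun x _ => by
          rw [hχ]
          dsimp only
          split_ifs with h2
          · rw [mul_inv_cancel₀ (by linarith)]
          · rw [mul_zero]
      _ = _ := by rw [cfc_mul _ _ w (hc _) (hc _), hid]

/-- A matrix close to a unitary is close to a unitary that is a function of it. -/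
theorem exists_unitary_near {w u : Matrix κ κ ℂ} (hu : u ∈ unitary (Matrix κ κ ℂ)) {η : ℝ}
    (hη : η ≤ 1 / 6) (h : ‖w - u‖ ≤ η) :
    ∃ y ∈ unitary (Matrix κ κ ℂ), ‖y - u‖ ≤ 7 * η ∧
      ∀ b, Commute w b → Commute (star w) b → Commute y b := by
  have hη0 : 0 ≤ η := (norm_nonneg _).trans h
  have hu1 : ‖u‖ ≤ 1 := by
    have h1 : ‖u‖ * ‖u‖ ≤ 1 := by
      rw [← CStarRing.norm_star_mul_self, (Unitary.mem_iff.1 hu).1]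
      exact IsStarProjection.norm_le _ ⟨one_mul 1, star_one _⟩
    nlinarith [norm_nonneg u]
  have hw1 : ‖w‖ ≤ 1 + η := by
    have := norm_add_le (w - u) u
    rw [sub_add_cancel] at this
    linarith
  obtain ⟨a, ha⟩ : ∃ a, a = star w * w := ⟨_, rfl⟩
  have hsa : IsSelfAdjoint a := by rw [ha, IsSelfAdjoint, star_mul, star_star]
  have ha1 : ‖a - 1‖ ≤ 3 * η := by
    have e1 : a - 1 = star w * (w - u) + star (w - u) * u := by
      rw [ha, star_sub, sub_mul, (Unitary.mem_iff.1 hu).1]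
      noncomm_ring
    rw [e1]
    have h1 := norm_add_le (star w * (w - u)) (star (w - u) * u)
    have h2 := norm_mul_le (star w) (w - u)
    have h3 := norm_mul_le (star (w - u)) u
    rw [norm_star] at h2 h3
    have h4 : ‖w‖ * ‖w - u‖ ≤ (1 + η) * η := mul_le_mul hw1 h (norm_nonneg _) (by linarith)
    have h5 : ‖w - u‖ * ‖u‖ ≤ η * 1 := mul_le_mul h hu1 (norm_nonneg _) hη0
    nlinarith
  have hc (f : ℝ → ℝ) : ContinuousOn f (spectrum ℝ a) := continuousOn_real_spectrum a f
  have hid : cfc (fun x : ℝ => x) a = a := cfc_id' ℝ a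
  have hone : cfc (fun _ : ℝ => (1 : ℝ)) a = 1 := cfc_const_one ℝ a
  have hspec (x : ℝ) (hx : x ∈ spectrum ℝ a) : |x - 1| ≤ 3 * η := by
    have e1 : cfc (fun x : ℝ => x - 1) a = a - 1 := by
      rw [cfc_sub _ _ a (hc _) (hc _), hid, hone]
    have := norm_apply_le_norm_cfc (fun x : ℝ => x - 1) a hx (hc _)
    rw [e1] at this
    exact this.trans ha1
  have hpos (x : ℝ) (hx : x ∈ spectrum ℝ a) : 1 / 2 ≤ x := by
    have := abs_le.1 (hspec x hx)
    linarith
  -- Polar decomposition: w (w* w)^(-1/2) is unitary. The bound η ≤ 1/6 keeps the spectrum of w* w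
  -- above 1/2.
  obtain ⟨b, hb⟩ : ∃ b, b = cfc (fun x : ℝ => (Real.sqrt x)⁻¹) a := ⟨_, rfl⟩
  have hsb : IsSelfAdjoint b := by rw [hb]; exact cfc_predicate _ a
  have hbab : b * a * b = 1 := by
    have e1 : b * a * b = cfc (fun x : ℝ => (Real.sqrt x)⁻¹ * x * (Real.sqrt x)⁻¹) a := by
      rw [cfc_mul _ _ a (hc _) (hc _), cfc_mul _ _ a (hc _) (hc _), hid, hb]
    rw [e1, ← hone]
    refine cfc_congr fun x hx => ?_
    have hx0 : 0 < x := by linarith [hpos x hx]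
    have hs := Real.sqrt_pos.2 hx0
    have hss := Real.mul_self_sqrt hx0.le
    field_simp
    nlinarith
  have hb1 : ‖b - 1‖ ≤ 3 * η := by
    have e1 : b - 1 = cfc (fun x : ℝ => (Real.sqrt x)⁻¹ - 1) a := by
      rw [cfc_sub _ _ a (hc _) (hc _), hone, hb]
    rw [e1]
    refine norm_cfc_le (by positivity) fun x hx => ?_
    have hx0 : 1 / 2 ≤ x := hpos x hx
    have hs : 1 / 2 ≤ Real.sqrt x := Real.le_sqrt_of_sq_le (by linarith)
    have hss := Real.mul_self_sqrt (by linarith : 0 ≤ x)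
    refine le_trans ?_ (hspec x hx)
    have e2 : (Real.sqrt x)⁻¹ - 1 = (1 - x) * (Real.sqrt x * (1 + Real.sqrt x))⁻¹ := by
      field_simp
      nlinarith
    rw [e2, norm_mul, Real.norm_eq_abs, abs_sub_comm]
    refine mul_le_of_le_one_right (abs_nonneg _) ?_
    rw [norm_inv, Real.norm_eq_abs, abs_of_nonneg (by positivity)]
    refine inv_le_one_of_one_le₀ ?_
    nlinarith
  refine ⟨w * b, ?_, ?_, fun c hc1 hc2 => ?_⟩
  · rw [Unitary.mem_iff]
    have e1 : star (w * b) * (w * b) = 1 := by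
      rw [star_mul, hsb.star_eq, ← hbab, ha]
      noncomm_ring
    exact ⟨e1, mul_eq_one_comm.1 e1⟩
  · have e1 : w * b - u = w * (b - 1) + (w - u) := by noncomm_ring
    rw [e1]
    have h1 := norm_add_le (w * (b - 1)) (w - u)
    have h2 := norm_mul_le w (b - 1)
    have h3 : ‖w‖ * ‖b - 1‖ ≤ (1 + η) * (3 * η) :=
      mul_le_mul hw1 hb1 (norm_nonneg _) (by linarith)
    nlinarith
  · refine hc1.mul_left ?_
    rw [hb]
    refine Commute.cfc_real ?_ _
    rw [ha]
    exact hc2.mul_left hc1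

/-- A unitary close to `1` is joined to `1` by a short path. -/
theorem exists_unitary_path_near {U : Matrix κ κ ℂ} (hU : U ∈ unitary (Matrix κ κ ℂ))
    (h : ‖U - 1‖ < 2) :
    ∃ w : I → Matrix κ κ ℂ, Continuous w ∧ w 0 = 1 ∧ w 1 = U ∧
      (∀ t, w t ∈ unitary (Matrix κ κ ℂ)) ∧ ∀ t, ‖w t - 1‖ ≤ ‖U - 1‖ := by
  let u : unitary (Matrix κ κ ℂ) := ⟨U, hU⟩
  let γ := selfAdjoint.expUnitaryPathToOne (Unitary.argSelfAdjoint u)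
  refine ⟨fun t => γ t, ?_, ?_, ?_, fun t => (γ t).2, fun t => ?_⟩
  · exact continuous_subtype_val.comp γ.continuous
  · exact congrArg Subtype.val γ.source
  · exact (congrArg Subtype.val γ.target).trans
      (congrArg Subtype.val (expUnitary_argSelfAdjoint (u := u) h))
  · exact Unitary.norm_expUnitary_smul_argSelfAdjoint_sub_one_le u t.2 h

end Perturbation

/-! ### Extension of representations to discontinuous functions -/

/-- The embedding `a ↦ a ⊗ 1`. -/
noncomputable def leftHom (p q : ℕ) : Matrix (Fin p) (Fin p) ℂ →⋆ₐ[ℂ] MatTensor p q where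
  toFun a := a ⊗ₖ 1
  map_one' := Matrix.one_kronecker_one
  map_mul' a b := by rw [← Matrix.mul_kronecker_mul, one_mul]
  map_zero' := Matrix.zero_kronecker _
  map_add' a b := Matrix.add_kronecker a b _
  commutes' c := by
    rw [Algebra.algebraMap_eq_smul_one, Algebra.algebraMap_eq_smul_one, Matrix.smul_kronecker,
      Matrix.one_kronecker_one]
  map_star' a := by
    rw [Matrix.star_eq_conjTranspose, Matrix.star_eq_conjTranspose,
      Matrix.conjTranspose_kronecker, Matrix.conjTranspose_one]

/-- The embedding `b ↦ 1 ⊗ b`. -/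
noncomputable def rightHom (p q : ℕ) : Matrix (Fin q) (Fin q) ℂ →⋆ₐ[ℂ] MatTensor p q where
  toFun b := 1 ⊗ₖ b
  map_one' := Matrix.one_kronecker_one
  map_mul' a b := by rw [← Matrix.mul_kronecker_mul, one_mul]
  map_zero' := Matrix.kronecker_zero _
  map_add' a b := Matrix.kronecker_add _ a b
  commutes' c := by
    rw [Algebra.algebraMap_eq_smul_one, Algebra.algebraMap_eq_smul_one, Matrix.kronecker_smul,
      Matrix.one_kronecker_one]
  map_star' a := by
    rw [Matrix.star_eq_conjTranspose, Matrix.star_eq_conjTranspose,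
      Matrix.conjTranspose_kronecker, Matrix.conjTranspose_one]

/-- The not necessarily continuous functions that satisfy the end point conditions of the dimension
drop algebra. -/
noncomputable def fiberAlg (p q : ℕ) : StarSubalgebra ℂ (I → MatTensor p q) where
  carrier := {f | (∃ a, f 0 = leftHom p q a) ∧ ∃ b, f 1 = rightHom p q b}
  mul_mem' := by
    rintro f g ⟨⟨a, ha⟩, b, hb⟩ ⟨⟨a', ha'⟩, b', hb'⟩
    exact ⟨⟨a * a', by rw [Pi.mul_apply, ha, ha', map_mul]⟩,
      b * b', by rw [Pi.mul_apply, hb, hb', map_mul]⟩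
  add_mem' := by
    rintro f g ⟨⟨a, ha⟩, b, hb⟩ ⟨⟨a', ha'⟩, b', hb'⟩
    exact ⟨⟨a + a', by rw [Pi.add_apply, ha, ha', map_add]⟩,
      b + b', by rw [Pi.add_apply, hb, hb', map_add]⟩
  algebraMap_mem' := fun c => ⟨⟨algebraMap ℂ _ c, (AlgHomClass.commutes (leftHom p q) c).symm⟩,
    algebraMap ℂ _ c, (AlgHomClass.commutes (rightHom p q) c).symm⟩
  star_mem' := by
    rintro f ⟨⟨a, ha⟩, b, hb⟩
    exact ⟨⟨star a, by rw [Pi.star_apply, ha, map_star]⟩,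
      star b, by rw [Pi.star_apply, hb, map_star]⟩

theorem norm_starAlgHom_le {A B : Type*} [CStarAlgebra A] [CStarAlgebra B] (φ : A →⋆ₐ[ℂ] B)
    (a : A) : ‖φ a‖ ≤ ‖a‖ := NonUnitalStarAlgHom.norm_apply_le φ a

namespace dimensionDrop
variable {p q : ℕ} {κ : Type*} [Fintype κ] [DecidableEq κ]

/-- The inclusion of the dimension drop algebra into the algebra of all functions. -/
noncomputable def toFiber : dimensionDrop p q →⋆ₐ[ℂ] fiberAlg p q where
  toFun f := ⟨fun t => eval t f, exists_eval_zero f, exists_eval_one f⟩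
  map_one' := rfl
  map_mul' _ _ := rfl
  map_zero' := rfl
  map_add' _ _ := rfl
  commutes' _ := rfl
  map_star' _ := rfl

/-- The points that carry a finite-dimensional representation, together with the end points. -/
def supp (Θ : dimensionDrop p q →⋆ₐ[ℂ] Matrix κ κ ℂ) : Set I :=
  {t | ((t : ℝ) : ℂ) ∈ spectrum ℂ (Θ (central idC))} ∪ {0, 1}

theorem finite_supp (Θ : dimensionDrop p q →⋆ₐ[ℂ] Matrix κ κ ℂ) : (supp Θ).Finite := by
  refine Set.Finite.union ?_ (Set.toFinite _)
  refine (Matrix.finite_spectrum (Θ (central idC))).preimage (Set.injOn_of_injective ?_)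
  exact Complex.ofReal_injective.comp Subtype.val_injective

/-- The real part and the projection onto [0,1] only serve to extend b to a continuous function on
ℂ. -/
theorem cfc_idC (b : C(I, ℂ)) :
    cfc (fun z : ℂ => b (Set.projIcc 0 1 zero_le_one z.re)) (idC : C(I, ℂ)) = b := by
  have hc : Continuous fun z : ℂ => b (Set.projIcc 0 1 zero_le_one z.re) :=
    b.continuous.comp (continuous_projIcc.comp Complex.continuous_re)
  ext t
  let φ : C(I, ℂ) →⋆ₐ[ℂ] ℂ := ContinuousMap.evalStarAlgHom ℂ ℂ t
  have h1 := StarAlgHomClass.map_cfc φ (fun z : ℂ => b (Set.projIcc 0 1 zero_le_one z.re)) idC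
    hc.continuousOn (continuous_eval_const t)
  refine h1.trans ?_
  have h2 : φ idC = algebraMap ℂ ℂ ((t : ℝ) : ℂ) := rfl
  rw [h2, cfc_algebraMap]
  change b (Set.projIcc 0 1 zero_le_one ((t : ℝ) : ℂ).re) = b t
  rw [Complex.ofReal_re, Set.projIcc_val]

/-- On the centre, Θ is the functional calculus of the single normal matrix Θ (central idC), so it
sees only the values on the spectrum of that matrix. -/
theorem central_eq_of_eqOn (Θ : dimensionDrop p q →⋆ₐ[ℂ] Matrix κ κ ℂ) {b b' : C(I, ℂ)}
    (h : ∀ t ∈ supp Θ, b t = b' t) : Θ (central b) = Θ (central b') := by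
  let φ : C(I, ℂ) →⋆ₐ[ℂ] Matrix κ κ ℂ := Θ.comp central
  have key (b : C(I, ℂ)) : φ b =
      cfc (fun z : ℂ => b (Set.projIcc 0 1 zero_le_one z.re)) (φ idC) := by
    have hc : Continuous fun z : ℂ => b (Set.projIcc 0 1 zero_le_one z.re) :=
      b.continuous.comp (continuous_projIcc.comp Complex.continuous_re)
    conv_lhs => rw [← cfc_idC b]
    refine StarAlgHomClass.map_cfc φ _ idC hc.continuousOn ?_
    exact AddMonoidHomClass.continuous_of_bound φ 1 fun f => by
      rw [one_mul]; exact NonUnitalStarAlgHom.norm_apply_le φ f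
  have hspec : ∀ z ∈ spectrum ℂ (φ idC), ∃ t : I, z = ((t : ℝ) : ℂ) := by
    intro z hz
    have h1 := AlgHom.spectrum_apply_subset φ idC hz
    rw [ContinuousMap.spectrum_eq_range] at h1
    obtain ⟨t, ht⟩ := h1
    exact ⟨t, ht.symm⟩
  refine (key b).trans (Eq.trans (cfc_congr fun z hz => ?_) (key b').symm)
  obtain ⟨t, rfl⟩ := hspec z hz
  rw [Complex.ofReal_re, Set.projIcc_val]
  exact h t (Or.inl hz)

/-- The norm of an element under a representation is governed by its values on the support. -/
theorem norm_le_of_supp (Θ : dimensionDrop p q →⋆ₐ[ℂ] Matrix κ κ ℂ) {g : dimensionDrop p q} {C : ℝ}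
    (hC : 0 < C) (h : ∀ t ∈ supp Θ, ‖eval t g‖ ≤ C) : ‖Θ g‖ ≤ C := by
  have hc : Continuous fun t : I => ‖eval t g‖ := (continuous_eval g).norm
  have hm (t : I) : 0 < max C ‖eval t g‖ := lt_max_of_lt_left hC
  -- A central truncation: it equals 1 on the support, so Θ does not notice it, and it brings g down
  -- to norm at most C everywhere.
  let b : C(I, ℝ) := ⟨fun t => C / max C ‖eval t g‖,
    continuous_const.div (continuous_const.max hc) fun t => (hm t).ne'⟩
  have hb1 : Θ (central (complexify b)) = 1 := by
    rw [central_eq_of_eqOn Θ (b' := 1), map_one, map_one]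
    intro t ht
    have e1 : b t = 1 := by
      change C / max C ‖eval t g‖ = 1
      rw [max_eq_left (h t ht), div_self hC.ne']
    rw [complexify_apply, e1, Complex.ofReal_one]
    rfl
  have e : Θ g = Θ (central (complexify b) * g) := by rw [map_mul, hb1, one_mul]
  rw [e]
  refine (norm_starAlgHom_le (A := dimensionDrop p q) Θ _).trans (norm_le hC.le fun t => ?_)
  rw [map_mul, eval_central, complexify_apply, smul_mul_assoc, one_mul, norm_smul,
    Complex.norm_real, Real.norm_eq_abs]
  change |C / max C ‖eval t g‖| * ‖eval t g‖ ≤ C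
  rw [abs_of_pos (div_pos hC (hm t)), div_mul_eq_mul_div, div_le_iff₀ (hm t)]
  exact mul_le_mul_of_nonneg_left (le_max_right _ _) hC.le

theorem eq_of_eqOn_supp (Θ : dimensionDrop p q →⋆ₐ[ℂ] Matrix κ κ ℂ) {f g : dimensionDrop p q}
    (h : ∀ t ∈ supp Θ, eval t f = eval t g) : Θ f = Θ g := by
  have h1 : ‖Θ (f + (-1 : ℂ) • g)‖ ≤ 0 := by
    refine le_of_forall_pos_le_add fun C hC => ?_
    rw [zero_add]
    refine norm_le_of_supp Θ hC fun t ht => ?_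
    rw [map_add, map_smul, h t ht, neg_one_smul, add_neg_cancel, norm_zero]
    exact hC.le
  have h2 := norm_le_zero_iff.1 h1
  rw [map_add, map_smul, neg_one_smul, add_neg_eq_zero] at h2
  exact h2

/-- Interpolation on finite sets. -/
theorem exists_interpolation (f : fiberAlg p q) {X : Set I} (hX : X.Finite) (h0 : (0 : I) ∈ X)
    (h1 : (1 : I) ∈ X) : ∃ g : dimensionDrop p q, ∀ t ∈ X, eval t g = f.1 t := by
  classical
  lift X to Finset I using hX
  -- Lagrange interpolation polynomials.
  let l (x t : I) : ℂ := ∏ y ∈ X.erase x, ((((t : ℝ) - y) / ((x : ℝ) - y) : ℝ) : ℂ)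
  have hl (x) : Continuous (l x) := by
    refine continuous_finsetProd _ fun y _ => ?_
    fun_prop
  let G : I → MatTensor p q := fun t => ∑ x ∈ X, l x t • f.1 x
  have hG : Continuous G := continuous_finsetSum _ fun x _ => (hl x).smul continuous_const
  have hGX : ∀ t ∈ X, G t = f.1 t := by
    intro t ht
    change ∑ x ∈ X, l x t • f.1 x = f.1 t
    rw [Finset.sum_eq_single t]
    · have : l t t = 1 := Finset.prod_eq_one fun y hy => by
        have hne : (t : ℝ) - y ≠ 0 := fun h =>
          (Finset.mem_erase.1 hy).1 (Subtype.ext (sub_eq_zero.1 h).symm)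
        rw [div_self hne, Complex.ofReal_one]
      rw [this, one_smul]
    · intro x _ hxt
      have : l x t = 0 := Finset.prod_eq_zero (Finset.mem_erase.2 ⟨hxt.symm, ht⟩) (by simp)
      rw [this, zero_smul]
    · exact fun h => absurd ht h
  obtain ⟨⟨a, ha⟩, b, hb⟩ := f.2
  exact ⟨⟨⟨G, hG⟩, ⟨a, (hGX 0 h0).trans ha⟩, ⟨b, (hGX 1 h1).trans hb⟩⟩, hGX⟩

/-- A finite-dimensional representation of the dimension drop algebra extends to discontinuous
functions. -/
theorem exists_extension (Θ : dimensionDrop p q →⋆ₐ[ℂ] Matrix κ κ ℂ) :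
    ∃ E : fiberAlg p q →⋆ₐ[ℂ] Matrix κ κ ℂ, (∀ f, E (toFiber f) = Θ f) ∧
      ∀ f C, 0 ≤ C → (∀ t, ‖f.1 t‖ ≤ C) → ‖E f‖ ≤ C := by
  -- The end points belong to `supp Θ` so that the continuous interpolant satisfies the end point
  -- conditions. The choice of r is immaterial because Θ depends only on values on the support.
  choose r hr using fun f : fiberAlg p q => exists_interpolation f (finite_supp Θ)
    (Or.inr (Or.inl rfl)) (Or.inr (Or.inr rfl))
  have key {f : fiberAlg p q} {g : dimensionDrop p q} (h : ∀ t, f.1 t = eval t g) :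
      Θ (r f) = Θ g := eq_of_eqOn_supp Θ fun t ht => (hr f t ht).trans (h t)
  refine ⟨{
    toFun := fun f => Θ (r f)
    map_one' := (key (g := 1) fun t => rfl).trans (map_one Θ)
    map_mul' := fun f g => by
      rw [← map_mul]
      exact eq_of_eqOn_supp Θ fun t ht => by rw [map_mul, hr _ t ht, hr _ t ht, hr _ t ht]; rfl
    map_zero' := (key (g := 0) fun t => rfl).trans (map_zero Θ)
    map_add' := fun f g => by
      rw [← map_add]
      exact eq_of_eqOn_supp Θ fun t ht => by rw [map_add, hr _ t ht, hr _ t ht, hr _ t ht]; rfl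
    commutes' := fun c => (key (g := algebraMap ℂ _ c) fun t => rfl).trans (AlgHomClass.commutes Θ c)
    map_star' := fun f => by
      rw [← map_star]
      exact eq_of_eqOn_supp Θ fun t ht => by rw [map_star, hr _ t ht, hr _ t ht]; rfl },
    fun f => key fun t => rfl, fun f C hC h => ?_⟩
  refine le_of_forall_pos_le_add fun η hη => ?_
  refine norm_le_of_supp Θ (by positivity) fun t ht => ?_
  rw [hr f t ht]
  exact (h t).trans (by linarith)

end dimensionDrop

/-! ### Cells -/

/-- A type of fibre of the dimension drop algebra: a matrix algebra embedded into `M_p ⊗ M_q`. -/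
structure Cell (p q : ℕ) where
  k : Type
  fin : Fintype k
  dec : DecidableEq k
  base : k
  ι : Matrix k k ℂ →⋆ₐ[ℂ] MatTensor p q

attribute [instance] Cell.fin Cell.dec

namespace Cell
variable {p q : ℕ}

/-- The functions on `S` with constant value in the range of the cell extend by zero to elements of
`fiberAlg`. -/
def Fits (c : Cell p q) (S : Set I) : Prop :=
  (0 ∈ S → ∀ M, ∃ a, c.ι M = leftHom p q a) ∧ (1 ∈ S → ∀ M, ∃ b, c.ι M = rightHom p q b)

/-- The cell of the left end point. -/
noncomputable def zero (hp : 0 < p) : Cell p q :=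
  ⟨Fin p, inferInstance, inferInstance, ⟨0, hp⟩, leftHom p q⟩

/-- The cell of the right end point. -/
noncomputable def one (hq : 0 < q) : Cell p q :=
  ⟨Fin q, inferInstance, inferInstance, ⟨0, hq⟩, rightHom p q⟩

/-- The cell of interior points. -/
noncomputable def mid (hp : 0 < p) (hq : 0 < q) : Cell p q :=
  ⟨Fin p × Fin q, inferInstance, inferInstance, (⟨0, hp⟩, ⟨0, hq⟩), StarAlgHom.id ℂ _⟩

theorem zero_fits (hp : 0 < p) {S : Set I} (h : (1 : I) ∉ S) : (zero hp : Cell p q).Fits S :=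
  ⟨fun _ M => ⟨M, rfl⟩, fun h1 => absurd h1 h⟩

theorem one_fits (hq : 0 < q) {S : Set I} (h : (0 : I) ∉ S) : (one hq : Cell p q).Fits S :=
  ⟨fun h0 => absurd h0 h, fun _ M => ⟨M, rfl⟩⟩

theorem mid_fits (hp : 0 < p) (hq : 0 < q) {S : Set I} (h0 : (0 : I) ∉ S) (h1 : (1 : I) ∉ S) :
    (mid hp hq : Cell p q).Fits S :=
  ⟨fun h => absurd h h0, fun h => absurd h h1⟩

/-- The element of `fiberAlg` with value `ι M` on `S` and `0` elsewhere. -/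
noncomputable def elt (c : Cell p q) {S : Set I} (h : c.Fits S) (M : Matrix c.k c.k ℂ) :
    fiberAlg p q :=
  ⟨S.indicator fun _ => c.ι M, by
    classical
    refine ⟨?_, ?_⟩
    · by_cases h0 : (0 : I) ∈ S
      · obtain ⟨a, ha⟩ := h.1 h0 M
        exact ⟨a, by rw [Set.indicator_of_mem h0, ha]⟩
      · exact ⟨0, by rw [Set.indicator_of_notMem h0, map_zero]⟩
    · by_cases h1 : (1 : I) ∈ S
      · obtain ⟨a, ha⟩ := h.2 h1 M
        exact ⟨a, by rw [Set.indicator_of_mem h1, ha]⟩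
      · exact ⟨0, by rw [Set.indicator_of_notMem h1, map_zero]⟩⟩

theorem elt_mem (c : Cell p q) {S : Set I} (h : c.Fits S) (M : Matrix c.k c.k ℂ) {t : I}
    (ht : t ∈ S) : (c.elt h M).1 t = c.ι M := Set.indicator_of_mem ht fun _ => c.ι M

theorem elt_notMem (c : Cell p q) {S : Set I} (h : c.Fits S) (M : Matrix c.k c.k ℂ) {t : I}
    (ht : t ∉ S) : (c.elt h M).1 t = 0 := Set.indicator_of_notMem ht fun _ => c.ι M

end Cell

/-! ### Central functions and central projections of `fiberAlg` -/

theorem fiberAlg_ext {p q : ℕ} {f g : fiberAlg p q} (h : ∀ t, f.1 t = g.1 t) : f = g :=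
  Subtype.ext (funext h)

/-- The central functions in `fiberAlg`. -/
noncomputable def fcentral (p q : ℕ) : (I → ℂ) →⋆ₐ[ℂ] fiberAlg p q where
  toFun g := ⟨fun t => g t • 1, ⟨g 0 • 1, by rw [map_smul, map_one]⟩,
    ⟨g 1 • 1, by rw [map_smul, map_one]⟩⟩
  map_one' := fiberAlg_ext fun t => one_smul ℂ _
  map_mul' f g := fiberAlg_ext fun t => by
    change (f t * g t) • (1 : MatTensor p q) = (f t • 1) * (g t • 1)
    rw [smul_mul_smul_comm, one_mul]
  map_zero' := fiberAlg_ext fun t => zero_smul ℂ _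
  map_add' f g := fiberAlg_ext fun t => add_smul _ _ _
  commutes' c := fiberAlg_ext fun t => (Algebra.algebraMap_eq_smul_one c).symm
  map_star' f := fiberAlg_ext fun t => by
    change (star (f t)) • (1 : MatTensor p q) = star (f t • 1)
    rw [star_smul, star_one]

theorem fcentral_apply {p q : ℕ} (g : I → ℂ) (t : I) : (fcentral p q g).1 t = g t • 1 := rfl

theorem fcentral_mul_comm {p q : ℕ} (g : I → ℂ) (f : fiberAlg p q) :
    Commute (fcentral p q g) f := fiberAlg_ext fun t => by
  change (g t • 1) * f.1 t = f.1 t * (g t • 1)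
  rw [smul_mul_assoc, mul_smul_comm, one_mul, mul_one]

/-- The central projection of a set. -/
noncomputable def ind (p q : ℕ) (S : Set I) : fiberAlg p q := fcentral p q (S.indicator 1)

section ind
variable {p q : ℕ}

theorem ind_mem {S : Set I} {t : I} (h : t ∈ S) : (ind p q S).1 t = 1 := by
  rw [ind, fcentral_apply, Set.indicator_of_mem h, Pi.one_apply, one_smul]

theorem ind_notMem {S : Set I} {t : I} (h : t ∉ S) : (ind p q S).1 t = 0 := by
  rw [ind, fcentral_apply, Set.indicator_of_notMem h, zero_smul]

theorem commute_ind (S : Set I) (f : fiberAlg p q) : Commute (ind p q S) f :=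
  fcentral_mul_comm _ _

theorem ind_mul_ind (S T : Set I) : ind p q S * ind p q T = ind p q (S ∩ T) := by
  classical
  refine fiberAlg_ext fun t => ?_
  change (ind p q S).1 t * (ind p q T).1 t = _
  by_cases h1 : t ∈ S
  · by_cases h2 : t ∈ T
    · rw [ind_mem h1, ind_mem h2, ind_mem (show t ∈ S ∩ T from ⟨h1, h2⟩), one_mul]
    · rw [ind_notMem h2, ind_notMem fun h : t ∈ S ∩ T => h2 h.2, mul_zero]
  · rw [ind_notMem h1, ind_notMem fun h : t ∈ S ∩ T => h1 h.1, zero_mul]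

theorem star_ind (S : Set I) : star (ind p q S) = ind p q S := by
  classical
  refine fiberAlg_ext fun t => ?_
  change star ((ind p q S).1 t) = _
  by_cases h1 : t ∈ S
  · rw [ind_mem h1, star_one]
  · rw [ind_notMem h1, star_zero]

theorem ind_empty : ind p q ∅ = 0 := fiberAlg_ext fun t => ind_notMem (Set.notMem_empty t)

theorem ind_univ : ind p q Set.univ = 1 := fiberAlg_ext fun t => ind_mem (Set.mem_univ t)

theorem ind_union {S T : Set I} (h : Disjoint S T) :
    ind p q (S ∪ T) = ind p q S + ind p q T := by
  classical
  refine fiberAlg_ext fun t => ?_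
  change _ = (ind p q S).1 t + (ind p q T).1 t
  by_cases h1 : t ∈ S
  · rw [ind_mem h1, ind_notMem (Set.disjoint_left.1 h h1), ind_mem (Or.inl h1), add_zero]
  · by_cases h2 : t ∈ T
    · rw [ind_mem h2, ind_notMem h1, ind_mem (Or.inr h2), zero_add]
    · rw [ind_notMem h1, ind_notMem h2, ind_notMem fun h => h.elim h1 h2, zero_add]

end ind

/-! ### Cells in representations -/

section Rep
variable {p q : ℕ} {κ : Type*} [Fintype κ] [DecidableEq κ]
  (E : fiberAlg p q →⋆ₐ[ℂ] Matrix κ κ ℂ)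

theorem isStarProjection_ind (S : Set I) : IsStarProjection (E (ind p q S)) :=
  ⟨by rw [IsIdempotentElem, ← map_mul, ind_mul_ind, Set.inter_self],
    by rw [IsSelfAdjoint, ← map_star, star_ind]⟩

theorem commute_map_ind (S : Set I) (f : fiberAlg p q) : Commute (E (ind p q S)) (E f) :=
  (commute_ind S f).map E

/-- The matrix units of a cell. -/
noncomputable def Cell.units (c : Cell p q) {S : Set I} (h : c.Fits S) (i j : c.k) :
    Matrix κ κ ℂ := E (c.elt h (Matrix.single i j 1))

theorem Cell.elt_mul (c : Cell p q) {S : Set I} (h : c.Fits S) (M N : Matrix c.k c.k ℂ) :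
    c.elt h M * c.elt h N = c.elt h (M * N) := by
  classical
  refine fiberAlg_ext fun t => ?_
  change (c.elt h M).1 t * (c.elt h N).1 t = _
  by_cases ht : t ∈ S
  · rw [c.elt_mem h _ ht, c.elt_mem h _ ht, c.elt_mem h _ ht, map_mul]
  · rw [c.elt_notMem h M ht, c.elt_notMem h N ht, c.elt_notMem h (M * N) ht, zero_mul]

theorem Cell.elt_linear (c : Cell p q) {S : Set I} (h : c.Fits S) (M : Matrix c.k c.k ℂ) :
    c.elt h M = ∑ i, ∑ j, M i j • c.elt h (Matrix.single i j 1) := by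
  classical
  refine fiberAlg_ext fun t => ?_
  have e (f : c.k → c.k → fiberAlg p q) :
      (∑ i, ∑ j, f i j).1 t = ∑ i, ∑ j, (f i j).1 t := by
    simp
  rw [e]
  change _ = ∑ i, ∑ j, M i j • (c.elt h (Matrix.single i j 1)).1 t
  by_cases ht : t ∈ S
  · simp only [c.elt_mem h _ ht, ← map_smul, ← map_sum]
    congr 1
    conv_lhs => rw [Matrix.matrix_eq_sum_single M]
    simp
  · simp only [c.elt_notMem h _ ht, smul_zero, Finset.sum_const_zero]

theorem Cell.star_elt (c : Cell p q) {S : Set I} (h : c.Fits S) (M : Matrix c.k c.k ℂ) :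
    star (c.elt h M) = c.elt h (star M) := by
  classical
  refine fiberAlg_ext fun t => ?_
  change star ((c.elt h M).1 t) = _
  by_cases ht : t ∈ S
  · rw [c.elt_mem h _ ht, c.elt_mem h _ ht, map_star]
  · rw [c.elt_notMem h _ ht, c.elt_notMem h _ ht, star_zero]

theorem Cell.elt_one (c : Cell p q) {S : Set I} (h : c.Fits S) : c.elt h 1 = ind p q S := by
  classical
  refine fiberAlg_ext fun t => ?_
  by_cases ht : t ∈ S
  · rw [c.elt_mem h _ ht, ind_mem ht, map_one]
  · rw [c.elt_notMem h _ ht, ind_notMem ht]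

theorem Cell.isMatUnits (c : Cell p q) {S : Set I} (h : c.Fits S) :
    IsMatUnits (c.units E h) where
  mul_same i j l := by
    rw [Cell.units, Cell.units, ← map_mul, c.elt_mul, Matrix.single_mul_single_same, one_mul]
    rfl
  mul_ne i j j' l hj := by
    rw [Cell.units, Cell.units, ← map_mul, c.elt_mul, Matrix.single_mul_single_of_ne (h := hj)]
    have : c.elt h 0 = 0 := by rw [c.elt_linear]; simp
    rw [this, map_zero]
  star_eq i j := by
    rw [Cell.units, ← map_star, c.star_elt, Matrix.star_eq_conjTranspose,
      Matrix.conjTranspose_single, star_one]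
    rfl

theorem Cell.sum_units (c : Cell p q) {S : Set I} (h : c.Fits S) :
    ∑ a, c.units E h a a = E (ind p q S) := by
  have e : ∑ a, c.units E h a a = E (∑ a, c.elt h (Matrix.single a a 1)) := by
    rw [map_sum]
    rfl
  rw [e, ← c.elt_one h, c.elt_linear h 1]
  congr 1
  refine Finset.sum_congr rfl fun i _ => ?_
  rw [Finset.sum_eq_single i]
  · rw [Matrix.one_apply_eq, one_smul]
  · intro j _ hj
    rw [Matrix.one_apply_ne hj.symm, zero_smul]
  · exact fun h => absurd (Finset.mem_univ _) h

/-- The matrix units of the cell split this projection into card k equivalent ones, each of natural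
number trace. -/
theorem Cell.card_dvd_trace (c : Cell p q) {S : Set I} (h : c.Fits S) :
    ∃ n : ℕ, (E (ind p q S)).trace = (Fintype.card c.k * n : ℕ) := by
  obtain ⟨n, hn⟩ := ((c.isMatUnits E h).isStarProjection_diag c.base).exists_trace_eq
  refine ⟨n, ?_⟩
  rw [← c.sum_units E h, (c.isMatUnits E h).trace_unit c.base, hn]
  push_cast
  rfl

theorem ntr_fcentral_mono {g g' : I → ℝ} (h : ∀ t, g t ≤ g' t) :
    ntr (E (fcentral p q fun t => (g t : ℂ))) ≤ ntr (E (fcentral p q fun t => (g' t : ℂ))) := by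
  obtain ⟨r, hr⟩ : ∃ r : I → ℂ, r = fun t => (Real.sqrt (g' t - g t) : ℂ) := ⟨_, rfl⟩
  have e : (fun t => (g' t : ℂ)) = (fun t => (g t : ℂ)) + star r * r := by
    funext t
    have e1 : star (r t) * r t = ((g' t - g t : ℝ) : ℂ) := by
      rw [hr]
      dsimp only
      rw [Complex.star_def, Complex.conj_ofReal, ← Complex.ofReal_mul,
        Real.mul_self_sqrt (sub_nonneg.2 (h t))]
    change (g' t : ℂ) = (g t : ℂ) + star (r t) * r t
    rw [e1]
    push_cast
    ring
  rw [e, map_add, map_mul, map_star, map_add, map_mul, map_star, map_add]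
  exact le_add_of_nonneg_right (ntr_star_mul_self_nonneg _)

end Rep

/-! ### Orthogonal decompositions of the unit -/

/-- T = ∑ q X q is block diagonal: T* T is the sum of the positive blocks (q X q)* (q X q), each at
most ε² q, and the q add up to 1. -/
theorem norm_sum_conj_le {A ι : Type*} [CStarAlgebra A] [PartialOrder A] [StarOrderedRing A]
    [Fintype ι] {q : ι → A} (hq : ∀ l, IsStarProjection (q l))
    (ho : ∀ l l', l ≠ l' → q l * q l' = 0) (hs : ∑ l, q l = 1) (X : ι → A) {ε : ℝ} (hε : 0 ≤ ε)
    (hX : ∀ l, ‖X l‖ ≤ ε) : ‖∑ l, q l * X l * q l‖ ≤ ε := by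
  obtain ⟨T, hT⟩ : ∃ T, T = ∑ l, q l * X l * q l := ⟨_, rfl⟩
  have hsq (l) : star (q l) = q l := (hq l).isSelfAdjoint
  have hqq (l) : q l * q l = q l := (hq l).isIdempotentElem
  have e : star T * T = ∑ l, star (q l) * (star (q l * X l) * (q l * X l)) * q l := by
    rw [hT, star_sum, Finset.sum_mul]
    refine Finset.sum_congr rfl fun l _ => ?_
    rw [Finset.mul_sum, Finset.sum_eq_single l]
    · simp only [star_mul, hsq, mul_assoc]
    · intro b _ hb
      rw [star_mul, hsq, show q l * star (q l * X l) * (q b * X b * q b) =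
        q l * (star (X l) * star (q l)) * (q b * X b * q b) by rw [star_mul], hsq,
        show q l * (star (X l) * q l) * (q b * X b * q b) =
          q l * star (X l) * (q l * q b) * X b * q b by simp only [mul_assoc], ho l b hb.symm]
      simp only [mul_zero, zero_mul]
    · exact fun h => absurd (Finset.mem_univ _) h
  have h1 : star T * T ≤ algebraMap ℝ A (ε ^ 2) := by
    have : algebraMap ℝ A (ε ^ 2) = ∑ l, ε ^ 2 • q l := by
      rw [← Finset.smul_sum, hs, Algebra.algebraMap_eq_smul_one]
    rw [e, this]
    refine Finset.sum_le_sum fun l _ => ?_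
    refine (CStarAlgebra.star_left_conjugate_le_norm_smul (IsSelfAdjoint.star_mul_self _)).trans ?_
    rw [hsq, hqq]
    refine smul_le_smul_of_nonneg_right ?_ (hq l).nonneg
    rw [CStarRing.norm_star_mul_self, ← sq]
    refine pow_le_pow_left₀ (norm_nonneg _) ?_ 2
    calc ‖q l * X l‖ ≤ ‖q l‖ * ‖X l‖ := norm_mul_le _ _
      _ ≤ 1 * ε := mul_le_mul (hq l).norm_le (hX l) (norm_nonneg _) zero_le_one
      _ = ε := one_mul _
  have h2 : ‖star T * T‖ ≤ ε ^ 2 :=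
    (CStarAlgebra.norm_le_iff_le_algebraMap _ (sq_nonneg ε) (star_mul_self_nonneg T)).2 h1
  rw [CStarRing.norm_star_mul_self, ← sq] at h2
  rw [← hT]
  exact (pow_le_pow_iff_left₀ (norm_nonneg _) hε two_ne_zero).1 h2

/-- A family of pairwise orthogonal projections with sum `1`. -/
structure IsDecomp {κ ι : Type*} [Fintype κ] [DecidableEq κ] [Fintype ι]
    (q : ι → Matrix κ κ ℂ) : Prop where
  proj : ∀ l, IsStarProjection (q l)
  ortho : ∀ l l', l ≠ l' → q l * q l' = 0
  sum : ∑ l, q l = 1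

namespace IsDecomp
variable {κ ι : Type*} [Fintype κ] [DecidableEq κ] [Fintype ι] {q q' : ι → Matrix κ κ ℂ}

open scoped MatrixOrder in
theorem norm_sum_le (hq : IsDecomp q) (X : ι → Matrix κ κ ℂ) {ε : ℝ} (hε : 0 ≤ ε)
    (hX : ∀ l, ‖X l‖ ≤ ε) : ‖∑ l, q l * X l * q l‖ ≤ ε :=
  norm_sum_conj_le hq.proj hq.ortho hq.sum X hε hX

theorem mul_right_of_star_mul {v q : Matrix κ κ ℂ} (hq : IsStarProjection q)
    (h : star v * v = q) : v * q = v := by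
  have hqq : q * q = q := hq.isIdempotentElem
  have hs : star q = q := hq.isSelfAdjoint
  have e : star (v * q - v) * (v * q - v) = 0 := by
    calc star (v * q - v) * (v * q - v) = star q * (star v * v) * q - star q * (star v * v) -
        (star v * v) * q + star v * v := by rw [star_sub, star_mul]; noncomm_ring
      _ = 0 := by rw [h, hs, hqq, hqq]; abel
  rw [Matrix.star_eq_conjTranspose, Matrix.conjTranspose_mul_self_eq_zero] at e
  exact sub_eq_zero.1 e

/-- Partial isometries between two decompositions add up to a unitary. -/
theorem exists_unitary (hq : IsDecomp q) (hq' : IsDecomp q') {v : ι → Matrix κ κ ℂ}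
    (h1 : ∀ l, star (v l) * v l = q l) (h2 : ∀ l, v l * star (v l) = q' l) :
    ∃ x ∈ unitary (Matrix κ κ ℂ), (∀ l, x * q l = v l) ∧ ∀ l, q' l * x = v l := by
  classical
  have hv (l) : v l * q l = v l := mul_right_of_star_mul (hq.proj l) (h1 l)
  have hv' (l) : q' l * v l = v l := by
    have : star (v l) * q' l = star (v l) :=
      mul_right_of_star_mul (hq'.proj l) (by rw [star_star, h2])
    rw [← star_star (q' l * v l), star_mul, (hq'.proj l).isSelfAdjoint.star_eq, this, star_star]
  have k1 (l) : (∑ a, v a) * q l = v l := by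
    rw [Finset.sum_mul, Finset.sum_eq_single l]
    · exact hv l
    · intro b _ hb
      rw [← hv b, mul_assoc, hq.ortho _ _ hb, mul_zero]
    · exact fun h => absurd (Finset.mem_univ _) h
  have k2 (l) : q' l * (∑ a, v a) = v l := by
    rw [Finset.mul_sum, Finset.sum_eq_single l]
    · exact hv' l
    · intro b _ hb
      rw [← hv' b, ← mul_assoc, hq'.ortho _ _ hb.symm, zero_mul]
    · exact fun h => absurd (Finset.mem_univ _) h
  have k3 : star (∑ a, v a) * ∑ a, v a = 1 := by
    rw [star_sum, Finset.sum_mul, ← hq.sum]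
    refine Finset.sum_congr rfl fun l _ => ?_
    rw [← h1 l]
    conv_lhs => rw [← hv' l, star_mul, (hq'.proj l).isSelfAdjoint.star_eq, mul_assoc, k2]
  refine ⟨∑ a, v a, Unitary.mem_iff.2 ⟨k3, ?_⟩, k1, k2⟩
  exact mul_eq_one_comm.1 k3

/-- The increments of an increasing chain of projections. -/
theorem of_chain {e : ℕ → Matrix κ κ ℂ} (he : ∀ l, IsStarProjection (e l))
    (hm : ∀ l, e l * e (l + 1) = e l) (n : ℕ) (h0 : e 0 = 0) (h1 : e n = 1) :
    IsDecomp fun l : Fin n => e (l + 1) - e l := by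
  have hs (l) : star (e l) = e l := (he l).isSelfAdjoint
  have mono {i j : ℕ} (h : i ≤ j) : e i * e j = e i := by
    induction j, h using Nat.le_induction with
    | base => exact (he i).isIdempotentElem
    | succ j hj ih => rw [← ih, mul_assoc, hm]
  have mono' {i j : ℕ} (h : i ≤ j) : e j * e i = e i := by
    have := congrArg star (mono h)
    rwa [star_mul, hs, hs] at this
  have ortho {i j : ℕ} (h : i < j) : (e (i + 1) - e i) * (e (j + 1) - e j) = 0 := by
    rw [sub_mul, mul_sub, mul_sub, mono (Nat.succ_le_of_lt h), mono (by omega : i + 1 ≤ j + 1),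
      mono h.le, mono (by omega : i ≤ j + 1)]
    abel
  refine ⟨fun l => ⟨?_, ?_⟩, fun l l' h => ?_, ?_⟩
  · rw [IsIdempotentElem, sub_mul, mul_sub, mul_sub, hm, mono' (Nat.le_succ _),
      (he _).isIdempotentElem.eq, (he _).isIdempotentElem.eq]
    abel
  · rw [IsSelfAdjoint, star_sub, hs, hs]
  · rcases lt_or_gt_of_ne (fun h' => h (Fin.ext h') : (l : ℕ) ≠ l') with h | h
    · exact ortho h
    · have := congrArg star (ortho h)
      rwa [star_mul, star_sub, star_sub, hs, hs, hs, hs, star_zero] at this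
  · rw [Fin.sum_univ_eq_sum_range (fun l => e (l + 1) - e l), Finset.sum_range_sub, h0, h1, sub_zero]

end IsDecomp

theorem IsMatUnits.mul_proj {κ k : Type*} [Fintype κ] [Fintype k] {G : k → k → Matrix κ κ ℂ}
    (hG : IsMatUnits G) {q : Matrix κ κ ℂ} (hq : IsStarProjection q)
    (hc : ∀ i j, Commute (G i j) q) : IsMatUnits fun i j => G i j * q where
  mul_same i j l := by
    rw [mul_assoc, ← mul_assoc q, ← (hc j l).eq, mul_assoc, hq.isIdempotentElem.eq, ← mul_assoc,
      hG.mul_same]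
  mul_ne i j j' l h := by
    rw [mul_assoc, ← mul_assoc q, ← (hc j' l).eq, mul_assoc, hq.isIdempotentElem.eq, ← mul_assoc,
      hG.mul_ne _ _ _ _ h, zero_mul]
  star_eq i j := by rw [star_mul, hG.star_eq, hq.isSelfAdjoint.star_eq, (hc j i).eq]

/-! ### Cuts -/

/-- The points of `[0,1]` below `r`. -/
def below (r : ℝ) : Set I := {t | (t : ℝ) < r}

/-- The points of `[0,1]` in `[r, s)`. -/
def slot (r s : ℝ) : Set I := {t | r ≤ t ∧ (t : ℝ) < s}

theorem below_inter_below {r s : ℝ} (h : r ≤ s) : below r ∩ below s = below r :=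
  Set.inter_eq_left.2 fun _ ht => lt_of_lt_of_le ht h

theorem below_eq_empty {r : ℝ} (h : r ≤ 0) : below r = ∅ :=
  Set.eq_empty_of_forall_notMem fun t ht => absurd (lt_of_lt_of_le ht h) (not_lt.2 t.2.1)

theorem below_eq_univ {r : ℝ} (h : 1 < r) : below r = Set.univ :=
  Set.eq_univ_of_forall fun t => lt_of_le_of_lt t.2.2 h

theorem below_eq_union {r s : ℝ} (h : r ≤ s) : below s = below r ∪ slot r s := by
  ext t
  refine ⟨fun ht => ?_, fun ht => ht.elim (fun h1 => lt_of_lt_of_le h1 h) fun h1 => h1.2⟩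
  exact (lt_or_ge (t : ℝ) r).imp (fun h1 => h1) fun h1 => ⟨h1, ht⟩

theorem disjoint_below_slot (r s : ℝ) : Disjoint (below r) (slot r s) :=
  Set.disjoint_left.2 fun _ h1 h2 => absurd h1 (not_lt.2 h2.1)

section Cut
variable {p q : ℕ} {κ : Type*} [Fintype κ] [DecidableEq κ]

theorem ind_below_eq_add {r s : ℝ} (h : r ≤ s) :
    ind p q (below s) = ind p q (below r) + ind p q (slot r s) := by
  rw [below_eq_union h, ind_union (disjoint_below_slot r s)]

/-- A projection that splits the representation `E` in two parts, the first of which lives below `s`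
and the second of which lives above `r`. -/
structure IsCut (E : fiberAlg p q →⋆ₐ[ℂ] Matrix κ κ ℂ) (r s : ℝ) (e : Matrix κ κ ℂ) : Prop where
  proj : IsStarProjection e
  left_le : E (ind p q (below r)) * e = E (ind p q (below r))
  le_right : e * E (ind p q (below s)) = e
  comm : ∀ f : fiberAlg p q, (∀ t ∈ slot r s, ∀ t' ∈ slot r s, f.1 t = f.1 t') → Commute (E f) e

variable {E : fiberAlg p q →⋆ₐ[ℂ] Matrix κ κ ℂ} {r s : ℝ} {e : Matrix κ κ ℂ}

theorem isCut_ind {c : ℝ} (h1 : r ≤ c) (h2 : c ≤ s) : IsCut E r s (E (ind p q (below c))) where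
  proj := isStarProjection_ind E _
  left_le := by rw [← map_mul, ind_mul_ind, below_inter_below h1]
  le_right := by rw [← map_mul, ind_mul_ind, below_inter_below h2]
  comm f _ := (commute_map_ind E _ f).symm

/-- The restriction to a slot of a function that is constant on the slot commutes with the commutant
of the matrix units of the slot. -/
theorem commute_mul_ind (hp : 0 < p) (hq : 0 < q) (h0 : (0 : I) ∉ slot r s)
    (h1 : (1 : I) ∉ slot r s)
    (hc : ∀ i j, Commute ((Cell.mid hp hq).units E (Cell.mid_fits hp hq h0 h1) i j) e)
    {f : fiberAlg p q} (hf : ∀ t ∈ slot r s, ∀ t' ∈ slot r s, f.1 t = f.1 t') :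
    Commute (E (f * ind p q (slot r s))) e := by
  classical
  have key : ∃ M, f * ind p q (slot r s) =
      (Cell.mid hp hq).elt (Cell.mid_fits hp hq h0 h1) M := by
    by_cases hne : (slot r s).Nonempty
    · obtain ⟨t₀, ht₀⟩ := hne
      refine ⟨f.1 t₀, fiberAlg_ext fun t => ?_⟩
      change f.1 t * (ind p q (slot r s)).1 t = _
      by_cases ht : t ∈ slot r s
      · rw [ind_mem ht, mul_one, hf t ht t₀ ht₀]
        exact ((Cell.mid hp hq).elt_mem (Cell.mid_fits hp hq h0 h1) (f.1 t₀) ht).symm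
      · rw [ind_notMem ht, mul_zero]
        exact ((Cell.mid hp hq).elt_notMem (Cell.mid_fits hp hq h0 h1) (f.1 t₀) ht).symm
    · refine ⟨0, fiberAlg_ext fun t => ?_⟩
      have ht : t ∉ slot r s := fun ht => hne ⟨t, ht⟩
      change f.1 t * (ind p q (slot r s)).1 t = _
      rw [ind_notMem ht, Cell.elt_notMem _ _ _ ht, mul_zero]
  obtain ⟨M, hM⟩ := key
  rw [hM, Cell.elt_linear, map_sum]
  refine Commute.sum_left _ _ _ fun i _ => ?_
  rw [map_sum]
  refine Commute.sum_left _ _ _ fun j _ => ?_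
  rw [map_smul]
  exact (hc i j).smul_left _

/-- On the slot, a function constant there acts through M_p ⊗ M_q, so a projection that lives on the
slot and commutes with the matrix units commutes with all such functions. -/
theorem isCut_of_subprojection (hp : 0 < p) (hq : 0 < q) (hrs : r ≤ s) (h0 : (0 : I) ∉ slot r s)
    (h1 : (1 : I) ∉ slot r s) (he : IsStarProjection e) (hl : E (ind p q (slot r s)) * e = e)
    (hr : e * E (ind p q (slot r s)) = e)
    (hc : ∀ i j, Commute ((Cell.mid hp hq).units E (Cell.mid_fits hp hq h0 h1) i j) e) :
    IsCut E r s (E (ind p q (below r)) + e) := by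
  have hz : E (ind p q (below r)) * e = 0 := by
    rw [← hl, ← mul_assoc, ← map_mul, ind_mul_ind, (disjoint_below_slot r s).inter_eq, ind_empty,
      map_zero, zero_mul]
  have hz' : e * E (ind p q (below r)) = 0 := by
    rw [← hr, mul_assoc, ← map_mul, ind_mul_ind, Set.inter_comm,
      (disjoint_below_slot r s).inter_eq, ind_empty, map_zero, mul_zero]
  have hi := isStarProjection_ind E (below r)
  refine ⟨⟨?_, ?_⟩, ?_, ?_, fun f hf => (commute_map_ind E _ f).symm.add_right ?_⟩
  · rw [IsIdempotentElem, add_mul, mul_add, mul_add, hz, hz', hi.isIdempotentElem.eq,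
      he.isIdempotentElem.eq, add_zero, zero_add]
  · rw [IsSelfAdjoint, star_add, hi.isSelfAdjoint.star_eq, he.isSelfAdjoint.star_eq]
  · rw [mul_add, hz, hi.isIdempotentElem.eq, add_zero]
  · rw [ind_below_eq_add hrs, map_add, add_mul, mul_add, mul_add, hz', hi.isIdempotentElem.eq, hr,
      ← map_mul, ind_mul_ind, (disjoint_below_slot r s).inter_eq, ind_empty, map_zero, add_zero,
      zero_add]
  · have hfe := commute_mul_ind hp hq h0 h1 hc hf
    calc E f * e = E (f * ind p q (slot r s)) * e := by rw [map_mul, mul_assoc, hl]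
      _ = e * E (f * ind p q (slot r s)) := hfe
      _ = e * E f := by
        rw [← (commute_ind (slot r s) f).eq, map_mul, ← mul_assoc, hr]

/-- The chain is e ≤ 1_{<s} ≤ 1_{<r'} ≤ e', with spectral projections in the middle. -/
theorem IsCut.mul_of_le {r' s' : ℝ} {e' : Matrix κ κ ℂ} (h : IsCut E r s e)
    (h' : IsCut E r' s' e') (hs : s ≤ r') : e * e' = e := by
  have k : e * E (ind p q (below r')) = e := by
    conv_lhs => rw [← h.le_right, mul_assoc, ← map_mul, ind_mul_ind, below_inter_below hs]
    exact h.le_right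
  conv_lhs => rw [← k, mul_assoc, h'.left_le]
  exact k

theorem IsCut.eq_zero (h : IsCut E r s e) (hs : s ≤ 0) : e = 0 := by
  rw [← h.le_right, below_eq_empty hs, ind_empty, map_zero, mul_zero]

theorem IsCut.eq_one (h : IsCut E r s e) (hr : 1 < r) : e = 1 := by
  have := h.left_le
  rwa [below_eq_univ hr, ind_univ, map_one, one_mul] at this

/-- The part between two cuts lives in the corresponding slot. -/
theorem IsCut.ind_slot_mul_sub {r' s' : ℝ} {e' : Matrix κ κ ℂ} (h : IsCut E r s e)
    (h' : IsCut E r' s' e') (hr : r ≤ r') (hrs : r ≤ s') (hs : s ≤ s') :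
    E (ind p q (slot r s')) * (e' - e) = e' - e := by
  have e1 : E (ind p q (slot r s')) = E (ind p q (below s')) - E (ind p q (below r)) := by
    rw [ind_below_eq_add hrs, map_add, add_sub_cancel_left]
  have l1 {x y : ℝ} {g : Matrix κ κ ℂ} (hg : IsCut E x y g) (hy : y ≤ s') :
      E (ind p q (below s')) * g = g := by
    have k : g * E (ind p q (below s')) = g := by
      conv_lhs => rw [← hg.le_right, mul_assoc, ← map_mul, ind_mul_ind, below_inter_below hy]
      exact hg.le_right
    have := congrArg star k
    rwa [star_mul, hg.proj.isSelfAdjoint.star_eq,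
      (isStarProjection_ind E (below s')).isSelfAdjoint.star_eq] at this
  have k : E (ind p q (below r)) * e' = E (ind p q (below r)) := by
    conv_lhs => rw [← below_inter_below hr, ← ind_mul_ind, map_mul, mul_assoc, h'.left_le,
      ← map_mul, ind_mul_ind, below_inter_below hr]
  rw [e1, sub_mul, mul_sub, mul_sub, l1 h' le_rfl, l1 h hs, k, h.left_le, sub_self, sub_zero]

end Cut

/-! ### Grids -/

/-- The mesh of the grid with `m` interior bands. -/
noncomputable def gap (m : ℕ) : ℝ := 2 / (4 * m + 1)

theorem gap_pos (m : ℕ) : 0 < gap m := by unfold gap; positivity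

/-- This normalisation puts 1 strictly between the right end 2m · gap of band m and the left end (2m
+ 1) · gap of band m + 1. Band 0 ends at 0. Hence only the bands 1, …, m meet I, and neither end
point of I lies in a band. -/
theorem gap_eq (m : ℕ) : (2 * m + 1 / 2) * gap m = 1 := by
  unfold gap
  field_simp
  ring

/-- The left end points of the bands. -/
noncomputable def gridL (m l : ℕ) : ℝ := (2 * l - 1) * gap m

/-- The centres of the bands. -/
noncomputable def gridC (m l : ℕ) : ℝ := (2 * l - 1 / 2) * gap m

/-- The right end points of the bands. -/
noncomputable def gridR (m l : ℕ) : ℝ := 2 * l * gap m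

section grid
variable (m l : ℕ)

theorem gridL_lt_gridC : gridL m l < gridC m l :=
  mul_lt_mul_of_pos_right (by linarith) (gap_pos m)

theorem gridC_lt_gridR : gridC m l < gridR m l :=
  mul_lt_mul_of_pos_right (by linarith) (gap_pos m)

theorem gridR_le_gridL : gridR m l ≤ gridL m (l + 1) :=
  mul_le_mul_of_nonneg_right (by push_cast; linarith) (gap_pos m).le

theorem gridR_zero : gridR m 0 = 0 := by simp [gridR]

theorem one_lt_gridL : 1 < gridL m (m + 1) := by
  rw [← gap_eq m]
  exact mul_lt_mul_of_pos_right (by push_cast; linarith) (gap_pos m)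

variable {m l}

theorem gridL_pos (hl : 1 ≤ l) : 0 < gridL m l := by
  have : (1 : ℝ) ≤ l := by exact_mod_cast hl
  exact mul_pos (by linarith) (gap_pos m)

theorem gridR_lt_one (hl : l ≤ m) : gridR m l < 1 := by
  have : (l : ℝ) ≤ m := by exact_mod_cast hl
  rw [← gap_eq m]
  exact mul_lt_mul_of_pos_right (by linarith) (gap_pos m)

theorem one_lt_gridL_of_lt (hl : m < l) : 1 < gridL m l := by
  have : (m : ℝ) + 1 ≤ l := by exact_mod_cast hl
  rw [← gap_eq m]
  exact mul_lt_mul_of_pos_right (by linarith) (gap_pos m)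

theorem zero_notMem_band (m l : ℕ) : (0 : I) ∉ slot (gridL m l) (gridR m l) := by
  rintro ⟨h1, h2⟩
  rcases Nat.eq_zero_or_pos l with rfl | hl
  · rw [gridR_zero] at h2
    exact lt_irrefl _ h2
  · exact absurd h1 (not_le.2 (gridL_pos hl))

theorem one_notMem_band (m l : ℕ) : (1 : I) ∉ slot (gridL m l) (gridR m l) := by
  rintro ⟨h1, h2⟩
  rcases le_or_gt l m with hl | hl
  · exact lt_asymm h2 (gridR_lt_one hl)
  · exact absurd h1 (not_le.2 (one_lt_gridL_of_lt hl))

theorem dist_le_of_mem_slot {t t' : I} (h : t ∈ slot (gridL m l) (gridR m (l + 1)))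
    (h' : t' ∈ slot (gridL m l) (gridR m (l + 1))) : dist t t' ≤ 3 * gap m := by
  have e : gridR m (l + 1) - gridL m l = 3 * gap m := by
    unfold gridR gridL
    push_cast
    ring
  rw [Subtype.dist_eq, Real.dist_eq, abs_le]
  constructor <;> linarith [h.1, h.2, h'.1, h'.2]

/-- The cells of the grid. -/
theorem exists_cell {p q : ℕ} (hp : 0 < p) (hq : 0 < q) (hm : 1 ≤ m) (hl : l ≤ m) :
    ∃ c : Cell p q, c.Fits (slot (gridL m l) (gridR m (l + 1))) ∧
      ∃ s ∈ slot (gridL m l) (gridR m (l + 1)), ∀ f : fiberAlg p q, ∃ M, c.ι M = f.1 s := by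
  have hlt : gridL m l < gridR m (l + 1) := (gridL_lt_gridC m l).trans <|
    (gridC_lt_gridR m l).trans_le <| (gridR_le_gridL m l).trans <|
      ((gridL_lt_gridC m _).trans (gridC_lt_gridR m _)).le
  have h1m (h : l < m) : (1 : I) ∉ slot (gridL m l) (gridR m (l + 1)) := fun h1 =>
    lt_asymm h1.2 (gridR_lt_one h)
  have h0m (h : 1 ≤ l) : (0 : I) ∉ slot (gridL m l) (gridR m (l + 1)) := fun h1 =>
    absurd h1.1 (not_le.2 (gridL_pos h))
  rcases Nat.eq_zero_or_pos l with rfl | hl0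
  · refine ⟨Cell.zero hp, Cell.zero_fits hp (h1m hm), 0, ⟨?_, ?_⟩, fun f => ?_⟩
    · exact ((gridL_lt_gridC m 0).trans (gridC_lt_gridR m 0)).le.trans (gridR_zero m).le
    · exact (gridL_pos le_rfl).trans ((gridL_lt_gridC m _).trans (gridC_lt_gridR m _))
    · obtain ⟨a, ha⟩ := f.2.1
      exact ⟨a, ha.symm⟩
  rcases hl.eq_or_lt with rfl | hlm
  · refine ⟨Cell.one hq, Cell.one_fits hq (h0m hl0), 1, ⟨?_, ?_⟩, fun f => ?_⟩
    · exact ((gridL_lt_gridC l l).trans (gridC_lt_gridR l l)).le.trans (gridR_lt_one le_rfl).le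
    · exact (one_lt_gridL l).trans ((gridL_lt_gridC l _).trans (gridC_lt_gridR l _))
    · obtain ⟨a, ha⟩ := f.2.2
      exact ⟨a, ha.symm⟩
  · refine ⟨Cell.mid hp hq, Cell.mid_fits hp hq (h0m hl0) (h1m hlm), ⟨gridL m l, (gridL_pos hl0).le,
      ?_⟩, ⟨le_rfl, hlt⟩, fun f => ⟨f.1 _, rfl⟩⟩
    exact hlt.le.trans (gridR_lt_one hlm).le

/-- A map of the interval that is constant on the bands. -/
theorem exists_flat (m : ℕ) : ∃ g : I → I, g 0 = 0 ∧ g 1 = 1 ∧ (∀ t, dist (g t) t ≤ gap m) ∧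
    ∀ l, ∀ t ∈ slot (gridL m l) (gridR m l), ∀ t' ∈ slot (gridL m l) (gridR m l),
      g t = g t' := by
  classical
  have hb : ∀ t : I, (∃ l, t ∈ slot (gridL m l) (gridR m l)) →
      ∃ g : I, dist g t ≤ gap m ∧ ∀ l, t ∈ slot (gridL m l) (gridR m l) → (g : ℝ) = gridL m l := by
    rintro t ⟨l, ht⟩
    have h0 : 0 ≤ gridL m l := by
      rcases Nat.eq_zero_or_pos l with rfl | hl
      · have h2 := ht.2
        rw [gridR_zero] at h2
        exact absurd h2 (not_lt.2 t.2.1)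
      · exact (gridL_pos hl).le
    refine ⟨⟨gridL m l, h0, ht.1.trans t.2.2⟩, ?_, fun l' ht' => ?_⟩
    · rw [Subtype.dist_eq, Real.dist_eq, abs_le]
      have e : gridR m l = gridL m l + gap m := by unfold gridR gridL; ring
      constructor
      · linarith [ht.2]
      · linarith [ht.1, gap_pos m]
    · have : l = l' := by
        have h1 : gridL m l < gridR m l' := ht.1.trans_lt ht'.2
        have h2 : gridL m l' < gridR m l := ht'.1.trans_lt ht.2
        have h1' := lt_of_mul_lt_mul_right h1 (gap_pos m).le
        have h2' := lt_of_mul_lt_mul_right h2 (gap_pos m).le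
        have h3 : (l : ℝ) < l' + 1 := by linarith
        have h4 : (l' : ℝ) < l + 1 := by linarith
        have h5 : l < l' + 1 := by exact_mod_cast h3
        have h6 : l' < l + 1 := by exact_mod_cast h4
        omega
      exact congrArg (gridL m) this
  choose g hg1 hg2 using hb
  -- Each band is collapsed to its left end and all other points stay fixed. The map is
  -- discontinuous, which is why the compositions live in `fiberAlg`.
  refine ⟨fun t => if h : ∃ l, t ∈ slot (gridL m l) (gridR m l) then g t h else t, ?_, ?_,
    fun t => ?_, fun l t ht t' ht' => ?_⟩
  · exact dif_neg fun ⟨l, h⟩ => zero_notMem_band m l h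
  · exact dif_neg fun ⟨l, h⟩ => one_notMem_band m l h
  · dsimp only
    split_ifs with h
    · exact hg1 t h
    · rw [dist_self]
      exact (gap_pos m).le
  · dsimp only
    rw [dif_pos ⟨l, ht⟩, dif_pos ⟨l, ht'⟩]
    exact Subtype.ext ((hg2 t ⟨l, ht⟩ l ht).trans (hg2 t' ⟨l, ht'⟩ l ht').symm)

end grid

/-! ### Families of cuts -/

section Cuts
variable {p q : ℕ} {κ : Type*} [Fintype κ] [DecidableEq κ]
  {E : fiberAlg p q →⋆ₐ[ℂ] Matrix κ κ ℂ} {m : ℕ} {e : ℕ → Matrix κ κ ℂ}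

theorem isDecomp_cuts (he : ∀ l, IsCut E (gridL m l) (gridR m l) (e l)) :
    IsDecomp fun l : Fin (m + 1) => e (l + 1) - e l :=
  IsDecomp.of_chain (fun l => (he l).proj)
    (fun l => (he l).mul_of_le (he (l + 1)) (gridR_le_gridL m l)) (m + 1)
    ((he 0).eq_zero (gridR_zero m).le) ((he (m + 1)).eq_one (one_lt_gridL m))

theorem gridL_le_gridL_succ (m l : ℕ) : gridL m l ≤ gridL m (l + 1) :=
  ((gridL_lt_gridC m l).trans (gridC_lt_gridR m l)).le.trans (gridR_le_gridL m l)

theorem gridR_le_gridR_succ (m l : ℕ) : gridR m l ≤ gridR m (l + 1) :=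
  (gridR_le_gridL m l).trans ((gridL_lt_gridC m _).trans (gridC_lt_gridR m _)).le

theorem ind_slot_mul_cuts (he : ∀ l, IsCut E (gridL m l) (gridR m l) (e l)) (l : ℕ) :
    E (ind p q (slot (gridL m l) (gridR m (l + 1)))) * (e (l + 1) - e l) = e (l + 1) - e l :=
  (he l).ind_slot_mul_sub (he (l + 1)) (gridL_le_gridL_succ m l)
    (((gridL_lt_gridC m l).trans (gridC_lt_gridR m l)).le.trans (gridR_le_gridR_succ m l))
    (gridR_le_gridR_succ m l)

/-- Functions that are constant on the two bands of a coarse slot commute with its projection. -/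
theorem commute_cuts (he : ∀ l, IsCut E (gridL m l) (gridR m l) (e l)) (l : ℕ) {f : fiberAlg p q}
    (h1 : ∀ t ∈ slot (gridL m l) (gridR m l), ∀ t' ∈ slot (gridL m l) (gridR m l), f.1 t = f.1 t')
    (h2 : ∀ t ∈ slot (gridL m (l + 1)) (gridR m (l + 1)),
      ∀ t' ∈ slot (gridL m (l + 1)) (gridR m (l + 1)), f.1 t = f.1 t') :
    Commute (E f) (e (l + 1) - e l) :=
  ((he (l + 1)).comm f h2).sub_right ((he l).comm f h1)

theorem commute_elt_cuts (he : ∀ l, IsCut E (gridL m l) (gridR m l) (e l)) {l : ℕ} (c : Cell p q)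
    (h : c.Fits (slot (gridL m l) (gridR m (l + 1)))) (M : Matrix c.k c.k ℂ) :
    Commute (E (c.elt h M)) (e (l + 1) - e l) := by
  have key {t : I} (ht : t ∈ slot (gridL m l) (gridR m (l + 1))) : (c.elt h M).1 t = c.ι M :=
    c.elt_mem h M ht
  have s1 {t : I} (ht : t ∈ slot (gridL m l) (gridR m l)) :
      t ∈ slot (gridL m l) (gridR m (l + 1)) := ⟨ht.1, ht.2.trans_le (gridR_le_gridR_succ m l)⟩
  have s2 {t : I} (ht : t ∈ slot (gridL m (l + 1)) (gridR m (l + 1))) :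
      t ∈ slot (gridL m l) (gridR m (l + 1)) := ⟨(gridL_le_gridL_succ m l).trans ht.1, ht.2⟩
  exact commute_cuts he l (fun t ht t' ht' => (key (s1 ht)).trans (key (s1 ht')).symm)
    fun t ht t' ht' => (key (s2 ht)).trans (key (s2 ht')).symm

/-- The precomposition of an element of `fiberAlg` with a map that fixes the end points. -/
def flatten (f : fiberAlg p q) (g : I → I) (h0 : g 0 = 0) (h1 : g 1 = 1) : fiberAlg p q :=
  ⟨fun t => f.1 (g t), by
    change (∃ a, f.1 (g 0) = _) ∧ ∃ b, f.1 (g 1) = _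
    rw [h0, h1]
    exact f.2⟩

/-- Discretisation of a representation along a family of cuts. -/
theorem norm_sub_sum_cuts_le (hE : ∀ f C, 0 ≤ C → (∀ t, ‖f.1 t‖ ≤ C) → ‖E f‖ ≤ C)
    (he : ∀ l, IsCut E (gridL m l) (gridR m l) (e l)) (c : Fin (m + 1) → Cell p q)
    (hc : ∀ l : Fin (m + 1), (c l).Fits (slot (gridL m l) (gridR m (l + 1)))) (s : Fin (m + 1) → I)
    (hs : ∀ l : Fin (m + 1), s l ∈ slot (gridL m l) (gridR m (l + 1))) {f : fiberAlg p q} {ε : ℝ}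
    (hf : ∀ t t', dist t t' ≤ 3 * gap m → ‖f.1 t - f.1 t'‖ ≤ ε)
    (M : ∀ l, Matrix (c l).k (c l).k ℂ) (hM : ∀ l, (c l).ι (M l) = f.1 (s l)) :
    ‖E f - ∑ l, E ((c l).elt (hc l) (M l)) * (e (l + 1) - e l)‖ ≤ 3 * ε := by
  classical
  have hg0 := gap_pos m
  have hε : 0 ≤ ε := (norm_nonneg _).trans (hf 0 0 (by rw [dist_self]; positivity))
  obtain ⟨g, g0, g1, hg, hgb⟩ := exists_flat m
  -- E f need not commute with the cuts, but E f' does, since f' is constant on the bands.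
  -- Flattening costs ε; freezing f' to the value of f at s l on each slot costs another 2ε.
  obtain ⟨f', hf'⟩ : ∃ f', f' = flatten f g g0 g1 := ⟨_, rfl⟩
  have hv (t) : f'.1 t = f.1 (g t) := by rw [hf']; rfl
  have hft (t) : ‖f.1 t - f'.1 t‖ ≤ ε := by
    rw [hv]
    exact hf _ _ (by rw [dist_comm]; linarith [hg t])
  have hq := isDecomp_cuts he
  have hcomm (l : ℕ) : Commute (E f') (e (l + 1) - e l) :=
    commute_cuts he l (fun t ht t' ht' => by rw [hv, hv, hgb l t ht t' ht'])
      fun t ht t' ht' => by rw [hv, hv, hgb (l + 1) t ht t' ht']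
  have h1 : ‖E f - E f'‖ ≤ ε := by
    rw [← map_sub]
    exact hE _ _ hε hft
  have h2 : E f' - ∑ l, E ((c l).elt (hc l) (M l)) * (e (l + 1) - e l) =
      ∑ l : Fin (m + 1), (e (l + 1) - e l) *
        E ((f' - (c l).elt (hc l) (M l)) * ind p q (slot (gridL m l) (gridR m (l + 1)))) *
        (e (l + 1) - e l) := by
    have : E f' = ∑ l : Fin (m + 1), E f' * (e (l + 1) - e l) := by
      rw [← Finset.mul_sum, hq.sum, mul_one]
    rw [this, ← Finset.sum_sub_distrib]
    refine Finset.sum_congr rfl fun l _ => ?_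
    have k := (hcomm l).sub_left (commute_elt_cuts he (c l) (hc l) (M l))
    rw [← sub_mul, map_mul, map_sub, ← mul_assoc, ← k.eq, mul_assoc _ (E (ind _ _ _)),
      ind_slot_mul_cuts he, mul_assoc, (hq.proj l).isIdempotentElem.eq]
  have h3 : ‖E f' - ∑ l, E ((c l).elt (hc l) (M l)) * (e (l + 1) - e l)‖ ≤ 2 * ε := by
    rw [h2]
    refine hq.norm_sum_le _ (by positivity) fun l => hE _ _ (by positivity) fun t => ?_
    change ‖(f'.1 t - ((c l).elt (hc l) (M l)).1 t) * (ind p q _).1 t‖ ≤ _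
    by_cases ht : t ∈ slot (gridL m l) (gridR m (l + 1))
    · rw [ind_mem ht, mul_one, (c l).elt_mem (hc l) (M l) ht, hM]
      calc ‖f'.1 t - f.1 (s l)‖ = ‖(f.1 t - f.1 (s l)) - (f.1 t - f'.1 t)‖ := by congr 1; abel
        _ ≤ ‖f.1 t - f.1 (s l)‖ + ‖f.1 t - f'.1 t‖ := norm_sub_le _ _
        _ ≤ ε + ε := add_le_add (hf _ _ (dist_le_of_mem_slot ht (hs l))) (hft t)
        _ = 2 * ε := by ring
    · rw [ind_notMem ht, mul_zero, norm_zero]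
      positivity
  calc _ = ‖(E f - E f') + (E f' - ∑ l, E ((c l).elt (hc l) (M l)) * (e (l + 1) - e l))‖ := by
        congr 1; abel
    _ ≤ ε + 2 * ε := (norm_add_le _ _).trans (add_le_add h1 h3)
    _ = 3 * ε := by ring

/-- The matrix units of a slot, cut down by the projection of the slot. -/
theorem isMatUnits_cuts (he : ∀ l, IsCut E (gridL m l) (gridR m l) (e l)) (c : Cell p q)
    {l : Fin (m + 1)} (h : c.Fits (slot (gridL m l) (gridR m (l + 1)))) :
    IsMatUnits (fun i j => c.units E h i j * (e (l + 1) - e l)) ∧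
      ∑ a, c.units E h a a * (e (l + 1) - e l) = e (l + 1) - e l := by
  refine ⟨(c.isMatUnits E h).mul_proj ((isDecomp_cuts he).proj l) fun i j =>
    commute_elt_cuts he c h _, ?_⟩
  rw [← Finset.sum_mul, c.sum_units E h, ind_slot_mul_cuts he]

theorem elt_mul_eq_sum (c : Cell p q) {S : Set I} (h : c.Fits S) (M : Matrix c.k c.k ℂ)
    (w : Matrix κ κ ℂ) : E (c.elt h M) * w = ∑ i, ∑ j, M i j • (c.units E h i j * w) := by
  rw [c.elt_linear h M, map_sum, Finset.sum_mul]
  refine Finset.sum_congr rfl fun i _ => ?_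
  rw [map_sum, Finset.sum_mul]
  refine Finset.sum_congr rfl fun j _ => ?_
  rw [map_smul, smul_mul_assoc]
  rfl

theorem norm_conj_le {x : Matrix κ κ ℂ} (hx : x ∈ unitary (Matrix κ κ ℂ)) (w : Matrix κ κ ℂ) :
    ‖x * w * star x‖ = ‖w‖ := by
  rw [CStarRing.norm_mul_mem_unitary _ (Unitary.star_mem hx), CStarRing.norm_mem_unitary_mul _ hx]

/-- Two representations with cuts of equal trace are approximately unitarily equivalent. -/
theorem exists_unitary_of_cuts (hp : 0 < p) (hq : 0 < q) (hm : 1 ≤ m)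
    {E' : fiberAlg p q →⋆ₐ[ℂ] Matrix κ κ ℂ} {e' : ℕ → Matrix κ κ ℂ}
    (hE : ∀ f C, 0 ≤ C → (∀ t, ‖f.1 t‖ ≤ C) → ‖E f‖ ≤ C)
    (hE' : ∀ f C, 0 ≤ C → (∀ t, ‖f.1 t‖ ≤ C) → ‖E' f‖ ≤ C)
    (he : ∀ l, IsCut E (gridL m l) (gridR m l) (e l))
    (he' : ∀ l, IsCut E' (gridL m l) (gridR m l) (e' l)) (htr : ∀ l, (e l).trace = (e' l).trace) :
    ∃ x ∈ unitary (Matrix κ κ ℂ), ∀ (f : fiberAlg p q) (ε : ℝ),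
      (∀ t t', dist t t' ≤ 3 * gap m → ‖f.1 t - f.1 t'‖ ≤ ε) →
      ‖x * E f * star x - E' f‖ ≤ 6 * ε := by
  classical
  choose c hc s hs M hM using fun l : Fin (m + 1) =>
    exists_cell hp hq hm (Nat.lt_succ_iff.1 l.2)
  have hu (l : Fin (m + 1)) := isMatUnits_cuts he (c l) (hc l)
  have hu' (l : Fin (m + 1)) := isMatUnits_cuts he' (c l) (hc l)
  -- Equal traces of the cuts give equal traces of the differences e (l + 1) - e l, so the cut-down
  -- matrix units of the two representations are intertwined slot by slot, and the partial
  -- isometries add up to a unitary.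
  choose v h1 h2 h3 using fun l : Fin (m + 1) => (hu l).1.exists_intertwiner (hu' l).1 (c l).base
    (by rw [(hu l).2, (hu' l).2, Matrix.trace_sub, Matrix.trace_sub, htr, htr])
  have hd := isDecomp_cuts he
  have hd' := isDecomp_cuts he'
  obtain ⟨x, hx, hx1, hx2⟩ := hd.exists_unitary hd' (fun l => (h1 l).trans (hu l).2)
    fun l => (h2 l).trans (hu' l).2
  have hxx := Unitary.mem_iff.1 hx
  refine ⟨x, hx, fun f ε hf => ?_⟩
  have key (l : Fin (m + 1)) (i j) : x * ((c l).units E (hc l) i j * (e (l + 1) - e l)) =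
      ((c l).units E' (hc l) i j * (e' (l + 1) - e' l)) * x := by
    have c1 := commute_elt_cuts he (c l) (hc l) (Matrix.single i j 1)
    have i1 := (hd.proj l).isIdempotentElem.eq
    have i2 := (hd'.proj l).isIdempotentElem.eq
    calc x * ((c l).units E (hc l) i j * (e (l + 1) - e l))
        = (x * (e (l + 1) - e l)) * ((c l).units E (hc l) i j * (e (l + 1) - e l)) := by
          rw [mul_assoc x, ← mul_assoc (e (l + 1) - e l), ← (show Commute ((c l).units E (hc l) i j)
            _ from c1).eq, mul_assoc ((c l).units E (hc l) i j), i1]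
      _ = v l * ((c l).units E (hc l) i j * (e (l + 1) - e l)) := by rw [hx1]
      _ = ((c l).units E' (hc l) i j * (e' (l + 1) - e' l)) * v l := h3 l i j
      _ = _ := by rw [← hx2 l, mul_assoc, ← mul_assoc (e' (l + 1) - e' l), i2, mul_assoc]
  have hT : x * (∑ l, E ((c l).elt (hc l) (M l f)) * (e (l + 1) - e l)) * star x =
      ∑ l, E' ((c l).elt (hc l) (M l f)) * (e' (l + 1) - e' l) := by
    have : x * (∑ l, E ((c l).elt (hc l) (M l f)) * (e (l + 1) - e l)) =
        (∑ l, E' ((c l).elt (hc l) (M l f)) * (e' (l + 1) - e' l)) * x := by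
      rw [Finset.mul_sum, Finset.sum_mul]
      refine Finset.sum_congr rfl fun l _ => ?_
      rw [elt_mul_eq_sum, elt_mul_eq_sum, Finset.mul_sum, Finset.sum_mul]
      refine Finset.sum_congr rfl fun i _ => ?_
      rw [Finset.mul_sum, Finset.sum_mul]
      refine Finset.sum_congr rfl fun j _ => ?_
      rw [mul_smul_comm, smul_mul_assoc, key]
    rw [this, mul_assoc, hxx.2, mul_one]
  have a1 := norm_sub_sum_cuts_le hE he c hc s hs hf (fun l => M l f) fun l => hM l f
  have a2 := norm_sub_sum_cuts_le hE' he' c hc s hs hf (fun l => M l f) fun l => hM l f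
  calc ‖x * E f * star x - E' f‖ =
      ‖x * (E f - ∑ l, E ((c l).elt (hc l) (M l f)) * (e (l + 1) - e l)) * star x -
        (E' f - ∑ l, E' ((c l).elt (hc l) (M l f)) * (e' (l + 1) - e' l))‖ := by
        rw [mul_sub, sub_mul, hT]
        congr 1
        abel
    _ ≤ 3 * ε + 3 * ε := by
        refine (norm_sub_le _ _).trans (add_le_add ?_ a2)
        rw [norm_conj_le hx]
        exact a1
    _ = 6 * ε := by ring

end Cuts

/-! ### Uniqueness of representations with prescribed trace -/

/-- A continuous function with value `1` up to `a` and `0` from `b` on. -/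
noncomputable def rampDown (a b : ℝ) : C(I, ℝ) :=
  ⟨fun t => max 0 (min 1 ((b - t) / (b - a))), by fun_prop⟩

section ramp
variable {a b : ℝ} {t : I}

theorem rampDown_apply (a b : ℝ) (t : I) :
    rampDown a b t = max 0 (min 1 ((b - t) / (b - a))) := rfl

theorem rampDown_nonneg (a b : ℝ) (t : I) : 0 ≤ rampDown a b t := le_max_left _ _

theorem rampDown_le_one (a b : ℝ) (t : I) : rampDown a b t ≤ 1 :=
  max_le zero_le_one (min_le_left _ _)

theorem rampDown_eq_one (h : a < b) (ht : t ≤ a) : rampDown a b t = 1 := by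
  have : 1 ≤ (b - t) / (b - a) := by rw [le_div_iff₀ (by linarith)]; linarith
  rw [rampDown_apply, min_eq_left this, max_eq_right zero_le_one]

theorem rampDown_eq_zero (h : a < b) (ht : b ≤ t) : rampDown a b t = 0 := by
  have : (b - t) / (b - a) ≤ 0 := div_nonpos_of_nonpos_of_nonneg (by linarith) (by linarith)
  rw [rampDown_apply, max_eq_left ((min_le_right _ _).trans this)]

end ramp

open dimensionDrop

section trace
variable {p q : ℕ}

theorem ind_eq_fcentral (S : Set I) :
    ind p q S = fcentral p q fun t => ((S.indicator (1 : I → ℝ) t : ℝ) : ℂ) := by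
  classical
  rw [ind]
  congr 1
  funext t
  by_cases h : t ∈ S
  · rw [Set.indicator_of_mem h, Set.indicator_of_mem h, Pi.one_apply, Pi.one_apply,
      Complex.ofReal_one]
  · rw [Set.indicator_of_notMem h, Set.indicator_of_notMem h, Complex.ofReal_zero]

theorem toFiber_central (h : C(I, ℝ)) :
    toFiber (central (complexify h) : dimensionDrop p q) = fcentral p q fun t => (h t : ℂ) := rfl

theorem trace_ind_mono {κ : Type*} [Fintype κ] [DecidableEq κ]
    (E : fiberAlg p q →⋆ₐ[ℂ] Matrix κ κ ℂ) {S T : Set I} (h : S ⊆ T) {n n' : ℕ}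
    (hn : (E (ind p q S)).trace = n) (hn' : (E (ind p q T)).trace = n') : n ≤ n' := by
  have e : ind p q T = ind p q S + ind p q (T \ S) := by
    rw [← ind_union Set.disjoint_sdiff_right, Set.union_sdiff_cancel h]
  obtain ⟨k, hk⟩ := (isStarProjection_ind E (T \ S)).exists_trace_eq
  rw [e, map_add, Matrix.trace_add, hn, hk] at hn'
  have : n + k = n' := by exact_mod_cast hn'
  omega

/-- A trace comparison for spectral projections of representations whose traces are close to a given
faithful tracial state. -/
theorem exists_trace_below_le (hp : 0 < p) (hq : 0 < q) {τ : TracialState (dimensionDrop p q)}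
    (hτ : τ.Faithful) {s t : ℝ} (hst : s < t) :
    ∃ δ > 0, ∃ h₁ h₂ : C(I, ℝ), ∀ (κ : Type) [Fintype κ] [DecidableEq κ]
      (E E' : fiberAlg p q →⋆ₐ[ℂ] Matrix κ κ ℂ),
      ‖ntr (E (toFiber (central (complexify h₁)))) - τ.toCLM (central (complexify h₁))‖ < δ →
      ‖ntr (E' (toFiber (central (complexify h₂)))) - τ.toCLM (central (complexify h₂))‖ < δ →
      ∀ n n' : ℕ, (E (ind p q (below s))).trace = n → (E' (ind p q (below t))).trace = n' →
        n ≤ n' := by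
  rcases le_or_gt s 0 with hs | hs
  · refine ⟨1, one_pos, 0, 0, fun κ _ _ E E' _ _ n n' hn _ => ?_⟩
    rw [below_eq_empty hs, ind_empty, map_zero, Matrix.trace_zero] at hn
    have : n = 0 := by exact_mod_cast hn.symm
    omega
  rcases lt_or_ge 1 t with ht | ht
  · refine ⟨1, one_pos, 0, 0, fun κ _ _ E E' _ _ n n' hn hn' => ?_⟩
    refine trace_ind_mono E (Set.subset_univ _) hn ?_
    rw [below_eq_univ ht, ind_univ, map_one] at hn'
    rw [ind_univ, map_one, hn']
  -- The indicator of [0,s), the ramp from s to d, the ramp from d to t and the indicator of [0,t)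
  -- increase in this order. The two ramps take the values 0 and 1 at d, so faithfulness of τ gives
  -- a positive gap between their traces; half of it is the tolerance.
  obtain ⟨d, hd⟩ : ∃ d, d = (s + t) / 2 := ⟨_, rfl⟩
  have hsd : s < d := by linarith
  have hdt : d < t := by linarith
  have hnn (x : I) : 0 ≤ (rampDown d t - rampDown s d) x := by
    rw [ContinuousMap.sub_apply, sub_nonneg]
    rcases le_total (x : ℝ) d with hx | hx
    · rw [rampDown_eq_one hdt hx]
      exact rampDown_le_one _ _ _
    · rw [rampDown_eq_zero hsd hx]
      exact rampDown_nonneg _ _ _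
  have hpos : 0 < τ.centralReal (rampDown d t - rampDown s d) := by
    have := τ.central_pos hτ hp hq hnn (t := ⟨d, by linarith, by linarith⟩) (by
      rw [ContinuousMap.sub_apply, rampDown_eq_one hdt le_rfl, rampDown_eq_zero hsd le_rfl]
      norm_num)
    rw [τ.central_complexify] at this
    exact_mod_cast this
  rw [map_sub] at hpos
  refine ⟨(τ.centralReal (rampDown d t) - τ.centralReal (rampDown s d)) / 2, by positivity,
    rampDown s d, rampDown d t, fun κ _ _ E E' h1 h2 n n' hn hn' => ?_⟩
  have m1 : ntr (E (ind p q (below s))) ≤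
      ntr (E (toFiber (central (complexify (rampDown s d))))) := by
    rw [ind_eq_fcentral, toFiber_central]
    refine ntr_fcentral_mono E fun x => ?_
    by_cases hx : x ∈ below s
    · rw [Set.indicator_of_mem hx, rampDown_eq_one hsd (le_of_lt hx)]
      rfl
    · rw [Set.indicator_of_notMem hx]
      exact rampDown_nonneg _ _ _
  have m2 : ntr (E' (toFiber (central (complexify (rampDown d t))))) ≤
      ntr (E' (ind p q (below t))) := by
    rw [ind_eq_fcentral, toFiber_central]
    refine ntr_fcentral_mono E' fun x => ?_
    by_cases hx : x ∈ below t
    · rw [Set.indicator_of_mem hx]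
      exact rampDown_le_one _ _ _
    · rw [Set.indicator_of_notMem hx, rampDown_eq_zero hdt (not_lt.1 hx)]
  have k1 := (abs_lt.1 ((Complex.abs_re_le_norm _).trans_lt h1)).2
  have k2 := (abs_lt.1 ((Complex.abs_re_le_norm _).trans_lt h2)).1
  rw [τ.central_complexify, Complex.sub_re, Complex.ofReal_re] at k1 k2
  have m1' := (Complex.le_def.1 m1).1
  have m2' := (Complex.le_def.1 m2).1
  have r {k : ℕ} : ((Fintype.card κ : ℂ)⁻¹ * (k : ℂ)).re = (Fintype.card κ : ℝ)⁻¹ * k := by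
    rw [← Complex.ofReal_natCast, ← Complex.ofReal_natCast, ← Complex.ofReal_inv,
      ← Complex.ofReal_mul, Complex.ofReal_re]
  rw [ntr_apply (E (ind _ _ _)), hn, r] at m1'
  rw [ntr_apply (E' (ind _ _ _)), hn', r] at m2'
  have k3 : (Fintype.card κ : ℝ)⁻¹ * n < (Fintype.card κ : ℝ)⁻¹ * n' := by linarith
  have k4 := lt_of_mul_lt_mul_left k3 (inv_nonneg.2 (Nat.cast_nonneg _))
  exact le_of_lt (by exact_mod_cast k4)

/-- The algebra M_p of the left end acts on the range of the spectral projection of [0,r), so its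
rank is divisible by p. The algebra M_q of the right end acts on the complement, so this rank is
congruent to card κ modulo q. Coprimality combines the two. The conditions 0 < r ≤ 1 keep 0 inside
and 1 outside. The truncated subtraction is harmless, as divisibility of 0 is trivial. -/
theorem dvd_sub_of_trace_below (hcop : p.Coprime q) (hp : 0 < p) (hq : 0 < q) {κ : Type*} [Fintype κ]
    [DecidableEq κ] (E E' : fiberAlg p q →⋆ₐ[ℂ] Matrix κ κ ℂ) {r r' : ℝ} (hr : 0 < r) (hr1 : r ≤ 1)
    (hr' : 0 < r') (hr1' : r' ≤ 1) {n n' : ℕ} (hn : (E (ind p q (below r))).trace = n)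
    (hn' : (E' (ind p q (below r'))).trace = n') : p * q ∣ n - n' := by
  have key {E : fiberAlg p q →⋆ₐ[ℂ] Matrix κ κ ℂ} {r : ℝ} (hr : 0 < r) (hr1 : r ≤ 1) {n : ℕ}
      (hn : (E (ind p q (below r))).trace = n) : p ∣ n ∧ ∃ k, n + q * k = Fintype.card κ := by
    obtain ⟨k, hk⟩ := (Cell.zero hp).card_dvd_trace E (S := below r) (Cell.zero_fits hp
      fun h => absurd (show (1 : ℝ) < r from h) (not_lt.2 hr1))
    obtain ⟨k', hk'⟩ := (Cell.one hq).card_dvd_trace E (S := (below r)ᶜ) (Cell.one_fits hq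
      fun h => h (show (0 : ℝ) < r from hr))
    rw [show Fintype.card (Cell.zero hp : Cell p q).k = p from Fintype.card_fin p] at hk
    rw [show Fintype.card (Cell.one hq : Cell p q).k = q from Fintype.card_fin q] at hk'
    refine ⟨⟨k, ?_⟩, k', ?_⟩
    · rw [hk] at hn
      exact_mod_cast hn.symm
    · have e : (E (ind p q (below r))).trace + (E (ind p q (below r)ᶜ)).trace =
          Fintype.card κ := by
        rw [← Matrix.trace_add, ← map_add, ← ind_union disjoint_compl_right, Set.union_compl_self,
          ind_univ, map_one, Matrix.trace_one]
      rw [hn, hk'] at e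
      exact_mod_cast e
  obtain ⟨h1, k, h2⟩ := key hr hr1 hn
  obtain ⟨h1', k', h2'⟩ := key hr' hr1' hn'
  refine hcop.mul_dvd_of_dvd_of_dvd (Nat.dvd_sub h1 h1') ⟨k' - k, ?_⟩
  rw [Nat.mul_sub]
  omega

/-- A cut of prescribed trace. -/
theorem exists_cut (hcop : p.Coprime q) (hp : 0 < p) (hq : 0 < q) {κ : Type*} [Fintype κ]
    [DecidableEq κ] (E E' : fiberAlg p q →⋆ₐ[ℂ] Matrix κ κ ℂ) {m l : ℕ}
    (h1 : ∀ n n' : ℕ, (E' (ind p q (below (gridL m l)))).trace = n →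
      (E (ind p q (below (gridC m l)))).trace = n' → n ≤ n')
    (h2 : ∀ n n' : ℕ, (E (ind p q (below (gridC m l)))).trace = n →
      (E' (ind p q (below (gridR m l)))).trace = n' → n ≤ n') :
    ∃ e', IsCut E' (gridL m l) (gridR m l) e' ∧
      (E (ind p q (below (gridC m l)))).trace = e'.trace := by
  have lc := gridL_lt_gridC m l
  have cr := gridC_lt_gridR m l
  rcases Nat.eq_zero_or_pos l with rfl | hl
  · have h0 := gridR_zero m
    refine ⟨_, isCut_ind lc.le cr.le, ?_⟩
    rw [below_eq_empty (by linarith), ind_empty, map_zero, map_zero]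
  rcases lt_or_ge m l with hm | hm
  · have h0 := one_lt_gridL_of_lt hm
    refine ⟨_, isCut_ind lc.le cr.le, ?_⟩
    rw [below_eq_univ (by linarith), ind_univ, map_one, map_one]
  have hL := gridL_pos (m := m) hl
  have hR := gridR_lt_one hm
  obtain ⟨n, hn⟩ := (isStarProjection_ind E (below (gridC m l))).exists_trace_eq
  obtain ⟨a, ha⟩ := (isStarProjection_ind E' (below (gridL m l))).exists_trace_eq
  obtain ⟨b, hb⟩ := (isStarProjection_ind E' (below (gridR m l))).exists_trace_eq
  obtain ⟨k, hk⟩ := (isStarProjection_ind E' (slot (gridL m l) (gridR m l))).exists_trace_eq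
  have hab : a + k = b := by
    rw [ind_below_eq_add (lc.trans cr).le, map_add, Matrix.trace_add, ha, hk] at hb
    exact_mod_cast hb
  obtain ⟨d, hd⟩ := dvd_sub_of_trace_below hcop hp hq E E' (hL.trans lc) (by linarith) hL
    (by linarith) hn ha
  have han := h1 a n ha hn
  have hnb := h2 n b hn hb
  have hz := zero_notMem_band m l
  have ho := one_notMem_band m l
  have hcard : Fintype.card (Cell.mid hp hq : Cell p q).k = p * q :=
    (Fintype.card_prod (Fin p) (Fin q)).trans (by rw [Fintype.card_fin, Fintype.card_fin])
  have hu := (Cell.mid hp hq).isMatUnits E' (Cell.mid_fits hp hq hz ho)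
  have hs := (Cell.mid hp hq).sum_units E' (Cell.mid_fits hp hq hz ho)
  -- The missing trace n - a is pq · d with pq · d ≤ k, so it is supplied by a projection in the
  -- band that commutes with the pq × pq matrix units.
  obtain ⟨e, he, e1, e2, e3, e4⟩ := hu.exists_subprojection (Cell.mid hp hq).base (n := k) (d := d)
    (by rw [hs, hk]) (by rw [hcard]; omega)
  rw [hs] at e1 e2
  refine ⟨_, isCut_of_subprojection hp hq (lc.trans cr).le hz ho he e1 e2 e3, ?_⟩
  rw [Matrix.trace_add, e4, ha, hn, hcard, ← hd]
  push_cast [han]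
  ring

theorem exists_modulus {F : Set (dimensionDrop p q)} (hF : F.Finite) {η : ℝ} (hη : 0 < η) :
    ∃ δ > 0, ∀ f ∈ F, ∀ t t' : I, dist t t' ≤ δ → ‖eval t f - eval t' f‖ ≤ η := by
  induction F, hF using Set.Finite.induction_on with
  | empty => exact ⟨1, one_pos, fun f hf => absurd hf (Set.notMem_empty f)⟩
  | @insert a s _ _ ih =>
    obtain ⟨δ, hδ, h⟩ := ih
    have hu := CompactSpace.uniformContinuous_of_continuous (continuous_eval a)
    obtain ⟨δ', hδ', h'⟩ := Metric.uniformContinuous_iff.1 hu η hη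
    refine ⟨min δ (δ' / 2), by positivity, fun f hf t t' ht => ?_⟩
    rcases hf with rfl | hf
    · rw [← dist_eq_norm]
      exact (h' (ht.trans_lt ((min_le_right _ _).trans_lt (half_lt_self hδ')))).le
    · exact h f hf t t' (ht.trans (min_le_left _ _))

theorem exists_grid_modulus {F : Set (dimensionDrop p q)} (hF : F.Finite) {η : ℝ} (hη : 0 < η) :
    ∃ m, 1 ≤ m ∧ ∀ f ∈ F, ∀ t t', dist t t' ≤ 3 * gap m → ‖eval t f - eval t' f‖ ≤ η := by
  obtain ⟨δ, hδ, h⟩ := exists_modulus hF hη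
  obtain ⟨m, hm⟩ := exists_nat_gt (2 / δ)
  refine ⟨m + 1, by omega, fun f hf t t' ht => h f hf t t' (ht.trans ?_)⟩
  rw [div_lt_iff₀ hδ] at hm
  unfold gap
  rw [mul_div, div_le_iff₀ (by positivity)]
  push_cast
  nlinarith

/-- Representations of a dimension drop algebra whose traces are close to a given faithful tracial
state are approximately unitarily equivalent. -/
theorem exists_unitary_of_trace_close (hcop : p.Coprime q) (hp : 0 < p) (hq : 0 < q)
    {τ : TracialState (dimensionDrop p q)} (hτ : τ.Faithful) {F : Set (dimensionDrop p q)}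
    (hF : F.Finite) {ε : ℝ} (hε : 0 < ε) :
    ∃ δ > 0, ∃ H : Set C(I, ℝ), H.Finite ∧ ∀ (κ : Type) [Fintype κ] [DecidableEq κ]
      (Θ Θ' : dimensionDrop p q →⋆ₐ[ℂ] Matrix κ κ ℂ),
      (∀ h ∈ H, ‖ntr (Θ (central (complexify h))) - τ.toCLM (central (complexify h))‖ < δ) →
      (∀ h ∈ H, ‖ntr (Θ' (central (complexify h))) - τ.toCLM (central (complexify h))‖ < δ) →
      ∃ x ∈ unitary (Matrix κ κ ℂ), ∀ f ∈ F, ‖x * Θ f * star x - Θ' f‖ ≤ ε := by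
  obtain ⟨m, hm, hmod⟩ := exists_grid_modulus hF (show 0 < ε / 6 by positivity)
  choose δ hδ a b hab using fun l => exists_trace_below_le hp hq hτ (gridL_lt_gridC m l)
  choose δ' hδ' a' b' hab' using fun l => exists_trace_below_le hp hq hτ (gridC_lt_gridR m l)
  obtain ⟨d, hd, hdl⟩ : ∃ d > 0, ∀ l ∈ Finset.range (m + 1), d ≤ δ l ∧ d ≤ δ' l := by
    refine ⟨(Finset.range (m + 1)).inf' ⟨0, by simp⟩ fun l => min (δ l) (δ' l), ?_, fun l hl => ?_⟩
    · exact (Finset.lt_inf'_iff _).2 fun l _ => lt_min (hδ l) (hδ' l)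
    · exact le_min_iff.1 (Finset.inf'_le (fun l => min (δ l) (δ' l)) hl)
  refine ⟨d, hd, ⋃ l ∈ Finset.range (m + 1), {a l, b l, a' l, b' l},
    Set.Finite.biUnion (Finset.finite_toSet _) fun l _ => by simp, fun κ _ _ Θ Θ' h h' => ?_⟩
  obtain ⟨E, hE, hEn⟩ := exists_extension Θ
  obtain ⟨E', hE', hEn'⟩ := exists_extension Θ'
  -- For E the cuts are the spectral projections at the centres of the bands. Their ranks lie
  -- between those of E' at the two ends of the band, so E' has cuts of the same ranks. Beyond l = m
  -- all cuts are 1, so finitely many test functions suffice.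
  have hcut (l : ℕ) : ∃ e', IsCut E' (gridL m l) (gridR m l) e' ∧
      (E (ind p q (below (gridC m l)))).trace = e'.trace := by
    rcases Nat.lt_or_ge m l with hl | hl
    · have h0 := one_lt_gridL_of_lt hl
      have lc := gridL_lt_gridC m l
      have cr := gridC_lt_gridR m l
      refine ⟨_, isCut_ind lc.le cr.le, ?_⟩
      rw [below_eq_univ (by linarith), ind_univ, map_one, map_one]
    have hl' : l ∈ Finset.range (m + 1) := Finset.mem_range.2 (by omega)
    have mem {x : C(I, ℝ)} (hx : x ∈ ({a l, b l, a' l, b' l} : Set C(I, ℝ))) :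
        x ∈ ⋃ l ∈ Finset.range (m + 1), ({a l, b l, a' l, b' l} : Set C(I, ℝ)) :=
      Set.mem_biUnion hl' hx
    refine exists_cut hcop hp hq E E' (fun n n' => hab l κ E' E ?_ ?_ n n')
      (fun n n' => hab' l κ E E' ?_ ?_ n n')
    · rw [hE']
      exact (h' _ (mem (by simp))).trans_le (hdl l hl').1
    · rw [hE]
      exact (h _ (mem (by simp))).trans_le (hdl l hl').1
    · rw [hE]
      exact (h _ (mem (by simp))).trans_le (hdl l hl').2
    · rw [hE']
      exact (h' _ (mem (by simp))).trans_le (hdl l hl').2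
  choose e' he' htr using hcut
  obtain ⟨x, hx, hxf⟩ := exists_unitary_of_cuts hp hq hm hEn hEn'
    (fun l => isCut_ind (gridL_lt_gridC m l).le (gridC_lt_gridR m l).le) he' htr
  refine ⟨x, hx, fun f hf => ?_⟩
  rw [← hE, ← hE']
  exact (hxf (toFiber f) (ε / 6) (hmod f hf)).trans (by linarith)

end trace

/-! ### Cuts that almost follow a unitary -/

section Matrix
variable {κ : Type*} [Fintype κ] [DecidableEq κ]

theorem norm_mul_le_of_le_one {M N : Matrix κ κ ℂ} {a : ℝ} (hM : ‖M‖ ≤ 1) (hN : ‖N‖ ≤ a) :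
    ‖M * N‖ ≤ a :=
  (norm_mul_le _ _).trans <| (mul_le_mul hM hN (norm_nonneg _) zero_le_one).trans (one_mul a).le

theorem norm_mul_le_of_le_one' {M N : Matrix κ κ ℂ} {a : ℝ} (hM : ‖M‖ ≤ a) (hN : ‖N‖ ≤ 1) :
    ‖M * N‖ ≤ a :=
  (norm_mul_le _ _).trans <| (mul_le_mul hM hN (norm_nonneg _) ((norm_nonneg _).trans hM)).trans
    (mul_one a).le

theorem norm_unitary_le {y : Matrix κ κ ℂ} (hy : y ∈ unitary (Matrix κ κ ℂ)) : ‖y‖ ≤ 1 := by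
  rw [← mul_one y, CStarRing.norm_mem_unitary_mul _ hy]
  exact IsStarProjection.norm_le _ ⟨one_mul 1, star_one _⟩

theorem norm_star_commutator {y : Matrix κ κ ℂ} (hy : y ∈ unitary (Matrix κ κ ℂ))
    (w : Matrix κ κ ℂ) : ‖star y * w - w * star y‖ = ‖y * w - w * y‖ := by
  have h := Unitary.mem_iff.1 hy
  have : star y * w - w * star y = -(star y * (y * w - w * y) * star y) := by
    calc star y * w - w * star y
        = star y * w * (y * star y) - (star y * y) * w * star y := by rw [h.1, h.2]; noncomm_ring
      _ = _ := by noncomm_ring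
  rw [this, norm_neg, CStarRing.norm_mul_mem_unitary _ (Unitary.star_mem hy),
    CStarRing.norm_mem_unitary_mul _ (Unitary.star_mem hy)]

theorem norm_conj_mul_sub_le {y e h : Matrix κ κ ℂ} (hy : y ∈ unitary (Matrix κ κ ℂ))
    (he : ‖e‖ ≤ 1) {δ : ℝ} (hd : ‖y * h - h * y‖ ≤ δ) :
    ‖y * e * star y * h - y * (e * h) * star y‖ ≤ δ := by
  have : y * e * star y * h - y * (e * h) * star y = (y * e) * (star y * h - h * star y) := by
    noncomm_ring
  rw [this]
  refine norm_mul_le_of_le_one (norm_mul_le_of_le_one (norm_unitary_le hy) he) ?_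
  rwa [norm_star_commutator hy]

theorem norm_conj_sub_le {y h : Matrix κ κ ℂ} (hy : y ∈ unitary (Matrix κ κ ℂ)) {δ : ℝ}
    (hd : ‖y * h - h * y‖ ≤ δ) : ‖y * h * star y - h‖ ≤ δ := by
  have : y * h * star y - h = (y * h - h * y) * star y := by
    rw [sub_mul, mul_assoc h, (Unitary.mem_iff.1 hy).2, mul_one]
  rwa [this, CStarRing.norm_mul_mem_unitary _ (Unitary.star_mem hy)]

/-- A conjugate of a projection between `P` and `P + ∑ G a a` by a unitary that almost commutes with
enough elements is close to a projection of the form `P + e'`, where `e'` commutes with `G`. -/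
theorem exists_projection_near_conj {k : Type*} [Fintype k] {G : k → k → Matrix κ κ ℂ}
    (hG : IsMatUnits G) (i₀ : k) {P e h h' y : Matrix κ κ ℂ} {b : k → Matrix κ κ ℂ} {δ : ℝ}
    (hP : IsStarProjection P) (he : IsStarProjection e) (hy : y ∈ unitary (Matrix κ κ ℂ))
    (hPB : IsStarProjection (P + ∑ a, G a a)) (hPB0 : P * ∑ a, G a a = 0) (hhP : h * P = P)
    (heh : e * h = h) (heh' : e * h' = e) (hhQ : h' * (P + ∑ a, G a a) = h') (hbG : ∀ i, b i * ∑ a, G a a = G i₀ i)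
    (hGb : ∀ i, (∑ a, G a a) * b i = G i₀ i) (hbe : ∀ i, Commute e (b i))
    (h1 : ‖y * h - h * y‖ ≤ δ) (h2 : ‖y * h' - h' * y‖ ≤ δ)
    (h3 : ∀ i, ‖y * b i - b i * y‖ ≤ δ) (hδ : (10 + 2 * Fintype.card k) * δ ≤ 1) :
    ∃ e', IsStarProjection e' ∧ (∑ a, G a a) * e' = e' ∧ e' * (∑ a, G a a) = e' ∧
      (∀ i j, Commute (G i j) e') ∧
      ‖P + e' - y * e * star y‖ ≤ 21 * ((10 + 2 * Fintype.card k) * δ) := by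
  obtain ⟨B, hB⟩ : ∃ B, B = ∑ a, G a a := ⟨_, rfl⟩
  obtain ⟨g, hg⟩ : ∃ g, g = y * e * star y := ⟨_, rfl⟩
  obtain ⟨Q, hQ⟩ : ∃ Q, Q = P + B := ⟨_, rfl⟩
  have hgp : IsStarProjection g := hg ▸ he.conj hy
  have hBp : IsStarProjection B := hB ▸ hG.isStarProjection_unit
  rw [← hB] at hPB hPB0 hhQ hbG hGb ⊢
  rw [← hQ] at hPB hhQ
  rw [← hg]
  have hδ0 : 0 ≤ δ := (norm_nonneg _).trans h1
  have nP := hP.norm_le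
  have nQ := hPB.norm_le
  have nB := hBp.norm_le
  have ng := hgp.norm_le
  -- Since e h = h and y almost commutes with h, the conjugate g almost fixes h, hence also P = h P.
  -- In the same way h', which fixes e from the right, places g almost under Q.
  have gP : ‖g * P - P‖ ≤ 2 * δ := by
    have e1 : g * P - P = ((g * h - y * (e * h) * star y) + (y * h * star y - h)) * P := by
      rw [heh, sub_add_sub_cancel, sub_mul, mul_assoc, hhP]
    rw [e1]
    refine norm_mul_le_of_le_one' ((norm_add_le _ _).trans ?_) nP
    have := norm_conj_mul_sub_le hy he.norm_le h1
    rw [← hg] at this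
    linarith [norm_conj_sub_le hy h1]
  have Pg : ‖P * g - P‖ ≤ 2 * δ := by
    rw [← norm_star, star_sub, star_mul, hgp.isSelfAdjoint.star_eq, hP.isSelfAdjoint.star_eq]
    exact gP
  have gh : ‖g * h' - g‖ ≤ δ := by
    have := norm_conj_mul_sub_le hy he.norm_le h2
    rwa [heh', ← hg] at this
  have gQ : ‖g * Q - g‖ ≤ 2 * δ := by
    have e1 : g * Q - g = (g * h' - g) - (g * h' - g) * Q := by
      rw [sub_mul, mul_assoc, hhQ]
      abel
    rw [e1]
    have := norm_mul_le_of_le_one' gh nQ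
    linarith [norm_sub_le (g * h' - g) ((g * h' - g) * Q)]
  have Qg : ‖Q * g - g‖ ≤ 2 * δ := by
    rw [← norm_star, star_sub, star_mul, hgp.isSelfAdjoint.star_eq, hPB.isSelfAdjoint.star_eq]
    exact gQ
  have PP : P * P = P := hP.isIdempotentElem
  have gg : g * g = g := hgp.isIdempotentElem
  have PQ : P * Q = P := by rw [hQ, mul_add, PP, hPB0, add_zero]
  have QP : Q * P = P := by
    have := congrArg star PQ
    rwa [star_mul, hPB.isSelfAdjoint.star_eq, hP.isSelfAdjoint.star_eq] at this
  -- As g almost lies between P and Q = P + B, its compression to B is almost g - P.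
  have hBgB : ‖B * g * B - (g - P)‖ ≤ 10 * δ := by
    have e1 : B * g * B - (g - P) = (Q * (g * Q - g) + (Q * g - g)) - (P * g - P) * Q -
        Q * (g * P - P) + (P * g - P) * P := by
      rw [show B = Q - P by rw [hQ, add_sub_cancel_left]]
      have a1 : Q * (g * P - P) = Q * g * P - P := by rw [mul_sub, QP, mul_assoc]
      have a2 : (P * g - P) * Q = P * g * Q - P := by rw [sub_mul, PQ]
      have a3 : (P * g - P) * P = P * g * P - P := by rw [sub_mul, PP]
      rw [a1, a2, a3]
      noncomm_ring
    rw [e1]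
    have b1 := norm_mul_le_of_le_one nQ gQ
    have b2 := norm_mul_le_of_le_one' Pg nQ
    have b3 := norm_mul_le_of_le_one nQ gP
    have b4 := norm_mul_le_of_le_one' Pg nP
    refine (norm_add_le _ _).trans ?_
    have c1 := norm_sub_le (Q * (g * Q - g) + (Q * g - g) - (P * g - P) * Q) (Q * (g * P - P))
    have c2 := norm_sub_le (Q * (g * Q - g) + (Q * g - g)) ((P * g - P) * Q)
    have c3 := norm_add_le (Q * (g * Q - g)) (Q * g - g)
    linarith
  have hbg (i) : ‖g * b i - b i * g‖ ≤ 2 * δ := by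
    have e1 : g * b i - b i * g = (g * b i - y * (e * b i) * star y) +
        (y * (b i * e) * star y - b i * (y * e * star y)) := by
      rw [(hbe i).eq, ← hg, sub_add_sub_cancel]
    have e2 : y * (b i * e) * star y - b i * (y * e * star y) =
        (y * b i - b i * y) * (e * star y) := by noncomm_ring
    have b1 := norm_conj_mul_sub_le hy he.norm_le (h3 i)
    rw [← hg] at b1
    have b2 : ‖(y * b i - b i * y) * (e * star y)‖ ≤ δ := norm_mul_le_of_le_one' (h3 i)
      (norm_mul_le_of_le_one he.norm_le (norm_unitary_le (Unitary.star_mem hy)))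
    rw [e1, e2]
    exact (norm_add_le _ _).trans (by linarith)
  -- Averaging moves g into the commutant of G. It changes the compression only a little because g
  -- almost commutes with the elements b i, which restrict to the matrix units.
  obtain ⟨w, hw⟩ : ∃ w, w = IsMatUnits.avg G i₀ g := ⟨_, rfl⟩
  have hwsa : IsSelfAdjoint w := by
    rw [IsSelfAdjoint, hw, hG.star_avg, hgp.isSelfAdjoint.star_eq]
  have hwB : ‖w - B * g * B‖ ≤ Fintype.card k * (2 * δ) := by
    have := hG.norm_avg_sub_le i₀ g (η := 2 * δ) fun i => by
      rw [← hB]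
      have e1 : B * g * G i₀ i - G i₀ i * g * B = B * (g * b i - b i * g) * B := by
        have a1 : B * g * G i₀ i = B * g * (b i * B) := by rw [hbG]
        have a2 : G i₀ i * g * B = (B * b i) * g * B := by rw [hGb]
        rw [a1, a2]
        noncomm_ring
      rw [e1]
      exact norm_mul_le_of_le_one' (norm_mul_le_of_le_one nB (hbg i)) nB
    rwa [← hB, ← hw] at this
  -- 10δ comes from the compression and 2 card k · δ from averaging. Then w is a projection up to
  -- 10η, so a genuine projection lies within 20η of it; with the distance η from w to g - P this
  -- makes 21η.
  obtain ⟨η, hη⟩ : ∃ η, η = (10 + 2 * Fintype.card k) * δ := ⟨_, rfl⟩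
  have hη0 : 0 ≤ η := by rw [hη]; positivity
  rw [← hη] at hδ ⊢
  have hwd : ‖w - (g - P)‖ ≤ η := by
    calc ‖w - (g - P)‖ = ‖(w - B * g * B) + (B * g * B - (g - P))‖ := by rw [sub_add_sub_cancel]
      _ ≤ Fintype.card k * (2 * δ) + 10 * δ := (norm_add_le _ _).trans (add_le_add hwB hBgB)
      _ = η := by rw [hη]; ring
  obtain ⟨d, hd⟩ : ∃ d, d = g - P := ⟨_, rfl⟩
  rw [← hd] at hwd
  have nd : ‖d‖ ≤ 2 := by
    rw [hd]
    linarith [norm_sub_le g P]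
  have nw : ‖w‖ ≤ 3 := by
    have := norm_add_le (w - d) d
    rw [sub_add_cancel] at this
    linarith
  have hdd : ‖d * d - d‖ ≤ 4 * δ := by
    have e1 : d * d - d = -(g * P - P) - (P * g - P) := by
      rw [hd, sub_mul, mul_sub, mul_sub, gg, PP]
      abel
    rw [e1]
    have := norm_sub_le (-(g * P - P)) (P * g - P)
    rw [norm_neg] at this
    linarith
  have h4 : 4 * δ ≤ η := by
    rw [hη]
    have : (0 : ℝ) ≤ Fintype.card k := Nat.cast_nonneg _
    nlinarith
  have hww : ‖w * w - w‖ ≤ 10 * η := by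
    have e1 : w * w - w = w * (w - d) + (w - d) * d + (d * d - d) - (w - d) := by noncomm_ring
    have b1 : ‖w * (w - d)‖ ≤ 3 * η :=
      (norm_mul_le _ _).trans (mul_le_mul nw hwd (norm_nonneg _) (by norm_num))
    have b2 : ‖(w - d) * d‖ ≤ η * 2 :=
      (norm_mul_le _ _).trans (mul_le_mul hwd nd (norm_nonneg _) hη0)
    rw [e1]
    have c1 := norm_sub_le (w * (w - d) + (w - d) * d + (d * d - d)) (w - d)
    have c2 := norm_add_le (w * (w - d) + (w - d) * d) (d * d - d)
    have c3 := norm_add_le (w * (w - d)) ((w - d) * d)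
    linarith
  obtain ⟨e', he', hn, hc, c, hc1, hc2⟩ := exists_isStarProjection_near hwsa hww
  have hBw : B * w = w := by rw [hw, hB, hG.unit_mul_avg]
  have hwB' : w * B = w := by rw [hw, hB, hG.avg_mul_unit]
  refine ⟨e', he', ?_, ?_, fun i j => (hc _ ?_).symm, ?_⟩
  · rw [hc2, ← mul_assoc, hBw]
  · rw [hc1, mul_assoc, hwB']
  · rw [hw]
    exact (hG.commute_avg i₀ g i j).symm
  · have e1 : P + e' - g = (e' - w) + (w - d) := by rw [hd]; abel
    rw [e1]
    exact (norm_add_le _ _).trans (by linarith)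

end Matrix

open dimensionDrop

section AlmostCommutes
variable {p q : ℕ}

/-- The matrix `y` commutes up to `δ` with the image of the elements of `F`. -/
def AlmostCommutes {κ : Type*} [Fintype κ] [DecidableEq κ] (E : fiberAlg p q →⋆ₐ[ℂ] Matrix κ κ ℂ)
    (F : Set (dimensionDrop p q)) (δ : ℝ) (y : Matrix κ κ ℂ) : Prop :=
  ∀ f ∈ F, ‖y * E (toFiber f) - E (toFiber f) * y‖ ≤ δ

theorem fcentral_mul_ind_of_eq_one {g : I → ℂ} {S : Set I} (h : ∀ t ∈ S, g t = 1) :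
    fcentral p q g * ind p q S = ind p q S := by
  rw [ind, ← map_mul]
  congr 1
  funext t
  classical
  by_cases ht : t ∈ S
  · rw [Pi.mul_apply, h t ht, one_mul]
  · rw [Pi.mul_apply, Set.indicator_of_notMem ht, mul_zero]

theorem fcentral_mul_ind_of_eq_zero {g : I → ℂ} {S : Set I} (h : ∀ t, t ∉ S → g t = 0) :
    fcentral p q g * ind p q S = fcentral p q g := by
  rw [ind, ← map_mul]
  congr 1
  funext t
  classical
  by_cases ht : t ∈ S
  · rw [Pi.mul_apply, Set.indicator_of_mem ht, Pi.one_apply, mul_one]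
  · rw [Pi.mul_apply, h t ht, zero_mul]

/-- Almost commutation is assumed only for continuous elements, so `exists_projection_near_conj` is
fed with continuous stand-ins: ramps over the two halves of the band, which sandwich the spectral
projection at its centre, and functions that equal the first row of matrix units on the band and
vanish at 0 and 1. -/
theorem exists_near_cut (hp : 0 < p) (hq : 0 < q) {m l : ℕ} (hl : 1 ≤ l) (hlm : l ≤ m) :
    ∃ F : Set (dimensionDrop p q), F.Finite ∧ ∀ (κ : Type) [Fintype κ] [DecidableEq κ]
      (E : fiberAlg p q →⋆ₐ[ℂ] Matrix κ κ ℂ) (y : Matrix κ κ ℂ) (δ : ℝ),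
      y ∈ unitary (Matrix κ κ ℂ) → AlmostCommutes E F δ y → (10 + 2 * (p * q)) * δ ≤ 1 →
      ∃ e', IsCut E (gridL m l) (gridR m l) e' ∧
        ‖e' - y * E (ind p q (below (gridC m l))) * star y‖ ≤ 21 * ((10 + 2 * (p * q)) * δ) := by
  have lc := gridL_lt_gridC m l
  have cr := gridC_lt_gridR m l
  have hL := gridL_pos (m := m) hl
  have hR := gridR_lt_one hlm
  have hz := zero_notMem_band m l
  have ho := one_notMem_band m l
  obtain ⟨β, hβ0, hβ1, hβ⟩ : ∃ β : C(I, ℂ), β 0 = 0 ∧ β 1 = 0 ∧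
      ∀ t ∈ slot (gridL m l) (gridR m l), β t = 1 := by
    refine ⟨complexify (rampDown (gridR m l) 1 * (1 - rampDown 0 (gridL m l))), ?_, ?_,
      fun t ht => ?_⟩ <;> rw [complexify_apply, ContinuousMap.mul_apply, ContinuousMap.sub_apply,
        ContinuousMap.one_apply]
    · rw [rampDown_eq_one hL (t := 0) le_rfl, sub_self, mul_zero, Complex.ofReal_zero]
    · rw [rampDown_eq_zero hR (t := 1) le_rfl, zero_mul, Complex.ofReal_zero]
    · rw [rampDown_eq_one hR ht.2.le, rampDown_eq_zero hL ht.1, sub_zero, one_mul,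
        Complex.ofReal_one]
  obtain ⟨b, hb⟩ : ∃ b : Fin p × Fin q → dimensionDrop p q, ∀ i t,
      eval t (b i) = β t • Matrix.single (⟨0, hp⟩, ⟨0, hq⟩) i 1 :=
    ⟨fun i => bump β (Matrix.single (⟨0, hp⟩, ⟨0, hq⟩) i 1)
      ⟨0, by rw [hβ0, zero_smul, Matrix.zero_kronecker]⟩
      ⟨0, by rw [hβ1, zero_smul, Matrix.kronecker_zero]⟩, fun i t => rfl⟩
  refine ⟨{central (complexify (rampDown (gridL m l) (gridC m l))),
    central (complexify (rampDown (gridC m l) (gridR m l)))} ∪ Set.range b,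
    (Set.toFinite _).union (Set.finite_range b), fun κ _ _ E y δ hy hF hδ => ?_⟩
  obtain ⟨G, hG⟩ : ∃ G, G = (Cell.mid hp hq).units E (Cell.mid_fits hp hq hz ho) := ⟨_, rfl⟩
  have hu : IsMatUnits G := hG ▸ (Cell.mid hp hq).isMatUnits E (Cell.mid_fits hp hq hz ho)
  have hs : ∑ a, G a a = E (ind p q (slot (gridL m l) (gridR m l))) :=
    hG ▸ (Cell.mid hp hq).sum_units E (Cell.mid_fits hp hq hz ho)
  have hPB : E (ind p q (below (gridL m l))) + ∑ a, G a a = E (ind p q (below (gridR m l))) := by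
    rw [hs, ← map_add, ← ind_below_eq_add (lc.trans cr).le]
  have hcard : Fintype.card (Cell.mid hp hq : Cell p q).k = p * q :=
    (Fintype.card_prod (Fin p) (Fin q)).trans (by rw [Fintype.card_fin, Fintype.card_fin])
  have hbB (i : Fin p × Fin q) : E (toFiber (b i)) * ∑ a, G a a = G (⟨0, hp⟩, ⟨0, hq⟩) i := by
    rw [hs, ← map_mul, hG]
    refine congrArg E (fiberAlg_ext fun t => ?_)
    change eval t (b i) * (ind p q _).1 t = _
    by_cases ht : t ∈ slot (gridL m l) (gridR m l)
    · rw [ind_mem ht, mul_one, hb, hβ t ht, one_smul]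
      exact ((Cell.mid hp hq).elt_mem (Cell.mid_fits hp hq hz ho) _ ht).symm
    · rw [ind_notMem ht, mul_zero]
      exact ((Cell.mid hp hq).elt_notMem (Cell.mid_fits hp hq hz ho) _ ht).symm
  have hmul (g : C(I, ℝ)) (S : Set I) : E (ind p q S) * E (toFiber (central (complexify g))) =
      E (fcentral p q (fun t => (g t : ℂ)) * ind p q S) := by
    rw [(commute_map_ind E S _).eq, ← map_mul, toFiber_central]
  obtain ⟨e', h1, h2, h3, h4, h5⟩ := exists_projection_near_conj hu (⟨0, hp⟩, ⟨0, hq⟩)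
    (P := E (ind p q (below (gridL m l)))) (e := E (ind p q (below (gridC m l))))
    (h := E (toFiber (central (complexify (rampDown (gridL m l) (gridC m l))))))
    (h' := E (toFiber (central (complexify (rampDown (gridC m l) (gridR m l))))))
    (y := y) (b := fun i => E (toFiber (b i))) (δ := δ)
    (isStarProjection_ind E _) (isStarProjection_ind E _) hy (hPB ▸ isStarProjection_ind E _)
    (by rw [hs, ← map_mul, ind_mul_ind, (disjoint_below_slot _ _).inter_eq, ind_empty, map_zero])
    (by
      rw [← map_mul, toFiber_central, fcentral_mul_ind_of_eq_one fun t ht => ?_]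
      rw [rampDown_eq_one lc (le_of_lt ht), Complex.ofReal_one])
    (by
      rw [hmul, fcentral_mul_ind_of_eq_zero fun t ht => ?_, toFiber_central]
      rw [rampDown_eq_zero lc (not_lt.1 ht), Complex.ofReal_zero])
    (by
      rw [hmul, fcentral_mul_ind_of_eq_one fun t ht => ?_]
      rw [rampDown_eq_one cr (le_of_lt ht), Complex.ofReal_one])
    (by
      rw [hPB, ← map_mul, toFiber_central, fcentral_mul_ind_of_eq_zero fun t ht => ?_]
      rw [rampDown_eq_zero cr (not_lt.1 ht), Complex.ofReal_zero])
    hbB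
    (fun i => by rw [← hbB i, hs]; exact (commute_map_ind E _ _).eq)
    (fun i => commute_map_ind E _ _)
    (hF _ (Or.inl (Or.inl rfl))) (hF _ (Or.inl (Or.inr rfl))) (fun i => hF _ (Or.inr ⟨i, rfl⟩))
    (by rw [hcard]; push_cast; exact hδ)
  rw [hs] at h2 h3
  rw [hcard] at h5
  push_cast at h5
  exact ⟨_, isCut_of_subprojection hp hq (lc.trans cr).le hz ho h1 h2 h3
    (fun i j => by rw [← hG]; exact h4 i j), h5⟩

/-- A family of cuts that almost follows a unitary. -/
theorem exists_near_cuts (hp : 0 < p) (hq : 0 < q) (m : ℕ) {η : ℝ} (hη : 0 < η) :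
    ∃ δ > 0, ∃ F : Set (dimensionDrop p q), F.Finite ∧ ∀ (κ : Type) [Fintype κ] [DecidableEq κ]
      (E : fiberAlg p q →⋆ₐ[ℂ] Matrix κ κ ℂ) (y : Matrix κ κ ℂ), y ∈ unitary (Matrix κ κ ℂ) →
      AlmostCommutes E F δ y → ∃ e' : ℕ → Matrix κ κ ℂ,
        (∀ l, IsCut E (gridL m l) (gridR m l) (e' l)) ∧
        ∀ l, ‖e' l - y * E (ind p q (below (gridC m l))) * star y‖ ≤ η := by
  choose F hF hF' using fun l : Finset.Icc 1 m => exists_near_cut hp hq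
    (Finset.mem_Icc.1 l.2).1 (Finset.mem_Icc.1 l.2).2
  have hK : 0 < (10 + 2 * (p * q) : ℝ) := by positivity
  refine ⟨min 1 (η / 21) / (10 + 2 * (p * q)), by positivity, ⋃ l, F l,
    Set.finite_iUnion hF, fun κ _ _ E y hy h => ?_⟩
  have key (l : ℕ) : ∃ e', IsCut E (gridL m l) (gridR m l) e' ∧
      ‖e' - y * E (ind p q (below (gridC m l))) * star y‖ ≤ η := by
    have lc := gridL_lt_gridC m l
    have cr := gridC_lt_gridR m l
    rcases Nat.eq_zero_or_pos l with rfl | hl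
    · have h0 := gridR_zero m
      refine ⟨_, isCut_ind lc.le cr.le, ?_⟩
      rw [below_eq_empty (by linarith), ind_empty, map_zero, mul_zero, zero_mul, sub_zero, norm_zero]
      exact hη.le
    rcases lt_or_ge m l with hm | hm
    · have h0 := one_lt_gridL_of_lt hm
      refine ⟨_, isCut_ind lc.le cr.le, ?_⟩
      rw [below_eq_univ (by linarith), ind_univ, map_one, mul_one, (Unitary.mem_iff.1 hy).2,
        sub_self, norm_zero]
      exact hη.le
    obtain ⟨e', h1, h2⟩ := hF' ⟨l, Finset.mem_Icc.2 ⟨hl, hm⟩⟩ κ E y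
      (min 1 (η / 21) / (10 + 2 * (p * q))) hy (fun f hf => h f (Set.mem_iUnion.2 ⟨_, hf⟩))
      (by rw [mul_div_cancel₀ _ hK.ne']; exact min_le_left _ _)
    refine ⟨e', h1, h2.trans ?_⟩
    rw [mul_div_cancel₀ _ hK.ne']
    linarith [min_le_right 1 (η / 21)]
  choose e' he' hn using key
  exact ⟨e', he', hn⟩

end AlmostCommutes

open dimensionDrop

/-! ### Unitaries that move cuts -/

section Matrix
variable {κ : Type*} [Fintype κ] [DecidableEq κ]

theorem IsDecomp.of_ortho {ι : Type*} [Fintype ι] {q : ι → Matrix κ κ ℂ}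
    (hp : ∀ l, IsStarProjection (q l)) (ho : ∀ l l', l ≠ l' → q l * q l' = 0) :
    IsDecomp fun o : Option ι => o.elim (1 - ∑ l, q l) q := by
  classical
  have e1 (l) : (∑ a, q a) * q l = q l := by
    rw [Finset.sum_mul, Finset.sum_eq_single l]
    · exact (hp l).isIdempotentElem
    · exact fun b _ hb => ho b l hb
    · exact fun h => absurd (Finset.mem_univ _) h
  have e2 (l) : q l * (∑ a, q a) = q l := by
    rw [Finset.mul_sum, Finset.sum_eq_single l]
    · exact (hp l).isIdempotentElem
    · exact fun b _ hb => ho l b hb.symm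
    · exact fun h => absurd (Finset.mem_univ _) h
  have hs : IsStarProjection (∑ a, q a) := by
    refine ⟨?_, ?_⟩
    · rw [IsIdempotentElem, Finset.mul_sum]
      exact Finset.sum_congr rfl fun i _ => e1 i
    · rw [IsSelfAdjoint, star_sum]
      exact Finset.sum_congr rfl fun i _ => (hp i).isSelfAdjoint
  refine ⟨?_, ?_, ?_⟩
  · rintro (_ | l)
    · exact hs.one_sub
    · exact hp l
  · rintro (_ | l) (_ | l') h
    · exact absurd rfl h
    · change (1 - ∑ a, q a) * q l' = 0
      rw [sub_mul, one_mul, e1, sub_self]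
    · change q l * (1 - ∑ a, q a) = 0
      rw [mul_sub, mul_one, e2, sub_self]
    · exact ho l l' fun h' => h (congrArg some h')
  · rw [Fintype.sum_option]
    exact sub_add_cancel _ _

/-- One partial isometry in the commutant of G carries r to r', another carries the complement of r
in the unit of G to that of r'. Both exist by equality of traces, and their sum moves r to r' while
being unitary on the unit of G. -/
theorem IsMatUnits.exists_intertwiner_pair {k : Type*} [Fintype k] {G : k → k → Matrix κ κ ℂ}
    (hG : IsMatUnits G) (i₀ : k) {r r' : Matrix κ κ ℂ} (hr : IsStarProjection r)
    (hr' : IsStarProjection r') (hB : (∑ a, G a a) * r = r) (hB' : (∑ a, G a a) * r' = r')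
    (hc : ∀ i j, Commute (G i j) r) (hc' : ∀ i j, Commute (G i j) r') (htr : r.trace = r'.trace) :
    ∃ w, star w * w = ∑ a, G a a ∧ w * star w = ∑ a, G a a ∧ (∀ i j, Commute (G i j) w) ∧
      w * r = r' * w := by
  obtain ⟨B, hBd⟩ : ∃ B, B = ∑ a, G a a := ⟨_, rfl⟩
  have hBp : IsStarProjection B := hBd ▸ hG.isStarProjection_unit
  have hcB {z : Matrix κ κ ℂ} (h : ∀ i j, Commute (G i j) z) : Commute B z :=
    hBd ▸ Commute.sum_left _ _ _ fun i _ => h i i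
  rw [← hBd] at hB hB' ⊢
  have comp {z : Matrix κ κ ℂ} (hz : IsStarProjection z) (h : ∀ i j, Commute (G i j) z)
      (hb : B * z = z) : IsStarProjection (B - z) ∧ (∀ i j, Commute (G i j) (B - z)) ∧
        B * (B - z) = B - z ∧ z * (B - z) = 0 ∧ (B - z) * z = 0 := by
    have hb' : z * B = z := by rw [← (hcB h).eq, hb]
    have zz := hz.isIdempotentElem.eq
    have bb := hBp.isIdempotentElem.eq
    refine ⟨⟨?_, ?_⟩, fun i j => Commute.sub_right ?_ (h i j), ?_, ?_, ?_⟩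
    · rw [IsIdempotentElem, sub_mul, mul_sub, mul_sub, bb, hb, hb', zz]
      abel
    · rw [IsSelfAdjoint, star_sub, hBp.isSelfAdjoint.star_eq, hz.isSelfAdjoint.star_eq]
    · rw [commute_iff_eq, hBd, hG.mul_unit, hG.unit_mul]
    · rw [mul_sub, bb, hb]
    · rw [mul_sub, hb', zz, sub_self]
    · rw [sub_mul, hb, zz, sub_self]
  obtain ⟨c1, c2, c3, c4, c5⟩ := comp hr hc hB
  obtain ⟨d1, d2, d3, d4, d5⟩ := comp hr' hc' hB'
  have part {z z' : Matrix κ κ ℂ} (hz : IsStarProjection z) (hz' : IsStarProjection z')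
      (h : ∀ i j, Commute (G i j) z) (h' : ∀ i j, Commute (G i j) z') (hb : B * z = z)
      (hb' : B * z' = z') (ht : z.trace = z'.trace) :
      ∃ v, star v * v = z ∧ v * star v = z' ∧ (∀ i j, Commute (G i j) v) ∧ v * z = v ∧
        z' * v = v := by
    have s1 : ∑ a, G a a * z = z := by rw [← Finset.sum_mul, ← hBd, hb]
    have s2 : ∑ a, G a a * z' = z' := by rw [← Finset.sum_mul, ← hBd, hb']
    obtain ⟨v, v1, v2, v3⟩ := (hG.mul_proj hz h).exists_intertwiner (hG.mul_proj hz' h') i₀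
      (by rw [s1, s2, ht])
    rw [s1] at v1
    rw [s2] at v2
    have v4 : v * z = v := IsDecomp.mul_right_of_star_mul hz v1
    have v5 : z' * v = v := by
      have : star v * z' = star v := IsDecomp.mul_right_of_star_mul hz' (by rw [star_star, v2])
      rw [← star_star (z' * v), star_mul, hz'.isSelfAdjoint.star_eq, this, star_star]
    refine ⟨v, v1, v2, fun i j => ?_, v4, v5⟩
    have := v3 i j
    rw [(h i j).eq, ← mul_assoc, v4, mul_assoc, v5] at this
    exact this.symm
  obtain ⟨v, v1, v2, v3, v4, v5⟩ := part hr hr' hc hc' hB hB' htr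
  obtain ⟨u, u1, u2, u3, u4, u5⟩ := part c1 d1 c2 d2 c3 d3 (by rw [Matrix.trace_sub,
    Matrix.trace_sub, htr])
  have vu : star v * u = 0 := by
    rw [← v5, ← u5, star_mul, hr'.isSelfAdjoint.star_eq, mul_assoc, ← mul_assoc r', d4, zero_mul,
      mul_zero]
  have uv : star u * v = 0 := by
    have := congrArg star vu
    rwa [star_mul, star_star, star_zero] at this
  have vu' : v * star u = 0 := by
    rw [← v4, ← u4, star_mul, c1.isSelfAdjoint.star_eq, mul_assoc, ← mul_assoc r, c4, zero_mul,
      mul_zero]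
  have uv' : u * star v = 0 := by
    have := congrArg star vu'
    rwa [star_mul, star_star, star_zero] at this
  refine ⟨v + u, ?_, ?_, fun i j => (v3 i j).add_right (u3 i j), ?_⟩
  · rw [star_add, add_mul, mul_add, mul_add, v1, u1, vu, uv]
    abel
  · rw [star_add, add_mul, mul_add, mul_add, v2, u2, vu', uv']
    abel
  · have w1 : u * r = 0 := by rw [← u4, mul_assoc, c5, mul_zero]
    have w2 : r' * u = 0 := by rw [← u5, ← mul_assoc, d4, zero_mul]
    rw [add_mul, mul_add, v4, v5, w1, w2]

end Matrix

theorem gridL_mono {m l l' : ℕ} (h : l ≤ l') : gridL m l ≤ gridL m l' := by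
  have : (l : ℝ) ≤ l' := by exact_mod_cast h
  exact mul_le_mul_of_nonneg_right (by linarith) (gap_pos m).le

theorem gridR_le_gridL_of_lt {m l l' : ℕ} (h : l < l') : gridR m l ≤ gridL m l' :=
  (gridR_le_gridL m l).trans (gridL_mono h)

/-- The elements of `fiberAlg` that are constant on the bands. -/
def BandConst (p q m : ℕ) (f : fiberAlg p q) : Prop :=
  ∀ l, ∀ t ∈ slot (gridL m l) (gridR m l), ∀ t' ∈ slot (gridL m l) (gridR m l), f.1 t = f.1 t'

section Cuts
variable {p q : ℕ} {κ : Type*} [Fintype κ] [DecidableEq κ]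
  {E : fiberAlg p q →⋆ₐ[ℂ] Matrix κ κ ℂ} {m : ℕ} {e e' : ℕ → Matrix κ κ ℂ}

theorem bandConst_ind_below (l : ℕ) : BandConst p q m (ind p q (below (gridL m l))) := by
  intro k t ht t' ht'
  rcases lt_or_ge k l with h | h
  · have h1 := gridR_le_gridL_of_lt (m := m) h
    rw [ind_mem (show t ∈ below _ from ht.2.trans_le h1),
      ind_mem (show t' ∈ below _ from ht'.2.trans_le h1)]
  · have h1 := gridL_mono (m := m) h
    rw [ind_notMem (show t ∉ below _ from not_lt.2 (h1.trans ht.1)),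
      ind_notMem (show t' ∉ below _ from not_lt.2 (h1.trans ht'.1))]

/-- Two families of cuts of equal trace are conjugate by a unitary that commutes with the functions
that are constant on the bands. -/
theorem exists_band_unitary (hp : 0 < p) (hq : 0 < q)
    (he : ∀ l, IsCut E (gridL m l) (gridR m l) (e l))
    (he' : ∀ l, IsCut E (gridL m l) (gridR m l) (e' l)) (htr : ∀ l, (e l).trace = (e' l).trace) :
    ∃ x ∈ unitary (Matrix κ κ ℂ), (∀ l, x * e l = e' l * x) ∧
      ∀ f, BandConst p q m f → Commute (E f) x := by
  obtain ⟨P, hP⟩ : ∃ P : ℕ → Matrix κ κ ℂ, P = fun l => E (ind p q (below (gridL m l))) :=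
    ⟨_, rfl⟩
  have lr (l) : gridL m l ≤ gridR m l := ((gridL_lt_gridC m l).trans (gridC_lt_gridR m l)).le
  have hPc (l) : IsCut E (gridL m l) (gridR m l) (P l) := hP ▸ isCut_ind le_rfl (lr l)
  obtain ⟨G, hG⟩ : ∃ G : ℕ → Fin p × Fin q → Fin p × Fin q → Matrix κ κ ℂ, G = fun l =>
      (Cell.mid hp hq).units E (Cell.mid_fits hp hq (zero_notMem_band m l) (one_notMem_band m l)) :=
    ⟨_, rfl⟩
  have hu (l) : IsMatUnits (G l) := by rw [hG]; exact (Cell.mid hp hq).isMatUnits E _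
  have hs (l) : ∑ a, G l a a = E (ind p q (slot (gridL m l) (gridR m l))) := by
    rw [hG]; exact (Cell.mid hp hq).sum_units E _
  have part {g : ℕ → Matrix κ κ ℂ} (hg : ∀ l, IsCut E (gridL m l) (gridR m l) (g l)) (l : ℕ) :
      IsStarProjection (g l - P l) ∧ (∑ a, G l a a) * (g l - P l) = g l - P l ∧
        ∀ i j, Commute (G l i j) (g l - P l) := by
    have h1 : P l * g l = P l := by rw [hP]; exact (hg l).left_le
    have h2 : g l * P l = P l := by
      have := congrArg star h1
      rwa [star_mul, (hg l).proj.isSelfAdjoint.star_eq, (hPc l).proj.isSelfAdjoint.star_eq] at this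
    refine ⟨⟨?_, ?_⟩, ?_, fun i j => ?_⟩
    · rw [IsIdempotentElem, sub_mul, mul_sub, mul_sub, h1, h2, (hg l).proj.isIdempotentElem.eq,
        (hPc l).proj.isIdempotentElem.eq]
      abel
    · rw [IsSelfAdjoint, star_sub, (hg l).proj.isSelfAdjoint.star_eq,
        (hPc l).proj.isSelfAdjoint.star_eq]
    · rw [hs]
      exact (hPc l).ind_slot_mul_sub (hg l) le_rfl (lr l) le_rfl
    · have hcst : ∀ t ∈ slot (gridL m l) (gridR m l), ∀ t' ∈ slot (gridL m l) (gridR m l),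
          ((Cell.mid hp hq).elt (Cell.mid_fits hp hq (zero_notMem_band m l) (one_notMem_band m l))
            (Matrix.single i j 1)).1 t = ((Cell.mid hp hq).elt (Cell.mid_fits hp hq
              (zero_notMem_band m l) (one_notMem_band m l)) (Matrix.single i j 1)).1 t' :=
        fun t ht t' ht' => ((Cell.mid hp hq).elt_mem _ _ ht).trans
          ((Cell.mid hp hq).elt_mem _ _ ht').symm
      rw [hG]
      exact ((hg l).comm _ hcst).sub_right ((hPc l).comm _ hcst)
  -- Inside band l the cuts e l and e' l differ from the spectral projection P l by projections of
  -- equal trace in the commutant of the matrix units of the band; w l moves one to the other. Off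
  -- the bands the unitary is the identity N.
  choose w w1 w2 w3 w4 using fun l => (hu l).exists_intertwiner_pair (⟨0, hp⟩, ⟨0, hq⟩)
    (part he l).1 (part he' l).1 (part he l).2.1 (part he' l).2.1 (part he l).2.2 (part he' l).2.2
    (by rw [Matrix.trace_sub, Matrix.trace_sub, htr])
  have ortho {l l' : ℕ} (h : l < l') : E (ind p q (slot (gridL m l) (gridR m l))) *
      E (ind p q (slot (gridL m l') (gridR m l'))) = 0 := by
    rw [← map_mul, ind_mul_ind, show slot (gridL m l) (gridR m l) ∩
      slot (gridL m l') (gridR m l') = ∅ from ?_, ind_empty, map_zero]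
    refine Set.eq_empty_of_forall_notMem fun t ht => ?_
    exact absurd (ht.1.2.trans_le (gridR_le_gridL_of_lt h)) (not_lt.2 ht.2.1)
  have hd := IsDecomp.of_ortho (q := fun l : Fin (m + 1) =>
    E (ind p q (slot (gridL m l) (gridR m l)))) (fun l => isStarProjection_ind E _)
    fun l l' h => by
      rcases lt_or_gt_of_ne (fun h' => h (Fin.ext h') : (l : ℕ) ≠ l') with h | h
      · exact ortho h
      · rw [(commute_map_ind E _ _).eq]
        exact ortho h
  obtain ⟨N, hN⟩ : ∃ N, N = 1 - ∑ l : Fin (m + 1), E (ind p q (slot (gridL m l) (gridR m l))) :=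
    ⟨_, rfl⟩
  have hNp : IsStarProjection N := hN ▸ hd.proj none
  obtain ⟨x, hx, hx1, hx2⟩ := hd.exists_unitary hd
    (v := fun o => o.elim N fun l : Fin (m + 1) => w l)
    (by
      rintro (_ | l)
      · change star N * N = _
        rw [hNp.isSelfAdjoint.star_eq, hNp.isIdempotentElem.eq, hN]
        rfl
      · exact (w1 l).trans (hs l))
    (by
      rintro (_ | l)
      · change N * star N = _
        rw [hNp.isSelfAdjoint.star_eq, hNp.isIdempotentElem.eq, hN]
        rfl
      · exact (w2 l).trans (hs l))
  have xl (l : ℕ) (hl : l ≤ m) : x * E (ind p q (slot (gridL m l) (gridR m l))) = w l :=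
    hx1 (some ⟨l, Nat.lt_succ_iff.2 hl⟩)
  have lx (l : ℕ) (hl : l ≤ m) : E (ind p q (slot (gridL m l) (gridR m l))) * x = w l :=
    hx2 (some ⟨l, Nat.lt_succ_iff.2 hl⟩)
  have hxsum : x = N + ∑ l : Fin (m + 1), w l := by
    rw [← mul_one x, ← hd.sum, Finset.mul_sum, Fintype.sum_option]
    exact congrArg₂ (· + ·) (hx1 none) (Finset.sum_congr rfl fun l _ => hx1 (some l))
  have hcomm (f) (hf : BandConst p q m f) : Commute (E f) x := by
    rw [hxsum]
    refine Commute.add_right ?_ (Commute.sum_right _ _ _ fun l _ => ?_)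
    · rw [hN]
      exact (Commute.one_right _).sub_right
        (Commute.sum_right _ _ _ fun l _ => (commute_map_ind E _ f).symm)
    · have k1 : Commute (E (f * ind p q (slot (gridL m l) (gridR m l)))) (w l) :=
        commute_mul_ind hp hq (zero_notMem_band m l) (one_notMem_band m l)
          (fun i j => by have := w3 l i j; rwa [hG] at this) (hf l)
      have hl := Nat.lt_succ_iff.1 l.2
      have a1 : E (ind p q (slot (gridL m l) (gridR m l))) * w l = w l := by
        rw [← lx l hl, ← mul_assoc, (isStarProjection_ind E _).isIdempotentElem.eq]
      have a2 : w l * E (ind p q (slot (gridL m l) (gridR m l))) = w l := by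
        rw [← xl l hl, mul_assoc, (isStarProjection_ind E _).isIdempotentElem.eq]
      calc E f * w l = E (f * ind p q (slot (gridL m l) (gridR m l))) * w l := by
            rw [map_mul, mul_assoc, a1]
        _ = w l * E (f * ind p q (slot (gridL m l) (gridR m l))) := k1
        _ = w l * E f := by rw [← (commute_ind _ f).eq, map_mul, ← mul_assoc, a2]
  refine ⟨x, hx, fun l => ?_, hcomm⟩
  rcases lt_or_ge m l with hl | hl
  · have h1 := one_lt_gridL_of_lt hl
    rw [(he l).eq_one h1, (he' l).eq_one h1, mul_one, one_mul]
  · have k1 : x * P l = P l * x := by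
      rw [hP]
      exact (hcomm _ (bandConst_ind_below l)).symm
    have k2 : x * (e l - P l) = (e' l - P l) * x := by
      have a1 := (part he l).2.1
      have a2 := (part he' l).2.1
      rw [hs] at a1 a2
      have a3 : (e' l - P l) * E (ind p q (slot (gridL m l) (gridR m l))) = e' l - P l := by
        have := congrArg star a2
        rwa [star_mul, (part he' l).1.isSelfAdjoint.star_eq,
          (isStarProjection_ind E _).isSelfAdjoint.star_eq] at this
      rw [← a1, ← mul_assoc, xl l hl, w4 l, ← lx l hl, ← mul_assoc, a3]
    calc x * e l = x * (e l - P l) + x * P l := by rw [← mul_add, sub_add_cancel]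
      _ = e' l * x := by rw [k1, k2, ← add_mul, sub_add_cancel]

end Cuts

open dimensionDrop

/-! ### Almost commuting unitaries -/

/-- Plateau functions of the grid. -/
theorem exists_plateau (m l : ℕ) : ∃ ρ : C(I, ℂ),
    (∀ t ∈ slot (gridL m l) (gridR m (l + 1)), ρ t = 1) ∧ (1 ≤ l → ρ 0 = 0) ∧
    (l < m → ρ 1 = 0) ∧ ∀ k, ∀ t ∈ slot (gridL m k) (gridR m k),
      ∀ t' ∈ slot (gridL m k) (gridR m k), ρ t = ρ t' := by
  -- The plateau is a product of a rising and a falling ramp. Both ramps run inside the gaps between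
  -- consecutive bands, so the product is constant on every band.
  obtain ⟨a, a1, a2, a3⟩ : ∃ a : C(I, ℝ), (∀ t : I, gridL m l ≤ t → a t = 1) ∧
      (1 ≤ l → a 0 = 0) ∧ ∀ k, ∀ t ∈ slot (gridL m k) (gridR m k),
      ∀ t' ∈ slot (gridL m k) (gridR m k), a t = a t' := by
    rcases Nat.eq_zero_or_pos l with rfl | hl
    · exact ⟨1, fun t _ => rfl, fun h => absurd h (by omega), fun k t _ t' _ => rfl⟩
    obtain ⟨n, rfl⟩ : ∃ n, l = n + 1 := ⟨l - 1, by omega⟩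
    have hlt : gridR m n < gridL m (n + 1) := by
      unfold gridR gridL
      have := gap_pos m
      push_cast
      nlinarith
    have hRn : 0 ≤ gridR m n := by
      unfold gridR
      have := gap_pos m
      positivity
    have one {k : ℕ} (hk : n + 1 ≤ k) {t : I} (ht : t ∈ slot (gridL m k) (gridR m k)) :
        (1 - rampDown (gridR m n) (gridL m (n + 1))) t = 1 := by
      rw [ContinuousMap.sub_apply, rampDown_eq_zero hlt ((gridL_mono hk).trans ht.1), sub_zero]
      rfl
    have zero {k : ℕ} (hk : k ≤ n) {t : I} (ht : t ∈ slot (gridL m k) (gridR m k)) :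
        (1 - rampDown (gridR m n) (gridL m (n + 1))) t = 0 := by
      have hkn : gridR m k ≤ gridR m n := by
        have : (k : ℝ) ≤ n := by exact_mod_cast hk
        exact mul_le_mul_of_nonneg_right (by linarith) (gap_pos m).le
      rw [ContinuousMap.sub_apply, rampDown_eq_one hlt (ht.2.le.trans hkn)]
      exact sub_self 1
    refine ⟨1 - rampDown (gridR m n) (gridL m (n + 1)), fun t ht => ?_, fun _ => ?_,
      fun k t ht t' ht' => ?_⟩
    · rw [ContinuousMap.sub_apply, rampDown_eq_zero hlt ht, sub_zero]
      rfl
    · rw [ContinuousMap.sub_apply, rampDown_eq_one hlt (t := 0) hRn]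
      exact sub_self 1
    · rcases Nat.lt_or_ge n k with h | h
      · rw [one h ht, one h ht']
      · rw [zero h ht, zero h ht']
  obtain ⟨b, b1, b2, b3⟩ : ∃ b : C(I, ℝ), (∀ t : I, (t : ℝ) < gridR m (l + 1) → b t = 1) ∧
      (l < m → b 1 = 0) ∧ ∀ k, ∀ t ∈ slot (gridL m k) (gridR m k),
      ∀ t' ∈ slot (gridL m k) (gridR m k), b t = b t' := by
    rcases Nat.lt_or_ge l m with hl | hl
    · have hlt : gridR m (l + 1) < min (gridL m (l + 2)) 1 := by
        refine lt_min ?_ (gridR_lt_one hl)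
        unfold gridR gridL
        have := gap_pos m
        push_cast
        nlinarith
      refine ⟨rampDown (gridR m (l + 1)) (min (gridL m (l + 2)) 1), fun t ht => ?_, fun _ => ?_,
        fun k t ht t' ht' => ?_⟩
      · exact rampDown_eq_one hlt ht.le
      · exact rampDown_eq_zero hlt (t := 1) (min_le_right _ _)
      · rcases Nat.lt_or_ge (l + 1) k with h | h
        · have hk : min (gridL m (l + 2)) 1 ≤ gridL m k := (min_le_left _ _).trans (gridL_mono h)
          rw [rampDown_eq_zero hlt (hk.trans ht.1), rampDown_eq_zero hlt (hk.trans ht'.1)]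
        · have hk : gridR m k ≤ gridR m (l + 1) := by
            have : (k : ℝ) ≤ (l + 1 : ℕ) := by exact_mod_cast h
            exact mul_le_mul_of_nonneg_right (by linarith) (gap_pos m).le
          rw [rampDown_eq_one hlt (ht.2.le.trans hk), rampDown_eq_one hlt (ht'.2.le.trans hk)]
    · exact ⟨1, fun t _ => rfl, fun h => absurd h (by omega), fun k t _ t' _ => rfl⟩
  refine ⟨complexify (a * b), fun t ht => ?_, fun h => ?_, fun h => ?_, fun k t ht t' ht' => ?_⟩
  · rw [complexify_apply, ContinuousMap.mul_apply, a1 t ht.1, b1 t ht.2, one_mul,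
      Complex.ofReal_one]
  · rw [complexify_apply, ContinuousMap.mul_apply, a2 h, zero_mul, Complex.ofReal_zero]
  · rw [complexify_apply, ContinuousMap.mul_apply, b2 h, mul_zero, Complex.ofReal_zero]
  · rw [complexify_apply, complexify_apply, ContinuousMap.mul_apply, ContinuousMap.mul_apply,
      a3 k t ht t' ht', b3 k t ht t' ht']

section
variable {p q : ℕ}

/-- Elements of the dimension drop algebra with prescribed constant value on a slot. -/
theorem exists_bump_on_slot {m l : ℕ} (hl : l ≤ m) (c : Cell p q)
    (hc : c.Fits (slot (gridL m l) (gridR m (l + 1)))) (hm : 1 ≤ m) (M : Matrix c.k c.k ℂ) :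
    ∃ b : dimensionDrop p q, (∀ t ∈ slot (gridL m l) (gridR m (l + 1)), eval t b = c.ι M) ∧
      BandConst p q m (toFiber b) := by
  obtain ⟨ρ, h1, h2, h3, h4⟩ := exists_plateau m l
  refine ⟨bump ρ (c.ι M) ?_ ?_, fun t ht => ?_, fun k t ht t' ht' => ?_⟩
  · rcases Nat.eq_zero_or_pos l with rfl | h
    · have h0 : (0 : I) ∈ slot (gridL m 0) (gridR m (0 + 1)) :=
        ⟨((gridL_lt_gridC m 0).trans (gridC_lt_gridR m 0)).le.trans (gridR_zero m).le,
          (gridL_pos le_rfl).trans ((gridL_lt_gridC m _).trans (gridC_lt_gridR m _))⟩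
      obtain ⟨a, ha⟩ := hc.1 h0 M
      exact ⟨a, by rw [h1 0 h0, one_smul, ha]; rfl⟩
    · exact ⟨0, by rw [h2 h, zero_smul, Matrix.zero_kronecker]⟩
  · rcases hl.eq_or_lt with rfl | h
    · have h0 : (1 : I) ∈ slot (gridL l l) (gridR l (l + 1)) :=
        ⟨((gridL_lt_gridC l l).trans (gridC_lt_gridR l l)).le.trans (gridR_lt_one le_rfl).le,
          (one_lt_gridL l).trans ((gridL_lt_gridC l _).trans (gridC_lt_gridR l _))⟩
      obtain ⟨a, ha⟩ := hc.2 h0 M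
      exact ⟨a, by rw [h1 1 h0, one_smul, ha]; rfl⟩
    · exact ⟨0, by rw [h3 h, zero_smul, Matrix.kronecker_zero]⟩
  · rw [eval_bump, h1 t ht, one_smul]
  · change ρ t • c.ι M = ρ t' • c.ι M
    rw [h4 k t ht t' ht']

/-- A unitary that almost commutes with enough elements is close to a unitary that commutes with a
discretisation. -/
theorem exists_commuting_unitary (hp : 0 < p) (hq : 0 < q) {m : ℕ} (hm : 1 ≤ m) :
    ∃ F : Set (dimensionDrop p q), F.Finite ∧ (∀ f ∈ F, BandConst p q m (toFiber f)) ∧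
      ∃ C : ℝ, 0 ≤ C ∧ ∀ (κ : Type) [Fintype κ] [DecidableEq κ]
      (E : fiberAlg p q →⋆ₐ[ℂ] Matrix κ κ ℂ) (y : Matrix κ κ ℂ) (η : ℝ),
      (∀ f C, 0 ≤ C → (∀ t, ‖f.1 t‖ ≤ C) → ‖E f‖ ≤ C) →
      y ∈ unitary (Matrix κ κ ℂ) → AlmostCommutes E F η y → 0 ≤ η →
      (∀ l, ‖y * E (ind p q (below (gridC m l))) - E (ind p q (below (gridC m l))) * y‖ ≤ η) →
      C * η ≤ 1 / 6 →
      ∃ y' ∈ unitary (Matrix κ κ ℂ), ‖y' - y‖ ≤ 7 * (C * η) ∧ ∀ (f : fiberAlg p q) (ε : ℝ),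
        (∀ t t', dist t t' ≤ 3 * gap m → ‖f.1 t - f.1 t'‖ ≤ ε) →
        ∃ T, ‖E f - T‖ ≤ 3 * ε ∧ Commute T y' := by
  classical
  choose c hc s hs M hM using fun l : Fin (m + 1) =>
    exists_cell hp hq hm (Nat.lt_succ_iff.1 l.2)
  choose b hb hbc using fun (l : Fin (m + 1)) (i : (c l).k) =>
    exists_bump_on_slot (Nat.lt_succ_iff.1 l.2) (c l) (hc l) hm
      (Matrix.single (c l).base i 1)
  refine ⟨⋃ l, Set.range (b l), Set.finite_iUnion fun l => Set.finite_range _, ?_,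
    ∑ l, (2 + Fintype.card (c l).k : ℝ), by positivity,
    fun κ _ _ E y η hE hy hF hη hcut hC => ?_⟩
  · intro f hf
    obtain ⟨l, i, rfl⟩ := Set.mem_iUnion.1 hf
    exact hbc l i
  obtain ⟨e, he⟩ : ∃ e : ℕ → Matrix κ κ ℂ, e = fun l => E (ind p q (below (gridC m l))) :=
    ⟨_, rfl⟩
  have hec : ∀ l, IsCut E (gridL m l) (gridR m l) (e l) := fun l => by
    rw [he]
    exact isCut_ind (gridL_lt_gridC m l).le (gridC_lt_gridR m l).le
  have hd := isDecomp_cuts hec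
  obtain ⟨G, hG⟩ : ∃ G : ∀ l : Fin (m + 1), (c l).k → (c l).k → Matrix κ κ ℂ,
      G = fun l i j => (c l).units E (hc l) i j * (e (l + 1) - e l) := ⟨_, rfl⟩
  have hu (l : Fin (m + 1)) : IsMatUnits (G l) := by
    rw [hG]
    exact (isMatUnits_cuts hec (c l) (hc l)).1
  have hus (l : Fin (m + 1)) : ∑ a, G l a a = e (l + 1) - e l := by
    rw [hG]
    exact (isMatUnits_cuts hec (c l) (hc l)).2
  have hGl (l : Fin (m + 1)) (i j) : (e (l + 1) - e l) * G l i j = G l i j := by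
    rw [← hus]
    exact (hu l).unit_mul i j
  have hGr (l : Fin (m + 1)) (i j) : G l i j * (e (l + 1) - e l) = G l i j := by
    rw [← hus]
    exact (hu l).mul_unit i j
  -- Averaging y over the matrix units of every slot makes it commute exactly with all of them,
  -- hence with the discretised representation.
  obtain ⟨w, hw⟩ : ∃ w : Fin (m + 1) → Matrix κ κ ℂ,
      w = fun l => IsMatUnits.avg (G l) (c l).base y := ⟨_, rfl⟩
  have hwl (l : Fin (m + 1)) : (e (l + 1) - e l) * w l = w l := by
    rw [hw, ← hus]
    exact (hu l).unit_mul_avg _ _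
  have hwr (l : Fin (m + 1)) : w l * (e (l + 1) - e l) = w l := by
    rw [hw, ← hus]
    exact (hu l).avg_mul_unit _ _
  have hGw (l : Fin (m + 1)) (i j) : Commute (G l i j) (∑ a, w a) := by
    have e1 : G l i j * ∑ a, w a = G l i j * w l := by
      rw [Finset.mul_sum, Finset.sum_eq_single l]
      · intro a _ ha
        rw [← hGr, ← hwl a, mul_assoc, ← mul_assoc (e (l + 1) - e l), hd.ortho _ _ ha.symm,
          zero_mul, mul_zero]
      · exact fun h => absurd (Finset.mem_univ _) h
    have e2 : (∑ a, w a) * G l i j = w l * G l i j := by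
      rw [Finset.sum_mul, Finset.sum_eq_single l]
      · intro a _ ha
        rw [← hGl, ← hwr a, mul_assoc, ← mul_assoc (e (a + 1) - e a), hd.ortho _ _ ha,
          zero_mul, mul_zero]
      · exact fun h => absurd (Finset.mem_univ _) h
    rw [commute_iff_eq, e1, e2, hw]
    exact (hu l).commute_avg _ _ _ _
  have hcq (l : Fin (m + 1)) : ‖y * (e (l + 1) - e l) - (e (l + 1) - e l) * y‖ ≤ 2 * η := by
    have h1 := hcut (l + 1)
    have h2 := hcut l
    have e1 : y * (e (l + 1) - e l) - (e (l + 1) - e l) * y =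
        (y * e (l + 1) - e (l + 1) * y) - (y * e l - e l * y) := by noncomm_ring
    rw [e1, he]
    exact (norm_sub_le _ _).trans (by linarith)
  have hbG (l : Fin (m + 1)) (i) : E (toFiber (b l i)) * (e (l + 1) - e l) = G l (c l).base i := by
    have k := ind_slot_mul_cuts hec l
    rw [hG]
    change _ = (c l).units E (hc l) (c l).base i * (e (l + 1) - e l)
    rw [← k, ← mul_assoc, ← mul_assoc, ← map_mul, Cell.units, ← map_mul]
    congr 2
    refine fiberAlg_ext fun t => ?_
    change eval t (b l i) * (ind p q _).1 t =
      ((c l).elt (hc l) (Matrix.single (c l).base i 1)).1 t * (ind p q _).1 t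
    by_cases ht : t ∈ slot (gridL m l) (gridR m (l + 1))
    · rw [hb l i t ht, (c l).elt_mem (hc l) _ ht]
    · rw [ind_notMem ht, mul_zero, mul_zero]
  have hbG' (l : Fin (m + 1)) (i) : (e (l + 1) - e l) * E (toFiber (b l i)) = G l (c l).base i := by
    rw [← hbG, he]
    exact ((commute_map_ind E _ _).sub_left (commute_map_ind E _ _)).eq
  have hww (l : Fin (m + 1)) : ‖w l - (e (l + 1) - e l) * y * (e (l + 1) - e l)‖ ≤
      Fintype.card (c l).k * η := by
    have := (hu l).norm_avg_sub_le (c l).base y (η := η) fun i => by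
      rw [hus]
      have n1 := (hd.proj l).norm_le
      have e1 : (e (l + 1) - e l) * y * G l (c l).base i - G l (c l).base i * y *
          (e (l + 1) - e l) = (e (l + 1) - e l) * (y * E (toFiber (b l i)) -
            E (toFiber (b l i)) * y) * (e (l + 1) - e l) := by
        conv_lhs => rw [← hbG]
        conv_lhs =>
          right
          rw [hbG, ← hbG']
        noncomm_ring
      rw [e1]
      exact norm_mul_le_of_le_one' (norm_mul_le_of_le_one n1
        (hF _ (Set.mem_iUnion.2 ⟨l, i, rfl⟩))) n1
    rw [hus] at this
    rw [hw]
    exact this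
  -- On slot l the off-diagonal part of y costs 2η, by the almost commutation with two cuts, and the
  -- averaging costs card k · η. The resulting matrix is replaced by its unitary polar part, which
  -- has the same commutation.
  have hwy : ‖∑ l, w l - y‖ ≤ (∑ l, (2 + Fintype.card (c l).k : ℝ)) * η := by
    have e1 : ∑ l, w l - y = ∑ l : Fin (m + 1),
        ((w l - (e (l + 1) - e l) * y * (e (l + 1) - e l)) -
          (y * (e (l + 1) - e l) - (e (l + 1) - e l) * y) * (e (l + 1) - e l)) := by
      have : y = ∑ l : Fin (m + 1), y * (e (l + 1) - e l) := by
        rw [← Finset.mul_sum, hd.sum, mul_one]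
      conv_lhs => rw [this, ← Finset.sum_sub_distrib]
      refine Finset.sum_congr rfl fun l _ => ?_
      rw [sub_mul (y * _), mul_assoc y, (hd.proj l).isIdempotentElem.eq]
      abel
    rw [e1, Finset.sum_mul]
    refine (norm_sum_le _ _).trans (Finset.sum_le_sum fun l _ => (norm_sub_le _ _).trans ?_)
    have := norm_mul_le_of_le_one' (hcq l) (hd.proj l).norm_le
    linarith [hww l]
  obtain ⟨y', hy', hn, hcomm⟩ := exists_unitary_near hy hC hwy
  refine ⟨y', hy', hn, fun f ε hf => ⟨_, norm_sub_sum_cuts_le hE hec c hc s hs hf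
    (fun l => M l f) fun l => hM l f, Commute.sum_left _ _ _ fun l _ => ?_⟩⟩
  rw [elt_mul_eq_sum]
  refine Commute.sum_left _ _ _ fun i _ => Commute.sum_left _ _ _ fun j _ =>
    Commute.smul_left ?_ _
  have hG' : (c l).units E (hc l) i j * (e (l + 1) - e l) = G l i j := by rw [hG]
  rw [hG']
  refine (hcomm _ (hGw l i j).symm ?_).symm
  have := congrArg star (hGw l j i).eq
  rw [star_mul, star_mul, (hu l).star_eq] at this
  exact this

end

open dimensionDrop

/-! ### Paths of almost commuting unitaries -/

section Matrix
variable {κ : Type*} [Fintype κ] [DecidableEq κ]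

theorem norm_commutator_mul_le {a b f : Matrix κ κ ℂ} (ha : a ∈ unitary (Matrix κ κ ℂ))
    (hb : b ∈ unitary (Matrix κ κ ℂ)) {r s : ℝ} (h1 : ‖a * f - f * a‖ ≤ r)
    (h2 : ‖b * f - f * b‖ ≤ s) : ‖a * b * f - f * (a * b)‖ ≤ r + s := by
  have e : a * b * f - f * (a * b) = a * (b * f - f * b) + (a * f - f * a) * b := by noncomm_ring
  have k1 := norm_mul_le_of_le_one (norm_unitary_le ha) h2
  have k2 := norm_mul_le_of_le_one' h1 (norm_unitary_le hb)
  rw [e]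
  exact (norm_add_le _ _).trans (by linarith)

theorem norm_commutator_le_of_commute {a f T : Matrix κ κ ℂ} (ha : a ∈ unitary (Matrix κ κ ℂ))
    {r : ℝ} (h : ‖f - T‖ ≤ r) (hT : Commute T a) : ‖a * f - f * a‖ ≤ 2 * r := by
  have e : a * f - f * a = a * (f - T) - (f - T) * a := by
    rw [mul_sub, sub_mul, hT.eq]
    abel
  have k1 := norm_mul_le_of_le_one (norm_unitary_le ha) h
  have k2 := norm_mul_le_of_le_one' h (norm_unitary_le ha)
  rw [e]
  exact (norm_sub_le _ _).trans (by linarith)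

theorem norm_commutator_le_of_near_one {a f : Matrix κ κ ℂ} {r N : ℝ} (h : ‖a - 1‖ ≤ r)
    (hf : ‖f‖ ≤ N) : ‖a * f - f * a‖ ≤ 2 * (r * N) := by
  have e : a * f - f * a = (a - 1) * f - f * (a - 1) := by noncomm_ring
  have hr := (norm_nonneg _).trans h
  have hN := (norm_nonneg _).trans hf
  have k1 : ‖(a - 1) * f‖ ≤ r * N :=
    (norm_mul_le _ _).trans (mul_le_mul h hf (norm_nonneg _) hr)
  have k2 : ‖f * (a - 1)‖ ≤ N * r :=
    (norm_mul_le _ _).trans (mul_le_mul hf h (norm_nonneg _) hN)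
  rw [e]
  exact (norm_sub_le _ _).trans (by linarith)

end Matrix

section
variable {p q : ℕ}

theorem exists_bandConst_near {κ : Type*} [Fintype κ] [DecidableEq κ]
    {E : fiberAlg p q →⋆ₐ[ℂ] Matrix κ κ ℂ}
    (hE : ∀ f C, 0 ≤ C → (∀ t, ‖f.1 t‖ ≤ C) → ‖E f‖ ≤ C) {m : ℕ} {f : fiberAlg p q} {ε : ℝ}
    (hf : ∀ t t', dist t t' ≤ 3 * gap m → ‖f.1 t - f.1 t'‖ ≤ ε) :
    ∃ f', BandConst p q m f' ∧ ‖E f - E f'‖ ≤ ε := by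
  have hg0 := gap_pos m
  obtain ⟨g, g0, g1, hg, hgb⟩ := exists_flat m
  refine ⟨flatten f g g0 g1, fun l t ht t' ht' => congrArg f.1 (hgb l t ht t' ht'), ?_⟩
  rw [← map_sub]
  refine hE _ _ ((norm_nonneg _).trans (hf 0 0 (by rw [dist_self]; positivity))) fun t => ?_
  exact hf _ _ (by rw [dist_comm]; linarith [hg t])

/-- A unitary that almost commutes with a large finite part of a representation of a dimension drop
algebra is joined to `1` by a path of unitaries that almost commute with a given finite part. -/
theorem exists_path_of_almostCommutes (hp : 0 < p) (hq : 0 < q) {F : Set (dimensionDrop p q)}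
    (hF : F.Finite) {ε : ℝ} (hε : 0 < ε) :
    ∃ δ > 0, ∃ F' : Set (dimensionDrop p q), F'.Finite ∧ ∀ (κ : Type) [Fintype κ] [DecidableEq κ]
      (Θ : dimensionDrop p q →⋆ₐ[ℂ] Matrix κ κ ℂ) (y : Matrix κ κ ℂ),
      y ∈ unitary (Matrix κ κ ℂ) → (∀ f ∈ F', ‖y * Θ f - Θ f * y‖ ≤ δ) →
      ∃ z : I → Matrix κ κ ℂ, Continuous z ∧ z 0 = 1 ∧ z 1 = y ∧
        (∀ t, z t ∈ unitary (Matrix κ κ ℂ)) ∧ ∀ t, ∀ f ∈ F, ‖z t * Θ f - Θ f * z t‖ ≤ ε := by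
  obtain ⟨N, hN0, hN⟩ : ∃ N : ℝ, 0 ≤ N ∧ ∀ f ∈ F, ‖f‖ ≤ N := by
    obtain ⟨N, hN⟩ := (hF.image fun f : dimensionDrop p q => ‖f‖).bddAbove
    exact ⟨max N 0, le_max_right _ _, fun f hf => (hN ⟨f, hf, rfl⟩).trans (le_max_left _ _)⟩
  -- Budget: the first path contributes 2 · ε/16, the second 2 · 3ε/16, together ε/2; the third path
  -- takes the other half.
  obtain ⟨m, hm, hmod⟩ := exists_grid_modulus hF (show 0 < ε / 16 by positivity)
  obtain ⟨F₁, hF₁, hF₁c, C, hC, hD⟩ := exists_commuting_unitary hp hq hm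
  -- 1/3 makes close projections have equal trace, 1/6 is needed for the polar decomposition, and
  -- the last bound controls the path close to 1.
  obtain ⟨η, hη0, hη1, hη2, hη3⟩ : ∃ η > 0, η < 1 / 3 ∧ C * η ≤ 1 / 6 ∧
      14 * (C * η) * N ≤ ε / 2 := by
    refine ⟨min (1 / 4) (min (1 / (6 * (C + 1))) (ε / (28 * (C + 1) * (N + 1)))), by positivity,
      (min_le_left _ _).trans_lt (by norm_num), ?_, ?_⟩
    · calc C * _ ≤ (C + 1) * (1 / (6 * (C + 1))) := mul_le_mul (by linarith)
            ((min_le_right _ _).trans (min_le_left _ _)) (by positivity) (by positivity)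
        _ = 1 / 6 := by field_simp
    · calc 14 * (C * _) * N ≤ 14 * ((C + 1) * (ε / (28 * (C + 1) * (N + 1)))) * (N + 1) := by
            refine mul_le_mul (mul_le_mul_of_nonneg_left (mul_le_mul (by linarith)
              ((min_le_right _ _).trans (min_le_right _ _)) (by positivity) (by positivity))
              (by norm_num)) (by linarith) hN0 (by positivity)
        _ = ε / 2 := by field_simp; norm_num
  obtain ⟨δ, hδ, F₂, hF₂, hcuts⟩ := exists_near_cuts hp hq m hη0
  refine ⟨min δ η, lt_min hδ hη0, F₁ ∪ F₂, hF₁.union hF₂, fun κ _ _ Θ y hy h => ?_⟩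
  obtain ⟨E, hEΘ, hE⟩ := exists_extension Θ
  obtain ⟨e', he', hne'⟩ := hcuts κ E y hy fun f hf => by
    rw [hEΘ]
    exact (h f (Or.inr hf)).trans (min_le_left _ _)
  obtain ⟨e, he⟩ : ∃ e : ℕ → Matrix κ κ ℂ, e = fun l => E (ind p q (below (gridC m l))) :=
    ⟨_, rfl⟩
  have hec : ∀ l, IsCut E (gridL m l) (gridR m l) (e l) := fun l => by
    rw [he]
    exact isCut_ind (gridL_lt_gridC m l).le (gridC_lt_gridR m l).le
  -- The cuts e' l are close to y (e l) y*, so they have the traces of the e l. Hence x moves e l to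
  -- e' l exactly, and star x * y almost commutes with the cuts e l while, by commutation of x with
  -- band-constant elements, still almost commuting with F₁.
  obtain ⟨x, hx, hxe, hxc⟩ := exists_band_unitary hp hq hec he' fun l => by
    rw [(he' l).proj.trace_eq_of_norm_sub_lt ((hec l).proj.conj hy) (by
      rw [he]; exact (hne' l).trans_lt hη1), trace_conj hy]
  have hxx := Unitary.mem_iff.1 hx
  have hyy := Unitary.mem_iff.1 hy
  have hsx := Unitary.star_mem hx
  have hxy : star x * y ∈ unitary (Matrix κ κ ℂ) := mul_mem hsx hy
  have hy1 : AlmostCommutes E F₁ η (star x * y) := fun f hf => by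
    have k := hxc _ (hF₁c f hf)
    have k' : E (toFiber f) * star x = star x * E (toFiber f) := by
      calc E (toFiber f) * star x = (star x * x) * E (toFiber f) * star x := by rw [hxx.1, one_mul]
        _ = star x * (E (toFiber f) * x) * star x := by rw [k.eq, mul_assoc (star x)]
        _ = star x * E (toFiber f) * (x * star x) := by noncomm_ring
        _ = _ := by rw [hxx.2, mul_one]
    have e1 : star x * y * E (toFiber f) - E (toFiber f) * (star x * y) =
        star x * (y * E (toFiber f) - E (toFiber f) * y) := by
      rw [← mul_assoc (E _), k']
      noncomm_ring
    rw [e1, CStarRing.norm_mem_unitary_mul _ hsx, hEΘ]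
    exact (h f (Or.inl hf)).trans (min_le_right _ _)
  have hy2 (l : ℕ) : ‖star x * y * e l - e l * (star x * y)‖ ≤ η := by
    have e1 : e l * star x = star x * e' l := by
      calc e l * star x = (star x * x) * e l * star x := by rw [hxx.1, one_mul]
        _ = star x * (e' l * x) * star x := by rw [← hxe, mul_assoc (star x)]
        _ = star x * e' l * (x * star x) := by noncomm_ring
        _ = _ := by rw [hxx.2, mul_one]
    have e2 : star x * y * e l - e l * (star x * y) =
        -(star x * (e' l - y * e l * star y) * y) := by
      rw [← mul_assoc (e l), e1]
      calc _ = star x * y * e l * (star y * y) - star x * e' l * y := by rw [hyy.1, mul_one]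
        _ = _ := by noncomm_ring
    rw [e2, norm_neg, CStarRing.norm_mul_mem_unitary _ hy, CStarRing.norm_mem_unitary_mul _ hsx, he]
    exact hne' l
  rw [he] at hy2
  obtain ⟨y', hy', hyn, hyT⟩ := hD κ E (star x * y) η hE hxy hy1 hη0.le hy2 hη2
  have hsy' := Unitary.star_mem hy'
  have hv : star y' * (star x * y) ∈ unitary (Matrix κ κ ℂ) := mul_mem hsy' hxy
  have hvn : ‖star y' * (star x * y) - 1‖ ≤ 7 * (C * η) := by
    have e1 : star y' * (star x * y) - 1 = -(star y' * (y' - star x * y)) := by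
      rw [mul_sub, (Unitary.mem_iff.1 hy').1, neg_sub]
    rw [e1, norm_neg, CStarRing.norm_mem_unitary_mul _ hsy']
    exact hyn
  -- y is the product of x, which commutes with band-constant elements, of y', which commutes with a
  -- discretisation, and of a unitary close to 1. Each factor is joined to 1 without losing its
  -- property.
  obtain ⟨z₁, c₁, a₁, b₁, u₁, k₁⟩ := exists_unitary_path hx
  obtain ⟨z₂, c₂, a₂, b₂, u₂, k₂⟩ := exists_unitary_path hy'
  obtain ⟨z₃, c₃, a₃, b₃, u₃, k₃⟩ := exists_unitary_path_near hv (by linarith)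
  refine ⟨fun t => z₁ t * z₂ t * z₃ t, (c₁.mul c₂).mul c₃, ?_, ?_,
    fun t => mul_mem (mul_mem (u₁ t) (u₂ t)) (u₃ t), fun t f hf => ?_⟩
  · change z₁ 0 * z₂ 0 * z₃ 0 = 1
    rw [a₁, a₂, a₃, one_mul, one_mul]
  · change z₁ 1 * z₂ 1 * z₃ 1 = y
    rw [b₁, b₂, b₃]
    calc x * y' * (star y' * (star x * y)) = x * (y' * star y') * star x * y := by noncomm_ring
      _ = y := by rw [(Unitary.mem_iff.1 hy').2, mul_one, hxx.2, one_mul]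
  · obtain ⟨f', hf', hn'⟩ := exists_bandConst_near hE (f := toFiber f) (hmod f hf)
    obtain ⟨T, hT, hTc⟩ := hyT (toFiber f) (ε / 16) (hmod f hf)
    rw [hEΘ] at hn' hT
    have n1 := norm_commutator_le_of_commute (u₁ t) hn' (k₁ _ (hxc f' hf') t)
    have n2 := norm_commutator_le_of_commute (u₂ t) hT (k₂ _ hTc t)
    have n3 := norm_commutator_le_of_near_one ((k₃ t).trans hvn) (f := Θ f) (N := N)
      ((norm_starAlgHom_le (A := dimensionDrop p q) Θ f).trans (hN f hf))
    refine (norm_commutator_mul_le (mul_mem (u₁ t) (u₂ t)) (u₃ t)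
      (norm_commutator_mul_le (u₁ t) (u₂ t) n1 n2) n3).trans ?_
    linarith

end

open dimensionDrop

/-! ### Near amalgamation -/

theorem exists_starAlgHom_lift {A B C : Type*} [Semiring A] [Algebra ℂ A] [Star A] [Semiring B]
    [Algebra ℂ B] [Star B] [Semiring C] [Algebra ℂ C] [Star C] (Θ : A →⋆ₐ[ℂ] C) (j : B →⋆ₐ[ℂ] C)
    (hj : Function.Injective j) (h : ∀ a, ∃ b, Θ a = j b) :
    ∃ Θ' : A →⋆ₐ[ℂ] B, ∀ a, j (Θ' a) = Θ a := by
  choose r hr using h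
  exact ⟨{
    toFun := r
    map_one' := hj (by rw [← hr, map_one, map_one])
    map_mul' := fun a b => hj (by rw [← hr, map_mul, map_mul, hr, hr])
    map_zero' := hj (by rw [← hr, map_zero, map_zero])
    map_add' := fun a b => hj (by rw [← hr, map_add, map_add, hr, hr])
    commutes' := fun c => hj (by rw [← hr, AlgHomClass.commutes, AlgHomClass.commutes])
    map_star' := fun a => hj (by rw [← hr, map_star, map_star, hr]) }, fun a => (hr a).symm⟩

section
variable {p q : ℕ}

theorem ntr_leftHom (hq : 0 < q) (a : Matrix (Fin p) (Fin p) ℂ) : ntr (leftHom p q a) = ntr a := by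
  have : Nonempty (Fin q) := ⟨⟨0, hq⟩⟩
  exact (ntr_kronecker a 1).trans (by rw [ntr_one, mul_one])

theorem ntr_rightHom (hp : 0 < p) (b : Matrix (Fin q) (Fin q) ℂ) :
    ntr (rightHom p q b) = ntr b := by
  have : Nonempty (Fin p) := ⟨⟨0, hp⟩⟩
  exact (ntr_kronecker 1 b).trans (by rw [ntr_one, one_mul])

theorem injective_of_ntr_eq {κ ι : Type*} [Fintype κ] [DecidableEq κ] [Fintype ι] [DecidableEq ι]
    (j : Matrix κ κ ℂ →⋆ₐ[ℂ] Matrix ι ι ℂ) (h : ∀ a, ntr (j a) = ntr a) : Function.Injective j := by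
  rw [injective_iff_map_eq_zero]
  intro a ha
  refine eq_zero_of_ntr_star_mul_self ?_
  rw [← h, map_mul, ha, mul_zero, map_zero]

/-- Approximate uniqueness for representations with values in a matrix subalgebra. -/
theorem exists_unitary_in_range {κ ι : Type} [Fintype κ] [DecidableEq κ] [Fintype ι]
    [DecidableEq ι] (j : Matrix κ κ ℂ →⋆ₐ[ℂ] Matrix ι ι ℂ) (hj : ∀ a, ntr (j a) = ntr a)
    {τ : TracialState (dimensionDrop p q)} {F : Set (dimensionDrop p q)} {H : Set C(I, ℝ)}
    {δ ε : ℝ}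
    (hU : ∀ (Θ Θ' : dimensionDrop p q →⋆ₐ[ℂ] Matrix κ κ ℂ),
      (∀ h ∈ H, ‖ntr (Θ (central (complexify h))) - τ.toCLM (central (complexify h))‖ < δ) →
      (∀ h ∈ H, ‖ntr (Θ' (central (complexify h))) - τ.toCLM (central (complexify h))‖ < δ) →
      ∃ x ∈ unitary (Matrix κ κ ℂ), ∀ f ∈ F, ‖x * Θ f * star x - Θ' f‖ ≤ ε)
    (Θ Θ' : dimensionDrop p q →⋆ₐ[ℂ] Matrix ι ι ℂ) (h : ∀ f, ∃ b, Θ f = j b)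
    (h' : ∀ f, ∃ b, Θ' f = j b)
    (ht : ∀ h ∈ H, ‖ntr (Θ (central (complexify h))) - τ.toCLM (central (complexify h))‖ < δ)
    (ht' : ∀ h ∈ H, ‖ntr (Θ' (central (complexify h))) - τ.toCLM (central (complexify h))‖ < δ) :
    ∃ x ∈ unitary (Matrix κ κ ℂ), j x ∈ unitary (Matrix ι ι ℂ) ∧
      ∀ f ∈ F, ‖j x * Θ f * star (j x) - Θ' f‖ ≤ ε := by
  obtain ⟨Λ, hΛ⟩ := exists_starAlgHom_lift Θ j (injective_of_ntr_eq j hj) h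
  obtain ⟨Λ', hΛ'⟩ := exists_starAlgHom_lift Θ' j (injective_of_ntr_eq j hj) h'
  obtain ⟨x, hx, hxf⟩ := hU Λ Λ' (fun h hh => by rw [← hj, hΛ]; exact ht h hh)
    fun h hh => by rw [← hj, hΛ']; exact ht' h hh
  have hxx := Unitary.mem_iff.1 hx
  refine ⟨x, hx, Unitary.mem_iff.2 ⟨?_, ?_⟩, fun f hf => ?_⟩
  · rw [← map_star, ← map_mul, hxx.1, map_one]
  · rw [← map_star, ← map_mul, hxx.2, map_one]
  · rw [← hΛ, ← hΛ', ← map_star, ← map_mul, ← map_mul, ← map_sub]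
    exact (norm_starAlgHom_le j _).trans (hxf f hf)

/-- Used to turn the slow variation of the blocks of a standard embedding into closeness of every
pointwise trace to the given tracial state, as the uniqueness theorem requires. -/
theorem norm_ntr_eval_sub_lebCLM_le {R S : ℕ} (f : dimensionDrop R S) {η : ℝ} (s : I)
    (h : ∀ t, ‖ntr (eval s f) - ntr (eval t f)‖ ≤ η) : ‖ntr (eval s f) - lebCLM R S f‖ ≤ η := by
  have e : ntr (eval s f) - lebCLM R S f = ∫ t : I, (ntr (eval s f) - ntr (eval t f)) := by
    rw [lebCLM_apply, integral_sub (f := fun _ => ntr (eval s f)) (g := fun t => ntr (eval t f))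
      (integrable_const _) (integrable_of_continuous (ntrFun f).continuous)]
    simp
  rw [e]
  exact norm_integral_le_of_forall h

theorem norm_conj_sub_conj {κ : Type*} [Fintype κ] [DecidableEq κ] {x : Matrix κ κ ℂ}
    (hx : x ∈ unitary (Matrix κ κ ℂ)) (a b : Matrix κ κ ℂ) :
    ‖x * a * star x - x * b * star x‖ = ‖a - b‖ := by
  rw [← sub_mul, ← mul_sub, norm_conj_le hx]

set_option maxHeartbeats 1600000 in
/-- Amalgamation of two trace-preserving maps into a dimension drop algebra with the Lebesgue
trace. -/
theorem exists_standard_amalgam (hcop : p.Coprime q) (hp : 0 < p) (hq : 0 < q)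
    {τ : TracialState (dimensionDrop p q)} (hτ : τ.Faithful) {P Q : ℕ} (hP : 0 < P) (hQ : 0 < Q)
    (hPQ : P.Coprime Q) (φ₁ φ₂ : dimensionDrop p q →⋆ₐ[ℂ] dimensionDrop P Q)
    (h₁ : ∀ a, lebCLM P Q (φ₁ a) = τ.toCLM a) (h₂ : ∀ a, lebCLM P Q (φ₂ a) = τ.toCLM a)
    {G : Set (dimensionDrop p q)} (hG : G.Finite) {ε : ℝ} (hε : 0 < ε) :
    ∃ R, 0 < R ∧ ∃ ψ₁ ψ₂ : dimensionDrop P Q →⋆ₐ[ℂ] dimensionDrop R (R + 1),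
      (∀ f, lebCLM R (R + 1) (ψ₁ f) = lebCLM P Q f) ∧
      (∀ f, lebCLM R (R + 1) (ψ₂ f) = lebCLM P Q f) ∧
      ∀ a ∈ G, ∀ t, ‖eval t (ψ₁ (φ₁ a)) - eval t (ψ₂ (φ₂ a))‖ ≤ ε := by
  obtain ⟨δ, hδ, F, hF, hpath⟩ := exists_path_of_almostCommutes hp hq hG (half_pos hε)
  obtain ⟨r, hr⟩ : ∃ r, r = min (δ / 4) (ε / 8) := ⟨_, rfl⟩
  have hr0 : 0 < r := by rw [hr]; positivity
  have hrδ : 4 * r ≤ δ := by linarith [hr ▸ min_le_left (δ / 4) (ε / 8)]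
  have hrε : 8 * r ≤ ε := by linarith [hr ▸ min_le_right (δ / 4) (ε / 8)]
  -- Uniqueness is invoked for F ∪ G: F is what the homotopy lemma needs to be almost commuted with,
  -- G is what has to be amalgamated.
  obtain ⟨δU, hδU, H, hH, hU⟩ := exists_unitary_of_trace_close hcop hp hq hτ (hF.union hG) hr0
  obtain ⟨η, hη⟩ : ∃ η, η = min r (δU / 2) := ⟨_, rfl⟩
  have hη0 : 0 < η := by rw [hη]; positivity
  have hηr : η ≤ r := hη ▸ min_le_left _ _
  have hηU : η < δU := by linarith [hη ▸ min_le_right r (δU / 2)]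
  obtain ⟨T, hT⟩ : ∃ T : Set (dimensionDrop p q),
      T = (F ∪ G) ∪ (fun h : C(I, ℝ) => central (complexify h)) '' H := ⟨_, rfl⟩
  have hTf : T.Finite := hT ▸ (hF.union hG).union (hH.image _)
  -- All images of the relevant elements, including the test functions in H, must vary by at most η
  -- along the paths of the standard embedding.
  obtain ⟨d, hd, hdm⟩ := exists_modulus ((hTf.image φ₁).union (hTf.image φ₂)) hη0
  obtain ⟨L, hL⟩ := exists_standard hP hQ hPQ hd
  obtain ⟨R, hR⟩ : ∃ R, R = P * Q * (L + 1) := ⟨_, rfl⟩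
  have hPQ0 : 0 < P * Q := Nat.mul_pos hP hQ
  have hR0 : 0 < R := by rw [hR]; positivity
  have hRL : L ≤ R := by
    rw [hR]
    exact (Nat.le_succ L).trans (Nat.le_mul_of_pos_left _ hPQ0)
  obtain ⟨D, u, ψ, hu, hu0, huu, hψ, hD, hleb⟩ := hL R hRL hR0 ⟨_, hR⟩
  have hD1 {f} (hf : f ∈ T) (s t : I) : ‖D s (φ₁ f) - D t (φ₁ f)‖ ≤ η :=
    hD _ η hη0.le (fun s t => hdm _ (Or.inl ⟨f, hf, rfl⟩) s t) s t
  have hD2 {f} (hf : f ∈ T) (s t : I) : ‖D s (φ₂ f) - D t (φ₂ f)‖ ≤ η :=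
    hD _ η hη0.le (fun s t => hdm _ (Or.inr ⟨f, hf, rfl⟩) s t) s t
  have htr {φ : dimensionDrop p q →⋆ₐ[ℂ] dimensionDrop P Q} (h : ∀ a, lebCLM P Q (φ a) = τ.toCLM a)
      (hφ : ∀ {f}, f ∈ T → ∀ s t : I, ‖D s (φ f) - D t (φ f)‖ ≤ η) (s : I) :
      ∀ h ∈ H, ‖ntr (((eval s).comp (ψ.comp φ)) (central (complexify h))) -
        τ.toCLM (central (complexify h))‖ < δU := fun g hg => by
    rw [← h, ← hleb]
    refine (norm_ntr_eval_sub_lebCLM_le (ψ (φ (central (complexify g)))) s fun t => ?_).trans_lt hηU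
    rw [hψ, hψ, ntr_conj (huu _), ntr_conj (huu _), ← map_sub]
    exact (norm_ntr_le _).trans (hφ (hT ▸ Or.inr ⟨g, hg, rfl⟩) s t)
  -- At the end points the unitaries are sought inside M_R ⊗ 1 and 1 ⊗ M_{R+1}, so that conjugation
  -- by them preserves the end point conditions.
  obtain ⟨x₀, hx₀, hX₀, hx₀f⟩ := exists_unitary_in_range (leftHom R (R + 1))
    (ntr_leftHom R.succ_pos) (hU (Fin R)) ((eval 0).comp (ψ.comp φ₁))
    ((eval 0).comp (ψ.comp φ₂)) (fun f => exists_eval_zero _) (fun f => exists_eval_zero _)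
    (htr h₁ hD1 0) (htr h₂ hD2 0)
  obtain ⟨x₁, hx₁, hX₁, hx₁f⟩ := exists_unitary_in_range (rightHom R (R + 1))
    (ntr_rightHom hR0) (hU (Fin (R + 1))) ((eval 1).comp (ψ.comp φ₁))
    ((eval 1).comp (ψ.comp φ₂)) (fun f => exists_eval_one _) (fun f => exists_eval_one _)
    (htr h₁ hD1 1) (htr h₂ hD2 1)
  obtain ⟨X₀, hX₀e⟩ : ∃ X, X = leftHom R (R + 1) x₀ := ⟨_, rfl⟩
  obtain ⟨X₁, hX₁e⟩ : ∃ X, X = rightHom R (R + 1) x₁ := ⟨_, rfl⟩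
  rw [← hX₀e] at hX₀ hx₀f
  rw [← hX₁e] at hX₁ hx₁f
  have hψ0 (f) : eval 0 (ψ f) = D 0 f := by rw [hψ, hu0, one_mul, star_one, mul_one]
  have k0 {f} (hf : f ∈ F ∪ G) : ‖X₀ * D 0 (φ₁ f) * star X₀ - D 0 (φ₂ f)‖ ≤ r := by
    rw [← hψ0, ← hψ0]
    exact hx₀f f hf
  have hX₀X := Unitary.mem_iff.1 hX₀
  have hu1 := Unitary.mem_iff.1 (huu 1)
  -- X₁ in the coordinates where ψ is the slowly varying diagonal D. Both X₀ and Y then almost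
  -- conjugate D φ₁ to D φ₂, so star X₀ * Y almost commutes with D 0 (φ₁ f); the error is two times
  -- r plus two times η, at most 4r ≤ δ.
  obtain ⟨Y, hY⟩ : ∃ Y, Y = star (u 1) * X₁ * u 1 := ⟨_, rfl⟩
  have hYu : Y ∈ unitary _ := hY ▸ mul_mem (mul_mem (Unitary.star_mem (huu 1)) hX₁) (huu 1)
  have k1 {f} (hf : f ∈ F ∪ G) : ‖Y * D 1 (φ₁ f) * star Y - D 1 (φ₂ f)‖ ≤ r := by
    have e1 : Y * D 1 (φ₁ f) * star Y - D 1 (φ₂ f) = star (u 1) *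
        (X₁ * eval 1 (ψ (φ₁ f)) * star X₁ - eval 1 (ψ (φ₂ f))) * star (star (u 1)) := by
      rw [hψ, hψ, hY, star_mul, star_mul, star_star]
      calc _ = star (u 1) * X₁ * u 1 * D 1 (φ₁ f) * (star (u 1) * (star X₁ * u 1)) -
            (star (u 1) * u 1) * D 1 (φ₂ f) * (star (u 1) * u 1) := by rw [hu1.1, one_mul, mul_one]
        _ = _ := by noncomm_ring
    rw [e1, norm_conj_le (Unitary.star_mem (huu 1))]
    exact hx₁f f hf
  have hy : star X₀ * Y ∈ unitary _ := mul_mem (Unitary.star_mem hX₀) hYu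
  have hTFG {f} (hf : f ∈ F ∪ G) : f ∈ T := hT ▸ Or.inl hf
  obtain ⟨z, hz, hz0, hz1, hzu, hzc⟩ := hpath _ ((eval 0).comp (ψ.comp φ₁)) (star X₀ * Y) hy
    fun f hf => by
      have hf' : f ∈ F ∪ G := Or.inl hf
      change ‖star X₀ * Y * eval 0 (ψ (φ₁ f)) - eval 0 (ψ (φ₁ f)) * (star X₀ * Y)‖ ≤ δ
      rw [hψ0]
      have e1 : star X₀ * Y * D 0 (φ₁ f) - D 0 (φ₁ f) * (star X₀ * Y) = star X₀ *
          (Y * D 0 (φ₁ f) * star Y - X₀ * D 0 (φ₁ f) * star X₀) * Y := by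
        calc _ = star X₀ * Y * D 0 (φ₁ f) * (star Y * Y) -
              (star X₀ * X₀) * D 0 (φ₁ f) * (star X₀ * Y) := by
              rw [(Unitary.mem_iff.1 hYu).1, hX₀X.1, one_mul, mul_one]
          _ = _ := by noncomm_ring
      rw [e1, CStarRing.norm_mul_mem_unitary _ hYu,
        CStarRing.norm_mem_unitary_mul _ (Unitary.star_mem hX₀)]
      have e2 : Y * D 0 (φ₁ f) * star Y - X₀ * D 0 (φ₁ f) * star X₀ =
          (Y * D 0 (φ₁ f) * star Y - Y * D 1 (φ₁ f) * star Y) +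
          (Y * D 1 (φ₁ f) * star Y - D 1 (φ₂ f)) + (D 1 (φ₂ f) - D 0 (φ₂ f)) -
          (X₀ * D 0 (φ₁ f) * star X₀ - D 0 (φ₂ f)) := by abel
      have n1 := (norm_conj_sub_conj hYu (D 0 (φ₁ f)) (D 1 (φ₁ f))).le.trans
        (hD1 (hTFG hf') 0 1)
      have n2 := k1 hf'
      have n3 := hD2 (hTFG hf') 1 0
      have n4 := k0 hf'
      rw [e2]
      refine (norm_sub_le _ _).trans ?_
      refine (add_le_add ((norm_add_le _ _).trans (add_le_add (norm_add_le _ _) le_rfl))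
        le_rfl).trans ?_
      linarith
  -- At 0 this is X₀, because u and z start at 1. At 1 it is u₁ Y u₁* = X₁, because z ends at star
  -- X₀ * Y.
  obtain ⟨W, hW⟩ : ∃ W : I → MatTensor R (R + 1), W = fun t => u t * (X₀ * z t) * star (u t) :=
    ⟨_, rfl⟩
  have hWu (t) : W t ∈ unitary (MatTensor R (R + 1)) := by
    rw [hW]
    exact mul_mem (mul_mem (huu t) (mul_mem hX₀ (hzu t))) (Unitary.star_mem (huu t))
  have hWc : Continuous W := by
    rw [hW]
    exact (hu.mul (continuous_const.mul hz)).mul hu.star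
  have hW0 : W 0 = X₀ := by
    rw [hW]
    change u 0 * (X₀ * z 0) * star (u 0) = X₀
    rw [hu0, hz0, one_mul, mul_one, star_one, mul_one]
  have hW1 : W 1 = X₁ := by
    rw [hW]
    change u 1 * (X₀ * z 1) * star (u 1) = X₁
    rw [hz1, hY]
    calc _ = u 1 * ((X₀ * star X₀) * (star (u 1) * X₁ * u 1)) * star (u 1) := by noncomm_ring
      _ = (u 1 * star (u 1)) * X₁ * (u 1 * star (u 1)) := by
        rw [hX₀X.2, one_mul]
        noncomm_ring
      _ = X₁ := by rw [hu1.2, one_mul, mul_one]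
  obtain ⟨ψ', hψ'⟩ := exists_starAlgHom_of_family
    (fun t => conj ((eval t).comp ψ) (W t) (hWu t))
    (fun f => (hWc.mul (continuous_eval (ψ f))).mul hWc.star)
    (fun f => by
      obtain ⟨a, ha⟩ := exists_eval_zero (ψ f)
      refine ⟨x₀ * a * star x₀, ?_⟩
      change W 0 * eval 0 (ψ f) * star (W 0) = leftHom R (R + 1) (x₀ * a * star x₀)
      rw [hW0, hX₀e, ha, map_mul, map_mul, map_star]
      rfl)
    (fun f => by
      obtain ⟨a, ha⟩ := exists_eval_one (ψ f)
      refine ⟨x₁ * a * star x₁, ?_⟩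
      change W 1 * eval 1 (ψ f) * star (W 1) = rightHom R (R + 1) (x₁ * a * star x₁)
      rw [hW1, hX₁e, ha, map_mul, map_mul, map_star]
      rfl)
  refine ⟨R, hR0, ψ', ψ, fun f => ?_, hleb, fun f hf t => ?_⟩
  · rw [← hleb, lebCLM_apply, lebCLM_apply]
    refine integral_congr_ae (Filter.Eventually.of_forall fun t => ?_)
    change ntr (eval t (ψ' f)) = ntr (eval t (ψ f))
    rw [hψ', conj_apply, ntr_conj (hWu t)]
    rfl
  · have hf' : f ∈ F ∪ G := Or.inr hf
    have hut := Unitary.mem_iff.1 (huu t)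
    have hzt := Unitary.mem_iff.1 (hzu t)
    have hXz : X₀ * z t ∈ unitary _ := mul_mem hX₀ (hzu t)
    have e1 : eval t (ψ' (φ₁ f)) - eval t (ψ (φ₂ f)) = u t *
        ((X₀ * z t) * D t (φ₁ f) * star (X₀ * z t) - D t (φ₂ f)) * star (u t) := by
      rw [hψ', conj_apply]
      change W t * eval t (ψ (φ₁ f)) * star (W t) - _ = _
      rw [hψ, hψ, hW]
      dsimp only
      rw [star_mul, star_mul (u t) (X₀ * z t), star_star]
      calc _ = u t * (X₀ * z t) * (star (u t) * u t) * D t (φ₁ f) * (star (u t) * u t) *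
            (star (X₀ * z t) * star (u t)) - u t * D t (φ₂ f) * star (u t) := by noncomm_ring
        _ = _ := by
          rw [hut.1]
          noncomm_ring
    rw [e1, norm_conj_le (huu t)]
    -- Move D t to D 0, drop z t, which almost commutes with D 0 (φ₁ f), apply the estimate at 0,
    -- and return to D t. The errors η + ε/2 + r + η stay below ε by 8r ≤ ε.
    have e2 : (X₀ * z t) * D t (φ₁ f) * star (X₀ * z t) - D t (φ₂ f) =
        ((X₀ * z t) * D t (φ₁ f) * star (X₀ * z t) - (X₀ * z t) * D 0 (φ₁ f) * star (X₀ * z t)) +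
        ((X₀ * z t) * D 0 (φ₁ f) * star (X₀ * z t) - X₀ * D 0 (φ₁ f) * star X₀) +
        (X₀ * D 0 (φ₁ f) * star X₀ - D 0 (φ₂ f)) + (D 0 (φ₂ f) - D t (φ₂ f)) := by abel
    have n1 := (norm_conj_sub_conj hXz (D t (φ₁ f)) (D 0 (φ₁ f))).le.trans (hD1 (hTFG hf') t 0)
    have n2 : ‖(X₀ * z t) * D 0 (φ₁ f) * star (X₀ * z t) - X₀ * D 0 (φ₁ f) * star X₀‖ ≤ ε / 2 := by
      have e3 : (X₀ * z t) * D 0 (φ₁ f) * star (X₀ * z t) - X₀ * D 0 (φ₁ f) * star X₀ =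
          X₀ * ((z t * D 0 (φ₁ f) - D 0 (φ₁ f) * z t) * star (z t)) * star X₀ := by
        rw [star_mul]
        calc _ = X₀ * z t * D 0 (φ₁ f) * (star (z t) * star X₀) -
              X₀ * D 0 (φ₁ f) * (z t * star (z t)) * star X₀ := by rw [hzt.2, mul_one]
          _ = _ := by noncomm_ring
      rw [e3, norm_conj_le hX₀, CStarRing.norm_mul_mem_unitary _ (Unitary.star_mem (hzu t)), ← hψ0]
      exact hzc t f hf
    have n3 := k0 hf'
    have n4 := hD2 (hTFG hf') 0 t
    rw [e2]
    refine (norm_add_le _ _).trans ?_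
    refine (add_le_add ((norm_add_le _ _).trans (add_le_add (norm_add_le _ _) le_rfl))
      le_rfl).trans ?_
    linarith

end

namespace KZ

/-- JEP and the Lebesgue trace first give the two extensions a common codomain, so that only two
maps from X into one algebra have to be reconciled; both pull the Lebesgue trace back to the
faithful trace of X, which is the hypothesis of `exists_standard_amalgam`. -/
theorem nap : KZ.NAP := by
  intro X Y₁ Y₂ i₁ _ i₂ _ G hG ε hε
  obtain ⟨J⟩ := jep Y₁ Y₂
  obtain ⟨k⟩ := exists_embedding_leb J.target
  obtain ⟨φ₁, -, t₁, f₁⟩ := exists_starAlgHom (X := X) ((k.comp J.left).comp i₁)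
  obtain ⟨φ₂, -, t₂, f₂⟩ := exists_starAlgHom (X := X) ((k.comp J.right).comp i₂)
  have hP := PrimeDimDrop.p_pos J.target
  have hQ := PrimeDimDrop.q_pos J.target
  obtain ⟨R, hR, ψ₁, ψ₂, l₁, l₂, h⟩ := exists_standard_amalgam (PrimeDimDrop.coprime X)
    (PrimeDimDrop.p_pos X) (PrimeDimDrop.q_pos X) (PrimeDimDrop.faithful X) hP hQ
    (PrimeDimDrop.coprime J.target) φ₁ φ₂ t₁ t₂ hG hε
  have hc : Nat.Coprime R (R + 1) := by simp
  obtain ⟨g₁, hg₁⟩ := exists_embedding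
    (X := PrimeDimDrop.leb _ _ hP hQ (PrimeDimDrop.coprime J.target))
    (Y := PrimeDimDrop.leb R (R + 1) hR R.succ_pos hc) ψ₁ (injective_of_lebCLM hP hQ ψ₁ l₁) l₁
  obtain ⟨g₂, hg₂⟩ := exists_embedding
    (X := PrimeDimDrop.leb _ _ hP hQ (PrimeDimDrop.coprime J.target))
    (Y := PrimeDimDrop.leb R (R + 1) hR R.succ_pos hc) ψ₂ (injective_of_lebCLM hP hQ ψ₂ l₂) l₂
  refine ⟨⟨PrimeDimDrop.leb R (R + 1) hR R.succ_pos hc, g₁.comp (k.comp J.left),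
    g₂.comp (k.comp J.right), Set.mem_univ _, Set.mem_univ _⟩, fun a ha => ?_⟩
  have e₁ : g₁ (k (J.left (i₁ a))) = ψ₁ (φ₁ a) := (hg₁ _).trans (congrArg ψ₁ (f₁ a))
  have e₂ : g₂ (k (J.right (i₂ a))) = ψ₂ (φ₂ a) := (hg₂ _).trans (congrArg ψ₂ (f₂ a))
  change dist (g₁ (k (J.left (i₁ a)))) (g₂ (k (J.right (i₂ a)))) ≤ ε
  rw [e₁, e₂]
  change dist (ψ₁ (φ₁ a)) (ψ₂ (φ₂ a)) ≤ ε
  exact (ContinuousMap.dist_le hε.le).2 fun t => (dist_eq_norm _ _).le.trans (h a ha t)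

end KZ

theorem mainTheorem5 : KZ.IsFraisse :=
  ⟨KZ.finitelyGenerated, KZ.separable, KZ.jep, KZ.nap, KZ.wpp, KZ.ccp⟩
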